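/- **Conventions.** Let $\aleph_0\le\kappa<\lambda\le\mu^+$ be cardinals. For $\nu\ge\aleph_0$ let $S_\nu(\mu)$ be the group of permutations of $\mu$ with support of cardinality $<\nu$, and let $G=S_\lambda(\mu)/S_\kappa(\mu)$. A set is *small* if its cardinality is $<\kappa$. The many-sorted structure $\mathcal M_{\kappa\lambda\mu}$ is as follows. *Sorts* ($n\ge 1$). - $IS_n$: isomorphism types $t$ of pairs $(A_t,\overline g)$, where $\overline g$ is an $n$-tuple of permutations of the non-empty set $A_t$ generating a transitive group; if $\lambda\le\mu$, the trivial type (all $g_i=1$) is excluded. - $Card^-$: the cardinals $\nu<\lambda$ with $\nu=0$ or $\nu\ge\kappa$. For a cardinal $\nu$ put $\nu^-=\nu$ if $\nu\ge\kappa$, and $\nu^-=0$ otherwise. - $F_n$: the functions $h$ from $IS_n$ to cardinals $<\lambda$ such that $\sum_t w_t h(t)<\lambda$, and $\sum_t w_t h(t)=\mu$ if $\lambda=\mu^+$, modulo the equivalence relation $\mathcal E_n$: $\sum_t w_t\,|h(t)-h'(t)|<\kappa$. Here $w_t=1$ if $\kappa>\aleph_0$, $w_t=|A_t|$ if $\kappa=\aleph_0$,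 and, for $a\le b$, $|a-b|=|b-a|$ is the least $c$ with $a+c=b$. *Relations and functions.* - $Eq^1\subseteq IS_2$: $g_1=g_2$; and $Prod^1\subseteq IS_3$: $g_1g_2=g_3$. - $Proj^1_n\subseteq IS_{n+1}\times IS_n$: the pairs $(t_1,t_2)$ with $t_1$ the type of some $(A,g_1,\dots,g_{n+1})$ and $t_2$ the type of the restriction of $(g_1,\dots,g_n)$ to some subset of $A$. - $<$ on $Card^-$. - $App_n:F_n\times IS_n\to Card^-$, sending the class of $h$ and $t$ to $h(t)^-$. - $Eq\subseteq F_2$ and $Prod\subseteq F_3$: the classes of those $h$ for which the sum of $h(t)$ over the types $t$ in which $g_1=g_2$ (respectively $g_1g_2=g_3$) fails is $<\kappa$; if $\kappa=\aleph_0$, $h(t)$ is multiplied in this sum by the number of points of $A_t$ at which the equation fails. - $Proj_n:F_{n+1}\to F_n$, induced by $h\mapsto\bigl(t\mapsto\sum_{t'\in IS_{n+1}}|B_{t't}|\,h(t')\bigr)$, where, for $(A,\overline g)$ of type $t'$, $B_{t't}$ is the set of orbits of $\langle g_1,\dots,g_n\rangle$ on $A$ on which $(g_1,\dots,g_n)$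 has type $t$. An *interpretation* of $\mathcal M_{\kappa\lambda\mu}$ in $G$ assigns to each sort $s$ a number $d_s$ and a map from a subset of $G^{d_s}$ onto the sort $s$ (a tuple is said to represent its image), such that the following are definable in $G$ by parameter-free first-order formulae of the language of groups: the domains of these maps, the relation of representing the same element, and the preimages of all relations of the signature and of the graphs of all its functions. For $\overline f\in S_\lambda(\mu)^n$ let $Ch_{\overline f}(t)$ be the number of orbits of $\langle\overline f\rangle$ on $\mu$ on which $\overline f$ has type $t$. **Theorem 4.3.** For all $\aleph_0\le\kappa<\lambda\le\mu^+$, the structure $\mathcal M_{\kappa\lambda\mu}$ is interpretable without parameters in the group $S_\lambda(\mu)/S_\kappa(\mu)$, by numbers $d_s$ and formulae which do not depend on $\kappa,\lambda,\mu$; here the elements of $Card^-$ are represented by the $x\in G$ with $x^2=1$, the coset $x$ of $f$ representing $|\mathrm{supp}\,f|^-$. If $\kappa>\aleph_0$, this can be done (again by formulae not depending on $\kappa,\lambda,\mu$) in the following way. 1. The elements of $IS_n$ are represented by the pure $n$-tuples. The tuple $\overline x$ of cosets of $\overline f$ represents a non-trivial type $t$ if $\overline x\ne 1$ and, outside a small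 set, all non-trivial orbits of $\overline f$ are of type $t$; it represents the trivial type (when $\lambda=\mu^+$) if $\overline x=1$. 2. The elements of $Card^-$ are represented as above by the $x$ with $x^2=1$, modulo equal cardinality (of supports, cardinals $<\kappa$ being identified with $0$). 3. The elements of $F_n$ are represented by all $n$-tuples of elements of $G$, modulo conjugacy: the tuple of cosets of $\overline f$ represents the $\mathcal E_n$-class of $Ch_{\overline f}$, and two tuples represent the same element if and only if they are conjugate in $G$. -/

import Mathlib

open Cardinal

universe u v w

namespace QuotSym

noncomputable section

/-! ### Many-sorted first-order structures and the language of groups -/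

/-- A many-sorted first-order signature: relation symbols and function symbols, each argument
place carrying a sort. -/
structure MSLanguage where
  Srt : Type
  Rel : Type
  relArity : Rel → ℕ
  relSort : ∀ R : Rel, Fin (relArity R) → Srt
  Fun : Type
  funArity : Fun → ℕ
  funDom : ∀ F : Fun, Fin (funArity F) → Srt
  funCod : Fun → Srt

/-- A structure for a many-sorted signature. -/
structure MSStructure (L : MSLanguage) where
  carrier : L.Srt → Type v
  rel : ∀ R : L.Rel, (∀ i, carrier (L.relSort R i)) → Prop
  func : ∀ F : L.Fun, (∀ i, carrier (L.funDom F i)) → carrier (L.funCod F)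

/-- The function symbols of the language of groups. -/
inductive GroupFunc : ℕ → Type
  | mul : GroupFunc 2
  | inv : GroupFunc 1
  | one : GroupFunc 0

/-- The first-order language of groups. -/
def groupLang : FirstOrder.Language where
  Functions := GroupFunc
  Relations := fun _ => Empty

/-- Every group is a structure for the language of groups. -/
instance groupStructure (G : Type w) [Group G] : groupLang.Structure G where
  funMap := fun {_} f =>
    match f with
    | .mul => fun x => x 0 * x 1
    | .inv => fun x => (x 0)⁻¹
    | .one => fun _ => 1
  RelMap := fun r => r.elim

/-- The syntactic part of a parameter-free interpretation of structures for the signature `L` in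
groups: the elements of the sort `s` are to be represented by `dim s`-tuples, and everything is
given by parameter-free first-order formulae of the language of groups. -/
structure Interp (L : MSLanguage) (dim : L.Srt → ℕ) where
  /-- the tuples which represent an element of the sort `s` -/
  dom : ∀ s, groupLang.Formula (Fin (dim s))
  /-- two tuples represent the same element of the sort `s` -/
  eqv : ∀ s, groupLang.Formula (Fin (dim s) ⊕ Fin (dim s))
  rel : ∀ R : L.Rel, groupLang.Formula (Σ i, Fin (dim (L.relSort R i)))
  /-- the graph of a function symbol -/
  func : ∀ F : L.Fun,
    groupLang.Formula ((Σ i, Fin (dim (L.funDom F i))) ⊕ Fin (dim (L.funCod F)))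

/-- `Γ.Interprets M G rep`: the formulae `Γ` interpret the many-sorted structure `M` in the group
`G`, where `rep s x m` says that the tuple `x` represents the element `m` of the sort `s`
(so `rep s` is the graph of the coordinate map of the sort `s`, a map from the tuples satisfying
`Γ.dom s` onto the sort `s`). -/
structure Interp.Interprets {L : MSLanguage} {dim : L.Srt → ℕ} (Γ : Interp L dim) (M : MSStructure.{v} L)
    (G : Type w) [Group G] (rep : ∀ s, (Fin (dim s) → G) → M.carrier s → Prop) : Prop where
  dom_iff : ∀ s x, (Γ.dom s).Realize x ↔ ∃ m, rep s x m
  unique : ∀ s x m m', rep s x m → rep s x m' → m = m'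
  surj : ∀ s m, ∃ x, rep s x m
  eqv_iff : ∀ s x y m m', rep s x m → rep s y m' →
    ((Γ.eqv s).Realize (Sum.elim x y) ↔ m = m')
  rel_iff : ∀ (R : L.Rel) (x : ∀ i, Fin (dim (L.relSort R i)) → G)
    (m : ∀ i, M.carrier (L.relSort R i)), (∀ i, rep _ (x i) (m i)) →
    ((Γ.rel R).Realize (fun p => x p.1 p.2) ↔ M.rel R m)
  func_iff : ∀ (F : L.Fun) (x : ∀ i, Fin (dim (L.funDom F i)) → G)
    (m : ∀ i, M.carrier (L.funDom F i)) (y : Fin (dim (L.funCod F)) → G)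
    (c : M.carrier (L.funCod F)), (∀ i, rep _ (x i) (m i)) → rep _ y c →
    ((Γ.func F).Realize (Sum.elim (fun p => x p.1 p.2) y) ↔ M.func F m = c)

/-! ### Isomorphism types of transitive tuples of permutations -/

/-- A pair `(A, g)`, where `g` is an `n`-tuple of permutations of the non-empty set `A` which
generates a transitive group. Such an `A` is countable, so up to isomorphism it may be taken
to be a set of natural numbers (see `exists_hasType`). -/
structure TransTuple (n : ℕ) where
  A : Set ℕ
  g : Fin n → Equiv.Perm A
  nonempty : A.Nonempty
  trans : ∀ a b : A, ∃ p ∈ Subgroup.closure (Set.range g), p a = b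

/-- Isomorphism of pairs `(A, g)`. -/
instance TransTuple.setoid (n : ℕ) : Setoid (TransTuple n) where
  r S T := ∃ e : S.A ≃ T.A, ∀ i a, e (S.g i a) = T.g i (e a)
  iseqv :=
    { refl := fun _ => ⟨Equiv.refl _, fun _ _ => rfl⟩
      symm := fun {S T} ⟨e, h⟩ => ⟨e.symm, fun i a => by
        rw [Equiv.symm_apply_eq, h, Equiv.apply_symm_apply]⟩
      trans := fun {S T U} ⟨e, h⟩ ⟨e', h'⟩ => ⟨e.trans e', fun i a => by simp [h, h']⟩ }

/-- Isomorphism types of pairs `(A, g)`, with `g` an `n`-tuple acting transitively on `A`. -/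
def IsoType (n : ℕ) : Type := Quotient (TransTuple.setoid n)

/-- `(A, g)` has isomorphism type `t`. -/
def TransTuple.Is {n : ℕ} (T : TransTuple n) (t : IsoType n) : Prop :=
  (Quotient.mk _ T : IsoType n) = t

/-- A chosen pair of the isomorphism type `t`. -/
def IsoType.out {n : ℕ} (t : IsoType n) : TransTuple n := Quotient.out t

/-- The isomorphism type of the tuple all of whose entries are the identity. -/
def IsoType.IsTrivial {n : ℕ} (t : IsoType n) : Prop :=
  ∃ T : TransTuple n, T.Is t ∧ ∀ i, T.g i = 1

/-- The restriction of the tuple `f` to the set `B` is (defined and) of isomorphism type `t`. -/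
def HasType {α : Type w} {n : ℕ} (f : Fin n → Equiv.Perm α) (B : Set α) (t : IsoType n) : Prop :=
  ∃ T : TransTuple n, T.Is t ∧
    ∃ e : T.A → α, Function.Injective e ∧ Set.range e = B ∧ ∀ i a, e (T.g i a) = f i (e a)

/-- The orbit of `a` under the group generated by the tuple `f`. -/
def orbit {α : Type w} {n : ℕ} (f : Fin n → Equiv.Perm α) (a : α) : Set α :=
  {b | ∃ p ∈ Subgroup.closure (Set.range f), p a = b}

/-- `B` is an orbit of the group generated by the tuple `f`. -/
def IsOrbit {α : Type w} {n : ℕ} (f : Fin n → Equiv.Perm α) (B : Set α) : Prop :=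
  ∃ a, B = orbit f a

/-- The support of a tuple: the union of the supports of its entries. -/
def supp {α : Type w} {n : ℕ} (f : Fin n → Equiv.Perm α) : Set α :=
  {a | ∃ i, f i a ≠ a}

/-- The number of elements of `A`, for `(A, g)` of type `t`. -/
def IsoType.size {n : ℕ} (t : IsoType n) : Cardinal.{0} := #t.out.A

/-- The first `n` entries of an `(n+1)`-tuple. -/
def initTuple {α : Type w} {n : ℕ} (g : Fin (n + 1) → α) : Fin n → α := fun i => g i.castSucc

/-- The cardinal `|B_{t't}|`: the number of orbits of the first `n` entries of `g` on which these
have isomorphism type `t`, where `(A, g)` has type `t'`. -/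
def orbCount {n : ℕ} (t' : IsoType (n + 1)) (t : IsoType n) : Cardinal.{0} :=
  #{B : Set t'.out.A // IsOrbit (initTuple t'.out.g) B ∧ HasType (initTuple t'.out.g) B t}

/-! ### Cardinal arithmetic -/

/-- `b - a`, for `a ≤ b`: the least `c` such that `a + c = b`. -/
def csub (b a : Cardinal.{u}) : Cardinal.{u} := sInf {c | a + c = b}

/-- `|a - b|` for cardinals. -/
def cdist (a b : Cardinal.{u}) : Cardinal.{u} := if a ≤ b then csub b a else csub a b

/-- `ν⁻`: cardinals below `κ` are replaced by zero. -/
def trunc (κ ν : Cardinal.{u}) : Cardinal.{u} := if κ ≤ ν then ν else 0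

theorem csub_le_iff {a b d : Cardinal.{u}} (h : a ≤ b) : csub b a ≤ d ↔ b ≤ a + d := by
  have hne : {c | a + c = b}.Nonempty := by
    obtain ⟨c, hc⟩ := _root_.le_iff_exists_add.1 h
    exact ⟨c, hc.symm⟩
  have hmem : a + csub b a = b := csInf_mem hne
  constructor
  · intro hd
    calc b = a + csub b a := hmem.symm
      _ ≤ a + d := by gcongr
  · intro hd
    by_cases hb : b < ℵ₀
    · have ha : a < ℵ₀ := h.trans_lt hb
      have hc : a + csub b a ≤ a + d := hmem.le.trans hd
      exact (Cardinal.add_le_add_iff_of_lt_aleph0 ha).1 (by simpa [add_comm] using hc)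
    · rw [not_lt] at hb
      rcases h.eq_or_lt with rfl | hlt
      · refine (csInf_le' (?_ : (0 : Cardinal) ∈ _)).trans (zero_le)
        simp
      · have hbd : b ≤ d := by
          by_contra hcon
          rw [not_le] at hcon
          exact absurd hd (not_le.2 (Cardinal.add_lt_of_lt hb hlt hcon))
        refine (csInf_le' (?_ : b ∈ _)).trans hbd
        exact Cardinal.add_eq_right hb h

theorem cdist_le_iff {a b d : Cardinal.{u}} : cdist a b ≤ d ↔ a ≤ b + d ∧ b ≤ a + d := by
  unfold cdist
  split_ifs with h
  · rw [csub_le_iff h]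
    exact ⟨fun h' => ⟨h.trans (self_le_add_right _ _), h'⟩, fun h' => h'.2⟩
  · rw [not_le] at h
    rw [csub_le_iff h.le]
    exact ⟨fun h' => ⟨h', h.le.trans (self_le_add_right _ _)⟩, fun h' => h'.1⟩

theorem cdist_self (a : Cardinal.{u}) : cdist a a = 0 := by
  have : cdist a a ≤ 0 := cdist_le_iff.2 ⟨by simp, by simp⟩
  exact le_antisymm this (zero_le)

theorem cdist_comm (a b : Cardinal.{u}) : cdist a b = cdist b a :=
  le_antisymm (cdist_le_iff.2 (cdist_le_iff.1 le_rfl).symm)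
    (cdist_le_iff.2 (cdist_le_iff.1 le_rfl).symm)

theorem cdist_triangle (a b c : Cardinal.{u}) : cdist a c ≤ cdist a b + cdist b c := by
  obtain ⟨h1, h2⟩ := cdist_le_iff.1 (le_refl (cdist a b))
  obtain ⟨h3, h4⟩ := cdist_le_iff.1 (le_refl (cdist b c))
  refine cdist_le_iff.2 ⟨?_, ?_⟩
  · calc a ≤ b + cdist a b := h1
      _ ≤ (c + cdist b c) + cdist a b := by gcongr
      _ = c + (cdist a b + cdist b c) := by ring
  · calc c ≤ b + cdist b c := h4
      _ ≤ (a + cdist a b) + cdist b c := by gcongr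
      _ = a + (cdist a b + cdist b c) := by ring

theorem mul_sum' {ι : Type} (a : Cardinal.{u}) (f : ι → Cardinal.{u}) :
    a * Cardinal.sum f = Cardinal.sum fun i => a * f i := by
  induction a using Cardinal.inductionOn with | _ α => ?_
  have : f = fun i => #(f i).out := by ext i; simp
  rw [this, ← Cardinal.mk_sigma]
  simp only [Cardinal.mul_def]
  rw [← Cardinal.mk_sigma]
  refine Cardinal.mk_congr ⟨fun p => ⟨p.2.1, p.1, p.2.2⟩, fun p => ⟨p.2.1, p.1, p.2.2⟩,
    fun _ => rfl, fun _ => rfl⟩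

theorem sum_comm' {ι ι' : Type} (f : ι → ι' → Cardinal.{u}) :
    (Cardinal.sum fun i => Cardinal.sum fun j => f i j) =
      Cardinal.sum fun j => Cardinal.sum fun i => f i j := by
  have : f = fun i j => #(f i j).out := by ext i j; simp
  rw [this]
  simp only [← Cardinal.mk_sigma]
  refine Cardinal.mk_congr ⟨fun p => ⟨p.2.1, p.1, p.2.2⟩, fun p => ⟨p.2.1, p.1, p.2.2⟩,
    fun _ => rfl, fun _ => rfl⟩

theorem cdist_sum_le {ι : Type} (f g : ι → Cardinal.{u}) :
    cdist (Cardinal.sum f) (Cardinal.sum g) ≤ Cardinal.sum fun i => cdist (f i) (g i) := by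
  refine cdist_le_iff.2 ⟨?_, ?_⟩
  · rw [← Cardinal.sum_add_distrib']
    exact Cardinal.sum_le_sum _ _ fun i => (cdist_le_iff.1 le_rfl).1
  · rw [← Cardinal.sum_add_distrib']
    exact Cardinal.sum_le_sum _ _ fun i => (cdist_le_iff.1 le_rfl).2

theorem cdist_mul_le (c a b : Cardinal.{u}) : cdist (c * a) (c * b) ≤ c * cdist a b := by
  obtain ⟨h1, h2⟩ := cdist_le_iff.1 (le_refl (cdist a b))
  refine cdist_le_iff.2 ⟨?_, ?_⟩
  · rw [← mul_add]; gcongr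
  · rw [← mul_add]; gcongr

/-! ### Basic facts on isomorphism types -/

theorem IsoType.out_is {n : ℕ} (t : IsoType n) : t.out.Is t := Quotient.out_eq t

theorem TransTuple.Is.mk_eq_size {n : ℕ} {T : TransTuple n} {t : IsoType n} (h : T.Is t) :
    #T.A = t.size := by
  obtain ⟨e, -⟩ : T ≈ t.out := Quotient.exact (h.trans t.out_is.symm)
  exact Cardinal.mk_congr e

theorem IsoType.one_le_size {n : ℕ} (t : IsoType n) : 1 ≤ t.size := by
  rw [IsoType.size, Cardinal.one_le_iff_ne_zero, Cardinal.mk_ne_zero_iff]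
  exact t.out.nonempty.to_subtype

theorem IsoType.size_le {n : ℕ} (t : IsoType n) : t.size ≤ ℵ₀ := Cardinal.mk_le_aleph0

/-- A set has at most one type under a given tuple. -/
theorem HasType.unique {α : Type w} {n : ℕ} {f : Fin n → Equiv.Perm α} {B : Set α}
    {t t' : IsoType n} (h : HasType f B t) (h' : HasType f B t') : t = t' := by
  obtain ⟨T, hT, e, he, hB, hf⟩ := h
  obtain ⟨T', hT', e', he', hB', hf'⟩ := h'
  rw [← hT, ← hT']
  refine Quotient.sound ⟨((Equiv.ofInjective e he).trans
    (Equiv.setCongr (hB.trans hB'.symm))).trans (Equiv.ofInjective e' he').symm, fun i a => ?_⟩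
  have key : ∀ a, e' (((Equiv.ofInjective e he).trans
    (Equiv.setCongr (hB.trans hB'.symm))).trans (Equiv.ofInjective e' he').symm a) = e a := by
    intro a
    simp only [Equiv.trans_apply]
    rw [Equiv.apply_ofInjective_symm he']
    rfl
  apply he'
  rw [key, hf, hf', key]

theorem HasType.mk_eq {α : Type w} {n : ℕ} {f : Fin n → Equiv.Perm α} {B : Set α}
    {t : IsoType n} (h : HasType f B t) : #B = Cardinal.lift.{w} t.size := by
  obtain ⟨T, hT, e, he, hB, -⟩ := h
  rw [← hT.mk_eq_size, ← hB]
  simpa using (Cardinal.mk_range_eq_of_injective he)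

theorem mem_orbit_self {α : Type w} {n : ℕ} (f : Fin n → Equiv.Perm α) (a : α) :
    a ∈ orbit f a := ⟨1, one_mem _, rfl⟩

theorem orbit_eq {α : Type w} {n : ℕ} {f : Fin n → Equiv.Perm α} {a b : α}
    (h : b ∈ orbit f a) : orbit f a = orbit f b := by
  obtain ⟨p, hp, rfl⟩ := h
  ext c
  constructor
  · rintro ⟨q, hq, rfl⟩
    exact ⟨q * p⁻¹, mul_mem hq (inv_mem hp), by simp⟩
  · rintro ⟨q, hq, rfl⟩
    exact ⟨q * p, mul_mem hq hp, by simp⟩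

/-- Every orbit of a tuple of permutations of any set has an isomorphism type. -/
theorem exists_hasType {α : Type w} {n : ℕ} (f : Fin n → Equiv.Perm α) (a : α) :
    ∃ t : IsoType n, HasType f (orbit f a) t := by
  have hcount : Countable (Subgroup.closure (Set.range f)) := by
    have : Subgroup.closure (Set.range f) = (FreeGroup.lift f).range := by
      rw [FreeGroup.range_lift_eq_closure]
    rw [this]
    exact (MonoidHom.rangeRestrict_surjective (FreeGroup.lift f)).countable
  have hB : Countable (orbit f a) := by
    let F : Subgroup.closure (Set.range f) → orbit f a := fun p => ⟨p.1 a, p.1, p.2, rfl⟩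
    have hF : Function.Surjective F := by
      rintro ⟨b, p, hp, rfl⟩
      exact ⟨⟨p, hp⟩, rfl⟩
    exact hF.countable
  obtain ⟨j, hj⟩ := exists_injective_nat (orbit f a)
  have hinv : ∀ i x, f i x ∈ orbit f a ↔ x ∈ orbit f a := by
    intro i x
    have hi : f i ∈ Subgroup.closure (Set.range f) := Subgroup.subset_closure ⟨i, rfl⟩
    constructor
    · rintro ⟨p, hp, h⟩
      exact ⟨(f i)⁻¹ * p, mul_mem (inv_mem hi) hp, by simp [h]⟩
    · rintro ⟨p, hp, rfl⟩
      exact ⟨f i * p, mul_mem hi hp, rfl⟩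
  let E : orbit f a ≃ Set.range j := Equiv.ofInjective j hj
  let g : Fin n → Equiv.Perm (Set.range j) := fun i =>
    E.permCongr ((f i).subtypePerm (p := fun x => x ∈ orbit f a) (fun x => hinv i x))
  have hg : ∀ i x, (E.symm (g i x) : α) = f i (E.symm x : α) := by
    intro i x
    simp [g, Equiv.permCongr_apply, Equiv.Perm.subtypePerm_apply]
  have hlift : ∀ p ∈ Subgroup.closure (Set.range f),
      ∃ q ∈ Subgroup.closure (Set.range g), ∀ x, (E.symm (q x) : α) = p (E.symm x : α) := by
    intro p hp
    induction hp using Subgroup.closure_induction with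
    | mem p hp =>
      obtain ⟨i, rfl⟩ := hp
      exact ⟨g i, Subgroup.subset_closure ⟨i, rfl⟩, hg i⟩
    | one => exact ⟨1, one_mem _, fun _ => rfl⟩
    | mul p p' _ _ h h' =>
      obtain ⟨q, hq, h⟩ := h
      obtain ⟨q', hq', h'⟩ := h'
      exact ⟨q * q', mul_mem hq hq', fun x => by simp [h, h']⟩
    | inv p _ h =>
      obtain ⟨q, hq, h⟩ := h
      refine ⟨q⁻¹, inv_mem hq, fun x => ?_⟩
      rw [Equiv.Perm.eq_inv_iff_eq, ← h]
      simp
  let T : TransTuple n :=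
    { A := Set.range j
      g := g
      nonempty := ⟨_, ⟨⟨a, mem_orbit_self f a⟩, rfl⟩⟩
      trans := by
        intro x y
        have hx := (E.symm x).2
        have hy := (E.symm y).2
        obtain ⟨p, hp, h⟩ : (E.symm y : α) ∈ orbit f (E.symm x : α) := (orbit_eq hx) ▸ hy
        obtain ⟨q, hq, h'⟩ := hlift p hp
        refine ⟨q, hq, E.symm.injective (Subtype.ext ?_)⟩
        rw [h', h] }
  refine ⟨Quotient.mk _ T, T, rfl, fun x => (E.symm x : α), ?_, ?_, hg⟩
  · exact Subtype.val_injective.comp E.symm.injective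
  · ext b
    constructor
    · rintro ⟨x, rfl⟩
      exact (E.symm x).2
    · intro hb
      exact ⟨E ⟨b, hb⟩, by simp⟩

/-! ### The groups and the sorts -/

/-- Cardinals `κ`, `lam`, and a set `Ω` of cardinality `μ`, where `ℵ₀ ≤ κ < lam ≤ μ⁺`. -/
structure Params where
  Ω : Type u
  κ : Cardinal.{u}
  lam : Cardinal.{u}
  aleph0_le : ℵ₀ ≤ κ
  lt : κ < lam
  le : lam ≤ Order.succ #Ω

/-- `S_ν(Ω)`: the permutations whose support has cardinality less than `ν`. -/
def symLt (Ω : Type u) (ν : Cardinal.{u}) (hν : ℵ₀ ≤ ν) : Subgroup (Equiv.Perm Ω) where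
  carrier := {g | #{a | g a ≠ a} < ν}
  one_mem' := by
    simpa using (Cardinal.aleph0_pos.trans_le hν)
  mul_mem' := by
    intro g h hg hh
    refine lt_of_le_of_lt ((Cardinal.mk_le_mk_of_subset ?_).trans
      (Cardinal.mk_union_le {a | g a ≠ a} {a | h a ≠ a})) (Cardinal.add_lt_of_lt hν hg hh)
    intro a ha
    by_contra hcon
    simp only [Set.mem_union, Set.mem_ofPred_eq, not_or, not_not] at hcon
    apply ha
    rw [Equiv.Perm.mul_apply, hcon.2, hcon.1]
  inv_mem' := by
    intro g hg
    have : {a | g⁻¹ a ≠ a} = {a | g a ≠ a} := by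
      ext a
      simp only [Set.mem_ofPred_eq, ne_eq, Equiv.Perm.inv_eq_iff_eq, not_iff_not]
      exact eq_comm
    change #{a | g⁻¹ a ≠ a} < ν
    rw [this]
    exact hg

instance symLt_normal (Ω : Type u) (ν : Cardinal.{u}) (hν : ℵ₀ ≤ ν) :
    (symLt Ω ν hν).Normal where
  conj_mem := by
    intro g hg p
    change #{a | (p * g * p⁻¹) a ≠ a} < ν
    have : {a | (p * g * p⁻¹) a ≠ a} = p '' {a | g a ≠ a} := by
      ext a
      simp only [Set.mem_ofPred_eq, Set.mem_image, Equiv.Perm.mul_apply]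
      constructor
      · intro h
        refine ⟨p⁻¹ a, fun h' => h ?_, by simp⟩
        rw [h']
        simp
      · rintro ⟨b, hb, rfl⟩
        simpa using hb
    rw [this, Cardinal.mk_image_eq p.injective]
    exact hg

namespace Params

variable (P : Params.{u})

/-- The cardinal `μ`. -/
def μ : Cardinal.{u} := #P.Ω

/-- The group `S_lam(μ)`. -/
abbrev SLam : Subgroup (Equiv.Perm P.Ω) := symLt P.Ω P.lam (P.aleph0_le.trans P.lt.le)

/-- The group `S_κ(μ)`. -/
abbrev SKap : Subgroup (Equiv.Perm P.Ω) := symLt P.Ω P.κ P.aleph0_le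

/-- The group `S_lam(μ) / S_κ(μ)`. -/
abbrev G : Type u := P.SLam ⧸ P.SKap.subgroupOf P.SLam

/-- The coset of a permutation. -/
def coset (f : P.SLam) : P.G := QuotientGroup.mk f

/-- The underlying tuple of permutations of `Ω`. -/
def perm {n : ℕ} (f : Fin n → P.SLam) : Fin n → Equiv.Perm P.Ω := fun i => (f i : Equiv.Perm P.Ω)

/-- A set is small if its cardinality is less than `κ`. -/
def Small (B : Set P.Ω) : Prop := #B < P.κ

/-- The sort `IS_n`; the trivial type is left out when `lam ≤ μ`. -/
def IS (n : ℕ) : Type := {t : IsoType n // P.lam ≤ P.μ → ¬ t.IsTrivial}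

/-- The sort `Card⁻`: the cardinals `ν < lam` such that `ν = 0` or `κ ≤ ν`. -/
def CardMinus : Type (u + 1) := {ν : Cardinal.{u} // ν < P.lam ∧ (ν = 0 ∨ P.κ ≤ ν)}

/-- The function `Ch_f`: the number of orbits of the various isomorphism types. -/
def Ch {n : ℕ} (f : Fin n → P.SLam) (t : P.IS n) : Cardinal.{u} :=
  #{B : Set P.Ω // IsOrbit (P.perm f) B ∧ HasType (P.perm f) B t.1}

open Classical in
/-- The weight with which a type is counted in the sums below: each orbit counts for one if
`κ > ℵ₀`, and for its number of elements if `κ = ℵ₀`. -/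
def wt {n : ℕ} (t : P.IS n) : Cardinal.{u} :=
  if P.κ = ℵ₀ then Cardinal.lift.{u} t.1.size else 1

/-- The sum `∑ {h(t) : t ∈ IS_n}` (weighted if `κ = ℵ₀`). -/
def total {n : ℕ} (h : P.IS n → Cardinal.{u}) : Cardinal.{u} :=
  Cardinal.sum fun t => P.wt t * h t

/-- The functions from `IS_n` to the cardinals below `lam` of which the classes are the members
of `F_n`. -/
def FPre (n : ℕ) : Type (u + 1) :=
  {h : P.IS n → Cardinal.{u} // (∀ t, h t < P.lam) ∧ P.total h < P.lam ∧
    (P.lam = Order.succ P.μ → P.total h = P.μ)}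

/-- The sum with each type counted with its number of elements. -/
def sizeTotal {n : ℕ} (h : P.IS n → Cardinal.{u}) : Cardinal.{u} :=
  Cardinal.sum fun t => Cardinal.lift.{u} t.1.size * h t

theorem one_le_lift_size {n : ℕ} (t : P.IS n) : 1 ≤ Cardinal.lift.{u} t.1.size := by
  simpa using Cardinal.lift_le.{u}.2 t.1.one_le_size

theorem one_le_wt {n : ℕ} (t : P.IS n) : 1 ≤ P.wt t := by
  unfold wt
  split_ifs
  · exact P.one_le_lift_size t
  · exact le_rfl

theorem le_total {n : ℕ} (h : P.IS n → Cardinal.{u}) (t : P.IS n) : h t ≤ P.total h := by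
  refine le_trans ?_ (Cardinal.le_sum _ t)
  calc h t = 1 * h t := (one_mul _).symm
    _ ≤ P.wt t * h t := by gcongr; exact P.one_le_wt t

theorem total_eq_sizeTotal {n : ℕ} (hκ : P.κ = ℵ₀) (h : P.IS n → Cardinal.{u}) :
    P.total h = P.sizeTotal h := by
  simp [total, sizeTotal, wt, hκ]

theorem total_le_sizeTotal {n : ℕ} (h : P.IS n → Cardinal.{u}) :
    P.total h ≤ P.sizeTotal h := by
  refine Cardinal.sum_le_sum _ _ fun t => ?_
  gcongr
  unfold wt
  split_ifs
  · exact le_rfl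
  · exact P.one_le_lift_size t

theorem sizeTotal_le {n : ℕ} (hκ : P.κ ≠ ℵ₀) (h : P.IS n → Cardinal.{u}) :
    P.sizeTotal h ≤ ℵ₀ * P.total h := by
  unfold total
  rw [mul_sum']
  refine Cardinal.sum_le_sum _ _ fun t => ?_
  simp only [wt, hκ, if_false, one_mul]
  gcongr
  simpa using Cardinal.lift_le.{u}.2 t.1.size_le

/-- For an uncountable bound, or if `κ = ℵ₀`, the weights are immaterial. -/
theorem total_lt_iff {n : ℕ} (h : P.IS n → Cardinal.{u}) {c : Cardinal.{u}} (hc : P.κ ≤ c) :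
    P.total h < c ↔ P.sizeTotal h < c := by
  by_cases hκ : P.κ = ℵ₀
  · rw [P.total_eq_sizeTotal hκ]
  · refine ⟨fun hlt => (P.sizeTotal_le hκ h).trans_lt ?_, (P.total_le_sizeTotal h).trans_lt⟩
    have : ℵ₀ < c := (lt_of_le_of_ne P.aleph0_le (Ne.symm hκ)).trans_le hc
    exact Cardinal.mul_lt_of_lt this.le this hlt

theorem κ_le_μ : P.κ ≤ P.μ := Order.lt_succ_iff.1 (P.lt.trans_le P.le)

theorem total_eq_μ_iff {n : ℕ} (h : P.IS n → Cardinal.{u}) :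
    P.total h = P.μ ↔ P.sizeTotal h = P.μ := by
  have h1 := P.total_lt_iff h P.κ_le_μ
  have h2 := P.total_lt_iff h (P.κ_le_μ.trans (Order.le_succ _))
  rw [Order.lt_succ_iff, Order.lt_succ_iff] at h2
  have h3 := not_congr h1
  rw [not_lt, not_lt] at h3
  rw [le_antisymm_iff, le_antisymm_iff, h2, h3]

/-- The relation `E_n` on functions from `IS_n` to cardinals. -/
def E {n : ℕ} (h k : P.IS n → Cardinal.{u}) : Prop :=
  P.total (fun t => cdist (h t) (k t)) < P.κ

theorem E_equivalence (n : ℕ) : Equivalence (P.E (n := n)) where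
  refl h := by
    simpa [E, total, cdist_self] using Cardinal.aleph0_pos.trans_le P.aleph0_le
  symm {h k} hE := by
    unfold E at *
    simpa only [cdist_comm] using hE
  trans {h k l} h1 h2 := by
    refine lt_of_le_of_lt ?_ (Cardinal.add_lt_of_lt P.aleph0_le h1 h2)
    unfold total
    rw [← Cardinal.sum_add_distrib']
    refine Cardinal.sum_le_sum _ _ fun t => ?_
    rw [← mul_add]
    gcongr
    exact cdist_triangle _ _ _

/-- The relation `E_n` on the functions considered in the definition of `F_n`. -/
instance fSetoid (n : ℕ) : Setoid (P.FPre n) where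
  r h k := P.E h.1 k.1
  iseqv :=
    { refl := fun h => (P.E_equivalence n).refl h.1
      symm := fun h => (P.E_equivalence n).symm h
      trans := fun h k => (P.E_equivalence n).trans h k }

/-- The sort `F_n`. -/
def F (n : ℕ) : Type (u + 1) := Quotient (P.fSetoid n)

/-- The `E_n`-class of a function. -/
def cls {n : ℕ} (h : P.FPre n) : P.F n := Quotient.mk _ h

/-! ### The relations and functions of the signature -/

/-- The relation `Eq¹` on `IS_2`. -/
def Eq1 (t : P.IS 2) : Prop := ∃ T : TransTuple 2, T.Is t.1 ∧ T.g 0 = T.g 1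

/-- The relation `Prod¹` on `IS_3`. -/
def Prod1 (t : P.IS 3) : Prop := ∃ T : TransTuple 3, T.Is t.1 ∧ T.g 0 * T.g 1 = T.g 2

/-- The relation `Proj¹_n` between `IS_{n+1}` and `IS_n`. -/
def Proj1 {n : ℕ} (t₁ : P.IS (n + 1)) (t₂ : P.IS n) : Prop :=
  ∃ T : TransTuple (n + 1), T.Is t₁.1 ∧ ∃ B : Set T.A, HasType (initTuple T.g) B t₂.1

open Classical in
/-- The weight with which a type counts if `D` is the set of points where an equation fails: if
`κ > ℵ₀` one or zero, according as `D` is non-empty or not, and if `κ = ℵ₀` the size of `D`. -/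
def badWt (D : Set ℕ) : Cardinal.{u} :=
  if P.κ = ℵ₀ then Cardinal.lift.{u} #D else if D.Nonempty then 1 else 0

/-- The relation `Eq` on `F_2`: the equation `g₁ = g₂` fails on fewer than `κ` orbits
(for `κ = ℵ₀`: at fewer than `κ` points). -/
def EqF (x : P.F 2) : Prop :=
  ∃ h : P.FPre 2, P.cls h = x ∧
    (Cardinal.sum fun t : P.IS 2 =>
      P.badWt {m | ∃ a : t.1.out.A, (a : ℕ) = m ∧ t.1.out.g 0 a ≠ t.1.out.g 1 a} * h.1 t) < P.κ

/-- The relation `Prod` on `F_3`: the equation `g₁ g₂ = g₃` fails on fewer than `κ` orbits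
(for `κ = ℵ₀`: at fewer than `κ` points). -/
def ProdF (x : P.F 3) : Prop :=
  ∃ h : P.FPre 3, P.cls h = x ∧
    (Cardinal.sum fun t : P.IS 3 =>
      P.badWt {m | ∃ a : t.1.out.A, (a : ℕ) = m ∧
        (t.1.out.g 0 * t.1.out.g 1) a ≠ t.1.out.g 2 a} * h.1 t) < P.κ

theorem trunc_lt {ν : Cardinal.{u}} (h : ν < P.lam) :
    trunc P.κ ν < P.lam ∧ (trunc P.κ ν = 0 ∨ P.κ ≤ trunc P.κ ν) := by
  unfold trunc
  split_ifs with hκ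
  · exact ⟨h, Or.inr hκ⟩
  · exact ⟨Cardinal.aleph0_pos.trans_le (P.aleph0_le.trans P.lt.le), Or.inl rfl⟩

theorem trunc_eq_of_E {n : ℕ} {h k : P.IS n → Cardinal.{u}} (hE : P.E h k) (t : P.IS n) :
    trunc P.κ (h t) = trunc P.κ (k t) := by
  have key : ∀ {h k : P.IS n → Cardinal.{u}}, P.E h k → P.κ ≤ h t → h t ≤ k t := by
    intro h k hE hκ
    have hd : cdist (h t) (k t) < P.κ :=
      (P.le_total (fun t => cdist (h t) (k t)) t).trans_lt hE
    by_contra hcon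
    rw [not_le] at hcon
    exact absurd (cdist_le_iff.1 (le_refl (cdist (h t) (k t)))).1
      (not_le.2 (Cardinal.add_lt_of_lt (P.aleph0_le.trans hκ) hcon (hd.trans_le hκ)))
  have hE' := (P.E_equivalence n).symm hE
  unfold trunc
  split_ifs with h1 h2 h2
  · exact le_antisymm (key hE h1) (key hE' h2)
  · exact absurd (h1.trans (key hE h1)) h2
  · exact absurd (h2.trans (key hE' h2)) h1
  · rfl

/-- The function `App_n : F_n × IS_n → Card⁻`, which sends the class of `h` and `t` to `h(t)⁻`. -/
def App {n : ℕ} (x : P.F n) (t : P.IS n) : P.CardMinus :=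
  Quotient.lift (fun h : P.FPre n => (⟨trunc P.κ (h.1 t), P.trunc_lt (h.2.1 t)⟩ : P.CardMinus))
    (fun _ _ hE => Subtype.ext (P.trunc_eq_of_E hE t)) x

/-- `Proj_n` on functions. -/
def projFun {n : ℕ} (h : P.IS (n + 1) → Cardinal.{u}) (t : P.IS n) : Cardinal.{u} :=
  Cardinal.sum fun t' : P.IS (n + 1) => Cardinal.lift.{u} (orbCount t'.1 t.1) * h t'

/-- The points of all the orbits counted by `orbCount t' t`, for fixed `t'`. -/
theorem sum_size_orbCount {n : ℕ} (t' : IsoType (n + 1)) (p : IsoType n → Prop) :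
    (Cardinal.sum fun t : {t // p t} => t.1.size * orbCount t' t.1) ≤ t'.size ∧
    ((∀ t, p t) →
      (Cardinal.sum fun t : {t // p t} => t.1.size * orbCount t' t.1) = t'.size) := by
  set f := initTuple t'.out.g with hf
  let X := Σ t : {t // p t}, Σ B : {B : Set t'.out.A // IsOrbit f B ∧ HasType f B t.1}, B.1
  have hX : (Cardinal.sum fun t : {t // p t} => t.1.size * orbCount t' t.1) = #X := by
    rw [Cardinal.mk_sigma]
    congr 1
    ext t
    rw [Cardinal.mk_sigma]
    have : (fun B : {B : Set t'.out.A // IsOrbit f B ∧ HasType f B t.1} => #B.1)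
        = fun _ => t.1.size := by
      ext B
      simpa using B.2.2.mk_eq
    rw [this, Cardinal.sum_const', mul_comm]
    rfl
  rw [hX]
  let φ : X → t'.out.A := fun x => x.2.2.1
  have hφ : Function.Injective φ := by
    rintro ⟨t, ⟨B, hB, hT⟩, b, hb⟩ ⟨s, ⟨C, hC, hS⟩, c, hc⟩ h
    obtain rfl : b = c := h
    obtain ⟨x, rfl⟩ := hB
    obtain ⟨y, rfl⟩ := hC
    dsimp only at hb hc
    have hxy : orbit f x = orbit f y := (orbit_eq hb).trans (orbit_eq hc).symm
    obtain rfl : t = s := Subtype.ext (hT.unique (hxy ▸ hS))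
    congr!
  refine ⟨Cardinal.mk_le_of_injective hφ, fun hp => ?_⟩
  refine Cardinal.mk_congr (Equiv.ofBijective φ ⟨hφ, fun a => ?_⟩)
  obtain ⟨t, ht⟩ := exists_hasType f a
  exact ⟨⟨⟨t, hp t⟩, ⟨orbit f a, ⟨a, rfl⟩, ht⟩, ⟨a, mem_orbit_self f a⟩⟩, rfl⟩

theorem sizeTotal_projFun {n : ℕ} (h : P.IS (n + 1) → Cardinal.{u}) :
    P.sizeTotal (P.projFun h) ≤ P.sizeTotal h ∧
      (¬ P.lam ≤ P.μ → P.sizeTotal (P.projFun h) = P.sizeTotal h) := by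
  have key : P.sizeTotal (P.projFun h) = Cardinal.sum fun t' : P.IS (n + 1) =>
      Cardinal.lift.{u} (Cardinal.sum fun t : P.IS n => t.1.size * orbCount t'.1 t.1) * h t' := by
    unfold sizeTotal projFun
    simp only [mul_sum']
    rw [sum_comm']
    congr 1
    ext t'
    rw [mul_comm (Cardinal.lift.{u} _), Cardinal.lift_sum, mul_sum']
    congr 1
    ext t
    rw [Cardinal.lift_mul]
    ring
  rw [key]
  constructor
  · refine Cardinal.sum_le_sum _ _ fun t' => ?_
    gcongr
    exact Cardinal.lift_le.2 (sum_size_orbCount t'.1 _).1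
  · intro hlam
    unfold sizeTotal
    congr 1
    ext t'
    congr 2
    exact (sum_size_orbCount t'.1 (fun t => P.lam ≤ P.μ → ¬ t.IsTrivial)).2
      (fun t hl => absurd hl hlam)

theorem projFun_mem {n : ℕ} (h : P.FPre (n + 1)) :
    (∀ t, P.projFun h.1 t < P.lam) ∧ P.total (P.projFun h.1) < P.lam ∧
      (P.lam = Order.succ P.μ → P.total (P.projFun h.1) = P.μ) := by
  have h2 : P.total (P.projFun h.1) < P.lam := by
    rw [P.total_lt_iff _ P.lt.le]
    exact (P.sizeTotal_projFun h.1).1.trans_lt ((P.total_lt_iff _ P.lt.le).1 h.2.2.1)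
  refine ⟨fun t => (P.le_total _ t).trans_lt h2, h2, fun hlam => ?_⟩
  have hnot : ¬ P.lam ≤ P.μ := by
    rw [hlam, not_le]
    exact Order.lt_succ _
  rw [P.total_eq_μ_iff, (P.sizeTotal_projFun h.1).2 hnot, ← P.total_eq_μ_iff]
  exact h.2.2.2 hlam

theorem projFun_E {n : ℕ} {h k : P.IS (n + 1) → Cardinal.{u}} (hE : P.E h k) :
    P.E (P.projFun h) (P.projFun k) := by
  unfold E at *
  rw [P.total_lt_iff _ le_rfl] at hE ⊢
  refine lt_of_le_of_lt ?_ hE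
  refine le_trans ?_ (P.sizeTotal_projFun _).1
  refine Cardinal.sum_le_sum _ _ fun t => ?_
  gcongr
  refine (cdist_sum_le _ _).trans (Cardinal.sum_le_sum _ _ fun t' => ?_)
  exact cdist_mul_le _ _ _

/-- The function `Proj_n : F_{n+1} → F_n`. -/
def Proj {n : ℕ} (x : P.F (n + 1)) : P.F n :=
  Quotient.map (fun h : P.FPre (n + 1) => (⟨P.projFun h.1, P.projFun_mem h⟩ : P.FPre n))
    (fun _ _ hE => P.projFun_E hE) x

end Params

/-! ### The structure `M_{κ lam μ}` -/

/-- The sorts. There are sorts `IS_n` and `F_n` for every `n ≥ 1`; `is n` stands for `IS_{n+1}`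
and `fn n` stands for `F_{n+1}`. -/
inductive MSort : Type
  | is (n : ℕ)
  | card
  | fn (n : ℕ)

/-- The relation symbols; `proj1 n` is a relation between `IS_{n+2}` and `IS_{n+1}`. -/
inductive MRel : Type
  | eq1
  | prod1
  | proj1 (n : ℕ)
  | lt
  | eq
  | prod

/-- The function symbols; `app n` is a function from `F_{n+1} × IS_{n+1}` to `Card⁻`, and `proj n`
is a function from `F_{n+2}` to `F_{n+1}`. -/
inductive MFun : Type
  | app (n : ℕ)
  | proj (n : ℕ)

/-- The signature of the structures `M_{κ lam μ}`. -/
def mLang : MSLanguage where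
  Srt := MSort
  Rel := MRel
  relArity
    | .eq1 => 1
    | .prod1 => 1
    | .proj1 _ => 2
    | .lt => 2
    | .eq => 1
    | .prod => 1
  relSort
    | .eq1 => ![.is 1]
    | .prod1 => ![.is 2]
    | .proj1 n => ![.is (n + 1), .is n]
    | .lt => ![.card, .card]
    | .eq => ![.fn 1]
    | .prod => ![.fn 2]
  Fun := MFun
  funArity
    | .app _ => 2
    | .proj _ => 1
  funDom
    | .app n => ![.fn n, .is n]
    | .proj n => ![.fn (n + 1)]
  funCod
    | .app _ => .card
    | .proj n => .fn n

namespace Params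

variable (P : Params.{u})

/-- The elements of the various sorts. -/
def Carrier : MSort → Type (u + 1)
  | .is n => ULift.{u + 1} (P.IS (n + 1))
  | .card => P.CardMinus
  | .fn n => P.F (n + 1)

/-- The many-sorted structure `M_{κ lam μ}`. -/
def M : MSStructure.{u + 1} mLang where
  carrier := P.Carrier
  rel
    | .eq1 => fun x => P.Eq1 (x (0 : Fin 1) : ULift.{u + 1} (P.IS 2)).down
    | .prod1 => fun x => P.Prod1 (x (0 : Fin 1) : ULift.{u + 1} (P.IS 3)).down
    | .proj1 n => fun x => P.Proj1 (x (0 : Fin 2) : ULift.{u + 1} (P.IS (n + 2))).down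
        (x (1 : Fin 2) : ULift.{u + 1} (P.IS (n + 1))).down
    | .lt => fun x => (x (0 : Fin 2) : P.CardMinus).1 < (x (1 : Fin 2) : P.CardMinus).1
    | .eq => fun x => P.EqF (x (0 : Fin 1))
    | .prod => fun x => P.ProdF (x (0 : Fin 1))
  func
    | .app n => fun x => P.App (x (0 : Fin 2) : P.F (n + 1))
        (x (1 : Fin 2) : ULift.{u + 1} (P.IS (n + 1))).down
    | .proj n => fun x => P.Proj (x (0 : Fin 1) : P.F (n + 2))

/-! ### The representation -/

/-- The tuple `x` of group elements is pure, and represents the type `t`: either `t` is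
non-trivial, `x ≠ 1`, and the non-trivial orbits are of type `t`, outside a small set; or `t` is
trivial (and so `lam = μ⁺`), and all orbits are trivial, outside a small set. -/
def RepIS {n : ℕ} (x : Fin n → P.G) (t : P.IS n) : Prop :=
  ∃ f : Fin n → P.SLam, (∀ i, P.coset (f i) = x i) ∧
    ((¬ t.1.IsTrivial ∧ ¬ P.Small (supp (P.perm f)) ∧
        P.Small {a | a ∈ supp (P.perm f) ∧ ¬ HasType (P.perm f) (orbit (P.perm f) a) t.1}) ∨
      (t.1.IsTrivial ∧ P.Small (supp (P.perm f))))

/-- The group element `x` satisfies `x² = 1`, and represents the cardinal of its support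
(where cardinals below `κ` are replaced by zero). -/
def RepCard (x : P.G) (ν : P.CardMinus) : Prop :=
  x * x = 1 ∧ ∃ f : P.SLam, P.coset f = x ∧ ν.1 = trunc P.κ #{a | (f : Equiv.Perm P.Ω) a ≠ a}

/-- The tuple `x` of group elements represents the class of `Ch_f`, for `x` the tuple of cosets
of `f`. -/
def RepF {n : ℕ} (x : Fin n → P.G) (c : P.F n) : Prop :=
  ∃ f : Fin n → P.SLam, (∀ i, P.coset (f i) = x i) ∧ ∃ h : P.FPre n, h.1 = P.Ch f ∧ P.cls h = c

end Params

/-- The lengths of the representing tuples: `n` for `IS_n` and for `F_n`, and `1` for `Card⁻`. -/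
def mDim : MSort → ℕ
  | .is n => n + 1
  | .card => 1
  | .fn n => n + 1

/-- Members of `IS_n` are represented by pure `n`-tuples, members of `Card⁻` by involutions, and
members of `F_n` by `n`-tuples. -/
def Params.Rep (P : Params.{u}) : ∀ s : MSort, (Fin (mDim s) → P.G) → P.Carrier s → Prop
  | .is _ => fun x t => P.RepIS x t.down
  | .card => fun x ν => P.RepCard (x (0 : Fin 1)) ν
  | .fn _ => fun x c => P.RepF x c

end

end QuotSym

namespace QuotSym
noncomputable section

/-! ### Uniform definability in groups -/

/-! Everything is done modulo small sets. By `coset_eq`, an equality in `G` means agreement at all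
but fewer than `κ` points, so an element of `G` has a support only up to a small set (`Reg`). The
first task is to recover these supports from the group.

Let `g` have order five. If the supports of `x` and `g` are almost disjoint and `h` does not commute
with `x`, then many points are moved by `x` and `h` and fixed by `g`. Two permutations living on a
set of such points which `h` displaces give a double commutator `[[h, f₁], f₂]` that is non-trivial
and does not meet the support of `g` (`preDisj_of_disjoint`). If the supports overlap, take for `h`
an involution living on a part `U` of the overlap which `x`, `g`, ..., `g⁴` displace. A double
commutator of `h` with `f₁`, `f₂` lives on four translates of `U` by elements that commute with `g`.
If it commutes with `g`, its support is a union of cycles of `g`, and two of the five points of a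
cycle would lie in the same translate of `U`, which is impossible (`disjoint_of_preDisj`). Hence
disjointness of supports is definable (`disj_coset_iff`). So are inclusion (`Reg.sub_iff`) and, by
covering one support with two conjugates of another, comparison of cardinalities (`Reg.cardLe_iff`),
which settles the sort `Card⁻`.

On the side of the structure, the class of `Ch_f` determines the tuple `f` up to isomorphism after
removal of small invariant parts (`E_chr_iff`); only the counted points `Dset` matter, that is, all
points if `lam = μ⁺` and the non-fixed ones otherwise.

If `κ > ℵ₀`, orbits are countable, so an exceptional small set spoils only a small set of orbits
(`eventually_orbit`). Then almost isomorphic tuples are the same as conjugate tuples of `G`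
(`conj_iff_almostIso`), which gives `F_n`. Types are given by pure tuples: a tuple is pure if any
two large invariant regions contain large parts on which it acts isomorphically (`exists_repIS_iff`,
resting on the combinatorial `exists_split`). The orbits of a given type form a definable region
(`meets_iff`), whose cardinal gives `App_n` (`RepF.app_iff`).

If `κ = ℵ₀`, finite changes can join or cut infinite orbits, and genuine points have to be found
instead. A minimal non-trivial region invariant under `x` is one end of an infinite cycle of `x`
(`EndOf.exists_tail`). The ends below a region `b` that leaves enough room form a set `Pt x b` whose
permutations are all induced by elements of `G` (`exists_smul_eq`), whose subsets are all coded by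
elements (`exists_Pt_eq`), and which can have any cardinality below `lam` (`exists_coded`). So
actual tuples of permutations of actual sets are available, and the structure can be read off from
them.

For uncountable `κ` there are no minimal invariant regions (`not_endOf`), so one sentence decides
which of the two sets of formulae applies. Uniformity in `κ`, `lam`, `μ` is automatic, since `UDef`
asks for one formula that works in all groups. -/

/-- A family of functions on groups which is given by a term. -/
def UTerm {α : Type} (t : ∀ (G : Type u) [Group G], (α → G) → G) : Prop :=
  ∃ τ : groupLang.Term α, ∀ (G : Type u) [Group G] (v : α → G), τ.realize v = t G v

/-- A family of relations on groups which is defined by one formula in all groups. -/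
def UDef {α : Type} (R : ∀ (G : Type u) [Group G], (α → G) → Prop) : Prop :=
  ∃ φ : groupLang.Formula α, ∀ (G : Type u) [Group G] (v : α → G), φ.Realize v ↔ R G v

section Calculus

variable {α β : Type}

theorem UTerm.var (a : α) : UTerm.{u} fun _ _ v => v a :=
  ⟨FirstOrder.Language.Term.var a, fun _ _ _ => rfl⟩

theorem UTerm.one : UTerm.{u} (α := α) fun _ _ _ => 1 :=
  ⟨FirstOrder.Language.Term.func (L := groupLang) (l := 0) GroupFunc.one Fin.elim0,
    fun _ _ _ => rfl⟩

theorem UTerm.mul {s t : ∀ (G : Type u) [Group G], (α → G) → G} (hs : UTerm s) (ht : UTerm t) :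
    UTerm fun G _ v => s G v * t G v := by
  obtain ⟨σ, hσ⟩ := hs
  obtain ⟨τ, hτ⟩ := ht
  refine ⟨FirstOrder.Language.Term.func (L := groupLang) (l := 2) GroupFunc.mul ![σ, τ],
    fun G _ v => ?_⟩
  change _ = s G v * t G v
  rw [← hσ, ← hτ]
  rfl

theorem UTerm.inv {s : ∀ (G : Type u) [Group G], (α → G) → G} (hs : UTerm s) :
    UTerm fun G _ v => (s G v)⁻¹ := by
  obtain ⟨σ, hσ⟩ := hs
  refine ⟨FirstOrder.Language.Term.func (L := groupLang) (l := 1) GroupFunc.inv ![σ],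
    fun G _ v => ?_⟩
  change _ = (s G v)⁻¹
  rw [← hσ]
  rfl

theorem UDef.eq {s t : ∀ (G : Type u) [Group G], (α → G) → G} (hs : UTerm s) (ht : UTerm t) :
    UDef fun G _ v => s G v = t G v := by
  obtain ⟨σ, hσ⟩ := hs
  obtain ⟨τ, hτ⟩ := ht
  refine ⟨σ.equal τ, fun G _ v => ?_⟩
  rw [FirstOrder.Language.Formula.realize_equal, hσ, hτ]

theorem UDef.not {R : ∀ (G : Type u) [Group G], (α → G) → Prop} (hR : UDef R) :
    UDef fun G _ v => ¬ R G v := by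
  obtain ⟨φ, hφ⟩ := hR
  refine ⟨φ.not, fun G _ v => ?_⟩
  rw [FirstOrder.Language.Formula.realize_not, hφ]

theorem UDef.ne {s t : ∀ (G : Type u) [Group G], (α → G) → G} (hs : UTerm s) (ht : UTerm t) :
    UDef fun G _ v => s G v ≠ t G v := (UDef.eq hs ht).not

theorem UDef.imp {R S : ∀ (G : Type u) [Group G], (α → G) → Prop} (hR : UDef R) (hS : UDef S) :
    UDef fun G _ v => R G v → S G v := by
  obtain ⟨φ, hφ⟩ := hR
  obtain ⟨ψ, hψ⟩ := hS
  refine ⟨φ.imp ψ, fun G _ v => ?_⟩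
  rw [FirstOrder.Language.Formula.realize_imp, hφ, hψ]

theorem UDef.congr {R S : ∀ (G : Type u) [Group G], (α → G) → Prop} (hR : UDef R)
    (h : ∀ (G : Type u) [Group G] (v : α → G), R G v ↔ S G v) : UDef S := by
  obtain ⟨φ, hφ⟩ := hR
  exact ⟨φ, fun G _ v => (hφ G v).trans (h G v)⟩

theorem UDef.and {R S : ∀ (G : Type u) [Group G], (α → G) → Prop} (hR : UDef R) (hS : UDef S) :
    UDef fun G _ v => R G v ∧ S G v :=
  (hR.imp hS.not).not.congr fun _ _ _ => by tauto

theorem UDef.or {R S : ∀ (G : Type u) [Group G], (α → G) → Prop} (hR : UDef R) (hS : UDef S) :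
    UDef fun G _ v => R G v ∨ S G v :=
  (hR.not.imp hS).congr fun _ _ _ => by tauto

theorem UDef.iff {R S : ∀ (G : Type u) [Group G], (α → G) → Prop} (hR : UDef R) (hS : UDef S) :
    UDef fun G _ v => (R G v ↔ S G v) :=
  ((hR.imp hS).and (hS.imp hR)).congr fun _ _ _ => by tauto

/-- The quantified element becomes the extra coordinate `Sum.inr ()`. The hypothesis is again a
statement about `UDef`, so that quantifiers can be peeled off one at a time. -/
theorem UDef.ex {R : ∀ (G : Type u) [Group G], (α → G) → G → Prop}
    (hR : UDef (α := α ⊕ Unit) fun G _ v => R G (fun a => v (Sum.inl a)) (v (Sum.inr ()))) :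
    UDef fun G _ v => ∃ g : G, R G v g := by
  obtain ⟨φ, hφ⟩ := hR
  refine ⟨φ.iExs Unit, fun G _ v => ?_⟩
  rw [FirstOrder.Language.Formula.realize_iExs]
  simp only [hφ, Sum.elim_inl, Sum.elim_inr]
  exact ⟨fun ⟨i, hi⟩ => ⟨i (), hi⟩, fun ⟨g, hg⟩ => ⟨fun _ => g, hg⟩⟩

theorem UDef.all {R : ∀ (G : Type u) [Group G], (α → G) → G → Prop}
    (hR : UDef (α := α ⊕ Unit) fun G _ v => R G (fun a => v (Sum.inl a)) (v (Sum.inr ()))) :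
    UDef fun G _ v => ∀ g : G, R G v g :=
  (UDef.ex (R := fun G _ v g => ¬ R G v g) hR.not).not.congr fun _ _ _ => by
    simp only [not_exists, not_not]

/-- The index `i` does not range over the group: there is one formula for each `i`, and they are
joined by a finite conjunction. This is how tuples of arbitrary fixed length are handled. -/
theorem UDef.fall {n : ℕ} {R : Fin n → ∀ (G : Type u) [Group G], (α → G) → Prop}
    (hR : ∀ i, UDef (R i)) : UDef fun G _ v => ∀ i, R i G v := by
  choose φ hφ using hR
  refine ⟨FirstOrder.Language.Formula.iInf φ, fun G _ v => ?_⟩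
  simp only [FirstOrder.Language.Formula.realize_iInf, hφ]

theorem UDef.fex {n : ℕ} {R : Fin n → ∀ (G : Type u) [Group G], (α → G) → Prop}
    (hR : ∀ i, UDef (R i)) : UDef fun G _ v => ∃ i, R i G v :=
  (UDef.fall (R := fun i G _ v => ¬ R i G v) fun i => (hR i).not).not.congr fun _ _ _ => by
    simp only [not_forall, not_not]

/-- Closure under substitution of terms. Most relations below are shown to be definable in plain
variables, by following the connectives, and are then transferred to arbitrary terms by this rule.
-/
theorem UDef.subst {R : ∀ (G : Type u) [Group G], (β → G) → Prop} (hR : UDef R)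
    {t : β → ∀ (G : Type u) [Group G], (α → G) → G} (ht : ∀ b, UTerm (t b)) :
    UDef fun G _ v => R G fun b => t b G v := by
  obtain ⟨φ, hφ⟩ := hR
  choose τ hτ using ht
  refine ⟨FirstOrder.Language.BoundedFormula.subst φ τ, fun G _ v => ?_⟩
  change _ ↔ R G fun b => t b G v
  rw [← hφ, FirstOrder.Language.Formula.Realize, FirstOrder.Language.BoundedFormula.realize_subst]
  simp only [hτ]
  rfl

theorem UDef.subst₁ {R : ∀ (G : Type u) [Group G], G → Prop}
    (hR : UDef (α := Fin 1) fun G _ v => R G (v 0))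
    {s : ∀ (G : Type u) [Group G], (α → G) → G} (hs : UTerm s) :
    UDef fun G _ v => R G (s G v) :=
  hR.subst (t := fun _ => s) fun _ => hs

theorem UDef.subst₂ {R : ∀ (G : Type u) [Group G], G → G → Prop}
    (hR : UDef (α := Fin 2) fun G _ v => R G (v 0) (v 1))
    {s t : ∀ (G : Type u) [Group G], (α → G) → G} (hs : UTerm s) (ht : UTerm t) :
    UDef fun G _ v => R G (s G v) (t G v) :=
  hR.subst (t := fun b => if b = 0 then s else t) fun b => by
    split_ifs
    exacts [hs, ht]

end Calculus

/-! ### The definable relations common to all cases -/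

section Relations

variable {G : Type u} [Group G]

/-- For `g` of order five this says that the supports of `x` and `g` are disjoint. -/
def PreDisj (x g : G) : Prop :=
  ∀ h, x * h ≠ h * x → ∃ f₁ f₂, f₁ * g = g * f₁ ∧ f₂ * g = g * f₂ ∧
    (h * f₁ * h⁻¹ * f₁⁻¹) * f₂ * (h * f₁ * h⁻¹ * f₁⁻¹)⁻¹ * f₂⁻¹ ≠ 1 ∧
    ((h * f₁ * h⁻¹ * f₁⁻¹) * f₂ * (h * f₁ * h⁻¹ * f₁⁻¹)⁻¹ * f₂⁻¹) * g =
      g * ((h * f₁ * h⁻¹ * f₁⁻¹) * f₂ * (h * f₁ * h⁻¹ * f₁⁻¹)⁻¹ * f₂⁻¹)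

/-- The supports of `x` and `y` are disjoint. -/
def Disj (x y : G) : Prop :=
  ∃ s, s * s * s * s * s = 1 ∧ PreDisj x s ∧
    ∀ r, r * r * r * r * r = 1 → PreDisj s r → PreDisj y r

/-- The support of `x` is contained in the support of `y`. -/
def Sub (x y : G) : Prop := ∀ z, Disj z y → Disj z x

/-- The supports of `x` and `y` are equal. -/
def EqR (x y : G) : Prop := Sub x y ∧ Sub y x

/-- The cardinal of the support of `x` is at most that of `y`. -/
def CardLe (x y : G) : Prop :=
  ∃ z₁ z₂ : G, ∀ w, Disj w (z₁ * y * z₁⁻¹) → Disj w (z₂ * y * z₂⁻¹) → Disj w x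

/-- Some element has full support. -/
def FullSupp (G : Type u) [Group G] : Prop := ∃ s : G, ∀ w, Disj w s → w = 1

end Relations

section

variable {α : Type} {s t : ∀ (G : Type u) [Group G], (α → G) → G}

theorem UDef.preDisj (hs : UTerm s) (ht : UTerm t) :
    UDef fun G _ v => PreDisj (s G v) (t G v) := by
  refine UDef.subst₂ (R := fun G _ x y => PreDisj x y) ?_ hs ht
  unfold PreDisj
  repeat' first
    | apply UDef.ne | apply UDef.all | apply UDef.imp | apply UDef.ex | apply UDef.and
    | apply UDef.eq | apply UTerm.mul | apply UTerm.inv | exact UTerm.var _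
    | exact UTerm.one

theorem UDef.disj (hs : UTerm s) (ht : UTerm t) :
    UDef fun G _ v => Disj (s G v) (t G v) := by
  refine UDef.subst₂ (R := fun G _ x y => Disj x y) ?_ hs ht
  unfold Disj
  repeat' first
    | apply UDef.preDisj | apply UDef.all | apply UDef.imp | apply UDef.ex | apply UDef.and
    | apply UDef.eq | apply UTerm.mul | apply UTerm.inv | exact UTerm.var _
    | exact UTerm.one

theorem UDef.sub (hs : UTerm s) (ht : UTerm t) :
    UDef fun G _ v => Sub (s G v) (t G v) := by
  refine UDef.subst₂ (R := fun G _ x y => Sub x y) ?_ hs ht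
  unfold Sub
  repeat' first
    | apply UDef.disj | apply UDef.all | apply UDef.imp | exact UTerm.var _

theorem UDef.eqR (hs : UTerm s) (ht : UTerm t) :
    UDef fun G _ v => EqR (s G v) (t G v) := (UDef.sub hs ht).and (UDef.sub ht hs)

theorem UDef.cardLe (hs : UTerm s) (ht : UTerm t) :
    UDef fun G _ v => CardLe (s G v) (t G v) := by
  refine UDef.subst₂ (R := fun G _ x y => CardLe x y) ?_ hs ht
  unfold CardLe
  repeat' first
    | apply UDef.disj | apply UDef.all | apply UDef.imp | apply UDef.ex | apply UTerm.mul
    | apply UTerm.inv | exact UTerm.var _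

theorem UDef.fullSupp : UDef.{u} (α := α) fun G _ _ => FullSupp G := by
  unfold FullSupp
  repeat' first
    | apply UDef.disj | apply UDef.all | apply UDef.imp | apply UDef.ex | apply UDef.eq
    | exact UTerm.var _ | exact UTerm.one

end

end
end QuotSym

namespace QuotSym
noncomputable section

/-! ### Sets displaced by a permutation, and permutations built from blocks -/

/-- Zorn's lemma. Maximality is recorded in the last clause: `U`, its preimage and its image under
`p` cover `S`, so `U` cannot be much smaller than `S`. Here `p` is any map; it is a permutation in
`exists_displaced` and a successor function on a set of cardinals in `exists_cofinal_pair`. -/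
theorem exists_maximal_displaced {X : Type u} (p : X → X) (S : Set X) (hS : ∀ a ∈ S, p a ≠ a) :
    ∃ U ⊆ S, (∀ a ∈ U, p a ∉ U) ∧ ∀ s ∈ S, s ∈ U ∨ p s ∈ U ∨ ∃ a ∈ U, p a = s := by
  obtain ⟨U, hU⟩ := zorn_subset {U : Set X | U ⊆ S ∧ ∀ a ∈ U, p a ∉ U} (by
    intro c hc hchain
    refine ⟨⋃₀ c, ⟨Set.sUnion_subset fun V hV => (hc hV).1, ?_⟩, fun V hV => Set.subset_sUnion_of_mem hV⟩
    rintro a ⟨V, hV, ha⟩ ⟨W, hW, hp⟩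
    rcases hchain.total hV hW with h | h
    · exact (hc hW).2 a (h ha) hp
    · exact (hc hV).2 a ha (h hp))
  refine ⟨U, hU.prop.1, hU.prop.2, fun s hs => ?_⟩
  by_contra hcon
  push Not at hcon
  obtain ⟨h1, h2, h3⟩ := hcon
  refine h1 (hU.le_of_ge (y := insert s U) ⟨Set.insert_subset hs hU.prop.1, ?_⟩
    (Set.subset_insert s U) (Set.mem_insert s U))
  rintro a (rfl | ha) (h | h)
  · exact hS _ hs h
  · exact h2 h
  · exact h3 a ha h
  · exact hU.prop.2 a ha h

/-- An infinite cardinal absorbs a finite factor. Permutations of the finite factor then act on all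
blocks simultaneously. -/
theorem exists_block {X : Type u} (A : Set X) (hA : A.Infinite) {k : ℕ} (hk : k ≠ 0) :
    ∃ φ : A × Fin k ↪ X, Set.range φ = A := by
  have h1 : ℵ₀ ≤ #A := by
    have := hA.to_subtype
    exact Cardinal.aleph0_le_mk A
  have h2 : #(A × Fin k) = #A := by
    rw [Cardinal.mk_prod, Cardinal.lift_uzero, Cardinal.mk_fin, Cardinal.lift_natCast]
    exact Cardinal.mul_eq_left h1 ((Cardinal.natCast_lt_aleph0 (n := k)).le.trans h1) (by exact_mod_cast hk)
  obtain ⟨e⟩ := Cardinal.eq.1 h2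
  refine ⟨e.toEmbedding.trans (Function.Embedding.subtype _), ?_⟩
  ext a
  constructor
  · rintro ⟨x, rfl⟩
    exact (e x).2
  · intro ha
    exact ⟨e.symm ⟨a, ha⟩, by simp⟩

/-- The permutation which acts as `σ` on the second coordinate of all the blocks of `φ`. -/
def blockPerm {X I : Type u} {k : ℕ} (φ : I × Fin k ↪ X) (σ : Equiv.Perm (Fin k)) :
    Equiv.Perm X :=
  Equiv.Perm.viaEmbedding (Equiv.prodCongr (Equiv.refl I) σ) φ

section blockPerm

variable {X I : Type u} {k : ℕ} (φ : I × Fin k ↪ X) (σ : Equiv.Perm (Fin k))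

theorem blockPerm_apply (i : I) (j : Fin k) : blockPerm φ σ (φ (i, j)) = φ (i, σ j) := by
  rw [blockPerm, Equiv.Perm.viaEmbedding_apply]
  rfl

theorem blockPerm_of_notMem {a : X} (h : a ∉ Set.range φ) : blockPerm φ σ a = a :=
  Equiv.Perm.viaEmbedding_apply_of_notMem _ _ _ h

theorem blockPerm_inv : (blockPerm φ σ)⁻¹ = blockPerm φ σ⁻¹ := by
  rw [inv_eq_iff_mul_eq_one]
  ext a
  by_cases h : a ∈ Set.range φ
  · obtain ⟨⟨i, j⟩, rfl⟩ := h
    simp [blockPerm_apply]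
  · simp [blockPerm_of_notMem _ _ h]

theorem blockPerm_pow_apply (m : ℕ) (i : I) (j : Fin k) :
    (blockPerm φ σ ^ m) (φ (i, j)) = φ (i, (σ ^ m) j) := by
  induction m generalizing j with
  | zero => simp
  | succ m ih => rw [pow_succ, Equiv.Perm.mul_apply, blockPerm_apply, ih, pow_succ]; rfl

end blockPerm

/-- Cut `A` into blocks of length `k` and rotate each of them; a rotation of length at least two has
no fixed points. -/
theorem exists_perm_pow_eq_one {X : Type u} (A : Set X) (hA : A.Infinite) {k : ℕ} (hk : 2 ≤ k) :
    ∃ f : Equiv.Perm X, f ^ k = 1 ∧ ∀ a, f a ≠ a ↔ a ∈ A := by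
  obtain ⟨k, rfl⟩ := Nat.exists_eq_add_of_le' hk
  obtain ⟨φ, hφ⟩ := exists_block A hA (k := k + 2) (by omega)
  refine ⟨blockPerm φ (finRotate (k + 2)), ?_, fun a => ?_⟩
  · ext a
    by_cases h : a ∈ Set.range φ
    · obtain ⟨⟨i, j⟩, rfl⟩ := h
      have : finRotate (k + 2) ^ (k + 2) = 1 := by
        have := pow_orderOf_eq_one (finRotate (k + 2))
        rwa [(isCycle_finRotate (n := k)).orderOf, support_finRotate, Finset.card_univ,
          Fintype.card_fin] at this
      rw [blockPerm_pow_apply, this]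
      rfl
    · have h1 := blockPerm_of_notMem φ (finRotate (k + 2)) h
      rw [Equiv.Perm.one_apply]
      exact Equiv.Perm.pow_apply_eq_self_of_apply_eq_self h1 _
  · have hφ' : a ∈ A ↔ a ∈ Set.range φ := iff_of_eq (congrArg (a ∈ ·) hφ.symm)
    rw [hφ']
    constructor
    · intro h
      by_contra hcon
      exact h (blockPerm_of_notMem _ _ hcon)
    · rintro ⟨⟨i, j⟩, rfl⟩
      rw [blockPerm_apply]
      intro h
      have := φ.injective h
      simp only [Prod.mk.injEq, true_and] at this
      rw [finRotate_apply] at this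
      simp at this

/-- As `h` moves `U` off itself, `h * p * h⁻¹` is trivial on `U`, so `[h, p]` acts on `U` as `p⁻¹`.
Since `q` lives on `U`, its commutator with `[h, p]` sees nothing else, and `h` disappears from the
result. -/
theorem double_commutator {X : Type u} {U : Set X} (h p q : Equiv.Perm X)
    (hp : ∀ a, a ∉ U → p a = a) (hp₁ : ∀ a ∈ U, p⁻¹ a ∈ U) (hp₂ : ∀ a ∈ U, p a ∈ U)
    (hq : ∀ a, a ∉ U → q a = a) (hq₁ : ∀ a ∈ U, q⁻¹ a ∈ U) (hq₂ : ∀ a ∈ U, q a ∈ U)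
    (hU : ∀ a ∈ U, h a ∉ U) :
    (h * p * h⁻¹ * p⁻¹) * q * (h * p * h⁻¹ * p⁻¹)⁻¹ * q⁻¹ = p⁻¹ * q * p * q⁻¹ := by
  have hU' : ∀ a ∈ U, h⁻¹ a ∉ U := fun a ha hcon => hU _ hcon (by simpa using ha)
  set k := h * p * h⁻¹ * p⁻¹ with hk
  have hk₁ : ∀ a ∈ U, k a = p⁻¹ a := by
    intro a ha
    simp only [hk, Equiv.Perm.mul_apply]
    rw [hp _ (hU' _ (hp₁ _ ha))]
    simp
  have hk₂ : ∀ a ∈ U, k⁻¹ a = p a := by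
    intro a ha
    rw [Equiv.Perm.inv_eq_iff_eq, hk₁ _ (hp₂ _ ha)]
    simp
  have hk₃ : ∀ a, a ∉ U → k⁻¹ a ∉ U := by
    intro a ha hcon
    have := hk₁ _ hcon
    rw [show k (k⁻¹ a) = a by simp] at this
    exact ha (this ▸ hp₁ _ hcon)
  have inv_off : ∀ r : Equiv.Perm X, (∀ a, a ∉ U → r a = a) → ∀ a, a ∉ U → r⁻¹ a = a := by
    intro r hr a ha
    rw [Equiv.Perm.inv_eq_iff_eq, hr a ha]
  ext a
  simp only [Equiv.Perm.mul_apply]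
  by_cases ha : a ∈ U
  · rw [hk₂ _ (hq₁ _ ha), hk₁ _ (hq₂ _ (hp₂ _ (hq₁ _ ha)))]
  · rw [inv_off q hq a ha, hq _ (hk₃ a ha), hp a ha, hq a ha, inv_off p hp a ha]
    simp

namespace Params

variable (P : Params.{u})

/-! ### The filter of sets with small complement -/

variable {P} in
theorem Small.mono {A B : Set P.Ω} (hB : P.Small B) (h : A ⊆ B) : P.Small A :=
  (Cardinal.mk_le_mk_of_subset h).trans_lt hB

variable {P} in
theorem Small.union {A B : Set P.Ω} (hA : P.Small A) (hB : P.Small B) : P.Small (A ∪ B) :=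
  (Cardinal.mk_union_le A B).trans_lt (Cardinal.add_lt_of_lt P.aleph0_le hA hB)

theorem small_of_finite {A : Set P.Ω} (hA : A.Finite) : P.Small A :=
  (Cardinal.lt_aleph0_iff_set_finite.2 hA).trans_le P.aleph0_le

/-- The filter of the sets with small complement. -/
def fil : Filter P.Ω :=
  Filter.comk P.Small (P.small_of_finite Set.finite_empty) (fun _ ht _ hs => ht.mono hs)
    (fun _ hs _ ht => hs.union ht)

theorem eventually_iff {p : P.Ω → Prop} : (∀ᶠ a in P.fil, p a) ↔ P.Small {a | ¬ p a} := by
  rw [Filter.Eventually, fil, Filter.mem_comk]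
  rfl

theorem eventually_notMem {A : Set P.Ω} : (∀ᶠ a in P.fil, a ∉ A) ↔ P.Small A := by
  rw [eventually_iff]
  simp

variable {P} in
theorem eventually_perm {q : P.Ω → Prop} (h : ∀ᶠ a in P.fil, q a) (p : Equiv.Perm P.Ω) :
    ∀ᶠ a in P.fil, q (p a) := by
  rw [eventually_iff] at *
  have : {a | ¬ q (p a)} = p ⁻¹' {a | ¬ q a} := rfl
  rw [this]
  refine lt_of_le_of_lt ?_ h
  exact Cardinal.mk_preimage_of_injective p _ p.injective

theorem eventually_perm_iff {q : P.Ω → Prop} (p : Equiv.Perm P.Ω) :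
    (∀ᶠ a in P.fil, q (p a)) ↔ ∀ᶠ a in P.fil, q a :=
  ⟨fun h => (eventually_perm h p⁻¹).mono fun a ha => by simpa using ha, fun h => eventually_perm h p⟩

theorem not_small_univ : ¬ P.Small Set.univ := by
  rw [Small, Cardinal.mk_univ, not_lt]
  exact P.κ_le_μ

variable {P} in
theorem infinite_of_not_small {A : Set P.Ω} (hA : ¬ P.Small A) : A.Infinite :=
  fun h => hA (P.small_of_finite h)

variable {P} in
-- By maximality, `S` is covered by `U` and its two translates under `p` and `p⁻¹`; if `U` were
-- small, so would be the translates, and hence `S`.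
theorem exists_displaced {S : Set P.Ω} (hS : ¬ P.Small S) (p : Equiv.Perm P.Ω)
    (hp : ∀ a ∈ S, p a ≠ a) : ∃ U ⊆ S, ¬ P.Small U ∧ ∀ a ∈ U, p a ∉ U := by
  obtain ⟨U, hUS, hU, hmax⟩ := exists_maximal_displaced p S hp
  refine ⟨U, hUS, fun hsmall => hS ?_, hU⟩
  rw [← eventually_notMem] at *
  filter_upwards [hsmall, eventually_perm hsmall p, eventually_perm hsmall p⁻¹] with a h1 h2 h3 ha
  rcases hmax a ha with h | h | ⟨b, hb, rfl⟩
  · exact h1 h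
  · exact h2 h
  · simp at h3
    exact h3 hb

variable {P} in
theorem exists_displaced_list (l : List (Equiv.Perm P.Ω)) {S : Set P.Ω} (hS : ¬ P.Small S)
    (hp : ∀ p ∈ l, ∀ a ∈ S, p a ≠ a) :
    ∃ U ⊆ S, ¬ P.Small U ∧ ∀ p ∈ l, ∀ a ∈ U, p a ∉ U := by
  induction l with
  | nil => exact ⟨S, subset_rfl, hS, by simp⟩
  | cons p l ih =>
    obtain ⟨U, hUS, hU, h⟩ := ih fun q hq => hp q (List.mem_cons_of_mem _ hq)
    obtain ⟨V, hVU, hV, h'⟩ := exists_displaced hU p fun a ha => hp p (by simp) a (hUS ha)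
    refine ⟨V, hVU.trans hUS, hV, fun q hq a ha => ?_⟩
    rcases List.mem_cons.1 hq with rfl | hq
    · exact h' a ha
    · exact fun hcon => h q hq a (hVU ha) (hVU hcon)

/-! ### Cosets -/

theorem mem_SLam_of_subset {f : Equiv.Perm P.Ω} {A : Set P.Ω} (hA : #A < P.lam)
    (h : ∀ a, f a ≠ a → a ∈ A) : f ∈ P.SLam :=
  (Cardinal.mk_le_mk_of_subset (show {a | f a ≠ a} ⊆ A from h)).trans_lt hA

theorem small_lt_lam {A : Set P.Ω} (hA : P.Small A) : #A < P.lam := hA.trans P.lt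

theorem aleph0_lt_lam : ℵ₀ < P.lam := P.aleph0_le.trans_lt P.lt

theorem aleph0_le_μ : ℵ₀ ≤ P.μ := P.aleph0_le.trans P.κ_le_μ

theorem coset_surj (x : P.G) : ∃ f : P.SLam, P.coset f = x := QuotientGroup.mk_surjective x

theorem coset_mul (f g : P.SLam) : P.coset (f * g) = P.coset f * P.coset g := rfl

theorem coset_inv (f : P.SLam) : P.coset f⁻¹ = (P.coset f)⁻¹ := rfl

theorem coset_one : P.coset 1 = 1 := rfl

theorem coset_eq {f g : P.SLam} :
    P.coset f = P.coset g ↔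
      ∀ᶠ a in P.fil, (f : Equiv.Perm P.Ω) a = (g : Equiv.Perm P.Ω) a := by
  rw [coset, coset, QuotientGroup.eq, Subgroup.mem_subgroupOf, eventually_iff]
  change #_ < P.κ ↔ #_ < P.κ
  have : {a | ((f⁻¹ * g : P.SLam) : Equiv.Perm P.Ω) a ≠ a} =
      {a | ¬ (f : Equiv.Perm P.Ω) a = (g : Equiv.Perm P.Ω) a} := by
    ext a
    simp only [Set.mem_ofPred_eq, Subgroup.coe_mul, Subgroup.coe_inv, Equiv.Perm.mul_apply, ne_eq,
      Equiv.Perm.inv_eq_iff_eq, not_iff_not]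
    exact eq_comm
  rw [this]

theorem coset_eq_one {f : P.SLam} :
    P.coset f = 1 ↔ ∀ᶠ a in P.fil, (f : Equiv.Perm P.Ω) a = a := by
  rw [← coset_one, coset_eq]
  rfl

/-! ### Regions -/

/-- The support of `x` is `A`, up to a small set. -/
def Reg (x : P.G) (A : Set P.Ω) : Prop :=
  ∃ f : P.SLam, P.coset f = x ∧ ∀ᶠ a in P.fil, ((f : Equiv.Perm P.Ω) a ≠ a ↔ a ∈ A)

variable {P}

theorem reg_coset_iff {f : P.SLam} {A : Set P.Ω} :
    P.Reg (P.coset f) A ↔ ∀ᶠ a in P.fil, ((f : Equiv.Perm P.Ω) a ≠ a ↔ a ∈ A) := by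
  constructor
  · rintro ⟨g, hg, h⟩
    rw [coset_eq] at hg
    filter_upwards [hg, h] with a h1 h2
    rw [← h1, h2]
  · exact fun h => ⟨f, rfl, h⟩

theorem reg_coset (f : P.SLam) : P.Reg (P.coset f) {a | (f : Equiv.Perm P.Ω) a ≠ a} :=
  ⟨f, rfl, by simp⟩

theorem exists_reg (x : P.G) : ∃ A, P.Reg x A ∧ #A < P.lam := by
  obtain ⟨f, rfl⟩ := P.coset_surj x
  exact ⟨_, reg_coset f, f.2⟩

theorem Reg.congr {x : P.G} {A B : Set P.Ω} (h : P.Reg x A)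
    (hAB : ∀ᶠ a in P.fil, a ∈ A ↔ a ∈ B) : P.Reg x B := by
  obtain ⟨f, hf, h⟩ := h
  refine ⟨f, hf, ?_⟩
  filter_upwards [h, hAB] with a h1 h2
  rw [h1, h2]

theorem Reg.unique {x : P.G} {A B : Set P.Ω} (h : P.Reg x A) (h' : P.Reg x B) :
    ∀ᶠ a in P.fil, a ∈ A ↔ a ∈ B := by
  obtain ⟨f, rfl⟩ := P.coset_surj x
  rw [reg_coset_iff] at h h'
  filter_upwards [h, h'] with a h1 h2
  rw [← h1, h2]

theorem Reg.eq_one_iff {x : P.G} {A : Set P.Ω} (h : P.Reg x A) : x = 1 ↔ P.Small A := by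
  obtain ⟨f, rfl⟩ := P.coset_surj x
  rw [reg_coset_iff] at h
  rw [coset_eq_one, ← eventually_notMem]
  apply Filter.eventually_congr
  filter_upwards [h] with a h1
  rw [← h1, not_not]

theorem Reg.conj {x : P.G} {A : Set P.Ω} (h : P.Reg x A) (z : P.SLam) :
    P.Reg (P.coset z * x * (P.coset z)⁻¹) {a | (z : Equiv.Perm P.Ω)⁻¹ a ∈ A} := by
  obtain ⟨f, rfl⟩ := P.coset_surj x
  rw [← coset_inv, ← coset_mul, ← coset_mul, reg_coset_iff] at *
  filter_upwards [eventually_perm h (z : Equiv.Perm P.Ω)⁻¹] with a h1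
  refine Iff.trans ?_ h1
  simp only [Subgroup.coe_mul, Subgroup.coe_inv, Equiv.Perm.mul_apply, ne_eq, not_iff_not]
  rw [Equiv.Perm.eq_inv_iff_eq]

theorem Reg.conj_inv {x : P.G} {A : Set P.Ω} (h : P.Reg x A) (z : P.SLam) :
    P.Reg ((P.coset z)⁻¹ * x * P.coset z) {a | (z : Equiv.Perm P.Ω) a ∈ A} := by
  have := h.conj z⁻¹
  rw [coset_inv, inv_inv] at this
  simpa using this

/-- Blocks need an infinite set, but a finite set is small, and then the identity has the right
support. -/
theorem exists_pow_eq_one {A : Set P.Ω} (hA : #A < P.lam) {k : ℕ} (hk : 2 ≤ k) :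
    ∃ x : P.G, x ^ k = 1 ∧ P.Reg x A := by
  by_cases h : A.Finite
  · refine ⟨1, one_pow _, 1, coset_one P, ?_⟩
    filter_upwards [eventually_notMem P |>.2 (P.small_of_finite h)] with a ha
    simp [ha]
  · obtain ⟨f, h1, h2⟩ := exists_perm_pow_eq_one A h hk
    have hf : f ∈ P.SLam := P.mem_SLam_of_subset hA fun a => (h2 a).1
    refine ⟨P.coset ⟨f, hf⟩, ?_, ⟨f, hf⟩, rfl, Filter.Eventually.of_forall h2⟩
    have h3 : (⟨f, hf⟩ : P.SLam) ^ k = 1 := Subtype.ext (by simpa using h1)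
    change P.coset (⟨f, hf⟩ ^ k) = 1
    rw [h3, coset_one]

theorem exists_elem {A : Set P.Ω} (hA : #A < P.lam) : ∃ x : P.G, P.Reg x A :=
  (exists_pow_eq_one hA le_rfl).imp fun _ h => h.2

/-! ### Definability of disjointness -/

/-- The order of `g` plays no role in this direction. The witnesses live on a set where `g` is
trivial, so they and their double commutator commute with `g` exactly and not only up to a small
set. -/
theorem preDisj_of_disjoint {f g : P.SLam}
    (hd : ∀ᶠ a in P.fil, (f : Equiv.Perm P.Ω) a = a ∨ (g : Equiv.Perm P.Ω) a = a) :
    PreDisj (P.coset f) (P.coset g) := by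
  intro h hne
  obtain ⟨h, rfl⟩ := P.coset_surj h
  set S : Set P.Ω := {a | (f : Equiv.Perm P.Ω) a ≠ a ∧ (h : Equiv.Perm P.Ω) a ≠ a ∧
    (g : Equiv.Perm P.Ω) a = a}
  have hS : ¬ P.Small S := by
    intro hs
    apply hne
    rw [← coset_mul, ← coset_mul, coset_eq]
    rw [← eventually_notMem] at hs
    -- If `S` were small, the supports of `f` and `h` would be almost disjoint, and `f` and `h`
    -- would commute modulo a small set.
    have key : ∀ᶠ a in P.fil, (f : Equiv.Perm P.Ω) a = a ∨ (h : Equiv.Perm P.Ω) a = a := by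
      filter_upwards [hs, hd] with a h1 h2
      simp only [S, Set.mem_ofPred_eq] at h1
      tauto
    filter_upwards [key, eventually_perm key f, eventually_perm key h] with a h1 h2 h3
    simp only [Subgroup.coe_mul, Equiv.Perm.mul_apply, EmbeddingLike.apply_eq_iff_eq] at *
    rcases h1 with h1 | h1
    · rcases h3 with h3 | h3
      · rw [h3, h1]
      · rw [h3, h1, h3]
    · rcases h2 with h2 | h2
      · rw [h2, h1, h2]
      · rw [h2, h1]
  obtain ⟨U, hUS, hU, hdis⟩ := exists_displaced hS h fun a ha => ha.2.1
  -- Three points in a block are needed: `f₁` and `f₂` act on it as two transpositions that do not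
  -- commute, and the double commutator becomes a 3-cycle, which moves every point of `U`.
  obtain ⟨φ, hφ⟩ := exists_block U (infinite_of_not_small hU) (k := 3) (by omega)
  have hmem : ∀ σ, blockPerm φ σ ∈ P.SLam := fun σ =>
    P.mem_SLam_of_subset f.2 (fun a ha => by
      have : a ∈ U := by
        by_contra hcon
        exact ha (blockPerm_of_notMem _ _ fun h' => hcon (hφ.subset h'))
      exact (hUS this).1)
  have hU' : ∀ a, a ∈ U ↔ a ∈ Set.range φ := fun a => iff_of_eq (congrArg (a ∈ ·) hφ.symm)
  have hoff : ∀ σ, ∀ a, a ∉ U → blockPerm φ σ a = a := fun σ a ha =>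
    blockPerm_of_notMem _ _ fun hcon => ha ((hU' a).2 hcon)
  have hin : ∀ σ, ∀ a ∈ U, blockPerm φ σ a ∈ U := by
    intro σ a ha
    rw [hU'] at ha ⊢
    obtain ⟨⟨i, j⟩, rfl⟩ := ha
    exact ⟨_, (blockPerm_apply φ σ i j).symm⟩
  have hcomm : ∀ p : Equiv.Perm P.Ω, (∀ a, a ∉ U → p a = a) →
      p * (g : Equiv.Perm P.Ω) = (g : Equiv.Perm P.Ω) * p := by
    intro p hp
    refine (Equiv.Perm.Disjoint.commute fun a => ?_).eq
    by_cases ha : a ∈ U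
    · exact Or.inr (hUS ha).2.2
    · exact Or.inl (hp a ha)
  set σ₁ : Equiv.Perm (Fin 3) := Equiv.swap 0 1
  set σ₂ : Equiv.Perm (Fin 3) := Equiv.swap 1 2
  set f₁ : P.SLam := ⟨blockPerm φ σ₁, hmem _⟩ with hf₁
  set f₂ : P.SLam := ⟨blockPerm φ σ₂, hmem _⟩ with hf₂
  set c : P.SLam := (h * f₁ * h⁻¹ * f₁⁻¹) * f₂ * (h * f₁ * h⁻¹ * f₁⁻¹)⁻¹ * f₂⁻¹ with hc
  have hcc : (c : Equiv.Perm P.Ω) =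
      (blockPerm φ σ₁)⁻¹ * blockPerm φ σ₂ * blockPerm φ σ₁ * (blockPerm φ σ₂)⁻¹ :=
    double_commutator (U := U) _ _ _ (hoff _) (by rw [blockPerm_inv]; exact hin _)
      (hin _) (hoff _) (by rw [blockPerm_inv]; exact hin _) (hin _) hdis
  have hcoff : ∀ a, a ∉ U → (c : Equiv.Perm P.Ω) a = a := by
    intro a ha
    rw [hcc]
    simp only [blockPerm_inv, Equiv.Perm.mul_apply]
    rw [hoff _ a ha, hoff _ a ha, hoff _ a ha, hoff _ a ha]
  have hcon : ∀ a ∈ U, (c : Equiv.Perm P.Ω) a = (blockPerm φ (σ₁⁻¹ * σ₂ * σ₁ * σ₂⁻¹)) a := by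
    intro a ha
    rw [hcc]
    rw [hU'] at ha
    obtain ⟨⟨i, j⟩, rfl⟩ := ha
    simp [blockPerm_apply, blockPerm_inv]
  refine ⟨P.coset f₁, P.coset f₂, ?_, ?_, ?_, ?_⟩
  · rw [← coset_mul, ← coset_mul]
    exact congrArg P.coset (Subtype.ext (hcomm _ (hoff σ₁)))
  · rw [← coset_mul, ← coset_mul]
    exact congrArg P.coset (Subtype.ext (hcomm _ (hoff σ₂)))
  · change P.coset c ≠ 1
    rw [Ne, coset_eq_one]
    intro hev
    have hev' := (P.eventually_notMem (A := U)).1 (by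
      filter_upwards [hev] with a h1 ha
      rw [hcon a ha] at h1
      rw [hU'] at ha
      obtain ⟨⟨i, j⟩, rfl⟩ := ha
      rw [blockPerm_apply] at h1
      have := φ.injective h1
      simp only [Prod.mk.injEq, true_and] at this
      clear h1
      revert this
      revert j
      decide)
    exact hU hev'
  · change P.coset c * P.coset g = P.coset g * P.coset c
    rw [← coset_mul, ← coset_mul]
    exact congrArg P.coset (Subtype.ext (hcomm _ hcoff))

end Params
end
end QuotSym

/-! ### Disjointness of supports: the converse, and inclusion -/

namespace QuotSym
noncomputable section

/-- Since `h` lives on `U`, `[h, p]` lives on `U ∪ p U`. The commutator of this with `q` lives on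
the same set together with its image under `q`, hence on four translates of `U`. -/
theorem double_commutator_supp {X : Type u} {U : Set X} (h p q : Equiv.Perm X)
    (hh : ∀ a, a ∉ U → h a = a) (b : X)
    (hb : ((h * p * h⁻¹ * p⁻¹) * q * (h * p * h⁻¹ * p⁻¹)⁻¹ * q⁻¹) b ≠ b) :
    b ∈ U ∨ p⁻¹ b ∈ U ∨ q⁻¹ b ∈ U ∨ p⁻¹ (q⁻¹ b) ∈ U := by
  by_contra! hcon
  obtain ⟨h1, h2, h3, h4⟩ := hcon
  have hk : ∀ b, b ∉ U → p⁻¹ b ∉ U → (h * p * h⁻¹ * p⁻¹) b = b := by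
    intro b h1 h2
    simp only [Equiv.Perm.mul_apply]
    rw [show h⁻¹ (p⁻¹ b) = p⁻¹ b by rw [Equiv.Perm.inv_eq_iff_eq, hh _ h2]]
    simp [hh b h1]
  apply hb
  rw [Equiv.Perm.mul_apply, Equiv.Perm.mul_apply,
    show (h * p * h⁻¹ * p⁻¹)⁻¹ (q⁻¹ b) = q⁻¹ b by
      rw [Equiv.Perm.inv_eq_iff_eq, hk _ h3 h4], Equiv.Perm.mul_apply]
  rw [show q (q⁻¹ b) = b by simp, hk b h1 h2]

/-- Five is prime, so `d` generates the integers modulo five. Thus a point that is not fixed has a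
cycle of exactly five points. -/
theorem perm_fixed_of_pow_five {X : Type u} (g : Equiv.Perm X) {a : X} (h5 : (g ^ 5) a = a)
    (d : ℕ) (hd : 0 < d) (hd' : d < 5) (h : (g ^ d) a = a) : g a = a := by
  have key : ∀ m k : ℕ, (g ^ m) a = a → (g ^ (k * m)) a = a := by
    intro m k hm
    induction k with
    | zero => simp
    | succ k ih => rw [Nat.succ_mul, pow_add, Equiv.Perm.mul_apply, hm, ih]
  have h6 : ∀ m, (g ^ m) a = a → (g ^ (m + 1)) a = a → g a = a := by
    intro m h1 h2
    rw [pow_succ', Equiv.Perm.mul_apply, h1] at h2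
    exact h2
  interval_cases d
  · simpa using h
  · exact h6 4 (key 2 2 h) h5
  · exact h6 5 h5 (key 3 2 h)
  · exact h6 4 h h5

namespace Params

variable {P : Params.{u}}

theorem eventually_comm_inv_pow {w g : Equiv.Perm P.Ω} (h : ∀ᶠ a in P.fil, w (g a) = g (w a))
    (d : ℕ) : ∀ᶠ a in P.fil, w⁻¹ ((g ^ d) a) = (g ^ d) (w⁻¹ a) := by
  have h1 : ∀ᶠ a in P.fil, w⁻¹ (g a) = g (w⁻¹ a) := by
    filter_upwards [eventually_perm h w⁻¹] with a ha
    rw [Equiv.Perm.inv_eq_iff_eq, ha]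
    simp
  induction d with
  | zero => simp
  | succ d ih =>
    filter_upwards [ih, eventually_perm h1 (g ^ d)] with a h2 h3
    rw [pow_succ', Equiv.Perm.mul_apply, h3, h2]
    rfl

/-- Five beats four: a double commutator which commutes with `g` moves all five points of a cycle or
none, while only four translates of `U` are available, and each of them contains at most one point
of a cycle. -/
theorem disjoint_of_preDisj {f g : P.SLam}
    (hg : P.coset g * P.coset g * P.coset g * P.coset g * P.coset g = 1)
    (hd : PreDisj (P.coset f) (P.coset g)) :
    ∀ᶠ a in P.fil, (f : Equiv.Perm P.Ω) a = a ∨ (g : Equiv.Perm P.Ω) a = a := by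
  by_contra hcon
  have hg5 : ∀ᶠ a in P.fil, ((g : Equiv.Perm P.Ω) ^ 5) a = a := by
    simp only [← coset_mul] at hg
    exact coset_eq_one P |>.1 hg
  set S : Set P.Ω := {a | ((f : Equiv.Perm P.Ω) a ≠ a ∧ (g : Equiv.Perm P.Ω) a ≠ a) ∧
    ((g : Equiv.Perm P.Ω) ^ 5) a = a}
  have hS : ¬ P.Small S := by
    intro hs
    rw [← eventually_notMem] at hs
    apply hcon
    filter_upwards [hs, hg5] with a h1 h2
    simp only [S, Set.mem_ofPred_eq] at h1
    tauto
  obtain ⟨U, hUS, hU, hdis⟩ := exists_displaced_list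
    [(f : Equiv.Perm P.Ω), (g : Equiv.Perm P.Ω) ^ 1, (g : Equiv.Perm P.Ω) ^ 2,
      (g : Equiv.Perm P.Ω) ^ 3, (g : Equiv.Perm P.Ω) ^ 4] hS (by
    intro p hp a ha
    simp only [List.mem_cons, List.not_mem_nil, or_false] at hp
    rcases hp with rfl | rfl | rfl | rfl | rfl
    · exact ha.1.1
    all_goals exact fun h => ha.1.2 (perm_fixed_of_pow_five _ ha.2 _ (by norm_num) (by norm_num) h))
  -- An involution with support exactly `U`. It does not commute with `f`, because `f` takes points
  -- of `U`, which `h` moves, to points outside `U`, which `h` fixes.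
  obtain ⟨h, -, hh⟩ := exists_perm_pow_eq_one U (infinite_of_not_small hU) le_rfl
  have hhoff : ∀ a, a ∉ U → h a = a := fun a ha => by
    by_contra hcon
    exact ha ((hh a).1 hcon)
  have hhmem : h ∈ P.SLam := P.mem_SLam_of_subset f.2 fun a ha => (hUS ((hh a).1 ha)).1.1
  obtain ⟨f₁, f₂, c1, c2, hne, hc⟩ := hd (P.coset ⟨h, hhmem⟩) (by
    rw [← coset_mul, ← coset_mul, Ne, coset_eq]
    intro hev
    apply hU
    rw [← eventually_notMem]
    filter_upwards [hev] with a h1 ha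
    simp only [Subgroup.coe_mul, Equiv.Perm.mul_apply] at h1
    rw [hhoff _ (hdis f (by simp) a ha), EmbeddingLike.apply_eq_iff_eq] at h1
    exact (hh a).2 ha h1)
  obtain ⟨f₁, rfl⟩ := P.coset_surj f₁
  obtain ⟨f₂, rfl⟩ := P.coset_surj f₂
  set h' : P.SLam := ⟨h, hhmem⟩ with hh'
  set c : P.SLam := (h' * f₁ * h'⁻¹ * f₁⁻¹) * f₂ * (h' * f₁ * h'⁻¹ * f₁⁻¹)⁻¹ * f₂⁻¹ with hcdef
  have hcc : P.coset c * P.coset g = P.coset g * P.coset c := hc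
  apply hne
  change P.coset c = 1
  rw [coset_eq_one]
  rw [← coset_mul, ← coset_mul, coset_eq] at c1 c2 hcc
  -- The four elements whose translates of `U` cover the support of the double commutator; all of
  -- them commute with `g` up to a small set.
  set W : Fin 4 → Equiv.Perm P.Ω := ![1, f₁, f₂, f₂ * f₁] with hW
  have hWc : ∀ w, ∀ᶠ a in P.fil, W w ((g : Equiv.Perm P.Ω) a) = (g : Equiv.Perm P.Ω) (W w a) := by
    intro w
    fin_cases w
    · simp [hW]
    · simpa [hW] using c1
    · simpa [hW] using c2
    · simp only [Subgroup.coe_mul, Equiv.Perm.mul_apply] at c1 c2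
      filter_upwards [c1, eventually_perm c2 f₁] with a h1 h2
      simp [hW, h1, h2]
  have hW' : ∀ᶠ a in P.fil, ∀ (w : Fin 4) (d : Fin 5), (W w)⁻¹ (((g : Equiv.Perm P.Ω) ^ (d : ℕ)) a)
      = ((g : Equiv.Perm P.Ω) ^ (d : ℕ)) ((W w)⁻¹ a) := by
    rw [Filter.eventually_all]
    intro w
    rw [Filter.eventually_all]
    intro d
    exact eventually_comm_inv_pow (hWc w) d
  have hC : ∀ᶠ a in P.fil, ∀ (d : Fin 5), (c : Equiv.Perm P.Ω)⁻¹ (((g : Equiv.Perm P.Ω) ^ (d : ℕ)) a)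
      = ((g : Equiv.Perm P.Ω) ^ (d : ℕ)) ((c : Equiv.Perm P.Ω)⁻¹ a) := by
    rw [Filter.eventually_all]
    intro d
    exact eventually_comm_inv_pow hcc d
  filter_upwards [hW', hC] with a h1 h2
  by_contra hca
  have h3 : ∀ d : Fin 5, ∃ w : Fin 4, (W w)⁻¹ (((g : Equiv.Perm P.Ω) ^ (d : ℕ)) a) ∈ U := by
    intro d
    have h4 : (c : Equiv.Perm P.Ω) (((g : Equiv.Perm P.Ω) ^ (d : ℕ)) a) ≠
        ((g : Equiv.Perm P.Ω) ^ (d : ℕ)) a := by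
      intro h5
      have h6 : (c : Equiv.Perm P.Ω)⁻¹ (((g : Equiv.Perm P.Ω) ^ (d : ℕ)) a) =
        ((g : Equiv.Perm P.Ω) ^ (d : ℕ)) a := by rw [Equiv.Perm.inv_eq_iff_eq, h5]
      rw [h2, EmbeddingLike.apply_eq_iff_eq, Equiv.Perm.inv_eq_iff_eq] at h6
      exact hca h6.symm
    rcases double_commutator_supp (U := U) h f₁ f₂ hhoff _ h4 with h5 | h5 | h5 | h5
    · exact ⟨0, by simpa [hW] using h5⟩
    · exact ⟨1, by simpa [hW] using h5⟩
    · exact ⟨2, by simpa [hW] using h5⟩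
    · exact ⟨3, by simpa [hW] using h5⟩
  choose w hw using h3
  -- Pigeonhole for the five powers of `g` and the four elements of `W`. Two points in one translate
  -- of `U` differ by a non-trivial power of `g`, and pulled back to `U` they contradict the choice
  -- of `U`.
  obtain ⟨i, j, hij, hwij⟩ := Fintype.exists_ne_map_eq_of_card_lt w (by simp)
  have key : ∀ i j : Fin 5, i < j → w i = w j → False := by
    intro i j hlt heq
    have hi := hw i
    have hj := hw j
    rw [← heq] at hj
    rw [h1] at hi hj
    obtain ⟨d, hd⟩ := Nat.exists_eq_add_of_lt (show (i : ℕ) < j from hlt)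
    rw [show (j : ℕ) = (d + 1) + i by omega, pow_add, Equiv.Perm.mul_apply] at hj
    have hd4 : d < 4 := by have := j.2; omega
    refine hdis ((g : Equiv.Perm P.Ω) ^ (d + 1)) ?_ _ hi hj
    interval_cases d <;> simp
  rcases lt_or_gt_of_ne hij with hlt | hlt
  · exact key i j hlt hwij
  · exact key j i hlt hwij.symm

/-- The analysis of `PreDisj` needs order five in the second place, which `y` may lack. So `s`
stands in for `y`: it has order five, is disjoint from `x`, and its support contains that of `y`.
The last property is expressed by testing against all `r` of order five. -/
theorem disj_coset_iff {f g : P.SLam} :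
    Disj (P.coset f) (P.coset g) ↔
      ∀ᶠ a in P.fil, (f : Equiv.Perm P.Ω) a = a ∨ (g : Equiv.Perm P.Ω) a = a := by
  constructor
  · rintro ⟨s, hs5, hs, h⟩
    obtain ⟨s, rfl⟩ := P.coset_surj s
    have h1 := disjoint_of_preDisj hs5 hs
    -- The test element lives on the common part of the two supports. It is disjoint from `s`, hence
    -- from `g`, although its support lies in that of `g`; so the common part is small.
    obtain ⟨r, hr5, hr⟩ := exists_pow_eq_one (P := P) (k := 5)
      (A := {a | (f : Equiv.Perm P.Ω) a ≠ a ∧ (g : Equiv.Perm P.Ω) a ≠ a})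
      (lt_of_le_of_lt (Cardinal.mk_le_mk_of_subset fun a ha => ha.1) f.2) (by norm_num)
    obtain ⟨r, rfl⟩ := P.coset_surj r
    rw [reg_coset_iff] at hr
    simp only [pow_succ, pow_zero, one_mul] at hr5
    have h2 := disjoint_of_preDisj hr5 (h _ hr5 (preDisj_of_disjoint (by
      filter_upwards [h1, hr] with a h2 h3
      have h4 : (r : Equiv.Perm P.Ω) a ≠ a ↔ (f : Equiv.Perm P.Ω) a ≠ a ∧ (g : Equiv.Perm P.Ω) a ≠ a := h3
      tauto)))
    filter_upwards [h2, hr] with a h3 h4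
    have h5 : (r : Equiv.Perm P.Ω) a ≠ a ↔ (f : Equiv.Perm P.Ω) a ≠ a ∧ (g : Equiv.Perm P.Ω) a ≠ a := h4
    tauto
  · intro h
    obtain ⟨s, hs5, hs⟩ := exists_pow_eq_one (P := P) (k := 5) g.2 (by norm_num)
    obtain ⟨s, rfl⟩ := P.coset_surj s
    rw [reg_coset_iff] at hs
    simp only [pow_succ, pow_zero, one_mul] at hs5
    refine ⟨P.coset s, hs5, preDisj_of_disjoint ?_, fun r hr5 hr => ?_⟩
    · filter_upwards [h, hs] with a h1 h2
      have h3 : (g : Equiv.Perm P.Ω) a ≠ a ↔ (s : Equiv.Perm P.Ω) a ≠ a := h2.symm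
      tauto
    · obtain ⟨r, rfl⟩ := P.coset_surj r
      apply preDisj_of_disjoint
      filter_upwards [disjoint_of_preDisj hr5 hr, hs] with a h1 h2
      have h3 : (g : Equiv.Perm P.Ω) a ≠ a ↔ (s : Equiv.Perm P.Ω) a ≠ a := h2.symm
      tauto

theorem Reg.disj_iff {x y : P.G} {A B : Set P.Ω} (hx : P.Reg x A) (hy : P.Reg y B) :
    Disj x y ↔ ∀ᶠ a in P.fil, a ∈ A → a ∉ B := by
  obtain ⟨f, rfl⟩ := P.coset_surj x
  obtain ⟨g, rfl⟩ := P.coset_surj y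
  rw [disj_coset_iff]
  rw [reg_coset_iff] at hx hy
  apply Filter.eventually_congr
  filter_upwards [hx, hy] with a h1 h2
  rw [← h1, ← h2]
  tauto

theorem Reg.sub_iff {x y : P.G} {A B : Set P.Ω} (hx : P.Reg x A) (hy : P.Reg y B) :
    Sub x y ↔ ∀ᶠ a in P.fil, a ∈ A → a ∈ B := by
  constructor
  · intro h
    obtain ⟨A', hA', hlt⟩ := exists_reg x
    obtain ⟨z, hz⟩ := exists_elem (P := P) (A := A' \ B)
      (lt_of_le_of_lt (Cardinal.mk_le_mk_of_subset Set.sdiff_subset) hlt)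
    have h1 := h z ((hz.disj_iff hy).2 (Filter.Eventually.of_forall fun a ha => ha.2))
    rw [hz.disj_iff hA'] at h1
    filter_upwards [h1, hx.unique hA'] with a h2 h3 ha
    by_contra hcon
    exact h2 ⟨h3.1 ha, hcon⟩ (h3.1 ha)
  · intro h z hz
    obtain ⟨C, hC, -⟩ := exists_reg z
    rw [hC.disj_iff hy] at hz
    rw [hC.disj_iff hx]
    filter_upwards [hz, h] with a h1 h2 h3 h4
    exact h1 h3 (h2 h4)

theorem Reg.eqR_iff {x y : P.G} {A B : Set P.Ω} (hx : P.Reg x A) (hy : P.Reg y B) :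
    EqR x y ↔ ∀ᶠ a in P.fil, (a ∈ A ↔ a ∈ B) := by
  rw [EqR, hx.sub_iff hy, hy.sub_iff hx, ← Filter.eventually_and]
  simp only [iff_def]

theorem exists_sub_reg {y : P.G} {A B : Set P.Ω} (hy : P.Reg y B)
    (hA : ∀ᶠ a in P.fil, a ∈ A → a ∈ B) : ∃ x, P.Reg x A := by
  obtain ⟨B', hB', hlt⟩ := exists_reg y
  obtain ⟨x, hx⟩ := exists_elem (P := P) (A := A ∩ B')
    (lt_of_le_of_lt (Cardinal.mk_le_mk_of_subset Set.inter_subset_right) hlt)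
  refine ⟨x, hx.congr ?_⟩
  filter_upwards [hA, hy.unique hB'] with a h1 h2
  exact ⟨fun h => h.1, fun h => ⟨h, h2.1 (h1 h)⟩⟩

end Params
end
end QuotSym

/-! ### Extending injections to permutations, and comparing cardinalities of supports -/

namespace QuotSym
noncomputable section

theorem exists_swap {X I : Type u} (φ ζ : I ↪ X) (hd : ∀ i j, φ i ≠ ζ j) :
    ∃ p : Equiv.Perm X, (∀ i, p (φ i) = ζ i) ∧ (∀ i, p (ζ i) = φ i) ∧
      ∀ a, p a ≠ a → a ∈ Set.range φ ∪ Set.range ζ := by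
  let ξ : I ⊕ I ↪ X := ⟨Sum.elim φ ζ, by
    rintro (i | i) (j | j) h
    · exact congrArg _ (φ.injective h)
    · exact absurd h (hd i j)
    · exact absurd h.symm (hd j i)
    · exact congrArg _ (ζ.injective h)⟩
  refine ⟨Equiv.Perm.viaEmbedding (Equiv.sumComm I I) ξ, fun i => ?_, fun i => ?_, fun a ha => ?_⟩
  · exact Equiv.Perm.viaEmbedding_apply _ ξ (Sum.inl i)
  · exact Equiv.Perm.viaEmbedding_apply _ ξ (Sum.inr i)
  · by_contra hcon
    refine ha (Equiv.Perm.viaEmbedding_apply_of_notMem _ _ _ fun h => hcon ?_)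
    obtain ⟨i | i, rfl⟩ := h
    · exact Or.inl ⟨i, rfl⟩
    · exact Or.inr ⟨i, rfl⟩

namespace Params

variable {P : Params.{u}}

instance : Infinite P.Ω := Cardinal.infinite_iff.2 P.aleph0_le_μ

theorem mk_le_μ (A : Set P.Ω) : #A ≤ P.μ := Cardinal.mk_set_le A

theorem mk_compl_eq_of_lt {A : Set P.Ω} (h : #A < P.μ) : #(Aᶜ : Set P.Ω) = P.μ :=
  Cardinal.mk_compl_of_infinite A h

theorem mk_compl_eq {A : Set P.Ω} (h : #A ≤ #(Aᶜ : Set P.Ω)) : #(Aᶜ : Set P.Ω) = P.μ := by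
  rcases (mk_le_μ A).lt_or_eq with hlt | heq
  · exact mk_compl_eq_of_lt hlt
  · exact le_antisymm (mk_le_μ _) (heq ▸ h)

theorem lam_eq_succ (h : ¬ P.lam ≤ P.μ) : P.lam = Order.succ P.μ :=
  le_antisymm P.le (Order.succ_le_of_lt (not_le.1 h))

theorem not_lam_le_of_eq (h : P.lam = Order.succ P.μ) : ¬ P.lam ≤ P.μ := by
  rw [h, not_le]
  exact Order.lt_succ _

theorem mem_SLam_of_not_le (h : ¬ P.lam ≤ P.μ) (p : Equiv.Perm P.Ω) : p ∈ P.SLam :=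
  (mk_le_μ _).trans_lt (not_le.1 h)

/-- An injection between subsets with complements of the same size extends to a permutation
in the group `S_lam(μ)`. -/
theorem exists_extend {I : Type u} (φ ψ : I ↪ P.Ω) (hI : #I < P.lam)
    (hc : #((Set.range φ)ᶜ : Set P.Ω) = #((Set.range ψ)ᶜ : Set P.Ω)) :
    ∃ z : P.SLam, ∀ i, (z : Equiv.Perm P.Ω) (φ i) = ψ i := by
  by_cases hlam : P.lam ≤ P.μ
  · have hK : #(Set.range φ ∪ Set.range ψ : Set P.Ω) < P.lam := by
      refine (Cardinal.mk_union_le _ _).trans_lt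
        (Cardinal.add_lt_of_lt P.aleph0_lt_lam.le ?_ ?_) <;>
      rwa [Cardinal.mk_range_eq _ (Function.Embedding.injective _)]
    -- If `lam ≤ μ`, the two ranges leave room for a third copy of `I`, disjoint from both. Swapping
    -- via this copy keeps the support below `lam`, even if the ranges overlap.
    have hK' := mk_compl_eq_of_lt (hK.trans_le hlam)
    have hle : #I ≤ #((Set.range φ ∪ Set.range ψ)ᶜ : Set P.Ω) := hK' ▸ (hI.le.trans hlam)
    obtain ⟨ζ⟩ := hle
    let ζ' : I ↪ P.Ω := ζ.trans (Function.Embedding.subtype _)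
    have hζ : ∀ i, ζ' i ∉ Set.range φ ∪ Set.range ψ := fun i => (ζ i).2
    obtain ⟨p, hp1, -, hp⟩ := exists_swap φ ζ' fun i j h => hζ j (Or.inl ⟨i, h⟩)
    obtain ⟨q, -, hq1, hq⟩ := exists_swap ψ ζ' fun i j h => hζ j (Or.inr ⟨i, h⟩)
    have hcard : ∀ ξ : I ↪ P.Ω, #(Set.range ξ ∪ Set.range ζ' : Set P.Ω) < P.lam := by
      intro ξ
      refine (Cardinal.mk_union_le _ _).trans_lt
        (Cardinal.add_lt_of_lt P.aleph0_lt_lam.le ?_ ?_) <;>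
      rwa [Cardinal.mk_range_eq _ (Function.Embedding.injective _)]
    refine ⟨⟨q, P.mem_SLam_of_subset (hcard ψ) hq⟩ * ⟨p, P.mem_SLam_of_subset (hcard φ) hp⟩,
      fun i => ?_⟩
    simp [hp1, hq1]
  -- If `lam = μ⁺`, all permutations are in the group, and a bijection of the complements can be
  -- glued on.
  · obtain ⟨e⟩ := Cardinal.eq.1 hc
    let e' : Set.range φ ≃ Set.range ψ :=
      (Equiv.ofInjective φ φ.injective).symm.trans (Equiv.ofInjective ψ ψ.injective)
    classical
    refine ⟨⟨(Equiv.Set.sumCompl (Set.range φ)).symm.trans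
      ((Equiv.sumCongr e' e).trans (Equiv.Set.sumCompl (Set.range ψ))),
      mem_SLam_of_not_le hlam _⟩, fun i => ?_⟩
    have h1 := Equiv.Set.sumCompl_symm_apply_of_mem (s := Set.range φ) ⟨i, rfl⟩
    have h2 : (⟨φ i, ⟨i, rfl⟩⟩ : Set.range φ) = Equiv.ofInjective φ φ.injective i := rfl
    have h3 : e' ⟨φ i, ⟨i, rfl⟩⟩ = ⟨ψ i, ⟨i, rfl⟩⟩ := by
      simp only [e', Equiv.trans_apply, h2, Equiv.symm_apply_apply]
      rfl
    simp only [Equiv.trans_apply, h1]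
    change ((e' ⟨φ i, ⟨i, rfl⟩⟩ : Set.range ψ) : P.Ω) = ψ i
    rw [h3]

/-- A set that is no larger than its complement has a complement of full size `μ`, so the two
complements are equinumerous. -/
theorem exists_extend_of_le {I : Type u} (φ ψ : I ↪ P.Ω) (hI : #I < P.lam)
    (hφ : #I ≤ #((Set.range φ)ᶜ : Set P.Ω)) (hψ : #I ≤ #((Set.range ψ)ᶜ : Set P.Ω)) :
    ∃ z : P.SLam, ∀ i, (z : Equiv.Perm P.Ω) (φ i) = ψ i := by
  refine exists_extend φ ψ hI ?_
  rw [mk_compl_eq, mk_compl_eq]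
  · rwa [Cardinal.mk_range_eq _ ψ.injective]
  · rwa [Cardinal.mk_range_eq _ φ.injective]

theorem Reg.card_lt {x : P.G} {A : Set P.Ω} (h : P.Reg x A) : #A < P.lam := by
  obtain ⟨B, hB, hlt⟩ := exists_reg x
  have h1 : P.Small {a | ¬ (a ∈ A → a ∈ B)} := by
    rw [← eventually_iff]
    exact (h.unique hB).mono fun a ha => ha.1
  have : A ⊆ {a | ¬ (a ∈ A → a ∈ B)} ∪ B := by
    intro a ha
    by_cases hb : a ∈ B
    · exact Or.inr hb
    · exact Or.inl fun hcon => hb (hcon ha)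
  exact ((Cardinal.mk_le_mk_of_subset this).trans (Cardinal.mk_union_le _ _)).trans_lt
    (Cardinal.add_lt_of_lt P.aleph0_lt_lam.le (P.small_lt_lam h1) hlt)

theorem le_of_le_add {a b c : Cardinal.{u}} (ha : ℵ₀ ≤ a) (h : a ≤ b + c) (hc : c < a) : a ≤ b := by
  by_contra hcon
  exact absurd h (not_le.2 (Cardinal.add_lt_of_lt ha (not_le.1 hcon) hc))

/-- Only one half of each set is mapped; the other half guarantees that the complement is large
enough for an extension to exist. This is the reason for the factor `Fin 2` in all block
constructions. -/
theorem exists_extend_half {I : Type u} (φ ψ : I × Fin 2 ↪ P.Ω) (hI : #I < P.lam) (j : Fin 2) :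
    ∃ z : P.SLam, ∀ i, (z : Equiv.Perm P.Ω) (φ (i, j)) = ψ (i, 0) := by
  let ι : Fin 2 → I ↪ I × Fin 2 := fun j => ⟨fun i => (i, j), fun a b h => (Prod.ext_iff.1 h).1⟩
  have key : ∀ (φ : I × Fin 2 ↪ P.Ω) (j : Fin 2),
      #I ≤ #((Set.range ((ι j).trans φ))ᶜ : Set P.Ω) := by
    intro φ j
    refine Cardinal.mk_le_of_injective (f := fun i => ⟨φ (i, 1 - j), ?_⟩) ?_
    · rintro ⟨i', h⟩
      have := φ.injective h
      have h2 : j = 1 - j := (Prod.ext_iff.1 this).2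
      revert h2
      clear * -
      revert j
      decide
    · intro a b h
      have := φ.injective (Subtype.ext_iff.1 h)
      exact (Prod.ext_iff.1 this).1
  exact exists_extend_of_le ((ι j).trans φ) ((ι 0).trans ψ) hI (key φ j) (key ψ 0)

/-- Two conjugates of `y` are used because one need not suffice: if both supports have size `μ`, the
complement of that of `y` may be too large for a conjugate to cover the support of `x`. Each of two
halves of `A` can be moved into `B`. Conversely, covering by two conjugates at most doubles an
infinite cardinal, up to a small set. -/
theorem Reg.cardLe_iff {x y : P.G} {A B : Set P.Ω} (hx : P.Reg x A) (hy : P.Reg y B) :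
    CardLe x y ↔ trunc P.κ #A ≤ trunc P.κ #B := by
  constructor
  · rintro ⟨z₁, z₂, h⟩
    obtain ⟨z₁, rfl⟩ := P.coset_surj z₁
    obtain ⟨z₂, rfl⟩ := P.coset_surj z₂
    set B₁ := {a | (z₁ : Equiv.Perm P.Ω)⁻¹ a ∈ B}
    set B₂ := {a | (z₂ : Equiv.Perm P.Ω)⁻¹ a ∈ B}
    have hc₁ : #B₁ ≤ #B := Cardinal.mk_preimage_of_injective _ _ (z₁ : Equiv.Perm P.Ω)⁻¹.injective
    have hc₂ : #B₂ ≤ #B := Cardinal.mk_preimage_of_injective _ _ (z₂ : Equiv.Perm P.Ω)⁻¹.injective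
    obtain ⟨w, hw⟩ := exists_sub_reg (A := A \ (B₁ ∪ B₂)) hx
      (Filter.Eventually.of_forall fun a ha => ha.1)
    have h1 := h w ((hw.disj_iff (hy.conj z₁)).2 (Filter.Eventually.of_forall fun a ha hb =>
        ha.2 (Or.inl hb)))
      ((hw.disj_iff (hy.conj z₂)).2 (Filter.Eventually.of_forall fun a ha hb =>
        ha.2 (Or.inr hb)))
    rw [hw.disj_iff hx] at h1
    have hs : P.Small (A \ (B₁ ∪ B₂)) := by
      rw [← eventually_notMem]
      exact h1.mono fun a h2 h3 => h2 h3 h3.1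
    by_cases hA : P.κ ≤ #A
    · have h2 : #A ≤ (#B + #B) + #(A \ (B₁ ∪ B₂) : Set P.Ω) := by
        refine (Cardinal.mk_le_mk_of_subset (show A ⊆ (B₁ ∪ B₂) ∪ (A \ (B₁ ∪ B₂)) by
          intro a ha
          by_cases h : a ∈ B₁ ∪ B₂
          · exact Or.inl h
          · exact Or.inr ⟨ha, h⟩)).trans ((Cardinal.mk_union_le _ _).trans ?_)
        gcongr
        exact (Cardinal.mk_union_le _ _).trans (add_le_add hc₁ hc₂)
      have h3 := le_of_le_add (P.aleph0_le.trans hA) h2 (lt_of_lt_of_le hs hA)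
      have h4 : #A ≤ #B := by
        by_contra hcon
        rw [not_le] at hcon
        exact absurd h3 (not_le.2 (Cardinal.add_lt_of_lt (P.aleph0_le.trans hA) hcon hcon))
      rw [trunc, trunc, if_pos hA, if_pos (hA.trans h4)]
      exact h4
    · rw [trunc, if_neg hA]
      exact zero_le
  · intro h
    by_cases hA : P.κ ≤ #A
    · have hAB : #A ≤ #B := by
        rw [trunc, if_pos hA, trunc] at h
        split_ifs at h with hB
        · exact h
        · exact h.trans zero_le
      have hAi := infinite_of_not_small (P := P) (A := A) (not_lt.2 hA)
      have hBi := infinite_of_not_small (P := P) (A := B) (not_lt.2 (hA.trans hAB))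
      obtain ⟨φ, hφ⟩ := exists_block A hAi (k := 2) (by norm_num)
      obtain ⟨ψ, hψ⟩ := exists_block B hBi (k := 2) (by norm_num)
      obtain ⟨ι⟩ := hAB
      -- Either half of `A` goes into the first half of the blocks of `B`; the conjugating elements
      -- are the inverses of these maps.
      have hz := exists_extend_half φ ((ι.prodMap (Function.Embedding.refl _)).trans ψ) hx.card_lt
      choose z hz using hz
      refine ⟨(P.coset (z 0))⁻¹, (P.coset (z 1))⁻¹, fun w h0 h1 => ?_⟩
      rw [inv_inv] at h0 h1
      obtain ⟨C, hC, -⟩ := exists_reg w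
      rw [hC.disj_iff (hy.conj_inv _)] at h0 h1
      rw [hC.disj_iff hx]
      filter_upwards [h0, h1] with a h0 h1 ha hA
      rw [← hφ] at hA
      obtain ⟨⟨i, j⟩, rfl⟩ := hA
      have hj : j = 0 ∨ j = 1 := by clear * -; revert j; decide
      rcases hj with rfl | rfl
      · apply h0 ha
        rw [hz 0]
        exact hψ.subset ⟨_, rfl⟩
      · apply h1 ha
        rw [hz 1]
        exact hψ.subset ⟨_, rfl⟩
    · refine ⟨1, 1, fun w _ _ => ?_⟩
      obtain ⟨C, hC, -⟩ := exists_reg w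
      rw [hC.disj_iff hx]
      filter_upwards [P.eventually_notMem.2 (not_le.1 hA)] with a h1 _
      exact h1

theorem Reg.trunc_eq {x : P.G} {A B : Set P.Ω} (h : P.Reg x A) (h' : P.Reg x B) :
    trunc P.κ #A = trunc P.κ #B :=
  le_antisymm ((h.cardLe_iff h').1 ((h.cardLe_iff h).2 le_rfl))
    ((h'.cardLe_iff h).1 ((h.cardLe_iff h).2 le_rfl))

/-- If `lam ≤ μ`, the complement of a support contains a set of size `κ`, and some non-trivial
element lives there. -/
theorem fullSupp_iff : FullSupp P.G ↔ ¬ P.lam ≤ P.μ := by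
  constructor
  · rintro ⟨s, hs⟩ hlam
    obtain ⟨A, hA, hlt⟩ := exists_reg s
    have h1 := mk_compl_eq_of_lt (hlt.trans_le hlam)
    obtain ⟨B, hB, hBκ⟩ := (Cardinal.le_mk_iff_exists_subset (c := P.κ) (s := Aᶜ)).1
      (h1 ▸ P.κ_le_μ)
    obtain ⟨w, hw⟩ := exists_elem (P := P) (A := B) (hBκ ▸ P.lt)
    have h2 := hs w ((hw.disj_iff hA).2 (Filter.Eventually.of_forall fun a ha => hB ha))
    rw [hw.eq_one_iff] at h2
    exact absurd h2 (not_lt.2 hBκ.ge)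
  · intro hlam
    obtain ⟨s, hs⟩ := exists_elem (P := P) (A := Set.univ)
      ((mk_le_μ _).trans_lt (not_le.1 hlam))
    refine ⟨s, fun w hw => ?_⟩
    obtain ⟨B, hB, -⟩ := exists_reg w
    rw [hB.disj_iff hs] at hw
    rw [hB.eq_one_iff, ← eventually_notMem]
    exact hw.mono fun a h1 h2 => h1 h2 (Set.mem_univ a)

theorem repCard_iff {x : P.G} {ν : P.CardMinus} {A : Set P.Ω} (h : P.Reg x A) :
    P.RepCard x ν ↔ x * x = 1 ∧ ν.1 = trunc P.κ #A := by
  constructor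
  · rintro ⟨h1, f, rfl, h2⟩
    exact ⟨h1, h2.trans ((reg_coset f).trunc_eq h)⟩
  · rintro ⟨h1, h2⟩
    obtain ⟨f, rfl⟩ := P.coset_surj x
    exact ⟨h1, f, rfl, h2.trans (h.trunc_eq (reg_coset f))⟩

theorem exists_repCard_iff (x : P.G) : (∃ ν, P.RepCard x ν) ↔ x * x = 1 := by
  obtain ⟨A, hA, hlt⟩ := exists_reg x
  simp only [repCard_iff hA]
  exact ⟨fun ⟨_, h⟩ => h.1, fun h => ⟨⟨_, P.trunc_lt hlt⟩, h, rfl⟩⟩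

theorem exists_repCard (ν : P.CardMinus) : ∃ x, P.RepCard x ν := by
  have h1 : #(ν.1.out) ≤ P.μ := by
    rw [Cardinal.mk_out]
    exact Order.lt_succ_iff.1 (ν.2.1.trans_le P.le)
  obtain ⟨e⟩ := h1
  have h2 : #(Set.range e) = ν.1 := by rw [Cardinal.mk_range_eq _ e.injective, Cardinal.mk_out]
  obtain ⟨x, hx1, hx2⟩ := exists_pow_eq_one (P := P) (A := Set.range e) (h2.trans_lt ν.2.1) le_rfl
  refine ⟨x, (repCard_iff hx2).2 ⟨by rw [← hx1, pow_two], ?_⟩⟩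
  rw [h2, trunc]
  split_ifs with h
  · rfl
  · exact ν.2.2.resolve_right h

theorem RepCard.eq_iff {x y : P.G} {ν ν' : P.CardMinus} (h : P.RepCard x ν) (h' : P.RepCard y ν') :
    (CardLe x y ∧ CardLe y x) ↔ ν = ν' := by
  obtain ⟨A, hA, -⟩ := exists_reg x
  obtain ⟨B, hB, -⟩ := exists_reg y
  rw [hA.cardLe_iff hB, hB.cardLe_iff hA, ← le_antisymm_iff, ← ((repCard_iff hA).1 h).2, ← ((repCard_iff hB).1 h').2]
  exact Subtype.ext_iff.symm

theorem RepCard.lt_iff {x y : P.G} {ν ν' : P.CardMinus} (h : P.RepCard x ν) (h' : P.RepCard y ν') :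
    ¬ CardLe y x ↔ ν.1 < ν'.1 := by
  obtain ⟨A, hA, -⟩ := exists_reg x
  obtain ⟨B, hB, -⟩ := exists_reg y
  rw [hB.cardLe_iff hA, not_le, ((repCard_iff hA).1 h).2, ((repCard_iff hB).1 h').2]

theorem RepCard.unique {x : P.G} {ν ν' : P.CardMinus} (h : P.RepCard x ν) (h' : P.RepCard x ν') :
    ν = ν' := by
  obtain ⟨A, hA, -⟩ := exists_reg x
  exact Subtype.ext (((repCard_iff hA).1 h).2.trans ((repCard_iff hA).1 h').2.symm)

end Params
end
end QuotSym

namespace QuotSym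
noncomputable section

/-! ### Orbits of tuples and their types -/

section Tuples

variable {X : Type v} {Z : Type w} {n : ℕ}

/-- The set `Y` is invariant under the tuple `σ`. -/
def IsInv (σ : Fin n → Equiv.Perm X) (Y : Set X) : Prop := ∀ i a, σ i a ∈ Y ↔ a ∈ Y

theorem IsInv.orbit_subset {σ : Fin n → Equiv.Perm X} {Y : Set X} (hY : IsInv σ Y) {a : X}
    (ha : a ∈ Y) : orbit σ a ⊆ Y := by
  have key : ∀ p ∈ Subgroup.closure (Set.range σ), ∀ b, p b ∈ Y ↔ b ∈ Y := by
    intro p hp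
    induction hp using Subgroup.closure_induction with
    | mem p hp =>
      obtain ⟨i, rfl⟩ := hp
      exact hY i
    | one => exact fun b => Iff.rfl
    | mul p q _ _ h h' => exact fun b => (h _).trans (h' b)
    | inv p _ h => exact fun b => by rw [← h]; simp
  rintro b ⟨p, hp, rfl⟩
  exact (key p hp a).2 ha

theorem isInv_orbit (σ : Fin n → Equiv.Perm X) (a : X) : IsInv σ (orbit σ a) := by
  intro i b
  have hi : σ i ∈ Subgroup.closure (Set.range σ) := Subgroup.subset_closure ⟨i, rfl⟩
  constructor
  · rintro ⟨p, hp, h⟩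
    exact ⟨(σ i)⁻¹ * p, mul_mem (inv_mem hi) hp, by simp [h]⟩
  · rintro ⟨p, hp, rfl⟩
    exact ⟨σ i * p, mul_mem hi hp, rfl⟩

theorem orbit_eq_of_mem_of_mem {σ : Fin n → Equiv.Perm X} {a b c : X} (h : c ∈ orbit σ a)
    (h' : c ∈ orbit σ b) : orbit σ a = orbit σ b := (orbit_eq h).trans (orbit_eq h').symm

theorem mem_orbit_comm {σ : Fin n → Equiv.Perm X} {a b : X} : b ∈ orbit σ a ↔ a ∈ orbit σ b :=
  ⟨fun h => orbit_eq h ▸ mem_orbit_self σ a, fun h => orbit_eq h ▸ mem_orbit_self σ b⟩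

theorem image_orbit {σ : Fin n → Equiv.Perm X} {τ : Fin n → Equiv.Perm Z} {φ : X → Z} {c : X}
    (h : ∀ b ∈ orbit σ c, ∀ i, φ (σ i b) = τ i (φ b)) : φ '' orbit σ c = orbit τ (φ c) := by
  apply subset_antisymm
  · have hinv : IsInv σ {b | b ∈ orbit σ c ∧ φ b ∈ orbit τ (φ c)} := by
      intro i b
      simp only [Set.mem_ofPred_eq, isInv_orbit σ c i b]
      refine and_congr_right fun hb => ?_
      rw [h b hb i, isInv_orbit]
    rintro _ ⟨b, hb, rfl⟩
    exact (hinv.orbit_subset ⟨mem_orbit_self σ c, mem_orbit_self _ _⟩ hb).2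
  · refine IsInv.orbit_subset ?_ ⟨c, mem_orbit_self σ c, rfl⟩
    intro i z
    constructor
    · rintro ⟨b, hb, hz⟩
      have hb' : (σ i)⁻¹ b ∈ orbit σ c := (isInv_orbit σ c i _).1 (by simpa using hb)
      refine ⟨_, hb', (τ i).injective ?_⟩
      rw [← h _ hb']
      simpa using hz
    · rintro ⟨b, hb, rfl⟩
      exact ⟨σ i b, (isInv_orbit σ c i b).2 hb, h b hb i⟩

/-- The transfer principle for types: equivariance and injectivity are required on the orbit alone.
The converse direction needs no inverse map, since every orbit has a type and types are unique. -/
theorem hasType_image {σ : Fin n → Equiv.Perm X} {τ : Fin n → Equiv.Perm Z} {φ : X → Z} {c : X}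
    (h : ∀ b ∈ orbit σ c, ∀ i, φ (σ i b) = τ i (φ b)) (hφ : Set.InjOn φ (orbit σ c))
    (t : IsoType n) : HasType τ (orbit τ (φ c)) t ↔ HasType σ (orbit σ c) t := by
  have key : ∀ t, HasType σ (orbit σ c) t → HasType τ (orbit τ (φ c)) t := by
    rintro t ⟨T, hT, e, he, hr, hσ⟩
    have hmem : ∀ a, e a ∈ orbit σ c := fun a => hr ▸ ⟨a, rfl⟩
    refine ⟨T, hT, φ ∘ e, fun a b hab => he (hφ (hmem a) (hmem b) hab), ?_, fun i a => ?_⟩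
    · rw [Set.range_comp, hr, image_orbit h]
    · simp only [Function.comp_apply]
      rw [hσ, h _ (hmem a)]
  refine ⟨fun ht => ?_, key t⟩
  obtain ⟨t', ht'⟩ := exists_hasType σ c
  rwa [ht.unique (key t' ht')]

theorem HasType.exists_out {σ : Fin n → Equiv.Perm X} {B : Set X} {t : IsoType n}
    (h : HasType σ B t) : ∃ e : t.out.A → X, Function.Injective e ∧ Set.range e = B ∧
      ∀ i a, e (t.out.g i a) = σ i (e a) := by
  obtain ⟨T, hT, e, he, hB, hσ⟩ := h
  obtain ⟨f, hf⟩ : t.out ≈ T := Quotient.exact (t.out_is.trans hT.symm)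
  refine ⟨e ∘ f, he.comp f.injective, ?_, fun i a => ?_⟩
  · rw [Set.range_comp, f.surjective.range_eq, Set.image_univ, hB]
  · simp [hf, hσ]

theorem IsoType.orbit_out (t : IsoType n) (a : t.out.A) : orbit t.out.g a = Set.univ :=
  Set.eq_univ_of_forall fun b => t.out.trans a b

theorem IsoType.hasType_out (t : IsoType n) : HasType t.out.g Set.univ t :=
  ⟨t.out, t.out_is, id, Function.injective_id, Set.range_id, fun _ _ => rfl⟩

theorem IsoType.isTrivial_iff (t : IsoType n) : t.IsTrivial ↔ ∀ i, t.out.g i = 1 := by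
  constructor
  · rintro ⟨T, hT, h⟩ i
    obtain ⟨f, hf⟩ : t.out ≈ T := Quotient.exact (t.out_is.trans hT.symm)
    ext a
    have := hf i a
    rw [h, Equiv.Perm.one_apply, EmbeddingLike.apply_eq_iff_eq] at this
    rw [this, Equiv.Perm.one_apply]
  · exact fun h => ⟨t.out, t.out_is, h⟩

theorem HasType.isTrivial_iff {σ : Fin n → Equiv.Perm X} {a : X} {t : IsoType n}
    (h : HasType σ (orbit σ a) t) : t.IsTrivial ↔ ∀ i, σ i a = a := by
  obtain ⟨e, he, hB, hσ⟩ := h.exists_out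
  rw [t.isTrivial_iff]
  constructor
  · intro h1 i
    obtain ⟨b, rfl⟩ : a ∈ Set.range e := hB ▸ mem_orbit_self σ a
    rw [← hσ, h1, Equiv.Perm.one_apply]
  · intro h1 i
    have h2 : orbit σ a ⊆ {a} := by
      refine IsInv.orbit_subset (fun i b => ?_) rfl
      simp only [Set.mem_singleton_iff]
      constructor
      · intro h
        exact (σ i).injective (h.trans (h1 i).symm)
      · rintro rfl
        exact h1 i
    ext b
    refine congrArg _ (he ?_)
    rw [h2 (hB ▸ ⟨_, rfl⟩ : e (t.out.g i b) ∈ orbit σ a),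
      h2 (hB ▸ ⟨_, rfl⟩ : e ((1 : Equiv.Perm t.out.A) b) ∈ orbit σ a)]

theorem IsoType.IsTrivial.unique {t t' : IsoType n} (h : t.IsTrivial) (h' : t'.IsTrivial) :
    t = t' := by
  obtain ⟨T, hT, h⟩ := h
  obtain ⟨T', hT', h'⟩ := h'
  have key : ∀ T : TransTuple n, (∀ i, T.g i = 1) → ∀ a b : T.A, a = b := by
    intro T h a b
    obtain ⟨p, hp, rfl⟩ := T.trans a b
    have : Subgroup.closure (Set.range T.g) ≤ ⊥ := by
      rw [Subgroup.closure_le]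
      rintro _ ⟨i, rfl⟩
      exact h i
    rw [Subgroup.mem_bot.1 (this hp)]
    rfl
  rw [← hT, ← hT']
  obtain ⟨a, ha⟩ := T.nonempty
  obtain ⟨b, hb⟩ := T'.nonempty
  exact Quotient.sound ⟨⟨fun _ => ⟨b, hb⟩, fun _ => ⟨a, ha⟩, fun _ => key T h _ _,
    fun _ => key T' h' _ _⟩, fun i a => key T' h' _ _⟩

theorem exists_isTrivial (n : ℕ) : ∃ t : IsoType n, t.IsTrivial := by
  let T : TransTuple n :=
    { A := {0}
      g := fun _ => 1
      nonempty := ⟨0, rfl⟩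
      trans := fun a b => ⟨1, one_mem _, Subtype.ext (a.2.trans b.2.symm)⟩ }
  exact ⟨Quotient.mk _ T, T, rfl, fun _ => rfl⟩

/-- The orbits of type `t`. -/
def Orb (σ : Fin n → Equiv.Perm X) (t : IsoType n) : Type v :=
  {B : Set X // IsOrbit σ B ∧ HasType σ B t}

end Tuples

namespace Params

variable (P : Params.{u}) {X Z W : Type u} {n : ℕ}

/-- The points in the orbits which are counted. -/
def Dset (σ : Fin n → Equiv.Perm X) : Set X := {a | P.lam ≤ P.μ → ∃ i, σ i a ≠ a}

/-- The number of orbits of the various types. -/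
def chr (σ : Fin n → Equiv.Perm X) (t : P.IS n) : Cardinal.{u} := #(Orb σ t.1)

theorem Ch_eq_chr (f : Fin n → P.SLam) : P.Ch f = P.chr (P.perm f) := rfl

variable {P}

theorem mem_Dset_iff {σ : Fin n → Equiv.Perm X} {a : X} {t : IsoType n}
    (h : HasType σ (orbit σ a) t) : a ∈ P.Dset σ ↔ (P.lam ≤ P.μ → ¬ t.IsTrivial) := by
  rw [h.isTrivial_iff, not_forall]
  rfl

theorem mem_Dset_of_hasType {σ : Fin n → Equiv.Perm X} {a : X} {t : P.IS n}
    (h : HasType σ (orbit σ a) t.1) : a ∈ P.Dset σ := (mem_Dset_iff h).2 t.2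

theorem exists_IS {σ : Fin n → Equiv.Perm X} {a : X} (h : a ∈ P.Dset σ) :
    ∃ t : P.IS n, HasType σ (orbit σ a) t.1 := by
  obtain ⟨t, ht⟩ := exists_hasType σ a
  exact ⟨⟨t, (mem_Dset_iff ht).1 h⟩, ht⟩

theorem Dset_of_not_le (h : ¬ P.lam ≤ P.μ) (σ : Fin n → Equiv.Perm X) : P.Dset σ = Set.univ :=
  Set.eq_univ_of_forall fun _ h' => absurd h' h

theorem isInv_Dset (σ : Fin n → Equiv.Perm X) : IsInv σ (P.Dset σ) := by
  intro i a
  obtain ⟨t, ht⟩ := exists_hasType σ a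
  rw [mem_Dset_iff ht]
  rw [orbit_eq ((isInv_orbit σ a i a).2 (mem_orbit_self σ a))] at ht
  rw [mem_Dset_iff ht]

/-- All the counted orbits of `σ`, in terms of the models of their types. -/
def dec (σ : Fin n → Equiv.Perm X) (x : Σ s : P.IS n, Orb σ s.1 × s.1.out.A) : X :=
  Classical.choose x.2.1.2.2.exists_out x.2.2

theorem dec_equivariant (σ : Fin n → Equiv.Perm X) (i : Fin n) (s : P.IS n) (B : Orb σ s.1)
    (a : s.1.out.A) : dec σ ⟨s, B, s.1.out.g i a⟩ = σ i (dec σ ⟨s, B, a⟩) :=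
  (Classical.choose_spec B.2.2.exists_out).2.2 i a

theorem range_dec_block (σ : Fin n → Equiv.Perm X) (s : P.IS n) (B : Orb σ s.1) :
    (Set.range fun a => dec σ ⟨s, B, a⟩) = B.1 :=
  (Classical.choose_spec B.2.2.exists_out).2.1

theorem dec_mem (σ : Fin n → Equiv.Perm X) (s : P.IS n) (B : Orb σ s.1) (a : s.1.out.A) :
    dec σ ⟨s, B, a⟩ ∈ B.1 := range_dec_block σ s B ▸ ⟨a, rfl⟩

theorem orbit_dec (σ : Fin n → Equiv.Perm X) (s : P.IS n) (B : Orb σ s.1) (a : s.1.out.A) :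
    orbit σ (dec σ ⟨s, B, a⟩) = B.1 := by
  obtain ⟨x, hx⟩ := B.2.1
  have := dec_mem σ s B a
  rw [hx] at this ⊢
  exact (orbit_eq this).symm

theorem hasType_dec (σ : Fin n → Equiv.Perm X) (s : P.IS n) (B : Orb σ s.1) (a : s.1.out.A) :
    HasType σ (orbit σ (dec σ ⟨s, B, a⟩)) s.1 := by
  rw [orbit_dec]
  exact B.2.2

theorem dec_injective (σ : Fin n → Equiv.Perm X) : Function.Injective (dec (P := P) σ) := by
  rintro ⟨s, B, a⟩ ⟨s', B', a'⟩ h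
  have h1 := hasType_dec σ s B a
  rw [h] at h1
  obtain rfl : s = s' := Subtype.ext (h1.unique (hasType_dec σ s' B' a'))
  obtain rfl : B = B' := Subtype.ext (by
    rw [← orbit_dec σ s B a, ← orbit_dec σ s B' a', h])
  have h2 : a = a' := (Classical.choose_spec B.2.2.exists_out).1 h
  rw [h2]

theorem dec_injective_block (σ : Fin n → Equiv.Perm X) (s : P.IS n) (B : Orb σ s.1) :
    Function.Injective fun a => dec σ ⟨s, B, a⟩ :=
  (Classical.choose_spec B.2.2.exists_out).1

theorem range_dec (σ : Fin n → Equiv.Perm X) : Set.range (dec (P := P) σ) = P.Dset σ := by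
  ext x
  constructor
  · rintro ⟨⟨s, B, a⟩, rfl⟩
    exact mem_Dset_of_hasType (hasType_dec σ s B a)
  · intro hx
    obtain ⟨s, hs⟩ := exists_IS hx
    have h1 := range_dec_block σ s ⟨orbit σ x, ⟨x, rfl⟩, hs⟩
    obtain ⟨a, ha⟩ := h1.symm.subset (mem_orbit_self σ x)
    exact ⟨_, ha⟩

theorem exists_dec {σ : Fin n → Equiv.Perm X} {x : X} (hx : x ∈ P.Dset σ) :
    ∃ (s : P.IS n) (B : Orb σ s.1) (a : s.1.out.A), dec σ ⟨s, B, a⟩ = x := by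
  rw [← range_dec] at hx
  obtain ⟨⟨s, B, a⟩, h⟩ := hx
  exact ⟨s, B, a, h⟩

/-! ### The model with given numbers of orbits -/

variable (P) in
/-- A set on which the tuples `out.g` act with orbits indexed by `I`. -/
abbrev Model (I : P.IS n → Type u) : Type u := Σ s : P.IS n, I s × s.1.out.A

theorem mk_model (I : P.IS n → Type u) : #(P.Model I) = P.sizeTotal fun s => #(I s) := by
  rw [Cardinal.mk_sigma, sizeTotal]
  congr 1
  ext s
  rw [Cardinal.mk_prod, Cardinal.lift_uzero, mul_comm]
  rfl

/-- The action on the model. -/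
def modelPerm (I : P.IS n → Type u) (i : Fin n) : Equiv.Perm (P.Model I) :=
  Equiv.sigmaCongrRight fun s => Equiv.prodCongr (Equiv.refl (I s)) (s.1.out.g i)

theorem modelPerm_apply (I : P.IS n → Type u) (i : Fin n) (s : P.IS n) (j : I s) (a : s.1.out.A) :
    modelPerm I i ⟨s, j, a⟩ = ⟨s, j, s.1.out.g i a⟩ := rfl

theorem model_block_injective (I : P.IS n → Type u) (s : P.IS n) (j : I s) :
    Function.Injective fun a : s.1.out.A => (⟨s, j, a⟩ : P.Model I) := by
  intro a b h
  simpa using h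

theorem hasType_model (I : P.IS n → Type u) (s : P.IS n) (j : I s) (a : s.1.out.A) :
    HasType (modelPerm I) (orbit (modelPerm I) ⟨s, j, a⟩) s.1 := by
  have := hasType_image (σ := s.1.out.g) (τ := modelPerm I) (φ := fun a => (⟨s, j, a⟩ : P.Model I))
    (c := a) (fun b _ i => (modelPerm_apply I i s j b).symm)
    (model_block_injective I s j).injOn s.1
  rw [this, IsoType.orbit_out]
  exact s.1.hasType_out

theorem orbit_model (I : P.IS n → Type u) (s : P.IS n) (j : I s) (a : s.1.out.A) :
    orbit (modelPerm I) ⟨s, j, a⟩ = Set.range fun a : s.1.out.A => (⟨s, j, a⟩ : P.Model I) := by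
  have := image_orbit (σ := s.1.out.g) (τ := modelPerm I) (φ := fun a => (⟨s, j, a⟩ : P.Model I))
    (c := a) (fun b _ i => (modelPerm_apply I i s j b).symm)
  rw [← this, IsoType.orbit_out, Set.image_univ]

theorem chr_model (I : P.IS n → Type u) : P.chr (modelPerm I) = fun s => #(I s) := by
  ext s
  refine (Cardinal.mk_congr (Equiv.ofBijective (fun j : I s =>
    (⟨Set.range fun a : s.1.out.A => (⟨s, j, a⟩ : P.Model I), ?_⟩ : Orb (modelPerm I) s.1))
    ⟨?_, ?_⟩)).symm
  · obtain ⟨a, ha⟩ := s.1.out.nonempty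
    rw [← orbit_model I s j ⟨a, ha⟩]
    exact ⟨⟨_, rfl⟩, hasType_model I s j _⟩
  · intro j j' h
    obtain ⟨a, ha⟩ := s.1.out.nonempty
    obtain ⟨b, hb⟩ := (Subtype.ext_iff.1 h).subset ⟨⟨a, ha⟩, rfl⟩
    have := congrArg (fun x : P.Model I => x) hb
    simp only [Sigma.mk.injEq, heq_eq_eq, true_and, Prod.mk.injEq] at this
    exact this.1.symm
  · rintro ⟨B, ⟨⟨s', j, a⟩, rfl⟩, hB⟩
    obtain rfl : s' = s := Subtype.ext ((hasType_model I s' j a).unique hB)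
    exact ⟨j, Subtype.ext (orbit_model I s' j a).symm⟩

theorem mk_Dset (σ : Fin n → Equiv.Perm X) : #(P.Dset σ) = P.sizeTotal (P.chr σ) := by
  rw [← range_dec, Cardinal.mk_range_eq _ (dec_injective σ)]
  exact mk_model _

/-- By `mk_Dset`, counting points gives the total weighted by size. For the bounds that define `F_n`
this is interchangeable with the weights `wt`, so it suffices to know the number of counted points.
-/
theorem chr_mem {σ : Fin n → Equiv.Perm X} (h1 : #(P.Dset σ) < P.lam)
    (h2 : P.lam = Order.succ P.μ → #(P.Dset σ) = P.μ) :
    (∀ t, P.chr σ t < P.lam) ∧ P.total (P.chr σ) < P.lam ∧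
      (P.lam = Order.succ P.μ → P.total (P.chr σ) = P.μ) := by
  rw [mk_Dset] at h1 h2
  have h3 : P.total (P.chr σ) < P.lam := (P.total_le_sizeTotal _).trans_lt h1
  exact ⟨fun t => (P.le_total _ t).trans_lt h3, h3, fun h => (P.total_eq_μ_iff _).2 (h2 h)⟩

theorem isInv_range {σ : Fin n → Equiv.Perm X} {τ : Fin n → Equiv.Perm Z} {φ : X → Z}
    (h : ∀ i a, φ (σ i a) = τ i (φ a)) : IsInv τ (Set.range φ) := by
  intro i z
  constructor
  · rintro ⟨a, ha⟩
    refine ⟨(σ i)⁻¹ a, (τ i).injective ?_⟩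
    rw [← h, ← ha]
    simp
  · rintro ⟨a, rfl⟩
    exact ⟨σ i a, h i a⟩

/-- The orbits in the image of an equivariant injection. -/
def Orb.map {σ : Fin n → Equiv.Perm X} {τ : Fin n → Equiv.Perm Z} {φ : X → Z}
    (h : ∀ i a, φ (σ i a) = τ i (φ a)) (hφ : Function.Injective φ) {t : IsoType n}
    (B : Orb σ t) : Orb τ t :=
  ⟨φ '' B.1, by
    obtain ⟨B, ⟨a, rfl⟩, hB⟩ := B
    rw [image_orbit fun b _ i => h i b]
    exact ⟨⟨_, rfl⟩, (hasType_image (fun b _ i => h i b) hφ.injOn t).2 hB⟩⟩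

theorem Orb.map_injective {σ : Fin n → Equiv.Perm X} {τ : Fin n → Equiv.Perm Z} {φ : X → Z}
    (h : ∀ i a, φ (σ i a) = τ i (φ a)) (hφ : Function.Injective φ) (t : IsoType n) :
    Function.Injective (Orb.map (t := t) h hφ) := fun _ _ hab =>
  Subtype.ext (hφ.image_injective (Subtype.ext_iff.1 hab))

theorem Orb.exists_map {σ : Fin n → Equiv.Perm X} {τ : Fin n → Equiv.Perm Z} {φ : X → Z}
    (h : ∀ i a, φ (σ i a) = τ i (φ a)) (hφ : Function.Injective φ) {t : IsoType n} {B : Orb τ t}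
    {z : Z} (hz : z ∈ B.1) (hz' : z ∈ Set.range φ) : ∃ C : Orb σ t, Orb.map h hφ C = B := by
  obtain ⟨a, rfl⟩ := hz'
  obtain ⟨B, ⟨x, rfl⟩, hB⟩ := B
  have h1 : orbit τ x = orbit τ (φ a) := orbit_eq hz
  refine ⟨⟨orbit σ a, ⟨a, rfl⟩, ?_⟩, Subtype.ext ?_⟩
  · rw [h1] at hB
    exact (hasType_image (fun b _ i => h i b) hφ.injOn t).1 hB
  · exact (image_orbit fun b _ i => h i b).trans h1.symm

theorem Orb.nonempty {σ : Fin n → Equiv.Perm X} {t : IsoType n} (B : Orb σ t) : B.1.Nonempty := by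
  obtain ⟨B, ⟨x, rfl⟩, hB⟩ := B
  exact ⟨x, mem_orbit_self σ x⟩

theorem Orb.mem_Dset {σ : Fin n → Equiv.Perm X} {t : P.IS n} (B : Orb σ t.1) {x : X}
    (hx : x ∈ B.1) : x ∈ P.Dset σ := by
  obtain ⟨B, ⟨y, rfl⟩, hB⟩ := B
  refine mem_Dset_of_hasType (t := t) ?_
  rw [← orbit_eq hx]
  exact hB

theorem chr_eq_of_injective {σ : Fin n → Equiv.Perm X} {τ : Fin n → Equiv.Perm Z} {φ : X → Z}
    (h : ∀ i a, φ (σ i a) = τ i (φ a)) (hφ : Function.Injective φ)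
    (hr : P.Dset τ ⊆ Set.range φ) : P.chr σ = P.chr τ := by
  ext s
  refine Cardinal.mk_congr (Equiv.ofBijective (Orb.map h hφ) ⟨Orb.map_injective h hφ _, fun B => ?_⟩)
  obtain ⟨z, hz⟩ := Orb.nonempty B
  exact Orb.exists_map h hφ hz (hr (Orb.mem_Dset B hz))

/-! ### The relation `E` -/

/-- The infimum in `csub` is attained, so the larger set is the disjoint union of a copy of the
smaller one and a set of size `cdist`. -/
theorem exists_matching (A B : Type u) : ∃ (J : Type u) (i : J ↪ A) (j : J ↪ B),
    #((Set.range i)ᶜ : Set A) ≤ cdist #A #B ∧ #((Set.range j)ᶜ : Set B) ≤ cdist #A #B := by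
  have key : ∀ A B : Type u, #A ≤ #B → ∃ (J : Type u) (i : J ↪ A) (j : J ↪ B),
      #((Set.range i)ᶜ : Set A) ≤ cdist #A #B ∧ #((Set.range j)ᶜ : Set B) ≤ cdist #A #B := by
    intro A B h
    have h1 : #A + csub #B #A = #B := by
      have hne : {c | #A + c = #B}.Nonempty := by
        obtain ⟨c, hc⟩ := _root_.le_iff_exists_add.1 h
        exact ⟨c, hc.symm⟩
      exact csInf_mem hne
    have h2 : #(A ⊕ (csub #B #A).out) = #B := by rw [Cardinal.mk_sum]; simpa using h1
    obtain ⟨e⟩ := Cardinal.eq.1 h2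
    refine ⟨A, Function.Embedding.refl A, Function.Embedding.inl.trans e.toEmbedding, ?_, ?_⟩
    · have : (Set.range (Function.Embedding.refl A))ᶜ = ∅ := by
        rw [Set.compl_empty_iff]
        exact Set.range_id
      rw [this, Cardinal.mk_eq_zero]
      exact zero_le
    · rw [cdist, if_pos h]
      have h3 : (Set.range (Function.Embedding.inl.trans e.toEmbedding : A ↪ B))ᶜ ⊆
          Set.range fun c => e (Sum.inr c) := by
        intro b hb
        obtain ⟨x | c, rfl⟩ := e.surjective b
        · exact absurd ⟨x, rfl⟩ hb
        · exact ⟨c, rfl⟩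
      refine (Cardinal.mk_le_mk_of_subset h3).trans (Cardinal.mk_range_le.trans ?_)
      rw [Cardinal.mk_out]
  rcases _root_.le_total #A #B with h | h
  · exact key A B h
  · obtain ⟨J, i, j, h1, h2⟩ := key B A h
    rw [cdist_comm] at h1 h2
    exact ⟨J, j, i, h2, h1⟩

theorem sizeTotal_mono {h k : P.IS n → Cardinal.{u}} (hk : ∀ t, h t ≤ k t) :
    P.sizeTotal h ≤ P.sizeTotal k :=
  Cardinal.sum_le_sum _ _ fun t => by gcongr; exact hk t

theorem sizeTotal_add (h k : P.IS n → Cardinal.{u}) :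
    P.sizeTotal (fun t => h t + k t) = P.sizeTotal h + P.sizeTotal k := by
  unfold sizeTotal
  rw [← Cardinal.sum_add_distrib']
  congr 1
  ext t
  rw [mul_add]

theorem mk_Dset_diff_le {σ : Fin n → Equiv.Perm X} {J : P.IS n → Type u}
    (i : ∀ s, J s ↪ Orb σ s.1) :
    #(P.Dset σ \ Set.range fun x : P.Model J => dec σ ⟨x.1, i x.1 x.2.1, x.2.2⟩ : Set X) ≤
      P.sizeTotal fun s => #((Set.range (i s))ᶜ : Set (Orb σ s.1)) := by
  rw [← mk_model]
  let f : P.Model (fun s => ((Set.range (i s))ᶜ : Set (Orb σ s.1))) → X :=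
    fun x => dec σ ⟨x.1, x.2.1.1, x.2.2⟩
  refine (Cardinal.mk_le_mk_of_subset ?_).trans (Cardinal.mk_range_le (f := f))
  rintro x ⟨hx, hx'⟩
  obtain ⟨s, B, a, rfl⟩ := exists_dec hx
  refine ⟨⟨s, ⟨B, fun ⟨j, hj⟩ => hx' ⟨⟨s, j, a⟩, ?_⟩⟩, a⟩, rfl⟩
  simp only [hj]

theorem chr_le_add {σ : Fin n → Equiv.Perm X} {ρ : Fin n → Equiv.Perm W} {φ : W → X}
    (h : ∀ i a, φ (ρ i a) = σ i (φ a)) (hφ : Function.Injective φ) (s : P.IS n) :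
    P.chr ρ s ≤ P.chr σ s ∧
    P.chr σ s ≤ P.chr ρ s + #{B : Orb σ s.1 // Disjoint B.1 (Set.range φ)} := by
  refine ⟨Cardinal.mk_le_of_injective (Orb.map_injective h hφ _), ?_⟩
  rw [chr, chr]
  have := Cardinal.mk_le_of_surjective (α := Orb ρ s.1 ⊕ {B : Orb σ s.1 // Disjoint B.1 (Set.range φ)})
    (f := Sum.elim (Orb.map h hφ) Subtype.val) (by
      intro B
      by_cases hB : Disjoint B.1 (Set.range φ)
      · exact ⟨Sum.inr ⟨B, hB⟩, rfl⟩
      · obtain ⟨z, hz, hz'⟩ := Set.not_disjoint_iff.1 hB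
        obtain ⟨C, hC⟩ := Orb.exists_map h hφ hz hz'
        exact ⟨Sum.inl C, hC⟩)
  simpa using this

/-- The orbits that avoid `Y` are disjoint sets of counted points outside `Y`, so their points can
be counted by means of `dec`. -/
theorem sizeTotal_disjoint_le (σ : Fin n → Equiv.Perm X) (Y : Set X) :
    (P.sizeTotal fun s => #{B : Orb σ s.1 // Disjoint B.1 Y}) ≤ #(P.Dset σ \ Y : Set X) := by
  rw [← mk_model]
  refine Cardinal.mk_le_of_injective (f := fun x => ⟨dec σ ⟨x.1, x.2.1.1, x.2.2⟩, ?_, ?_⟩) ?_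
  · exact mem_Dset_of_hasType (hasType_dec σ x.1 _ _)
  · exact fun h => Set.disjoint_left.1 x.2.1.2 (dec_mem σ x.1 _ _) h
  · rintro ⟨s, B, a⟩ ⟨s', B', a'⟩ hx
    have := dec_injective σ (Subtype.ext_iff.1 hx)
    simp only [Sigma.mk.injEq] at this
    obtain ⟨rfl, h2⟩ := this
    rw [heq_eq_eq, Prod.mk.injEq] at h2
    obtain ⟨h3, rfl⟩ := h2
    obtain rfl := Subtype.ext h3
    rfl

variable (P) in
/-- The tuples `σ` and `τ` are isomorphic outside small sets, on the counted orbits. -/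
def AlmostIso (σ : Fin n → Equiv.Perm X) (τ : Fin n → Equiv.Perm Z) : Prop :=
  ∃ (W : Type u) (ρ : Fin n → Equiv.Perm W) (φ : W ↪ X) (ψ : W ↪ Z),
    (∀ i a, φ (ρ i a) = σ i (φ a)) ∧ (∀ i a, ψ (ρ i a) = τ i (ψ a)) ∧
    Set.range φ ⊆ P.Dset σ ∧ Set.range ψ ⊆ P.Dset τ ∧
    #(P.Dset σ \ Set.range φ : Set X) < P.κ ∧ #(P.Dset τ \ Set.range ψ : Set Z) < P.κ

/-- From left to right, match the orbits of each type as far as possible; what remains unmatched has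
a size controlled by `cdist`. From right to left, an equivariant injection maps orbits to orbits of
the same type, so `Ch` changes by at most the number of orbits that are missed on either side. -/
theorem E_chr_iff {σ : Fin n → Equiv.Perm X} {τ : Fin n → Equiv.Perm Z} :
    P.E (P.chr σ) (P.chr τ) ↔ P.AlmostIso σ τ := by
  constructor
  · intro hE
    choose J i j h1 h2 using fun s : P.IS n => exists_matching (Orb σ s.1) (Orb τ s.1)
    -- From here on points are counted instead of orbits. For a bound `κ` this makes no difference:
    -- either the weights are the sizes already, or `κ` is uncountable and orbits are countable.
    rw [E, P.total_lt_iff _ le_rfl] at hE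
    have hinj : ∀ {X : Type u} (σ : Fin n → Equiv.Perm X) (i : ∀ s : P.IS n, J s ↪ Orb σ s.1),
        Function.Injective fun x : P.Model J => dec σ ⟨x.1, i x.1 x.2.1, x.2.2⟩ := by
      rintro X σ i ⟨s, B, a⟩ ⟨s', B', a'⟩ hx
      have := dec_injective σ hx
      simp only [Sigma.mk.injEq] at this
      obtain ⟨rfl, h2⟩ := this
      rw [heq_eq_eq, Prod.mk.injEq] at h2
      obtain ⟨h3, rfl⟩ := h2
      obtain rfl := (i s).injective h3
      rfl
    refine ⟨P.Model J, modelPerm J, ⟨_, hinj σ i⟩, ⟨_, hinj τ j⟩, ?_, ?_, ?_, ?_, ?_, ?_⟩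
    · rintro k ⟨s, B, a⟩
      exact dec_equivariant σ k s _ a
    · rintro k ⟨s, B, a⟩
      exact dec_equivariant τ k s _ a
    · rintro _ ⟨⟨s, B, a⟩, rfl⟩
      exact mem_Dset_of_hasType (hasType_dec σ s _ a)
    · rintro _ ⟨⟨s, B, a⟩, rfl⟩
      exact mem_Dset_of_hasType (hasType_dec τ s _ a)
    · exact ((mk_Dset_diff_le i).trans (sizeTotal_mono h1)).trans_lt hE
    · exact ((mk_Dset_diff_le j).trans (sizeTotal_mono h2)).trans_lt hE
  · rintro ⟨W, ρ, φ, ψ, hφ, hψ, -, -, h1, h2⟩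
    refine (P.total_le_sizeTotal _).trans_lt ?_
    refine lt_of_le_of_lt (sizeTotal_mono (k := fun s =>
      #{B : Orb σ s.1 // Disjoint B.1 (Set.range φ)} +
      #{B : Orb τ s.1 // Disjoint B.1 (Set.range ψ)}) fun s => ?_) ?_
    · obtain ⟨a1, a2⟩ := chr_le_add (P := P) hφ φ.injective s
      obtain ⟨b1, b2⟩ := chr_le_add (P := P) hψ ψ.injective s
      rw [cdist_le_iff]
      constructor
      · exact a2.trans (add_le_add b1 (self_le_add_right _ _))
      · exact b2.trans (add_le_add a1 (self_le_add_left _ _))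
    · rw [sizeTotal_add]
      exact Cardinal.add_lt_of_lt P.aleph0_le ((sizeTotal_disjoint_le σ _).trans_lt h1)
        ((sizeTotal_disjoint_le τ _).trans_lt h2)

end Params
end
end QuotSym

namespace QuotSym
noncomputable section
namespace Params

variable {P : Params.{u}} {X Z W : Type u} {n : ℕ}

/-! ### Projections -/

theorem Dset_initTuple_subset (σ : Fin (n + 1) → Equiv.Perm X) :
    P.Dset (initTuple σ) ⊆ P.Dset σ := fun _ ha hlam => (ha hlam).imp' Fin.castSucc fun _ h => h

/-- An orbit of the first `n` entries lies in a single orbit of `σ`, and within it corresponds to an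
orbit in the model of its type. So such orbits are pairs consisting of an orbit of `σ` and an orbit
in the model. -/
theorem chr_initTuple (σ : Fin (n + 1) → Equiv.Perm X) :
    P.chr (initTuple σ) = P.projFun (P.chr σ) := by
  ext t
  have hcard : P.projFun (P.chr σ) t =
      #(Σ s : P.IS (n + 1), Orb (initTuple s.1.out.g) t.1 × Orb σ s.1) := by
    rw [Cardinal.mk_sigma, projFun]
    congr 1
    ext s
    rw [Cardinal.mk_prod, Cardinal.lift_uzero]
    rfl
  rw [hcard]
  have himg : ∀ (s : P.IS (n + 1)) (B : Orb σ s.1) (a : s.1.out.A),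
      (fun a => dec σ ⟨s, B, a⟩) '' orbit (initTuple s.1.out.g) a =
        orbit (initTuple σ) (dec σ ⟨s, B, a⟩) := fun s B a =>
    image_orbit (φ := fun a => dec σ ⟨s, B, a⟩) (fun b _ i => dec_equivariant σ i.castSucc s B b)
  have htyp : ∀ (s : P.IS (n + 1)) (B : Orb σ s.1) (a : s.1.out.A) (t : IsoType n),
      HasType (initTuple σ) (orbit (initTuple σ) (dec σ ⟨s, B, a⟩)) t ↔
        HasType (initTuple s.1.out.g) (orbit (initTuple s.1.out.g) a) t := fun s B a t =>
    hasType_image (φ := fun a => dec σ ⟨s, B, a⟩) (fun b _ i => dec_equivariant σ i.castSucc s B b)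
      (dec_injective_block σ s B).injOn t
  refine (Cardinal.mk_congr (Equiv.ofBijective (fun x :
    (Σ s : P.IS (n + 1), Orb (initTuple s.1.out.g) t.1 × Orb σ s.1) =>
    (⟨(fun a => dec σ ⟨x.1, x.2.2, a⟩) '' x.2.1.1, ?_⟩ : Orb (initTuple σ) t.1)) ⟨?_, ?_⟩)).symm
  · obtain ⟨s, ⟨C, ⟨a, rfl⟩, hC⟩, B⟩ := x
    dsimp only
    rw [himg s B a]
    exact ⟨⟨_, rfl⟩, (htyp s B a t.1).2 hC⟩
  · rintro ⟨s, ⟨C, ⟨a, rfl⟩, hC⟩, B⟩ ⟨s', ⟨C', ⟨a', rfl⟩, hC'⟩, B'⟩ h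
    have h1 := Subtype.ext_iff.1 h
    dsimp only at h1
    have h2 : dec σ ⟨s, B, a⟩ ∈ (fun a => dec σ ⟨s', B', a⟩) '' orbit (initTuple s'.1.out.g) a' :=
      h1 ▸ ⟨a, mem_orbit_self _ a, rfl⟩
    obtain ⟨b, hb, hb'⟩ := h2
    have := dec_injective σ hb'
    simp only [Sigma.mk.injEq] at this
    obtain ⟨rfl, h2⟩ := this
    rw [heq_eq_eq, Prod.mk.injEq] at h2
    obtain ⟨rfl, rfl⟩ := h2
    have h3 := orbit_eq hb
    rw [Sigma.mk.injEq]
    exact ⟨rfl, heq_of_eq (Prod.ext (Subtype.ext h3.symm) rfl)⟩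
  · rintro ⟨D, ⟨x, rfl⟩, hD⟩
    -- A point moved by one of the first `n` entries is moved by the whole tuple, so no counted
    -- orbit is lost.
    obtain ⟨s, B, a, rfl⟩ := exists_dec (Dset_initTuple_subset σ (mem_Dset_of_hasType hD))
    exact ⟨⟨s, ⟨_, ⟨a, rfl⟩, (htyp s B a t.1).1 hD⟩, B⟩, Subtype.ext (himg s B a)⟩

/-! ### The points where an equation fails -/

theorem badWt_le_wt (t : P.IS n) (D : Set ℕ) (hD : D ⊆ t.1.out.A) : P.badWt D ≤ P.wt t := by
  unfold badWt wt
  split_ifs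
  · exact Cardinal.lift_le.2 (Cardinal.mk_le_mk_of_subset hD)
  · exact le_rfl
  · exact zero_le

theorem badWt_le (D : Set ℕ) : P.badWt D ≤ Cardinal.lift.{u} #D := by
  unfold badWt
  split_ifs with h h'
  · exact le_rfl
  · rw [Cardinal.one_le_iff_ne_zero]
    have : Nonempty D := h'.to_subtype
    simp [Cardinal.mk_ne_zero]
  · exact zero_le

theorem le_badWt (D : Set ℕ) : Cardinal.lift.{u} #D ≤ ℵ₀ * P.badWt D := by
  have h0 : Cardinal.lift.{u} #D ≤ ℵ₀ := by simp
  unfold badWt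
  split_ifs with h h'
  · conv_lhs => rw [← one_mul (Cardinal.lift.{u} #D)]
    gcongr
    exact Cardinal.one_le_aleph0
  · simp
  · rw [Set.not_nonempty_iff_eq_empty] at h'
    simp [h']

/-- The points of the models of the types where `q` holds. -/
def badSet (q : ∀ s : P.IS n, s.1.out.A → Prop) (s : P.IS n) : Set ℕ :=
  {m | ∃ a : s.1.out.A, (a : ℕ) = m ∧ q s a}

/-- If `κ = ℵ₀`, the sum counts exactly the points where `qX` holds. If `κ` is uncountable, it
counts orbits that contain such points, and the two numbers differ by a factor of at most `ℵ₀`. -/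
theorem badSum_lt_iff (σ : Fin n → Equiv.Perm X) (q : ∀ s : P.IS n, s.1.out.A → Prop)
    (qX : X → Prop) (hq : ∀ s B a, qX (dec σ ⟨s, B, a⟩) ↔ q s a) (hD : ∀ x, qX x → x ∈ P.Dset σ) :
    (Cardinal.sum fun s => P.badWt (badSet q s) * P.chr σ s) < P.κ ↔ #{x | qX x} < P.κ := by
  have hcard : (Cardinal.sum fun s => Cardinal.lift.{u} #(badSet q s) * P.chr σ s) =
      #{x | qX x} := by
    have h1 : (Cardinal.sum fun s => Cardinal.lift.{u} #(badSet q s) * P.chr σ s) =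
        #(Σ s : P.IS n, Orb σ s.1 × {a : s.1.out.A // q s a}) := by
      rw [Cardinal.mk_sigma]
      congr 1
      ext s
      rw [Cardinal.mk_prod, Cardinal.lift_uzero, mul_comm]
      congr 2
      refine Cardinal.mk_congr ⟨fun m => ⟨⟨m.1, ?_⟩, ?_⟩, fun a => ⟨a.1, a.1, rfl, a.2⟩, ?_, ?_⟩
      · obtain ⟨m, a, rfl, h⟩ := m
        exact a.2
      · obtain ⟨m, a, rfl, h⟩ := m
        exact h
      · intro m
        rfl
      · intro a
        rfl
    rw [h1]
    refine Cardinal.mk_congr (Equiv.ofBijective (fun x => ⟨dec σ ⟨x.1, x.2.1, x.2.2.1⟩, ?_⟩)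
      ⟨?_, ?_⟩)
    · exact (hq _ _ _).2 x.2.2.2
    · rintro ⟨s, B, a⟩ ⟨s', B', a'⟩ hx
      have := dec_injective σ (Subtype.ext_iff.1 hx)
      simp only [Sigma.mk.injEq] at this
      obtain ⟨rfl, h2⟩ := this
      rw [heq_eq_eq, Prod.mk.injEq] at h2
      obtain ⟨rfl, h3⟩ := h2
      obtain rfl := Subtype.ext h3
      rfl
    · rintro ⟨x, hx⟩
      obtain ⟨s, B, a, rfl⟩ := exists_dec (hD x hx)
      exact ⟨⟨s, B, a, (hq s B a).1 hx⟩, rfl⟩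
  rw [← hcard]
  by_cases hκ : P.κ = ℵ₀
  · simp only [badWt, if_pos hκ]
  · constructor
    · intro h
      have h1 : ℵ₀ < P.κ := lt_of_le_of_ne P.aleph0_le (Ne.symm hκ)
      refine lt_of_le_of_lt ?_ (Cardinal.mul_lt_of_lt P.aleph0_le h1 h)
      rw [mul_sum']
      refine Cardinal.sum_le_sum _ _ fun s => ?_
      rw [← mul_assoc]
      gcongr
      exact le_badWt _
    · refine lt_of_le_of_lt (Cardinal.sum_le_sum _ _ fun s => ?_)
      gcongr
      exact badWt_le _

/-- The weight of the bad points of a type never exceeds the weight of the type, so passing to an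
equivalent function adds less than `κ`. Hence `EqF` and `ProdF` may be tested on any representative.
-/
theorem badSum_congr (q : ∀ s : P.IS n, s.1.out.A → Prop) {h k : P.IS n → Cardinal.{u}}
    (hE : P.E h k) (hh : (Cardinal.sum fun s => P.badWt (badSet q s) * h s) < P.κ) :
    (Cardinal.sum fun s => P.badWt (badSet q s) * k s) < P.κ := by
  refine lt_of_le_of_lt ?_ (Cardinal.add_lt_of_lt P.aleph0_le hh hE)
  rw [total, ← Cardinal.sum_add_distrib']
  refine Cardinal.sum_le_sum _ _ fun s => ?_
  calc P.badWt (badSet q s) * k s ≤ P.badWt (badSet q s) * (h s + cdist (h s) (k s)) := by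
        gcongr
        exact (cdist_le_iff.1 le_rfl).2
    _ = P.badWt (badSet q s) * h s + P.badWt (badSet q s) * cdist (h s) (k s) := mul_add _ _ _
    _ ≤ _ := by
        gcongr
        refine badWt_le_wt s _ ?_
        rintro _ ⟨a, rfl, -⟩
        exact a.2

theorem exists_badSum_iff {σ : Fin n → Equiv.Perm X} {c : P.F n} {h : P.FPre n}
    (hh : h.1 = P.chr σ) (hc : P.cls h = c) (q : ∀ s : P.IS n, s.1.out.A → Prop)
    (qX : X → Prop) (hq : ∀ s B a, qX (dec σ ⟨s, B, a⟩) ↔ q s a) (hD : ∀ x, qX x → x ∈ P.Dset σ) :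
    (∃ h : P.FPre n, P.cls h = c ∧
      (Cardinal.sum fun s => P.badWt (badSet q s) * h.1 s) < P.κ) ↔ #{x | qX x} < P.κ := by
  rw [← badSum_lt_iff σ q qX hq hD, ← hh]
  constructor
  · rintro ⟨k, hk, hs⟩
    have : P.E k.1 h.1 := Quotient.exact (hk.trans hc.symm)
    exact badSum_congr q this hs
  · exact fun hs => ⟨h, hc, hs⟩

theorem EqF_iff {σ : Fin 2 → Equiv.Perm X} {c : P.F 2} {h : P.FPre 2}
    (hh : h.1 = P.chr σ) (hc : P.cls h = c) : P.EqF c ↔ #{x | σ 0 x ≠ σ 1 x} < P.κ := by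
  refine exists_badSum_iff hh hc (fun s a => s.1.out.g 0 a ≠ s.1.out.g 1 a)
    (fun x => σ 0 x ≠ σ 1 x) (fun s B a => ?_) fun x hx _ => ?_
  · rw [← dec_equivariant, ← dec_equivariant, (dec_injective_block σ s B).ne_iff]
  · by_contra! hcon
    exact hx ((hcon 0).trans (hcon 1).symm)

theorem ProdF_iff {σ : Fin 3 → Equiv.Perm X} {c : P.F 3} {h : P.FPre 3}
    (hh : h.1 = P.chr σ) (hc : P.cls h = c) :
    P.ProdF c ↔ #{x | (σ 0 * σ 1) x ≠ σ 2 x} < P.κ := by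
  refine exists_badSum_iff hh hc (fun s a => (s.1.out.g 0 * s.1.out.g 1) a ≠ s.1.out.g 2 a)
    (fun x => (σ 0 * σ 1) x ≠ σ 2 x) (fun s B a => ?_) fun x hx _ => ?_
  · rw [Equiv.Perm.mul_apply, Equiv.Perm.mul_apply, ← dec_equivariant, ← dec_equivariant,
      ← dec_equivariant, (dec_injective_block σ s B).ne_iff]
  · by_contra! hcon
    exact hx (by rw [Equiv.Perm.mul_apply, hcon 1, hcon 0, hcon 2])

theorem Proj_cls {σ : Fin (n + 1) → Equiv.Perm X} {h : P.FPre (n + 1)} (hh : h.1 = P.chr σ)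
    {k : P.FPre n} (hk : k.1 = P.chr (initTuple σ)) : P.Proj (P.cls h) = P.cls k := by
  have : (⟨P.projFun h.1, P.projFun_mem h⟩ : P.FPre n) = k :=
    Subtype.ext (by rw [hk, chr_initTuple, ← hh])
  rw [← this]
  rfl

theorem cls_eq_iff {σ : Fin n → Equiv.Perm X} {τ : Fin n → Equiv.Perm Z} {h k : P.FPre n}
    (hh : h.1 = P.chr σ) (hk : k.1 = P.chr τ) : P.cls h = P.cls k ↔ P.AlmostIso σ τ := by
  rw [← E_chr_iff, ← hh, ← hk]
  exact ⟨fun h => Quotient.exact h, fun h => Quotient.sound h⟩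

theorem App_cls {σ : Fin n → Equiv.Perm X} {h : P.FPre n} (hh : h.1 = P.chr σ) (t : P.IS n) :
    (P.App (P.cls h) t).1 = trunc P.κ #(Orb σ t.1) := by
  change trunc P.κ (h.1 t) = _
  rw [hh]
  rfl

/-! ### Tuples of elements of `S_lam(μ)` -/

theorem mk_supp_tuple_lt (f : Fin n → P.SLam) : #(supp (P.perm f)) < P.lam := by
  have key : ∀ s : Finset (Fin n), #{a | ∃ i ∈ s, P.perm f i a ≠ a} < P.lam := by
    intro s
    induction s using Finset.induction with
    | empty => simpa using Cardinal.aleph0_pos.trans P.aleph0_lt_lam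
    | insert i s _ ih =>
      have h1 : {a | ∃ j ∈ insert i s, P.perm f j a ≠ a} ⊆
          {a | P.perm f i a ≠ a} ∪ {a | ∃ i ∈ s, P.perm f i a ≠ a} := by
        rintro a ⟨j, hj, ha⟩
        rcases Finset.mem_insert.1 hj with rfl | hj
        · exact Or.inl ha
        · exact Or.inr ⟨j, hj, ha⟩
      exact ((Cardinal.mk_le_mk_of_subset h1).trans (Cardinal.mk_union_le _ _)).trans_lt
        (Cardinal.add_lt_of_lt P.aleph0_lt_lam.le (f i).2 ih)
  refine (Cardinal.mk_le_mk_of_subset ?_).trans_lt (key Finset.univ)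
  rintro a ⟨i, hi⟩
  exact ⟨i, Finset.mem_univ i, hi⟩

theorem mk_Dset_perm (f : Fin n → P.SLam) : #(P.Dset (P.perm f)) < P.lam ∧
    (P.lam = Order.succ P.μ → #(P.Dset (P.perm f)) = P.μ) := by
  constructor
  · by_cases h : P.lam ≤ P.μ
    · exact (Cardinal.mk_le_mk_of_subset (show P.Dset (P.perm f) ⊆ supp (P.perm f) from
        fun a ha => ha h)).trans_lt (mk_supp_tuple_lt f)
    · exact (mk_le_μ _).trans_lt (not_le.1 h)
  · intro h
    rw [Dset_of_not_le (not_lam_le_of_eq h), Cardinal.mk_univ]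
    rfl

theorem exists_repF (x : Fin n → P.G) : ∃ c, P.RepF x c := by
  choose f hf using fun i => P.coset_surj (x i)
  exact ⟨P.cls ⟨P.Ch f, chr_mem (mk_Dset_perm f).1 (mk_Dset_perm f).2⟩, f, hf, _, rfl, rfl⟩

theorem exists_extendPerm (ρ : Fin n → Equiv.Perm W) (h1 : #W < P.lam) (ι : W ↪ P.Ω) :
    ∃ f : Fin n → P.SLam, (∀ i a, ι (ρ i a) = P.perm f i (ι a)) ∧
      supp (P.perm f) ⊆ Set.range ι := by
  have hmem : ∀ i a, (ρ i).viaEmbedding ι a ≠ a → a ∈ Set.range ι := by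
    intro i a ha
    by_contra hcon
    exact ha (Equiv.Perm.viaEmbedding_apply_of_notMem _ _ _ hcon)
  refine ⟨fun i => ⟨(ρ i).viaEmbedding ι, P.mem_SLam_of_subset (A := Set.range ι) ?_ (hmem i)⟩,
    fun i a => ?_, ?_⟩
  · rwa [Cardinal.mk_range_eq _ ι.injective]
  · exact (Equiv.Perm.viaEmbedding_apply _ _ _).symm
  · rintro a ⟨i, hi⟩
    exact hmem i a hi

/-- If `lam ≤ μ`, fixed points are not counted and any injection will do. If `lam = μ⁺`, points
outside the range would add trivial orbits, so `ι` has to be onto, which the condition on `#W`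
permits. -/
theorem exists_realization (ρ : Fin n → Equiv.Perm W) (h1 : #W < P.lam)
    (h2 : P.lam = Order.succ P.μ → #W = P.μ) :
    ∃ (f : Fin n → P.SLam) (ι : W ↪ P.Ω), (∀ i a, ι (ρ i a) = P.perm f i (ι a)) ∧
      P.Dset (P.perm f) ⊆ Set.range ι := by
  obtain ⟨ι, hι⟩ : ∃ ι : W ↪ P.Ω, ¬ P.lam ≤ P.μ → Function.Surjective ι := by
    by_cases hlam : P.lam ≤ P.μ
    · obtain ⟨ι⟩ := (h1.le.trans hlam : #W ≤ #P.Ω)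
      exact ⟨ι, fun h => absurd hlam h⟩
    · obtain ⟨e⟩ := Cardinal.eq.1 (h2 (lam_eq_succ hlam))
      exact ⟨e.toEmbedding, fun _ => e.surjective⟩
  obtain ⟨f, hf, hs⟩ := exists_extendPerm ρ h1 ι
  refine ⟨f, ι, hf, fun a ha => ?_⟩
  by_cases hlam : P.lam ≤ P.μ
  · exact hs (ha hlam)
  · exact hι hlam a

theorem exists_model (h : P.FPre n) : ∃ (W : Type u) (ρ : Fin n → Equiv.Perm W),
    P.chr ρ = h.1 ∧ #W < P.lam ∧ (P.lam = Order.succ P.μ → #W = P.μ) ∧ P.Dset ρ = Set.univ := by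
  refine ⟨P.Model fun s => (h.1 s).out, modelPerm _, ?_, ?_, ?_, ?_⟩
  · rw [chr_model]
    ext s
    rw [Cardinal.mk_out]
  · rw [mk_model]
    simp only [Cardinal.mk_out]
    exact (P.total_lt_iff _ P.lt.le).1 h.2.2.1
  · intro hlam
    rw [mk_model]
    simp only [Cardinal.mk_out]
    exact (P.total_eq_μ_iff _).1 (h.2.2.2 hlam)
  · refine Set.eq_univ_of_forall ?_
    rintro ⟨s, j, a⟩
    exact mem_Dset_of_hasType (t := s) (hasType_model (fun s => (h.1 s).out) s j a)

theorem exists_repF_of_class (c : P.F n) : ∃ x, P.RepF x c := by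
  induction c using Quotient.inductionOn with | _ h => ?_
  obtain ⟨W, ρ, h1, h2, h3, -⟩ := exists_model h
  obtain ⟨f, ι, h4, h5⟩ := exists_realization ρ h2 h3
  refine ⟨fun i => P.coset (f i), f, fun _ => rfl, h, ?_, rfl⟩
  rw [← h1, Ch_eq_chr]
  exact chr_eq_of_injective h4 ι.injective h5

end Params
end
end QuotSym

namespace QuotSym
noncomputable section

theorem orbit_countable {X : Type u} {n : ℕ} (σ : Fin n → Equiv.Perm X) (a : X) :
    #(orbit σ a) ≤ ℵ₀ := by
  obtain ⟨t, ht⟩ := exists_hasType σ a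
  rw [ht.mk_eq]
  simpa using Cardinal.lift_le.{u}.2 t.size_le

namespace Params

variable {P : Params.{u}} {n : ℕ}

/-! ### Almost invariant sets, for uncountable `κ` -/

/-- The exceptional points lie on fewer than `κ` orbits, each of them countable; for uncountable `κ`
the union of these orbits is still small. The treatment of uncountable `κ` rests on this. -/
theorem eventually_orbit (hκ : ℵ₀ < P.κ) (σ : Fin n → Equiv.Perm P.Ω) {p : P.Ω → Prop}
    (h : ∀ᶠ c in P.fil, p c) : ∀ᶠ c in P.fil, ∀ c' ∈ orbit σ c, p c' := by
  rw [eventually_iff] at h ⊢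
  have hsub : {c | ¬ ∀ c' ∈ orbit σ c, p c'} ⊆ ⋃ c' : {c | ¬ p c}, orbit σ c'.1 := by
    intro c hc
    simp only [Set.mem_ofPred_eq, not_forall] at hc
    obtain ⟨c', hc', hp⟩ := hc
    exact Set.mem_iUnion.2 ⟨⟨c', hp⟩, mem_orbit_comm.1 hc'⟩
  refine (Cardinal.mk_le_mk_of_subset hsub).trans_lt ((Cardinal.mk_iUnion_le _).trans_lt ?_)
  refine Cardinal.mul_lt_of_lt P.aleph0_le h (lt_of_le_of_lt ?_ hκ)
  exact ciSup_le' fun c => orbit_countable σ c.1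

/-- For almost all points `c`, membership in `B` is unchanged by the generators everywhere on the
orbit of `c`, hence constant on it. So an almost invariant set is a union of orbits up to a small
set. -/
theorem eventually_saturated (hκ : ℵ₀ < P.κ) {σ : Fin n → Equiv.Perm P.Ω} {B : Set P.Ω}
    (h : ∀ i, ∀ᶠ c in P.fil, σ i c ∈ B ↔ c ∈ B) :
    ∀ᶠ c in P.fil, ∀ c' ∈ orbit σ c, (c' ∈ B ↔ c ∈ B) := by
  have h' := eventually_orbit hκ σ (Filter.eventually_all.2 h)
  filter_upwards [h'] with c hc
  have hinv : IsInv σ {c' | c' ∈ orbit σ c ∧ (c' ∈ B ↔ c ∈ B)} := by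
    intro i b
    simp only [Set.mem_ofPred_eq, isInv_orbit σ c i b]
    exact and_congr_right fun hb => by rw [hc b hb i]
  exact fun c' hc' => (hinv.orbit_subset ⟨mem_orbit_self σ c, Iff.rfl⟩ hc').2

theorem eventually_hasType_congr (hκ : ℵ₀ < P.κ) {σ τ : Fin n → Equiv.Perm P.Ω}
    (z : Equiv.Perm P.Ω) {B : Set P.Ω} (hB : ∀ i, ∀ᶠ c in P.fil, σ i c ∈ B ↔ c ∈ B)
    (h : ∀ i, ∀ᶠ c in P.fil, c ∈ B → z (σ i c) = τ i (z c)) :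
    ∀ᶠ c in P.fil, c ∈ B → ∀ t, HasType τ (orbit τ (z c)) t ↔ HasType σ (orbit σ c) t := by
  have h' := eventually_orbit hκ σ (Filter.eventually_all.2 h)
  filter_upwards [h', eventually_saturated hκ hB] with c h1 h2 hc t
  exact hasType_image (fun b hb i => h1 b hb i ((h2 b hb).2 hc)) z.injective.injOn t

/-! ### Conjugacy -/

/-- The conjugating permutation is equivariant only almost everywhere. Restricting it to the counted
points on whose whole orbit it is equivariant costs only a small set. -/
theorem almostIso_of_conj (hκ : ℵ₀ < P.κ) {f g : Fin n → P.SLam} (z : P.SLam)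
    (h : ∀ i, ∀ᶠ a in P.fil, (z : Equiv.Perm P.Ω) (P.perm g i a) = P.perm f i ((z : Equiv.Perm P.Ω) a)) :
    P.AlmostIso (P.perm f) (P.perm g) := by
  have h' := eventually_orbit hκ (P.perm g) (Filter.eventually_all.2 h)
  set W : Set P.Ω := {a | a ∈ P.Dset (P.perm g) ∧ ∀ b ∈ orbit (P.perm g) a, ∀ i,
    (z : Equiv.Perm P.Ω) (P.perm g i b) = P.perm f i ((z : Equiv.Perm P.Ω) b)}
  have hW : IsInv (P.perm g) W := by
    intro i a
    simp only [W, Set.mem_ofPred_eq]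
    rw [isInv_Dset (P.perm g) i a,
      orbit_eq ((isInv_orbit (P.perm g) a i a).2 (mem_orbit_self _ a))]
  have hmoved : ∀ a ∈ W, (z : Equiv.Perm P.Ω) a ∈ P.Dset (P.perm f) := by
    intro a ha hlam
    obtain ⟨i, hi⟩ := ha.1 hlam
    exact ⟨i, by rw [← ha.2 a (mem_orbit_self _ a) i, (z : Equiv.Perm P.Ω).injective.ne_iff]; exact hi⟩
  refine ⟨W, fun i => (P.perm g i).subtypePerm (p := fun x => x ∈ W) (hW i),
    (Function.Embedding.subtype _).trans (z : Equiv.Perm P.Ω).toEmbedding,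
    Function.Embedding.subtype _, fun i a => ?_, fun i a => rfl, ?_, ?_, ?_, ?_⟩
  · exact a.2.2 _ (mem_orbit_self _ _) i
  · rintro _ ⟨a, rfl⟩
    exact hmoved a a.2
  · rintro _ ⟨a, rfl⟩
    exact a.2.1
  · change P.Small _
    rw [← eventually_notMem]
    filter_upwards [eventually_perm h' (z : Equiv.Perm P.Ω)⁻¹] with x hx hcon
    refine hcon.2 ⟨⟨(z : Equiv.Perm P.Ω)⁻¹ x, fun hlam => ?_, hx⟩, by simp⟩
    obtain ⟨i, hi⟩ := hcon.1 hlam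
    refine ⟨i, fun h => hi ?_⟩
    have := hx _ (mem_orbit_self _ _) i
    rw [h] at this
    simpa using this.symm
  · change P.Small _
    rw [← eventually_notMem]
    filter_upwards [h'] with x hx hcon
    exact hcon.2 ⟨⟨x, hcon.1, hx⟩, rfl⟩

/-- If `lam = μ⁺`, the complements of the two ranges are small but may differ in size. Giving up a
small part of `W` makes them equal. -/
theorem exists_extend_eventually (hκ : ℵ₀ < P.κ) {W : Type u} (φ ψ : W ↪ P.Ω) (hW : #W < P.lam)
    (h : ¬ P.lam ≤ P.μ → P.Small (Set.range φ)ᶜ ∧ P.Small (Set.range ψ)ᶜ) :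
    ∃ (z : P.SLam) (C : Set W), #C < P.κ ∧ ∀ w, w ∉ C → (z : Equiv.Perm P.Ω) (φ w) = ψ w := by
  by_cases hlam : P.lam ≤ P.μ
  · obtain ⟨z, hz⟩ := exists_extend φ ψ hW (by
      rw [mk_compl_eq_of_lt, mk_compl_eq_of_lt] <;>
      · rw [Cardinal.mk_range_eq _ (Function.Embedding.injective _)]
        exact hW.trans_le hlam)
    exact ⟨z, ∅, by simpa using Cardinal.aleph0_pos.trans hκ, fun w _ => hz w⟩
  · obtain ⟨h1, h2⟩ := h hlam
    -- An infinite cardinal below `κ` that bounds both complements. Removing a set `C` of this size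
    -- from `W` makes both complements have size exactly `c`.
    set c := max (max #((Set.range φ)ᶜ : Set P.Ω) #((Set.range ψ)ᶜ : Set P.Ω)) ℵ₀ with hc
    have hcκ : c < P.κ := max_lt (max_lt h1 h2) hκ
    have hWμ : P.κ ≤ #W := by
      by_contra hcon
      rw [not_le, ← Cardinal.mk_range_eq _ φ.injective] at hcon
      apply not_small_univ P
      rw [← Set.union_compl_self (Set.range φ)]
      exact Small.union hcon h1
    obtain ⟨C, hC⟩ := Cardinal.le_mk_iff_exists_set.1 (hcκ.le.trans hWμ)
    have key : ∀ ξ : W ↪ P.Ω, #((Set.range ξ)ᶜ : Set P.Ω) ≤ c →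
        #((Set.range ((Function.Embedding.subtype (· ∉ C)).trans ξ))ᶜ : Set P.Ω) = c := by
      intro ξ hξ
      apply le_antisymm
      · have hsub : (Set.range ((Function.Embedding.subtype (· ∉ C)).trans ξ))ᶜ ⊆
            (Set.range ξ)ᶜ ∪ ξ '' C := by
          intro a ha
          by_cases h : a ∈ Set.range ξ
          · obtain ⟨w, rfl⟩ := h
            by_cases hw : w ∈ C
            · exact Or.inr ⟨w, hw, rfl⟩
            · exact absurd ⟨⟨w, hw⟩, rfl⟩ ha
          · exact Or.inl h
        refine (Cardinal.mk_le_mk_of_subset hsub).trans ((Cardinal.mk_union_le _ _).trans ?_)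
        refine (add_le_add hξ (Cardinal.mk_image_le.trans hC.le)).trans ?_
        rw [Cardinal.add_eq_self (le_max_right _ _)]
      · rw [← hC, ← Cardinal.mk_image_eq (s := C) ξ.injective]
        refine Cardinal.mk_le_mk_of_subset ?_
        rintro _ ⟨w, hw, rfl⟩ ⟨⟨w', hw'⟩, h⟩
        have h5 : w' = w := ξ.injective h
        exact hw' (h5 ▸ hw)
    obtain ⟨z, hz⟩ := exists_extend ((Function.Embedding.subtype (· ∉ C)).trans φ)
      ((Function.Embedding.subtype (· ∉ C)).trans ψ)
      ((Cardinal.mk_subtype_le _).trans_lt hW) (by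
        rw [key φ ((le_max_left _ _).trans (le_max_left _ _)),
          key ψ ((le_max_right _ _).trans (le_max_left _ _))])
    exact ⟨z, C, hC ▸ hcκ, fun w hw => hz ⟨w, hw⟩⟩

theorem conj_of_almostIso (hκ : ℵ₀ < P.κ) {f g : Fin n → P.SLam}
    (h : P.AlmostIso (P.perm f) (P.perm g)) : ∃ z : P.SLam,
      ∀ i, ∀ᶠ a in P.fil, (z : Equiv.Perm P.Ω) (P.perm g i a) = P.perm f i ((z : Equiv.Perm P.Ω) a) := by
  obtain ⟨W, ρ, φ, ψ, hφ, hψ, hφD, hψD, hφs, hψs⟩ := h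
  have hW : #W < P.lam := by
    rw [← Cardinal.mk_range_eq _ φ.injective]
    exact (Cardinal.mk_le_mk_of_subset hφD).trans_lt (mk_Dset_perm f).1
  obtain ⟨z, C, hC, hz⟩ := exists_extend_eventually hκ ψ φ hW (by
    intro hlam
    rw [Dset_of_not_le hlam, ← Set.compl_eq_univ_sdiff] at hφs hψs
    exact ⟨hψs, hφs⟩)
  have key : ∀ (ξ : W ↪ P.Ω) (D : Set P.Ω), P.Small (D \ Set.range ξ) →
      ∀ᶠ a in P.fil, a ∈ D → ∃ w, w ∉ C ∧ ξ w = a := by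
    intro ξ D hs
    have hs' : P.Small (ξ '' C) := (Cardinal.mk_image_le).trans_lt hC
    filter_upwards [P.eventually_notMem.2 hs, P.eventually_notMem.2 hs'] with a h1 h2 h3
    by_contra! hcon
    refine h1 ⟨h3, ?_⟩
    rintro ⟨w, rfl⟩
    exact hcon w (fun hw => h2 ⟨w, hw, rfl⟩) rfl
  refine ⟨z, fun i => ?_⟩
  have k1 := key ψ _ hψs
  have k2 := key φ _ hφs
  filter_upwards [k1, eventually_perm k1 (P.perm g i), eventually_perm k2 z] with a h1 h2 h3
  by_cases ha : a ∈ P.Dset (P.perm g)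
  · obtain ⟨w, hw, rfl⟩ := h1 ha
    obtain ⟨w', hw', h4⟩ := h2 ((isInv_Dset _ i _).2 ha)
    have h5 : w' = ρ i w := ψ.injective (by rw [h4, hψ])
    rw [← h4, hz w' hw', hz w hw, h5, hφ]
  -- An uncounted point `a` is fixed by `g`, so its image must be shown to be fixed by `f`.
  -- Otherwise the image is a counted point, in general of the form `φ w`; then `a = ψ w` would be
  -- counted.
  · have hlam : P.lam ≤ P.μ ∧ ∀ i, P.perm g i a = a := by
      simp only [Dset, Set.mem_ofPred_eq] at ha
      push Not at ha
      exact ha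
    rw [hlam.2 i]
    by_contra hcon
    obtain ⟨w, hw, h4⟩ := h3 fun _ => ⟨i, fun h => hcon h.symm⟩
    rw [← hz w hw, EmbeddingLike.apply_eq_iff_eq] at h4
    exact ha (hψD ⟨w, h4⟩)

theorem conj_iff_almostIso (hκ : ℵ₀ < P.κ) (f g : Fin n → P.SLam) :
    (∃ z : P.G, ∀ i, z⁻¹ * P.coset (f i) * z = P.coset (g i)) ↔
      P.AlmostIso (P.perm f) (P.perm g) := by
  have key : ∀ (z : P.SLam) (i : Fin n),
      (P.coset z)⁻¹ * P.coset (f i) * P.coset z = P.coset (g i) ↔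
      ∀ᶠ a in P.fil, (z : Equiv.Perm P.Ω) (P.perm g i a) = P.perm f i ((z : Equiv.Perm P.Ω) a) := by
    intro z i
    rw [← coset_inv, ← coset_mul, ← coset_mul, coset_eq]
    apply Filter.eventually_congr
    refine Filter.Eventually.of_forall fun a => ?_
    simp only [Subgroup.coe_mul, Subgroup.coe_inv, Equiv.Perm.mul_apply]
    rw [Equiv.Perm.inv_eq_iff_eq]
    exact eq_comm
  constructor
  · rintro ⟨z, hz⟩
    obtain ⟨z, rfl⟩ := P.coset_surj z
    exact almostIso_of_conj hκ z fun i => (key z i).1 (hz i)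
  · intro h
    obtain ⟨z, hz⟩ := conj_of_almostIso hκ h
    exact ⟨P.coset z, fun i => (key z i).2 (hz i)⟩

theorem RepF.eq_iff (hκ : ℵ₀ < P.κ) {x y : Fin n → P.G} {c d : P.F n} (h : P.RepF x c)
    (h' : P.RepF y d) : c = d ↔ ∃ z : P.G, ∀ i, z⁻¹ * x i * z = y i := by
  obtain ⟨f, hf, h, hh, rfl⟩ := h
  obtain ⟨g, hg, k, hk, rfl⟩ := h'
  simp only [← hf, ← hg]
  rw [conj_iff_almostIso hκ, cls_eq_iff hh hk]

theorem RepF.unique (hκ : ℵ₀ < P.κ) {x : Fin n → P.G} {c d : P.F n} (h : P.RepF x c)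
    (h' : P.RepF x d) : c = d := (h.eq_iff hκ h').2 ⟨1, fun i => by simp⟩

/-- The first `n` entries represent the projected class, so the graph of `Proj` reduces to equality
in `F_n`, that is, to conjugacy. -/
theorem RepF.proj_iff (hκ : ℵ₀ < P.κ) {x : Fin (n + 1) → P.G} {y : Fin n → P.G} {c : P.F (n + 1)}
    {d : P.F n} (h : P.RepF x c) (h' : P.RepF y d) :
    (∃ z : P.G, ∀ i, z⁻¹ * initTuple x i * z = y i) ↔ P.Proj c = d := by
  have h1 : P.RepF (initTuple x) (P.Proj c) := by
    obtain ⟨f, hf, h, hh, rfl⟩ := h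
    refine ⟨initTuple f, fun i => hf _, ⟨_, chr_mem (mk_Dset_perm (initTuple f)).1
      (mk_Dset_perm (initTuple f)).2⟩, rfl, ?_⟩
    exact (Proj_cls hh rfl).symm
  exact (h1.eq_iff hκ h').symm

theorem RepF.eq_rel_iff {x : Fin 2 → P.G} {c : P.F 2} (h : P.RepF x c) :
    x 0 = x 1 ↔ P.EqF c := by
  obtain ⟨f, hf, h, hh, rfl⟩ := h
  rw [EqF_iff hh rfl, ← hf, ← hf, coset_eq, eventually_iff]
  rfl

theorem RepF.prod_rel_iff {x : Fin 3 → P.G} {c : P.F 3} (h : P.RepF x c) :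
    x 0 * x 1 = x 2 ↔ P.ProdF c := by
  obtain ⟨f, hf, h, hh, rfl⟩ := h
  rw [ProdF_iff hh rfl, ← hf, ← hf, ← hf, ← coset_mul, coset_eq, eventually_iff]
  rfl

end Params
end
end QuotSym

namespace QuotSym
noncomputable section

/-! ### Definable relations on tuples -/

section

variable {G : Type u} [Group G] {n : ℕ}

/-- The support of `a` is invariant under the tuple `x`. -/
def InvR (x : Fin n → G) (a : G) : Prop := ∀ i, EqR (x i * a * (x i)⁻¹) a

/-- The support of `a` is not small, invariant, and contained in that of `x` if `x ≠ 1`. -/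
def Good (x : Fin n → G) (a : G) : Prop :=
  a ≠ 1 ∧ InvR x a ∧ ((∃ i, x i ≠ 1) → ∀ u, (∀ i, Disj u (x i)) → Disj u a)

/-- Some conjugation takes the action of `x` on the support of `a` to the action of `y` on that
of `b`. -/
def IsoR (x : Fin n → G) (a : G) (y : Fin n → G) (b : G) : Prop :=
  ∃ z, EqR (z * a * z⁻¹) b ∧ ∀ i, Disj ((z * x i * z⁻¹)⁻¹ * y i) b

/-- The orbits of the type represented by `y` cover a part of the support of `a` which is not
small. -/
def Meets (x : Fin n → G) (a : G) (y : Fin n → G) : Prop :=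
  ∃ a', Sub a' a ∧ a' ≠ 1 ∧ InvR x a' ∧ ∃ b, Good y b ∧ IsoR x a' y b

/-- All non-trivial orbits of `x` are of the same type. -/
def Pure (x : Fin n → G) : Prop :=
  ∀ a b, Good x a → Good x b →
    ∃ a' b', Sub a' a ∧ Sub b' b ∧ Good x a' ∧ Good x b' ∧ IsoR x a' x b'

end

section

variable {α : Type} {n : ℕ} {s r : Fin n → ∀ (G : Type u) [Group G], (α → G) → G}
  {t q : ∀ (G : Type u) [Group G], (α → G) → G}

theorem UDef.substTuple {R : ∀ (G : Type u) [Group G], (Fin n → G) → Prop}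
    (hR : UDef (α := Fin n) fun G _ v => R G v) (hs : ∀ i, UTerm (s i)) :
    UDef fun G _ v => R G (fun i => s i G v) :=
  hR.subst (t := s) hs

theorem UDef.substTuple₁ {R : ∀ (G : Type u) [Group G], (Fin n → G) → G → Prop}
    (hR : UDef (α := Fin n ⊕ Unit) fun G _ v => R G (fun i => v (Sum.inl i)) (v (Sum.inr ())))
    (hs : ∀ i, UTerm (s i)) (ht : UTerm t) :
    UDef fun G _ v => R G (fun i => s i G v) (t G v) :=
  hR.subst (t := Sum.elim s fun _ => t) (by
    rintro (i | i)
    exacts [hs i, ht])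

theorem UDef.substTuple₂ {m : ℕ} {r : Fin m → ∀ (G : Type u) [Group G], (α → G) → G}
    {R : ∀ (G : Type u) [Group G], (Fin n → G) → G → (Fin m → G) → G → Prop}
    (hR : UDef (α := (Fin n ⊕ Unit) ⊕ (Fin m ⊕ Unit)) fun G _ v =>
      R G (fun i => v (Sum.inl (Sum.inl i))) (v (Sum.inl (Sum.inr ())))
        (fun i => v (Sum.inr (Sum.inl i))) (v (Sum.inr (Sum.inr ()))))
    (hs : ∀ i, UTerm (s i)) (ht : UTerm t) (hr : ∀ i, UTerm (r i)) (hq : UTerm q) :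
    UDef fun G _ v => R G (fun i => s i G v) (t G v) (fun i => r i G v) (q G v) :=
  hR.subst (t := Sum.elim (Sum.elim s fun _ => t) (Sum.elim r fun _ => q)) (by
    rintro ((i | i) | (i | i))
    exacts [hs i, ht, hr i, hq])

theorem UDef.invR (hs : ∀ i, UTerm (s i)) (ht : UTerm t) :
    UDef fun G _ v => InvR (fun i => s i G v) (t G v) := by
  unfold InvR
  exact UDef.fall fun i => UDef.eqR (((hs i).mul ht).mul (hs i).inv) ht

theorem UDef.good (hs : ∀ i, UTerm (s i)) (ht : UTerm t) :
    UDef fun G _ v => Good (fun i => s i G v) (t G v) := by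
  refine UDef.substTuple₁ (R := fun G _ x a => Good x a) ?_ hs ht
  unfold Good
  repeat' first
    | apply UDef.invR | apply UDef.disj | apply UDef.ne | apply UDef.fall | apply UDef.all
    | apply UDef.imp | apply UDef.fex | apply UDef.ex | apply UDef.and | exact UTerm.var _
    | exact UTerm.one | intro _

theorem UDef.isoR (hs : ∀ i, UTerm (s i)) (ht : UTerm t) (hr : ∀ i, UTerm (r i)) (hq : UTerm q) :
    UDef fun G _ v => IsoR (fun i => s i G v) (t G v) (fun i => r i G v) (q G v) := by
  refine UDef.substTuple₂ (R := fun G _ x a y b => IsoR x a y b) ?_ hs ht hr hq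
  unfold IsoR
  repeat' first
    | apply UDef.eqR | apply UDef.disj | apply UDef.fall | apply UDef.ex | apply UDef.and
    | apply UTerm.mul | apply UTerm.inv | exact UTerm.var _ | intro _

theorem UDef.meets (hs : ∀ i, UTerm (s i)) (ht : UTerm t) (hr : ∀ i, UTerm (r i)) :
    UDef fun G _ v => Meets (fun i => s i G v) (t G v) (fun i => r i G v) := by
  refine UDef.substTuple₂ (R := fun G _ x a y _ => Meets x a y) ?_ hs ht hr ht
  unfold Meets
  repeat' first
    | apply UDef.good | apply UDef.isoR | apply UDef.invR | apply UDef.sub | apply UDef.ne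
    | apply UDef.ex | apply UDef.and | exact UTerm.var _ | exact UTerm.one | intro _

theorem UDef.pure (hs : ∀ i, UTerm (s i)) : UDef fun G _ v => Pure (fun i => s i G v) := by
  refine UDef.substTuple (R := fun G _ x => Pure x) ?_ hs
  unfold Pure
  repeat' first
    | apply UDef.good | apply UDef.isoR | apply UDef.sub | apply UDef.all | apply UDef.imp
    | apply UDef.ex | apply UDef.and | exact UTerm.var _ | intro _

end

theorem perm_inv_apply {X : Type u} (p : Equiv.Perm X) (a : X) : p⁻¹ (p a) = a := by simp

/-! ### Their meaning -/

namespace Params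

variable {P : Params.{u}} {n : ℕ}

theorem invR_iff {f : Fin n → P.SLam} {a : P.G} {A : Set P.Ω} (ha : P.Reg a A) :
    InvR (fun i => P.coset (f i)) a ↔ ∀ i, ∀ᶠ c in P.fil, P.perm f i c ∈ A ↔ c ∈ A := by
  refine forall_congr' fun i => ?_
  rw [(ha.conj (f i)).eqR_iff ha, ← P.eventually_perm_iff (P.perm f i)]
  refine Filter.eventually_congr (Filter.Eventually.of_forall fun c => ?_)
  have : ((f i : Equiv.Perm P.Ω))⁻¹ (P.perm f i c) = c := perm_inv_apply _ _
  rw [Set.mem_ofPred_eq, this]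
  exact iff_comm

/-- The support of a tuple is not given by one element. Containment in it is expressed by the
elements disjoint from all entries; the test element lives on the part of `A` outside the support.
-/
theorem disj_tuple_iff {f : Fin n → P.SLam} {a : P.G} {A : Set P.Ω} (ha : P.Reg a A) :
    (∀ u, (∀ i, Disj u (P.coset (f i))) → Disj u a) ↔
      ∀ᶠ c in P.fil, c ∈ A → c ∈ supp (P.perm f) := by
  constructor
  · intro h
    obtain ⟨u, hu⟩ := exists_elem (P := P) (A := A \ supp (P.perm f))
      ((Cardinal.mk_le_mk_of_subset Set.sdiff_subset).trans_lt ha.card_lt)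
    have h1 : Disj u a := h u fun i => by
      rw [hu.disj_iff (reg_coset (f i))]
      exact Filter.Eventually.of_forall fun c hc hc' => hc.2 ⟨i, hc'⟩
    rw [hu.disj_iff ha] at h1
    filter_upwards [h1] with c hc hA
    by_contra hcon
    exact hc ⟨hA, hcon⟩ hA
  · intro h u hu
    obtain ⟨U, hU, -⟩ := exists_reg u
    rw [hU.disj_iff ha]
    have h1 : ∀ᶠ c in P.fil, ∀ i, c ∈ U → c ∉ {c | (f i : Equiv.Perm P.Ω) c ≠ c} :=
      Filter.eventually_all.2 fun i => (hU.disj_iff (reg_coset (f i))).1 (hu i)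
    filter_upwards [h, h1] with c hc h2 hcU hcA
    obtain ⟨i, hi⟩ := hc hcA
    exact h2 i hcU hi

theorem small_supp_iff {f : Fin n → P.SLam} :
    P.Small (supp (P.perm f)) ↔ ∀ i, P.coset (f i) = 1 := by
  rw [← P.eventually_notMem]
  simp only [coset_eq_one]
  rw [← Filter.eventually_all]
  refine Filter.eventually_congr (Filter.Eventually.of_forall fun c => ?_)
  simp only [supp, Set.mem_ofPred_eq, not_exists, not_not]
  rfl

theorem good_iff {f : Fin n → P.SLam} {a : P.G} {A : Set P.Ω} (ha : P.Reg a A) :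
    Good (fun i => P.coset (f i)) a ↔ ¬ P.Small A ∧
      (∀ i, ∀ᶠ c in P.fil, P.perm f i c ∈ A ↔ c ∈ A) ∧
      (¬ P.Small (supp (P.perm f)) → ∀ᶠ c in P.fil, c ∈ A → c ∈ supp (P.perm f)) := by
  rw [Good, invR_iff ha, disj_tuple_iff ha, Ne, ha.eq_one_iff, small_supp_iff, not_forall]

/-- The quotient of the conjugated entry by the corresponding entry of the other tuple being
disjoint from `b` says that these two agree almost everywhere on `B`; pulled back along `z`, this is
equivariance on `A`. -/
theorem isoR_iff {f g : Fin n → P.SLam} {a b : P.G} {A B : Set P.Ω} (ha : P.Reg a A)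
    (hb : P.Reg b B) :
    IsoR (fun i => P.coset (f i)) a (fun i => P.coset (g i)) b ↔
      ∃ z : P.SLam, (∀ᶠ c in P.fil, (z : Equiv.Perm P.Ω) c ∈ B ↔ c ∈ A) ∧
        ∀ i, ∀ᶠ c in P.fil, c ∈ A →
          (z : Equiv.Perm P.Ω) (P.perm f i c) = P.perm g i ((z : Equiv.Perm P.Ω) c) := by
  have key : ∀ z : P.SLam, (EqR (P.coset z * a * (P.coset z)⁻¹) b ∧
      ∀ i, Disj ((P.coset z * P.coset (f i) * (P.coset z)⁻¹)⁻¹ * P.coset (g i)) b) ↔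
      (∀ᶠ c in P.fil, (z : Equiv.Perm P.Ω) c ∈ B ↔ c ∈ A) ∧
        ∀ i, ∀ᶠ c in P.fil, c ∈ A →
          (z : Equiv.Perm P.Ω) (P.perm f i c) = P.perm g i ((z : Equiv.Perm P.Ω) c) := by
    intro z
    rw [(ha.conj z).eqR_iff hb, ← P.eventually_perm_iff (z : Equiv.Perm P.Ω)]
    have h1 : (∀ᶠ c in P.fil, ((z : Equiv.Perm P.Ω) c ∈ {d | (z : Equiv.Perm P.Ω)⁻¹ d ∈ A} ↔
        (z : Equiv.Perm P.Ω) c ∈ B)) ↔ ∀ᶠ c in P.fil, (z : Equiv.Perm P.Ω) c ∈ B ↔ c ∈ A := by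
      refine Filter.eventually_congr (Filter.Eventually.of_forall fun c => ?_)
      rw [Set.mem_ofPred_eq, perm_inv_apply]
      exact iff_comm
    rw [h1]
    refine and_congr_right fun h2 => forall_congr' fun i => ?_
    rw [← coset_inv, ← coset_mul, ← coset_mul, ← coset_inv, ← coset_mul,
      (reg_coset _).disj_iff hb, ← P.eventually_perm_iff (z : Equiv.Perm P.Ω)]
    have h3 : ∀ c, (z : Equiv.Perm P.Ω) c ∈
        {d | (((z * f i * z⁻¹)⁻¹ * g i : P.SLam) : Equiv.Perm P.Ω) d ≠ d} ↔
        ¬ (z : Equiv.Perm P.Ω) (P.perm f i c) = P.perm g i ((z : Equiv.Perm P.Ω) c) := by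
      intro c
      rw [Set.mem_ofPred_eq, Ne, Subgroup.coe_mul, Subgroup.coe_inv, Subgroup.coe_mul,
        Subgroup.coe_mul, Subgroup.coe_inv, Equiv.Perm.mul_apply, Equiv.Perm.inv_eq_iff_eq,
        Equiv.Perm.mul_apply, Equiv.Perm.mul_apply, perm_inv_apply]
      exact not_congr eq_comm
    simp only [h3]
    constructor
    · intro h
      filter_upwards [h, h2] with c hc hc' hA
      by_contra hcon
      exact hc hcon (hc'.2 hA)
    · intro h
      filter_upwards [h, h2] with c hc hc' hne hB
      exact hne (hc (hc'.1 hB))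
  constructor
  · rintro ⟨z, hz⟩
    obtain ⟨z, rfl⟩ := P.coset_surj z
    exact ⟨z, (key z).1 hz⟩
  · rintro ⟨z, hz⟩
    exact ⟨_, (key z).2 hz⟩

end Params
end
end QuotSym

namespace QuotSym
noncomputable section

/-! ### Splitting a set into unions of classes -/

theorem lt_of_countable_fibers {X Y : Type u} {κ : Cardinal.{u}} (hκ : ℵ₀ < κ) {S : Set X}
    {O : Set Y} (B : Y → Set X) (hB : ∀ y, #(B y) ≤ ℵ₀) (hS : S ⊆ ⋃ y : O, B y.1) (hO : #O < κ) :
    #S < κ := by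
  refine (Cardinal.mk_le_mk_of_subset hS).trans_lt ((Cardinal.mk_iUnion_le _).trans_lt ?_)
  refine Cardinal.mul_lt_of_lt hκ.le hO (lt_of_le_of_lt ?_ hκ)
  exact ciSup_le' fun y => hB y.1

/-- A set of at least `κ` elements which is the union of fewer than `κ` classes of size less than
`κ` has classes of unbounded size below `κ`. -/
theorem exists_large_fiber {X T : Type u} {κ : Cardinal.{u}} (hκ : ℵ₀ ≤ κ) (f : X → T)
    (hX : κ ≤ #X) (hT : #(Set.range f) < κ) {c : Cardinal.{u}} (hc : c < κ) :
    ∃ x, c < #(f ⁻¹' {f x}) := by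
  by_contra! hcon
  refine absurd hX (not_le.2 ?_)
  have h1 : (Set.univ : Set X) ⊆ ⋃ t : Set.range f, f ⁻¹' {t.1} := fun x _ =>
    Set.mem_iUnion.2 ⟨⟨f x, x, rfl⟩, rfl⟩
  rw [← Cardinal.mk_univ]
  refine (Cardinal.mk_le_mk_of_subset h1).trans_lt ((Cardinal.mk_iUnion_le _).trans_lt ?_)
  refine Cardinal.mul_lt_of_lt hκ hT (lt_of_le_of_lt ?_ hc)
  refine ciSup_le' ?_
  rintro ⟨_, x, rfl⟩
  exact hcon x

/-- Let `p` be the successor function of the well-ordered set `C`. A maximal subset `U` with `p U`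
disjoint from `U` cannot contain a cardinal together with its successor, nor miss long stretches, so
both `U` and its complement in `C` are cofinal. -/
theorem exists_cofinal_pair {C : Set Cardinal.{u}} (hC : ∀ c ∈ C, ∃ d ∈ C, c < d) :
    ∃ U ⊆ C, (∀ c ∈ C, ∃ d ∈ U, c ≤ d) ∧ ∀ c ∈ C, ∃ d ∈ C, d ∉ U ∧ c ≤ d := by
  classical
  let p : Cardinal.{u} → Cardinal.{u} := fun c => if c ∈ C then sInf {d | d ∈ C ∧ c < d} else c
  have hp : ∀ c ∈ C, p c ∈ C ∧ c < p c := by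
    intro c hc
    simp only [p, hc, if_true]
    exact csInf_mem (s := {d | d ∈ C ∧ c < d}) (hC c hc)
  have hmin : ∀ c ∈ C, ∀ d ∈ C, c < d → p c ≤ d := by
    intro c hc d hd h
    simp only [p, hc, if_true]
    exact csInf_le' ⟨hd, h⟩
  have hinj : ∀ c ∈ C, ∀ d ∈ C, p c = p d → c = d := by
    intro c hc d hd h
    rcases lt_trichotomy c d with h1 | h1 | h1
    · exact absurd ((hmin c hc d hd h1).trans_lt ((hp d hd).2)) (by rw [h]; exact lt_irrefl _)
    · exact h1
    · exact absurd ((hmin d hd c hc h1).trans_lt ((hp c hc).2)) (by rw [h]; exact lt_irrefl _)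
  obtain ⟨U, hU, h1, h2⟩ := exists_maximal_displaced p C fun c hc => (hp c hc).2.ne'
  refine ⟨U, hU, fun c hc => ?_, fun c hc => ?_⟩
  · have hpc := hp c hc
    rcases h2 _ hpc.1 with h | h | ⟨d, hd, h⟩
    · exact ⟨_, h, hpc.2.le⟩
    · exact ⟨_, h, hpc.2.le.trans (hp _ hpc.1).2.le⟩
    · exact ⟨d, hd, (hinj d (hU hd) c hc h).symm.le⟩
  · by_cases h : c ∈ U
    · exact ⟨p c, (hp c hc).1, h1 c h, (hp c hc).2.le⟩
    · exact ⟨c, hc, h, le_rfl⟩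

/-- If no class is almost everything, there is a union of classes such that neither it nor its
complement is small. -/
theorem exists_split {X T : Type u} {κ : Cardinal.{u}} (hκ : ℵ₀ ≤ κ) (f : X → T)
    (h : ∀ t, κ ≤ #((f ⁻¹' {t})ᶜ : Set X)) (hX : κ ≤ #X) :
    ∃ U : Set T, κ ≤ #(f ⁻¹' U) ∧ κ ≤ #((f ⁻¹' U)ᶜ : Set X) := by
  by_cases hbig : ∃ t, κ ≤ #(f ⁻¹' {t})
  · obtain ⟨t, ht⟩ := hbig
    exact ⟨{t}, ht, h t⟩
  push Not at hbig
  -- All classes now have size below `κ`. If there are fewer than `κ` of them, their sizes are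
  -- unbounded below `κ` and have no maximum; the sizes are divided into two cofinal sets, and the
  -- classes accordingly.
  by_cases hT : #(Set.range f) < κ
  · have key := fun c (hc : c < κ) => exists_large_fiber hκ f hX hT hc
    obtain ⟨V, hV, h1, h2⟩ := exists_cofinal_pair (C := Set.range fun x => #(f ⁻¹' {f x})) (by
      rintro _ ⟨x, rfl⟩
      obtain ⟨y, hy⟩ := key _ (hbig (f x))
      exact ⟨_, ⟨y, rfl⟩, hy⟩)
    have hle : ∀ c, c < κ → ∀ A : Set X, (∀ c < κ, ∃ x, c < #(f ⁻¹' {f x}) ∧ f ⁻¹' {f x} ⊆ A) →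
        c < #A := fun c hc A hA => by
      obtain ⟨x, hx, hxA⟩ := hA c hc
      exact hx.trans_le (Cardinal.mk_le_mk_of_subset hxA)
    refine ⟨{t | #(f ⁻¹' {t}) ∈ V}, ?_, ?_⟩
    -- The bound is applied to the cardinality of the set itself: were it below `κ`, it would be
    -- exceeded by the size of a class contained in the set.
    · refine le_of_not_gt fun hlt => lt_irrefl _ (hle _ hlt _ fun c hc => ?_)
      obtain ⟨x, hx⟩ := key c hc
      obtain ⟨d, hd, hxd⟩ := h1 _ ⟨x, rfl⟩
      obtain ⟨y, rfl⟩ := hV hd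
      refine ⟨y, hx.trans_le hxd, fun z hz => ?_⟩
      rw [Set.mem_preimage, Set.mem_singleton_iff] at hz
      rw [Set.mem_preimage, Set.mem_ofPred_eq, hz]
      exact hd
    · refine le_of_not_gt fun hlt => lt_irrefl _ (hle _ hlt _ fun c hc => ?_)
      obtain ⟨x, hx⟩ := key c hc
      obtain ⟨_, ⟨y, rfl⟩, hd, hxd⟩ := h2 _ ⟨x, rfl⟩
      refine ⟨y, hx.trans_le hxd, fun z hz => ?_⟩
      rw [Set.mem_preimage, Set.mem_singleton_iff] at hz
      rw [Set.mem_compl_iff, Set.mem_preimage, Set.mem_ofPred_eq, hz]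
      exact hd
  -- With at least `κ` classes, sizes are irrelevant: put half of the classes on either side.
  · rw [not_lt] at hT
    have hinf : (Set.range f).Infinite := by
      rw [← Set.infinite_coe_iff, Cardinal.infinite_iff]
      exact hκ.trans hT
    obtain ⟨φ, hφ⟩ := exists_block (Set.range f) hinf two_ne_zero
    have key : ∀ j : Fin 2, ∃ ψ : Set.range f → X, ∀ t, f (ψ t) = φ (t, j) := fun j => by
      have : ∀ t, ∃ x, f x = φ (t, j) := fun t => by
        have : φ (t, j) ∈ Set.range f := hφ.subset ⟨(t, j), rfl⟩
        exact this
      exact ⟨fun t => (this t).choose, fun t => (this t).choose_spec⟩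
    have hle : ∀ (j : Fin 2) (A : Set X), (∀ x t, f x = φ (t, j) → x ∈ A) → κ ≤ #A := by
      intro j A hA
      obtain ⟨ψ, hψ⟩ := key j
      refine hT.trans (Cardinal.mk_le_of_injective (f := fun t => ⟨ψ t, hA _ t (hψ t)⟩) ?_)
      intro t t' htt'
      have h1 : ψ t = ψ t' := Subtype.ext_iff.1 htt'
      have h2 := φ.injective ((hψ t).symm.trans ((congrArg f h1).trans (hψ t')))
      exact (Prod.ext_iff.1 h2).1
    refine ⟨Set.range fun t => φ (t, 0), hle 0 _ fun x t hx => ⟨t, hx.symm⟩,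
      hle 1 _ fun x t hx => ?_⟩
    rintro ⟨t', ht'⟩
    have := φ.injective (ht'.trans hx)
    simp at this

namespace Params

variable {P : Params.{u}} {n : ℕ}

/-! ### Blocks of orbits of one type -/

/-- Fewer than `κ` countable orbits would cover only a small set, so there are at least `κ` orbits
of type `t` inside `A`. Taking two families of `κ` of them leaves a spare half for
`exists_extend_half`. -/
theorem exists_orbit_block (hκ : ℵ₀ < P.κ) {σ : Fin n → Equiv.Perm P.Ω} {A : Set P.Ω}
    (hA : ∀ i, ∀ᶠ c in P.fil, σ i c ∈ A ↔ c ∈ A) (t : P.IS n)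
    (h : ¬ P.Small {c | c ∈ A ∧ HasType σ (orbit σ c) t.1}) :
    ∃ φ : (P.κ.out × ULift.{u} t.1.out.A) × Fin 2 ↪ P.Ω,
      (∀ k m j i, φ ((k, ⟨t.1.out.g i m⟩), j) = σ i (φ ((k, ⟨m⟩), j))) ∧ Set.range φ ⊆ A ∧
      ∀ k m j, HasType σ (orbit σ (φ ((k, m), j))) t.1 := by
  set O : Set (Orb σ t.1) := {B | B.1 ⊆ A}
  have hO : P.κ ≤ #O := by
    by_contra hcon
    rw [not_le] at hcon
    refine h ?_
    have h2 : P.Small {c | (∀ c' ∈ orbit σ c, (c' ∈ A ↔ c ∈ A)) ∧ c ∈ A ∧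
        HasType σ (orbit σ c) t.1} := by
      refine lt_of_countable_fibers hκ (O := O) (fun B => B.1) (fun B => ?_) ?_ hcon
      · obtain ⟨a, ha⟩ := B.2.1
        rw [ha]
        exact orbit_countable σ a
      · rintro c ⟨h1, h2, h3⟩
        exact Set.mem_iUnion.2 ⟨⟨⟨orbit σ c, ⟨c, rfl⟩, h3⟩, fun c' hc' => (h1 c' hc').2 h2⟩,
          mem_orbit_self σ c⟩
    rw [← P.eventually_notMem] at h2 ⊢
    filter_upwards [h2, eventually_saturated hκ hA] with c h3 h4 h5
    exact h3 ⟨h4, h5⟩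
  have hmul : #(P.κ.out × Fin 2) ≤ #O := by
    rw [Cardinal.mk_prod, Cardinal.mk_out]
    simp only [Cardinal.lift_uzero, Cardinal.mk_fin, Cardinal.lift_natCast]
    refine le_of_eq_of_le (Cardinal.mul_eq_left P.aleph0_le ?_ (by norm_num)) hO
    exact (Cardinal.natCast_lt_aleph0 (n := 2)).le.trans P.aleph0_le
  obtain ⟨ξ⟩ := hmul
  refine ⟨⟨fun x => dec σ ⟨t, (ξ (x.1.1, x.2)).1, x.1.2.down⟩, ?_⟩, ?_, ?_, ?_⟩
  · rintro ⟨⟨k, ⟨m⟩⟩, j⟩ ⟨⟨k', ⟨m'⟩⟩, j'⟩ h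
    have := dec_injective σ h
    simp only [Sigma.mk.injEq, heq_eq_eq, Prod.mk.injEq, true_and] at this
    have h1 := ξ.injective (Subtype.ext this.1)
    simp only [Prod.mk.injEq] at h1
    rw [h1.1, h1.2, this.2]
  · exact fun k m j i => dec_equivariant σ i t _ m
  · rintro _ ⟨x, rfl⟩
    exact (ξ (x.1.1, x.2)).2 (dec_mem σ t _ _)
  · exact fun k m j => hasType_dec σ t _ _

end Params
end
end QuotSym

namespace QuotSym
noncomputable section

namespace Params

variable {P : Params.{u}} {n : ℕ}

/-! ### Pure tuples, for uncountable `κ` -/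

theorem not_small_mono {A B : Set P.Ω} (hA : ¬ P.Small A) (h : ∀ᶠ c in P.fil, c ∈ A → c ∈ B) :
    ¬ P.Small B := by
  rw [← P.eventually_notMem] at hA ⊢
  intro hB
  refine hA ?_
  filter_upwards [h, hB] with c h1 h2 h3
  exact h2 (h1 h3)

theorem exists_mem_of_not_small {A : Set P.Ω} (hA : ¬ P.Small A) {p : P.Ω → Prop}
    (hp : ∀ᶠ c in P.fil, p c) : ∃ c ∈ A, p c := by
  by_contra! hcon
  refine hA ((P.eventually_notMem).1 ?_)
  filter_upwards [hp] with c hc hA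
  exact hcon c hA hc

/-- Two liftings of the same tuple of cosets agree on whole orbits outside a small set, so the types
of orbits can be read off from any lifting. -/
theorem repIS_iff (hκ : ℵ₀ < P.κ) {g : Fin n → P.SLam} {t : P.IS n} :
    P.RepIS (fun i => P.coset (g i)) t ↔
      (¬ t.1.IsTrivial ∧ ¬ P.Small (supp (P.perm g)) ∧
        ∀ᶠ c in P.fil, c ∈ supp (P.perm g) → HasType (P.perm g) (orbit (P.perm g) c) t.1) ∨
      (t.1.IsTrivial ∧ P.Small (supp (P.perm g))) := by
  have hset : ∀ g : Fin n → P.SLam, P.Small {a | a ∈ supp (P.perm g) ∧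
      ¬ HasType (P.perm g) (orbit (P.perm g) a) t.1} ↔
      ∀ᶠ c in P.fil, c ∈ supp (P.perm g) → HasType (P.perm g) (orbit (P.perm g) c) t.1 := by
    intro g
    rw [P.eventually_iff]
    simp only [Classical.not_imp]
  constructor
  · rintro ⟨f, hf, h⟩
    have hfg : ∀ i, ∀ᶠ c in P.fil, P.perm f i c = P.perm g i c := fun i => P.coset_eq.1 (hf i)
    have hty : ∀ᶠ c in P.fil, ∀ t, HasType (P.perm g) (orbit (P.perm g) c) t ↔
        HasType (P.perm f) (orbit (P.perm f) c) t := by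
      have := eventually_hasType_congr hκ (σ := P.perm f) (τ := P.perm g) 1 (B := Set.univ)
        (fun i => Filter.Eventually.of_forall fun c => by simp)
        (fun i => (hfg i).mono fun c hc _ => by simpa using hc)
      exact this.mono fun c hc => hc trivial
    have hsupp : P.Small (supp (P.perm g)) ↔ P.Small (supp (P.perm f)) := by
      rw [small_supp_iff, small_supp_iff]
      simp only [hf]
    rw [hset] at h
    rw [hsupp]
    refine h.imp (fun h => ⟨h.1, h.2.1, ?_⟩) id
    filter_upwards [h.2.2, hty, Filter.eventually_all.2 hfg] with c h1 h2 h3 ⟨i, hi⟩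
    exact (h2 _).2 (h1 ⟨i, by rwa [h3 i]⟩)
  · intro h
    refine ⟨g, fun _ => rfl, ?_⟩
    rwa [hset]

theorem eventually_hasType_of_small {g : Fin n → P.SLam} (h : P.Small (supp (P.perm g)))
    {t : P.IS n} (ht : t.1.IsTrivial) :
    ∀ᶠ c in P.fil, HasType (P.perm g) (orbit (P.perm g) c) t.1 := by
  rw [← P.eventually_notMem] at h
  filter_upwards [h] with c hc
  obtain ⟨t', ht'⟩ := exists_hasType (P.perm g) c
  have : t'.IsTrivial := ht'.isTrivial_iff.2 fun i => by
    by_contra hcon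
    exact hc ⟨i, hcon⟩
  rwa [ht.unique this]

theorem eventually_hasType (hκ : ℵ₀ < P.κ) {g : Fin n → P.SLam} {t : P.IS n}
    (h : P.RepIS (fun i => P.coset (g i)) t) :
    ∀ᶠ c in P.fil, c ∈ supp (P.perm g) → HasType (P.perm g) (orbit (P.perm g) c) t.1 := by
  rcases (repIS_iff hκ).1 h with h | h
  · exact h.2.2
  · exact (eventually_hasType_of_small h.2 h.1).mono fun _ hc _ => hc

/-- This is the purpose of the last clause of `Good`: if the tuple is not trivial, a good region
contains almost no fixed points, so one type is found throughout the region. If the tuple is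
trivial, almost all orbits are trivial. -/
theorem eventually_hasType_of_good (hκ : ℵ₀ < P.κ) {g : Fin n → P.SLam} {t : P.IS n}
    (h : P.RepIS (fun i => P.coset (g i)) t) {a : P.G} {A : Set P.Ω} (ha : P.Reg a A)
    (hg : Good (fun i => P.coset (g i)) a) :
    ∀ᶠ c in P.fil, c ∈ A → HasType (P.perm g) (orbit (P.perm g) c) t.1 := by
  rw [good_iff ha] at hg
  rcases (repIS_iff hκ).1 h with h | h
  · filter_upwards [hg.2.2 h.2.1, h.2.2] with c h1 h2 h3
    exact h2 (h1 h3)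
  · exact (eventually_hasType_of_small h.2 h.1).mono fun _ hc _ => hc

theorem isInv_supp (σ : Fin n → Equiv.Perm P.Ω) : IsInv σ (supp σ) := by
  intro i c
  obtain ⟨t, ht⟩ := exists_hasType σ c
  have ht' := ht
  rw [orbit_eq ((isInv_orbit σ c i c).2 (mem_orbit_self σ c))] at ht'
  have h1 := ht.isTrivial_iff
  have h2 := ht'.isTrivial_iff
  have h3 : ∀ c, c ∈ supp σ ↔ ¬ ∀ i, σ i c = c := fun c => not_forall.symm
  rw [h3, h3, ← h1, ← h2]

theorem exists_good (g : Fin n → P.SLam)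
    (h : P.Small (supp (P.perm g)) → ¬ P.lam ≤ P.μ) :
    ∃ (a : P.G) (A : Set P.Ω), P.Reg a A ∧ Good (fun i => P.coset (g i)) a := by
  by_cases hs : P.Small (supp (P.perm g))
  · obtain ⟨a, ha⟩ := exists_elem (P := P) (A := Set.univ) ((mk_le_μ _).trans_lt (not_le.1 (h hs)))
    refine ⟨a, _, ha, (good_iff ha).2 ⟨P.not_small_univ, fun i => ?_, fun h => absurd hs h⟩⟩
    exact Filter.Eventually.of_forall fun c => by simp
  · obtain ⟨a, ha⟩ := exists_elem (P := P) (A := supp (P.perm g)) (mk_supp_tuple_lt g)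
    refine ⟨a, _, ha, (good_iff ha).2 ⟨hs, fun i => ?_, fun _ => ?_⟩⟩
    · exact Filter.Eventually.of_forall fun c => isInv_supp _ i c
    · exact Filter.Eventually.of_forall fun c h => h

theorem RepIS.exists_good (hκ : ℵ₀ < P.κ) {g : Fin n → P.SLam} {t : P.IS n}
    (h : P.RepIS (fun i => P.coset (g i)) t) :
    ∃ (a : P.G) (A : Set P.Ω), P.Reg a A ∧ Good (fun i => P.coset (g i)) a := by
  refine Params.exists_good g fun hs hlam => ?_
  rcases (repIS_iff hκ).1 h with h | h
  · exact h.2.1 hs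
  · exact t.2 hlam h.1

/-- Blocks modelled on the same action `ρ` are mapped to each other by an element of the group,
thanks to their spare halves. -/
theorem isoR_of_blocks {I : Type u} (hI : #I < P.lam) {f g : Fin n → P.SLam}
    (ρ : Fin n → Equiv.Perm I) (φ ψ : I × Fin 2 ↪ P.Ω) (j : Fin 2)
    (hφ : ∀ i m, φ (ρ i m, j) = P.perm f i (φ (m, j)))
    (hψ : ∀ i m, ψ (ρ i m, 0) = P.perm g i (ψ (m, 0))) {a b : P.G}
    (ha : P.Reg a (Set.range fun m => φ (m, j))) (hb : P.Reg b (Set.range fun m => ψ (m, 0))) :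
    IsoR (fun i => P.coset (f i)) a (fun i => P.coset (g i)) b := by
  obtain ⟨z, hz⟩ := exists_extend_half φ ψ hI j
  refine (isoR_iff ha hb).2 ⟨z, Filter.Eventually.of_forall fun c => ⟨?_, ?_⟩,
    fun i => Filter.Eventually.of_forall ?_⟩
  · rintro ⟨m, hm⟩
    exact ⟨m, (z : Equiv.Perm P.Ω).injective ((hz m).trans hm)⟩
  · rintro ⟨m, rfl⟩
    exact ⟨m, (hz m).symm⟩
  · rintro _ ⟨m, rfl⟩
    rw [← hφ, hz, hz, hψ]

/-- The action on blocks of orbits of type `t`. -/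
def blockPerm' (P : Params.{u}) (t : P.IS n) (i : Fin n) :
    Equiv.Perm (P.κ.out × ULift.{u} t.1.out.A) :=
  Equiv.prodCongr (Equiv.refl _) (Equiv.ulift.trans ((t.1.out.g i).trans Equiv.ulift.symm))

theorem mk_blocks (t : P.IS n) : #(P.κ.out × ULift.{u} t.1.out.A) = P.κ := by
  rw [Cardinal.mk_prod, Cardinal.lift_id, Cardinal.lift_id, Cardinal.mk_out]
  refine Cardinal.mul_eq_left P.aleph0_le ?_ ?_
  · rw [Cardinal.mk_uLift]
    refine le_trans ?_ P.aleph0_le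
    simp
  · rw [Cardinal.mk_ne_zero_iff]
    obtain ⟨m, hm⟩ := t.1.out.nonempty
    exact ⟨⟨⟨m, hm⟩⟩⟩

theorem exists_reg_block {t : P.IS n} (φ : (P.κ.out × ULift.{u} t.1.out.A) × Fin 2 ↪ P.Ω)
    (j : Fin 2) : ∃ a : P.G, P.Reg a (Set.range fun m => φ (m, j)) ∧
      ¬ P.Small (Set.range fun m => φ (m, j)) := by
  have h : #(Set.range fun m => φ (m, j)) = P.κ := by
    rw [Cardinal.mk_range_eq _ fun m m' h => (Prod.ext_iff.1 (φ.injective h)).1, mk_blocks]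
  obtain ⟨a, ha⟩ := exists_elem (P := P) (A := Set.range fun m => φ (m, j)) (h.trans_lt P.lt)
  exact ⟨a, ha, by rw [Small, h]; exact lt_irrefl _⟩

theorem isInv_block {t : P.IS n} {σ : Fin n → Equiv.Perm P.Ω}
    {φ : (P.κ.out × ULift.{u} t.1.out.A) × Fin 2 ↪ P.Ω}
    (h : ∀ k m j i, φ ((k, ⟨t.1.out.g i m⟩), j) = σ i (φ ((k, ⟨m⟩), j))) (j : Fin 2) :
    IsInv σ (Set.range fun m => φ (m, j)) :=
  isInv_range (σ := P.blockPerm' t) (τ := σ) (φ := fun m => φ (m, j)) fun i m => h m.1 m.2.down j i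

/-- A good region of `y` consists of orbits of type `t`, and a conjugation transports types, which
gives one direction. For the other, cut out `κ` orbits of type `t` on either side; any two such
blocks are isomorphic. -/
theorem meets_iff (hκ : ℵ₀ < P.κ) {f g : Fin n → P.SLam} {t : P.IS n}
    (h : P.RepIS (fun i => P.coset (g i)) t) {a : P.G} {A : Set P.Ω} (ha : P.Reg a A)
    (hinv : ∀ i, ∀ᶠ c in P.fil, P.perm f i c ∈ A ↔ c ∈ A) :
    Meets (fun i => P.coset (f i)) a (fun i => P.coset (g i)) ↔
      ¬ P.Small {c | c ∈ A ∧ HasType (P.perm f) (orbit (P.perm f) c) t.1} := by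
  constructor
  · rintro ⟨a', hsub, hne, hinv', b, hb, hiso⟩
    obtain ⟨A', ha', -⟩ := exists_reg a'
    obtain ⟨B, hB, -⟩ := exists_reg b
    have h1 := eventually_hasType_of_good hκ h hB hb
    obtain ⟨z, hz1, hz2⟩ := (isoR_iff ha' hB).1 hiso
    rw [Ne, ha'.eq_one_iff] at hne
    rw [invR_iff ha'] at hinv'
    rw [ha'.sub_iff ha] at hsub
    refine not_small_mono hne ?_
    filter_upwards [hsub, hz1, eventually_hasType_congr hκ (z : Equiv.Perm P.Ω) hinv' hz2,
      eventually_perm h1 (z : Equiv.Perm P.Ω)] with c h2 h3 h4 h5 hc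
    exact ⟨h2 hc, (h4 hc _).1 (h5 (h3.2 hc))⟩
  · intro hA
    obtain ⟨b, B, hB, hb⟩ := h.exists_good hκ
    have h1 := eventually_hasType_of_good hκ h hB hb
    have hb' := (good_iff hB).1 hb
    obtain ⟨φ, hφ1, hφ2, -⟩ := exists_orbit_block hκ hinv t hA
    obtain ⟨ψ, hψ1, hψ2, -⟩ := exists_orbit_block hκ hb'.2.1 t
      (not_small_mono hb'.1 (h1.mono fun c hc hcB => ⟨hcB, hc hcB⟩))
    obtain ⟨a₁, ha₁, hs₁⟩ := exists_reg_block φ 0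
    obtain ⟨b₁, hb₁, hs₂⟩ := exists_reg_block ψ 0
    refine ⟨a₁, ?_, ?_, ?_, b₁, ?_, ?_⟩
    · rw [ha₁.sub_iff ha]
      exact Filter.Eventually.of_forall fun c hc => hφ2 (by
        obtain ⟨m, rfl⟩ := hc
        exact ⟨_, rfl⟩)
    · rwa [Ne, ha₁.eq_one_iff]
    · rw [invR_iff ha₁]
      exact fun i => Filter.Eventually.of_forall fun c => isInv_block hφ1 0 i c
    · rw [good_iff hb₁]
      refine ⟨hs₂, fun i => Filter.Eventually.of_forall fun c => isInv_block hψ1 0 i c,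
        fun hns => (hb'.2.2 hns).mono fun c hc hcr => hc (hψ2 ?_)⟩
      obtain ⟨m, rfl⟩ := hcr
      exact ⟨_, rfl⟩
    · exact isoR_of_blocks ((mk_blocks t).trans_lt P.lt) (P.blockPerm' t) φ ψ 0
        (fun i m => hφ1 m.1 m.2.down 0 i) (fun i m => hψ1 m.1 m.2.down 0 i) ha₁ hb₁

theorem RepIS.unique (hκ : ℵ₀ < P.κ) {x : Fin n → P.G} {t t' : P.IS n} (h : P.RepIS x t)
    (h' : P.RepIS x t') : t = t' := by
  choose g hg using fun i => P.coset_surj (x i)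
  obtain rfl : (fun i => P.coset (g i)) = x := funext hg
  obtain ⟨a, A, ha, hgood⟩ := h.exists_good hκ
  obtain ⟨c, hc, h1⟩ := exists_mem_of_not_small ((good_iff ha).1 hgood).1
    ((eventually_hasType_of_good hκ h ha hgood).and (eventually_hasType_of_good hκ h' ha hgood))
  exact Subtype.ext ((h1.1 hc).unique (h1.2 hc))

theorem RepIS.eq_iff (hκ : ℵ₀ < P.κ) {x y : Fin n → P.G} {t s : P.IS n} (h : P.RepIS x t)
    (h' : P.RepIS y s) : (∃ a, Good x a ∧ Meets x a y) ↔ t = s := by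
  choose f hf using fun i => P.coset_surj (x i)
  choose g hg using fun i => P.coset_surj (y i)
  obtain rfl : (fun i => P.coset (f i)) = x := funext hf
  obtain rfl : (fun i => P.coset (g i)) = y := funext hg
  constructor
  · rintro ⟨a, hgood, hm⟩
    obtain ⟨A, ha, -⟩ := exists_reg a
    rw [meets_iff hκ h' ha ((good_iff ha).1 hgood).2.1] at hm
    obtain ⟨c, hc, h1⟩ := exists_mem_of_not_small hm (eventually_hasType_of_good hκ h ha hgood)
    exact Subtype.ext ((h1 hc.1).unique hc.2)
  · rintro rfl
    obtain ⟨a, A, ha, hgood⟩ := h.exists_good hκ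
    have hgood' := (good_iff ha).1 hgood
    refine ⟨a, hgood, (meets_iff hκ h' ha hgood'.2.1).2 (not_small_mono hgood'.1 ?_)⟩
    exact (eventually_hasType_of_good hκ h ha hgood).mono fun c h1 hc => ⟨hc, h1 hc⟩

/-! ### The domain of the sort `IS_n` -/

theorem exists_trivial_IS (h : ¬ P.lam ≤ P.μ) : ∃ t : P.IS n, t.1.IsTrivial := by
  obtain ⟨t, ht⟩ := exists_isTrivial n
  exact ⟨⟨t, fun h' => absurd h' h⟩, ht⟩

/-- If no single type fills almost the whole support, `exists_split` yields two disjoint good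
regions without common types. Purity would give isomorphic good parts of them. -/
theorem exists_repIS_of_pure (hκ : ℵ₀ < P.κ) {g : Fin n → P.SLam}
    (hs : ¬ P.Small (supp (P.perm g))) (h : Pure fun i => P.coset (g i)) :
    ∃ t : P.IS n, P.RepIS (fun i => P.coset (g i)) t := by
  set σ := P.perm g with hσ
  choose ty hty using fun c => exists_hasType σ c
  by_contra! hcon
  have htyσ : ∀ i c, ty (σ i c) = ty c := by
    intro i c
    have h1 := hty (σ i c)
    rw [← orbit_eq ((isInv_orbit σ c i c).2 (mem_orbit_self σ c))] at h1
    exact h1.unique (hty c)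
  obtain ⟨U, hU1, hU2⟩ := exists_split (T := ULift.{u} (IsoType n)) P.aleph0_le
    (fun c : supp σ => ⟨ty c⟩) (by
    rintro ⟨t⟩
    by_contra hlt
    rw [not_le] at hlt
    have h1 : P.Small {c | c ∈ supp σ ∧ ¬ ty c = t} := by
      refine lt_of_le_of_lt ?_ hlt
      refine Cardinal.mk_le_of_injective (f := fun c => ⟨⟨c.1, c.2.1⟩, fun hc => c.2.2 ?_⟩)
        fun c c' hcc' => ?_
      · exact congrArg ULift.down hc
      · simpa [Subtype.ext_iff] using hcc'
    obtain ⟨c, hc1, hc2⟩ := exists_mem_of_not_small hs (P.eventually_notMem.2 h1)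
    have hct : ty c = t := by
      by_contra hne
      exact hc2 ⟨hc1, hne⟩
    have hnt : ¬ t.IsTrivial := by
      rw [← hct, (hty c).isTrivial_iff, not_forall]
      exact hc1
    refine hcon ⟨t, fun _ => hnt⟩ ((repIS_iff hκ).2 (Or.inl ⟨hnt, hs, ?_⟩))
    filter_upwards [P.eventually_notMem.2 h1] with c' hc' hs'
    by_cases hne : ty c' = t
    · exact hne ▸ hty c'
    · exact absurd ⟨hs', hne⟩ hc') (not_lt.1 hs)
  have key : ∀ V : Set (ULift.{u} (IsoType n)),
      P.κ ≤ #((fun c : supp σ => (⟨ty c⟩ : ULift.{u} (IsoType n))) ⁻¹' V) →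
      ∃ a, P.Reg a {c | c ∈ supp σ ∧ ⟨ty c⟩ ∈ V} ∧ Good (fun i => P.coset (g i)) a := by
    intro V hV
    obtain ⟨a, ha⟩ := exists_elem (P := P) (A := {c | c ∈ supp σ ∧ ⟨ty c⟩ ∈ V})
      ((Cardinal.mk_le_mk_of_subset (fun c hc => hc.1)).trans_lt (mk_supp_tuple_lt g))
    refine ⟨a, ha, (good_iff ha).2 ⟨not_lt.2 (hV.trans ?_), fun i => ?_, fun _ => ?_⟩⟩
    · exact Cardinal.mk_le_of_injective (f := fun c => ⟨c.1.1, c.1.2, c.2⟩) fun c c' hcc' => by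
        simpa [Subtype.ext_iff] using hcc'
    · refine Filter.Eventually.of_forall fun c => ?_
      simp only [Set.mem_ofPred_eq]
      rw [htyσ i c, isInv_supp σ i c]
    · exact Filter.Eventually.of_forall fun c hc => hc.1
  obtain ⟨a, ha, hga⟩ := key U hU1
  obtain ⟨b, hb, hgb⟩ := key Uᶜ hU2
  obtain ⟨a', b', hsa, hsb, hga', hgb', hiso⟩ := h a b hga hgb
  obtain ⟨A', ha', -⟩ := exists_reg a'
  obtain ⟨B', hb', -⟩ := exists_reg b'
  obtain ⟨z, hz1, hz2⟩ := (isoR_iff ha' hb').1 hiso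
  have hA := (good_iff ha').1 hga'
  rw [ha'.sub_iff ha] at hsa
  rw [hb'.sub_iff hb] at hsb
  obtain ⟨c, hcA, ⟨⟨h1, h2⟩, h3⟩, h4⟩ := exists_mem_of_not_small hA.1 (((hsa.and hz1).and
    (eventually_hasType_congr hκ (z : Equiv.Perm P.Ω) hA.2.1 hz2)).and
    (eventually_perm hsb (z : Equiv.Perm P.Ω)))
  -- The conjugation preserves types, but those occurring in `a` belong to `U`, and those occurring
  -- in `b` to its complement.
  have h5 : ty ((z : Equiv.Perm P.Ω) c) = ty c := ((h3 hcA _).1 (hty _)).unique (hty c)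
  have h6 := (h4 (h2.2 hcA)).2
  rw [h5] at h6
  exact h6 (h1 hcA).2

/-- Every good region contains `κ` orbits of type `t`, and blocks of `κ` such orbits are isomorphic.
The number `κ` is chosen since it is the least that is not small and always lies below `lam`. -/
theorem pure_of_repIS (hκ : ℵ₀ < P.κ) {g : Fin n → P.SLam} {t : P.IS n}
    (h : P.RepIS (fun i => P.coset (g i)) t) : Pure fun i => P.coset (g i) := by
  intro a b hga hgb
  have key : ∀ a, Good (fun i => P.coset (g i)) a →
      ∃ (φ : (P.κ.out × ULift.{u} t.1.out.A) × Fin 2 ↪ P.Ω) (a' : P.G),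
        (∀ k m j i, φ ((k, ⟨t.1.out.g i m⟩), j) = P.perm g i (φ ((k, ⟨m⟩), j))) ∧
        P.Reg a' (Set.range fun m => φ (m, 0)) ∧ Sub a' a ∧ Good (fun i => P.coset (g i)) a' := by
    intro a hga
    obtain ⟨A, ha, -⟩ := exists_reg a
    have hA := (good_iff ha).1 hga
    have h1 := eventually_hasType_of_good hκ h ha hga
    obtain ⟨φ, hφ1, hφ2, -⟩ := exists_orbit_block hκ hA.2.1 t
      (not_small_mono hA.1 (h1.mono fun c hc hcB => ⟨hcB, hc hcB⟩))
    obtain ⟨a', ha', hs⟩ := exists_reg_block φ 0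
    have hsub : ∀ c, c ∈ (Set.range fun m => φ (m, 0)) → c ∈ A := by
      rintro _ ⟨m, rfl⟩
      exact hφ2 ⟨_, rfl⟩
    refine ⟨φ, a', hφ1, ha', (ha'.sub_iff ha).2 (Filter.Eventually.of_forall hsub),
      (good_iff ha').2 ⟨hs, fun i => Filter.Eventually.of_forall fun c => isInv_block hφ1 0 i c,
        fun hns => (hA.2.2 hns).mono fun c hc hcr => hc (hsub c hcr)⟩⟩
  obtain ⟨φ, a', hφ, ha', hsa, hga'⟩ := key a hga
  obtain ⟨ψ, b', hψ, hb', hsb, hgb'⟩ := key b hgb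
  exact ⟨a', b', hsa, hsb, hga', hgb', isoR_of_blocks ((mk_blocks t).trans_lt P.lt)
    (P.blockPerm' t) φ ψ 0 (fun i m => hφ m.1 m.2.down 0 i) (fun i m => hψ m.1 m.2.down 0 i)
    ha' hb'⟩

theorem exists_repIS_iff (hκ : ℵ₀ < P.κ) (x : Fin n → P.G) :
    (Pure x ∧ ((∀ i, x i = 1) → FullSupp P.G)) ↔ ∃ t, P.RepIS x t := by
  choose g hg using fun i => P.coset_surj (x i)
  obtain rfl : (fun i => P.coset (g i)) = x := funext hg
  rw [fullSupp_iff, ← small_supp_iff]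
  constructor
  · rintro ⟨h1, h2⟩
    by_cases hs : P.Small (supp (P.perm g))
    · obtain ⟨t, ht⟩ := exists_trivial_IS (n := n) (h2 hs)
      exact ⟨t, (repIS_iff hκ).2 (Or.inr ⟨ht, hs⟩)⟩
    · exact exists_repIS_of_pure hκ hs h1
  · rintro ⟨t, ht⟩
    refine ⟨pure_of_repIS hκ ht, fun hs hlam => ?_⟩
    rcases (repIS_iff hκ).1 ht with h | h
    · exact h.2.1 hs
    · exact t.2 hlam h.1

/-- A non-trivial type is realised by `κ` disjoint copies of its model; the trivial one by the
identity. -/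
theorem exists_repIS (hκ : ℵ₀ < P.κ) (t : P.IS n) : ∃ x, P.RepIS x t := by
  by_cases ht : t.1.IsTrivial
  · refine ⟨fun i => P.coset 1, (repIS_iff hκ).2 (Or.inr ⟨ht, small_supp_iff.2 fun i => ?_⟩)⟩
    rfl
  · have h1 : #(P.κ.out × ULift.{u} t.1.out.A) ≤ #P.Ω := (mk_blocks t).le.trans P.κ_le_μ
    obtain ⟨ι⟩ := h1
    obtain ⟨f, hf1, hf2⟩ := exists_extendPerm (P.blockPerm' t) ((mk_blocks t).trans_lt P.lt) ι
    have hty : ∀ m, HasType (P.perm f) (orbit (P.perm f) (ι m)) t.1 := by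
      rintro ⟨k, ⟨m⟩⟩
      have := hasType_image (σ := t.1.out.g) (τ := P.perm f) (φ := fun m => ι (k, ⟨m⟩)) (c := m)
        (fun b _ i => hf1 i (k, ⟨b⟩)) (fun b _ b' _ h => by simpa using ι.injective h) t.1
      rw [this, IsoType.orbit_out]
      exact t.1.hasType_out
    refine ⟨fun i => P.coset (f i), (repIS_iff hκ).2 (Or.inl ⟨ht, ?_, ?_⟩)⟩
    · have : Set.range ι ⊆ supp (P.perm f) := by
        rintro _ ⟨m, rfl⟩
        have := (hty m).isTrivial_iff.not.1 ht
        exact not_forall.1 this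
      intro hs
      have := hs.mono this
      rw [Small, Cardinal.mk_range_eq _ ι.injective, mk_blocks] at this
      exact lt_irrefl _ this
    · refine Filter.Eventually.of_forall fun c hc => ?_
      obtain ⟨m, rfl⟩ := hf2 hc
      exact hty m

end Params
end
end QuotSym

/-! ### Evaluating the relations on types in the chosen models -/

namespace QuotSym
noncomputable section

/-- The orbits of type `y` of the tuple `x` are those in the support of an element which
represents the same cardinal as `w`. -/
def AppR {G : Type u} [Group G] {n : ℕ} (x : Fin n → G) (y : Fin n → G) (w : G) : Prop :=
  ∃ a, InvR x a ∧ CardLe a w ∧ CardLe w a ∧ ∀ a', InvR x a' → (Meets x a' y ↔ ¬ Disj a' a)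

theorem UDef.appR {α : Type} {n : ℕ} {s r : Fin n → ∀ (G : Type u) [Group G], (α → G) → G}
    {t : ∀ (G : Type u) [Group G], (α → G) → G} (hs : ∀ i, UTerm (s i)) (hr : ∀ i, UTerm (r i))
    (ht : UTerm t) : UDef fun G _ v => AppR (fun i => s i G v) (fun i => r i G v) (t G v) := by
  refine UDef.substTuple₂ (R := fun G _ x w y _ => AppR x y w) ?_ hs ht hr ht
  unfold AppR
  repeat' first
    | apply UDef.meets | apply UDef.invR | apply UDef.cardLe | apply UDef.disj | apply UDef.not
    | apply UDef.iff | apply UDef.all | apply UDef.imp | apply UDef.ex | apply UDef.and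
    | exact UTerm.var _ | intro _

/-- An isomorphism-invariant property need only be tested on the chosen model. -/
theorem TransTuple.exists_is_iff {n : ℕ} {t : IsoType n} {p : TransTuple n → Prop}
    (hp : ∀ T T' : TransTuple n, T ≈ T' → p T → p T') : (∃ T : TransTuple n, T.Is t ∧ p T) ↔ p t.out :=
  ⟨fun ⟨T, hT, h⟩ => hp T _ (Quotient.exact (hT.trans t.out_is.symm)) h, fun h => ⟨_, t.out_is, h⟩⟩

theorem HasType.eq_orbit {X : Type v} {n : ℕ} {σ : Fin n → Equiv.Perm X} {B : Set X}
    {t : IsoType n} (h : HasType σ B t) : ∃ b, B = orbit σ b := by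
  obtain ⟨e, he, hr, hσ⟩ := h.exists_out
  obtain ⟨m, hm⟩ := t.out.nonempty
  refine ⟨e ⟨m, hm⟩, ?_⟩
  rw [← image_orbit (σ := t.out.g) fun b _ i => hσ i b, IsoType.orbit_out, Set.image_univ, hr]

namespace Params

variable {P : Params.{u}} {n : ℕ}

theorem Eq1_iff {t : P.IS 2} : P.Eq1 t ↔ ∀ m, t.1.out.g 0 m = t.1.out.g 1 m := by
  rw [Eq1, TransTuple.exists_is_iff (p := fun T => T.g 0 = T.g 1), Equiv.ext_iff]
  rintro T T' ⟨e, he⟩ h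
  ext m
  obtain ⟨m, rfl⟩ := e.surjective m
  rw [← he, ← he, h]

theorem Prod1_iff {t : P.IS 3} :
    P.Prod1 t ↔ ∀ m, t.1.out.g 0 (t.1.out.g 1 m) = t.1.out.g 2 m := by
  rw [Prod1, TransTuple.exists_is_iff (p := fun T => T.g 0 * T.g 1 = T.g 2), Equiv.ext_iff]
  · rfl
  rintro T T' ⟨e, he⟩ h
  ext m
  obtain ⟨m, rfl⟩ := e.surjective m
  rw [Equiv.Perm.mul_apply, ← he, ← he, ← he, ← h, Equiv.Perm.mul_apply]

theorem Proj1_iff {t : P.IS (n + 1)} {s : P.IS n} : P.Proj1 t s ↔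
    ∃ m, HasType (initTuple t.1.out.g) (orbit (initTuple t.1.out.g) m) s.1 := by
  rw [Proj1, TransTuple.exists_is_iff (p := fun T => ∃ B : Set T.A, HasType (initTuple T.g) B s.1)]
  · constructor
    · rintro ⟨B, hB⟩
      obtain ⟨b, rfl⟩ := hB.eq_orbit
      exact ⟨b, hB⟩
    · rintro ⟨m, hm⟩
      exact ⟨_, hm⟩
  rintro T T' ⟨e, he⟩ ⟨B, hB⟩
  obtain ⟨b, rfl⟩ := hB.eq_orbit
  exact ⟨_, (hasType_image (τ := initTuple T'.g) (φ := e) (fun a _ i => he _ a)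
    e.injective.injOn s.1).2 hB⟩

/-! ### The relations on `IS_n`, for uncountable `κ` -/

/-- Almost all of a good region consists of copies of the model, on whole orbits, so a property that
holds almost everywhere holds on some complete copy. Fixed points are no obstacle for the converse,
because `r` is required to hold there. -/
theorem RepIS.eventually_iff (hκ : ℵ₀ < P.κ) {g : Fin n → P.SLam} {t : P.IS n}
    (h : P.RepIS (fun i => P.coset (g i)) t) {q : t.1.out.A → Prop} {r : P.Ω → Prop}
    (hr : ∀ e : t.1.out.A → P.Ω, Function.Injective e →
      (∀ i a, e (t.1.out.g i a) = P.perm g i (e a)) → ∀ m, r (e m) ↔ q m)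
    (hr' : ∀ c, c ∉ supp (P.perm g) → r c) : (∀ᶠ c in P.fil, r c) ↔ ∀ m, q m := by
  constructor
  · intro hev m
    obtain ⟨a, A, ha, hgood⟩ := h.exists_good hκ
    obtain ⟨c, hc, h1, h2⟩ := exists_mem_of_not_small ((good_iff ha).1 hgood).1
      ((eventually_hasType_of_good hκ h ha hgood).and (eventually_orbit hκ (P.perm g) hev))
    obtain ⟨e, he, hB, hσ⟩ := (h1 hc).exists_out
    exact (hr e he hσ m).1 (h2 _ (hB ▸ ⟨m, rfl⟩))
  · intro hq
    filter_upwards [eventually_hasType hκ h] with c hc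
    by_cases hs : c ∈ supp (P.perm g)
    · obtain ⟨e, he, hB, hσ⟩ := (hc hs).exists_out
      obtain ⟨m, rfl⟩ := hB.symm.subset (mem_orbit_self _ c)
      exact (hr e he hσ m).2 (hq m)
    · exact hr' c hs

theorem RepIS.eq1_iff (hκ : ℵ₀ < P.κ) {x : Fin 2 → P.G} {t : P.IS 2} (h : P.RepIS x t) :
    x 0 = x 1 ↔ P.Eq1 t := by
  choose g hg using fun i => P.coset_surj (x i)
  obtain rfl : (fun i => P.coset (g i)) = x := funext hg
  rw [Eq1_iff, coset_eq, ← h.eventually_iff hκ (r := fun c => P.perm g 0 c = P.perm g 1 c)]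
  · rfl
  · intro e he hσ m
    rw [← hσ, ← hσ, he.eq_iff]
  · intro c hc
    have hc' : ∀ i, P.perm g i c = c := by simpa [supp] using hc
    rw [hc', hc']

theorem RepIS.prod1_iff (hκ : ℵ₀ < P.κ) {x : Fin 3 → P.G} {t : P.IS 3} (h : P.RepIS x t) :
    x 0 * x 1 = x 2 ↔ P.Prod1 t := by
  choose g hg using fun i => P.coset_surj (x i)
  obtain rfl : (fun i => P.coset (g i)) = x := funext hg
  rw [Prod1_iff, ← coset_mul, coset_eq,
    ← h.eventually_iff hκ (r := fun c => P.perm g 0 (P.perm g 1 c) = P.perm g 2 c)]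
  · rfl
  · intro e he hσ m
    rw [← hσ, ← hσ, ← hσ, he.eq_iff]
  · intro c hc
    have hc' : ∀ i, P.perm g i c = c := by simpa [supp] using hc
    rw [hc', hc', hc']

theorem RepIS.proj1_iff (hκ : ℵ₀ < P.κ) {x : Fin (n + 1) → P.G} {y : Fin n → P.G}
    {t : P.IS (n + 1)} {s : P.IS n} (h : P.RepIS x t) (h' : P.RepIS y s) :
    (∃ a, Good x a ∧ Meets (initTuple x) a y) ↔ P.Proj1 t s := by
  choose f hf using fun i => P.coset_surj (x i)
  choose g hg using fun i => P.coset_surj (y i)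
  obtain rfl : (fun i => P.coset (f i)) = x := funext hf
  obtain rfl : (fun i => P.coset (g i)) = y := funext hg
  have hinit : initTuple (fun i => P.coset (f i)) = fun i => P.coset (initTuple f i) := rfl
  have hty : ∀ e : t.1.out.A → P.Ω, Function.Injective e →
      (∀ i a, e (t.1.out.g i a) = P.perm f i (e a)) → ∀ m,
      HasType (P.perm (initTuple f)) (orbit (P.perm (initTuple f)) (e m)) s.1 ↔
      HasType (initTuple t.1.out.g) (orbit (initTuple t.1.out.g) m) s.1 := fun e he hσ m =>
    hasType_image (fun b _ i => hσ i.castSucc b) he.injOn s.1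
  rw [Proj1_iff, hinit]
  constructor
  · rintro ⟨a, hgood, hm⟩
    obtain ⟨A, ha, -⟩ := exists_reg a
    have hA := (good_iff ha).1 hgood
    rw [meets_iff (f := initTuple f) hκ h' ha fun i => hA.2.1 i.castSucc] at hm
    obtain ⟨c, ⟨hc, hc'⟩, h1⟩ :=
      exists_mem_of_not_small hm (eventually_hasType_of_good hκ h ha hgood)
    obtain ⟨e, he, hB, hσ⟩ := (h1 hc).exists_out
    obtain ⟨m, rfl⟩ := hB.symm.subset (mem_orbit_self _ c)
    exact ⟨m, (hty e he hσ m).1 hc'⟩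
  · rintro ⟨m, hm⟩
    obtain ⟨a, A, ha, hgood⟩ := h.exists_good hκ
    have hA := (good_iff ha).1 hgood
    refine ⟨a, hgood, (meets_iff hκ h' ha fun i => hA.2.1 i.castSucc).2 ?_⟩
    obtain ⟨φ, hφ1, hφ2, -⟩ := exists_orbit_block hκ hA.2.1 t
      (not_small_mono hA.1 ((eventually_hasType_of_good hκ h ha hgood).mono
        fun c hc hcA => ⟨hcA, hc hcA⟩))
    rw [Small, not_lt]
    rw [← Cardinal.mk_out P.κ]
    -- One point of the right type in the model of `t` yields `κ` such points, one in each orbit of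
    -- the block.
    refine Cardinal.mk_le_of_injective (f := fun k => ⟨φ ((k, ⟨m⟩), 0), hφ2 ⟨_, rfl⟩, ?_⟩) ?_
    · refine (hty (fun m => φ ((k, ⟨m⟩), 0)) ?_ (fun i m => hφ1 k m 0 i) m).2 hm
      intro a b hab
      simpa using φ.injective hab
    · intro k k' hk
      have := φ.injective (Subtype.ext_iff.1 hk)
      simpa using this

/-! ### The function `App`, for uncountable `κ` -/

theorem trunc_congr {A : Type u} {B : Type u} (hκ : ℵ₀ < P.κ) (h1 : #A ≤ #B * ℵ₀)
    (h2 : #B ≤ #A) : trunc P.κ #A = trunc P.κ #B := by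
  unfold trunc
  by_cases hB : P.κ ≤ #B
  · rw [Cardinal.mul_eq_left (P.aleph0_le.trans hB) (P.aleph0_le.trans hB) Cardinal.aleph0_ne_zero]
      at h1
    rw [if_pos hB, if_pos (hB.trans h2), le_antisymm h1 h2]
  · rw [if_neg hB, if_neg]
    rw [not_le] at hB ⊢
    exact h1.trans_lt (Cardinal.mul_lt_of_lt P.aleph0_le hB hκ)

/-- `App` counts orbits, while regions count points. Orbits are countable and `κ` is uncountable, so
after truncation the two cardinals agree. -/
theorem trunc_orb (hκ : ℵ₀ < P.κ) (σ : Fin n → Equiv.Perm P.Ω) (t : P.IS n) :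
    trunc P.κ #(Orb σ t.1) = trunc P.κ #{c | HasType σ (orbit σ c) t.1} := by
  refine (trunc_congr hκ ?_ ?_).symm
  · have hsub : {c | HasType σ (orbit σ c) t.1} ⊆ ⋃ B : Orb σ t.1, B.1 := fun c hc =>
      Set.mem_iUnion.2 ⟨⟨_, ⟨c, rfl⟩, hc⟩, mem_orbit_self σ c⟩
    refine (Cardinal.mk_le_mk_of_subset hsub).trans ((Cardinal.mk_iUnion_le _).trans ?_)
    gcongr
    refine ciSup_le' fun B => ?_
    obtain ⟨a, ha⟩ := B.2.1
    rw [ha]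
    exact orbit_countable σ a
  · refine Cardinal.mk_le_of_injective
      (f := fun B => ⟨(Orb.nonempty B).some, ?_⟩) fun B B' h => ?_
    · obtain ⟨B, ⟨a, rfl⟩, hB⟩ := B
      have := (Orb.nonempty (⟨_, ⟨a, rfl⟩, hB⟩ : Orb σ t.1)).some_mem
      rw [Set.mem_ofPred_eq, ← orbit_eq this]
      exact hB
    · have h1 := (Orb.nonempty B).some_mem
      have h2 := (Orb.nonempty B').some_mem
      have h3 : (Orb.nonempty B).some = (Orb.nonempty B').some := Subtype.ext_iff.1 h
      rw [← h3] at h2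
      obtain ⟨B, ⟨a, rfl⟩, hB⟩ := B
      obtain ⟨B', ⟨a', rfl⟩, hB'⟩ := B'
      exact Subtype.ext (orbit_eq_of_mem_of_mem h1 h2)

/-- The last clause of `AppR` determines the region of `a`: an invariant region meets the points `D`
on orbits of type `t` in a set that is not small exactly if it meets `a` in such a set. -/
theorem RepF.app_iff (hκ : ℵ₀ < P.κ) {x y : Fin n → P.G} {w : P.G} {c : P.F n} {t : P.IS n}
    {ν : P.CardMinus} (h : P.RepF x c) (h' : P.RepIS y t) (hw : P.RepCard w ν) :
    AppR x y w ↔ P.App c t = ν := by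
  obtain ⟨f, hf, k, hk, rfl⟩ := h
  choose g hg using fun i => P.coset_surj (y i)
  obtain rfl : (fun i => P.coset (f i)) = x := funext hf
  obtain rfl : (fun i => P.coset (g i)) = y := funext hg
  obtain ⟨C, hC, -⟩ := exists_reg w
  set σ := P.perm f with hσ
  set D : Set P.Ω := {c | HasType σ (orbit σ c) t.1} with hD
  have hDinv : ∀ i, ∀ᶠ c in P.fil, σ i c ∈ D ↔ c ∈ D := fun i =>
    Filter.Eventually.of_forall fun c => by
      simp only [D, Set.mem_ofPred_eq]
      rw [← orbit_eq ((isInv_orbit σ c i c).2 (mem_orbit_self σ c))]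
  have hDlt : #D < P.lam := (Cardinal.mk_le_mk_of_subset
    (show D ⊆ P.Dset σ from fun c hc => mem_Dset_of_hasType hc)).trans_lt (mk_Dset_perm f).1
  have happ : P.App (P.cls k) t = ν ↔ trunc P.κ #D = trunc P.κ #C := by
    refine (Subtype.ext_iff (a1 := P.App (P.cls k) t) (a2 := ν)).trans ?_
    rw [App_cls (σ := σ) hk, ((repCard_iff hC).1 hw).2, trunc_orb hκ]
  have hcard : ∀ {a : P.G} {A : Set P.Ω}, P.Reg a A →
      ((CardLe a w ∧ CardLe w a) ↔ trunc P.κ #A = trunc P.κ #C) := fun ha => by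
    rw [ha.cardLe_iff hC, hC.cardLe_iff ha, le_antisymm_iff]
  rw [happ]
  constructor
  · rintro ⟨a, hinv, h1, h2, h3⟩
    obtain ⟨A, ha, -⟩ := exists_reg a
    have hA := (hcard ha).1 ⟨h1, h2⟩
    rw [invR_iff ha] at hinv
    rw [← hA]
    -- Applied to `A \ D` and `D \ A`, this shows that `A` and `D` agree up to a small set.
    have key : ∀ B : Set P.Ω, #B < P.lam → (∀ i, ∀ᶠ c in P.fil, σ i c ∈ B ↔ c ∈ B) →
        ((∀ᶠ c in P.fil, c ∈ B → c ∉ D) ↔ ∀ᶠ c in P.fil, c ∈ B → c ∉ A) := by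
      intro B hB hBinv
      obtain ⟨b, hb⟩ := exists_elem (P := P) hB
      have := h3 b ((invR_iff hb).2 hBinv)
      rw [meets_iff hκ h' hb hBinv, hb.disj_iff ha, not_iff_not, ← P.eventually_notMem] at this
      rw [← this]
      refine Filter.eventually_congr (Filter.Eventually.of_forall fun c => ?_)
      simp only [Set.mem_ofPred_eq, not_and, D]
      rfl
    refine (Reg.trunc_eq ha (ha.congr ?_)).symm
    have k1 := (key (A \ D) ((Cardinal.mk_le_mk_of_subset Set.sdiff_subset).trans_lt ha.card_lt)
      fun i => by
        filter_upwards [hinv i, hDinv i] with c h4 h5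
        exact and_congr h4 (not_congr h5)).1 (Filter.Eventually.of_forall fun c hc => hc.2)
    have k2 := (key (D \ A) ((Cardinal.mk_le_mk_of_subset Set.sdiff_subset).trans_lt hDlt)
      fun i => by
        filter_upwards [hinv i, hDinv i] with c h4 h5
        exact and_congr h5 (not_congr h4)).2 (Filter.Eventually.of_forall fun c hc => hc.2)
    filter_upwards [k1, k2] with c h4 h5
    constructor
    · intro hcA
      by_contra hcD
      exact h4 ⟨hcA, hcD⟩ hcA
    · intro hcD
      by_contra hcA
      exact h5 ⟨hcD, hcA⟩ hcD
  · intro hDC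
    obtain ⟨a, ha⟩ := exists_elem (P := P) hDlt
    refine ⟨a, (invR_iff ha).2 hDinv, ((hcard ha).2 hDC).1, ((hcard ha).2 hDC).2, ?_⟩
    intro b hb
    obtain ⟨B, hB, -⟩ := exists_reg b
    rw [invR_iff hB] at hb
    rw [meets_iff hκ h' hB hb, hB.disj_iff ha, not_iff_not, ← P.eventually_notMem]
    refine Filter.eventually_congr (Filter.Eventually.of_forall fun c => ?_)
    simp only [Set.mem_ofPred_eq, not_and, D]
    rfl

end Params
end
end QuotSym

namespace QuotSym
noncomputable section

/-! ### Interpretations from definable relations -/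

/-- The relations which make up an interpretation, for all groups. -/
structure RelFamily (L : MSLanguage) (dim : L.Srt → ℕ) where
  dom : ∀ s, ∀ (G : Type u) [Group G], (Fin (dim s) → G) → Prop
  eqv : ∀ s, ∀ (G : Type u) [Group G], (Fin (dim s) → G) → (Fin (dim s) → G) → Prop
  rel : ∀ R : L.Rel, ∀ (G : Type u) [Group G], (∀ i, Fin (dim (L.relSort R i)) → G) → Prop
  func : ∀ F : L.Fun, ∀ (G : Type u) [Group G], (∀ i, Fin (dim (L.funDom F i)) → G) →
    (Fin (dim (L.funCod F)) → G) → Prop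

/-- The relations of the family are uniformly definable. -/
structure RelFamily.Definable {L : MSLanguage} {dim : L.Srt → ℕ} (D : RelFamily.{u} L dim) :
    Prop where
  dom : ∀ s, UDef (D.dom s)
  eqv : ∀ s, UDef (α := Fin (dim s) ⊕ Fin (dim s)) fun G _ v =>
    D.eqv s G (fun i => v (Sum.inl i)) (fun i => v (Sum.inr i))
  rel : ∀ R : L.Rel, UDef (α := Σ i, Fin (dim (L.relSort R i))) fun G _ v =>
    D.rel R G fun i j => v ⟨i, j⟩
  func : ∀ F : L.Fun, UDef (α := (Σ i, Fin (dim (L.funDom F i))) ⊕ Fin (dim (L.funCod F)))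
    fun G _ v => D.func F G (fun i j => v (Sum.inl ⟨i, j⟩)) fun j => v (Sum.inr j)

/-- The relations of the family interpret `M` in the group `G`. -/
structure RelFamily.Interprets {L : MSLanguage} {dim : L.Srt → ℕ} (D : RelFamily.{u} L dim)
    (M : MSStructure.{v} L) (G : Type u) [Group G]
    (rep : ∀ s, (Fin (dim s) → G) → M.carrier s → Prop) : Prop where
  dom_iff : ∀ s x, D.dom s G x ↔ ∃ m, rep s x m
  unique : ∀ s x m m', rep s x m → rep s x m' → m = m'
  surj : ∀ s m, ∃ x, rep s x m
  eqv_iff : ∀ s x y m m', rep s x m → rep s y m' → (D.eqv s G x y ↔ m = m')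
  rel_iff : ∀ (R : L.Rel) (x : ∀ i, Fin (dim (L.relSort R i)) → G)
    (m : ∀ i, M.carrier (L.relSort R i)), (∀ i, rep _ (x i) (m i)) → (D.rel R G x ↔ M.rel R m)
  func_iff : ∀ (F : L.Fun) (x : ∀ i, Fin (dim (L.funDom F i)) → G)
    (m : ∀ i, M.carrier (L.funDom F i)) (y : Fin (dim (L.funCod F)) → G)
    (c : M.carrier (L.funCod F)), (∀ i, rep _ (x i) (m i)) → rep _ y c →
    (D.func F G x y ↔ M.func F m = c)

/-- The formulae are chosen before any group or structure is mentioned, so they serve for all of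
them. -/
theorem RelFamily.Definable.exists_interp {L : MSLanguage} {dim : L.Srt → ℕ}
    {D : RelFamily.{u} L dim} (hD : D.Definable) : ∃ Γ : Interp L dim,
    ∀ (M : MSStructure.{v} L) (G : Type u) [Group G]
      (rep : ∀ s, (Fin (dim s) → G) → M.carrier s → Prop),
      D.Interprets M G rep → Γ.Interprets M G rep := by
  choose dom hdom using hD.dom
  choose eqv heqv using hD.eqv
  choose rel hrel using hD.rel
  choose func hfunc using hD.func
  refine ⟨⟨dom, eqv, rel, func⟩, fun M G _ rep h => ⟨?_, h.unique, h.surj, ?_, ?_, ?_⟩⟩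
  · exact fun s x => (hdom s G x).trans (h.dom_iff s x)
  · exact fun s x y m m' hm hm' => (heqv s G _).trans (h.eqv_iff s x y m m' hm hm')
  · exact fun R x m hm => (hrel R G _).trans (h.rel_iff R x m hm)
  · exact fun F x m y c hm hc => (hfunc F G _).trans (h.func_iff F x m y c hm hc)

/-! ### The interpretation for uncountable `κ` -/

/-- The relations interpreting `M` for uncountable `κ`. -/
def uncountableFamily : RelFamily.{u} mLang mDim where
  dom
    | .is n => fun G _ (x : Fin (n + 1) → G) => Pure x ∧ ((∀ i, x i = 1) → FullSupp G)
    | .card => fun G _ (x : Fin 1 → G) => x 0 * x 0 = 1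
    | .fn _ => fun _ _ _ => True
  eqv
    | .is n => fun G _ (x y : Fin (n + 1) → G) => ∃ a, Good x a ∧ Meets x a y
    | .card => fun G _ (x y : Fin 1 → G) => CardLe (x 0) (y 0) ∧ CardLe (y 0) (x 0)
    | .fn n => fun G _ (x y : Fin (n + 1) → G) => ∃ z : G, ∀ i, z⁻¹ * x i * z = y i
  rel
    | .eq1 => fun _ _ x => x (0 : Fin 1) (0 : Fin 2) = x (0 : Fin 1) (1 : Fin 2)
    | .prod1 => fun _ _ x => x (0 : Fin 1) (0 : Fin 3) * x (0 : Fin 1) (1 : Fin 3) =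
        x (0 : Fin 1) (2 : Fin 3)
    | .proj1 n => fun G _ x => ∃ a, Good (x (0 : Fin 2) : Fin (n + 2) → G) a ∧
        Meets (initTuple (x (0 : Fin 2) : Fin (n + 2) → G)) a (x (1 : Fin 2) : Fin (n + 1) → G)
    | .lt => fun _ _ x =>
        ¬ CardLe (x (1 : Fin 2) (0 : Fin 1)) (x (0 : Fin 2) (0 : Fin 1))
    | .eq => fun _ _ x => x (0 : Fin 1) (0 : Fin 2) = x (0 : Fin 1) (1 : Fin 2)
    | .prod => fun _ _ x => x (0 : Fin 1) (0 : Fin 3) * x (0 : Fin 1) (1 : Fin 3) =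
        x (0 : Fin 1) (2 : Fin 3)
  func
    | .app n => fun G _ x y => AppR (x (0 : Fin 2) : Fin (n + 1) → G)
        (x (1 : Fin 2) : Fin (n + 1) → G) (y (0 : Fin 1))
    | .proj n => fun G _ x y => ∃ z : G, ∀ i,
        z⁻¹ * initTuple (x (0 : Fin 1) : Fin (n + 2) → G) i * z = (y : Fin (n + 1) → G) i

theorem uncountableFamily_definable : uncountableFamily.{u}.Definable where
  dom
    | .is _ => (UDef.pure fun _ => UTerm.var _).and
        ((UDef.fall fun _ => UDef.eq (UTerm.var _) UTerm.one).imp UDef.fullSupp)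
    | .card => UDef.eq ((UTerm.var _).mul (UTerm.var _)) UTerm.one
    | .fn _ => (UDef.eq UTerm.one UTerm.one).congr fun _ _ _ => by simp [uncountableFamily]
  eqv
    | .is _ => UDef.ex ((UDef.good (fun _ => UTerm.var _) (UTerm.var _)).and
        (UDef.meets (fun _ => UTerm.var _) (UTerm.var _) fun _ => UTerm.var _))
    | .card => (UDef.cardLe (UTerm.var _) (UTerm.var _)).and
        (UDef.cardLe (UTerm.var _) (UTerm.var _))
    | .fn _ => UDef.ex (UDef.fall fun i => UDef.eq
        (((UTerm.var _).inv.mul (UTerm.var _)).mul (UTerm.var _)) (UTerm.var _))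
  rel
    | .eq1 => UDef.eq (UTerm.var _) (UTerm.var _)
    | .prod1 => UDef.eq ((UTerm.var _).mul (UTerm.var _)) (UTerm.var _)
    | .proj1 _ => UDef.ex ((UDef.good (fun _ => UTerm.var _) (UTerm.var _)).and
        (UDef.meets (fun _ => UTerm.var _) (UTerm.var _) fun _ => UTerm.var _))
    | .lt => (UDef.cardLe (UTerm.var _) (UTerm.var _)).not
    | .eq => UDef.eq (UTerm.var _) (UTerm.var _)
    | .prod => UDef.eq ((UTerm.var _).mul (UTerm.var _)) (UTerm.var _)
  func
    | .app _ => UDef.appR (fun _ => UTerm.var _) (fun _ => UTerm.var _) (UTerm.var _)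
    | .proj _ => UDef.ex (UDef.fall fun i => UDef.eq
        (((UTerm.var _).inv.mul (UTerm.var _)).mul (UTerm.var _)) (UTerm.var _))

theorem ulift_down_eq_iff {X : Type v} {a b : ULift.{w} X} : a.down = b.down ↔ a = b :=
  ⟨fun h => ULift.ext _ _ h, fun h => h ▸ rfl⟩

theorem uncountableFamily_interprets {P : Params.{u}} (hκ : ℵ₀ < P.κ) :
    uncountableFamily.Interprets P.M P.G P.Rep where
  dom_iff
    | .is _, x => (Params.exists_repIS_iff hκ x).trans
        ⟨fun ⟨t, ht⟩ => ⟨⟨t⟩, ht⟩, fun ⟨t, ht⟩ => ⟨t.down, ht⟩⟩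
    | .card, x => (Params.exists_repCard_iff (x (0 : Fin 1))).symm
    | .fn _, x => ⟨fun _ => Params.exists_repF x, fun _ => trivial⟩
  unique
    | .is _, _, _, _, h, h' => ULift.ext _ _ (Params.RepIS.unique hκ h h')
    | .card, _, _, _, h, h' => Params.RepCard.unique h h'
    | .fn _, _, _, _, h, h' => Params.RepF.unique hκ h h'
  surj
    | .is _, m => Params.exists_repIS hκ m.down
    | .card, m => (Params.exists_repCard m).elim fun x hx => ⟨fun _ => x, hx⟩
    | .fn _, m => Params.exists_repF_of_class m
  eqv_iff
    | .is _, _, _, _, _, h, h' => (Params.RepIS.eq_iff hκ h h').trans ulift_down_eq_iff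
    | .card, _, _, _, _, h, h' => Params.RepCard.eq_iff h h'
    | .fn _, _, _, _, _, h, h' => (Params.RepF.eq_iff hκ h h').symm
  rel_iff
    | .eq1, _, _, h => Params.RepIS.eq1_iff hκ (h (0 : Fin 1))
    | .prod1, _, _, h => Params.RepIS.prod1_iff hκ (h (0 : Fin 1))
    | .proj1 _, _, _, h => Params.RepIS.proj1_iff hκ (h (0 : Fin 2)) (h (1 : Fin 2))
    | .lt, _, _, h => Params.RepCard.lt_iff (h (0 : Fin 2)) (h (1 : Fin 2))
    | .eq, _, _, h => Params.RepF.eq_rel_iff (h (0 : Fin 1))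
    | .prod, _, _, h => Params.RepF.prod_rel_iff (h (0 : Fin 1))
  func_iff
    | .app _, _, _, _, _, h, hc => Params.RepF.app_iff hκ (h (0 : Fin 2)) (h (1 : Fin 2)) hc
    | .proj _, _, _, _, _, h, hc => Params.RepF.proj_iff hκ (h (0 : Fin 1)) hc

theorem exists_interp_uncountable : ∃ Γ : Interp mLang mDim,
    ∀ P : Params.{u}, ℵ₀ < P.κ → Γ.Interprets P.M P.G P.Rep ∧
      (∀ g : P.G, (∃ ν, P.RepCard g ν) ↔ g * g = 1) ∧
      (∀ (n : ℕ) (x : Fin (n + 1) → P.G), ∃ c, P.RepF x c) ∧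
      (∀ (n : ℕ) (x y : Fin (n + 1) → P.G) (c d : P.F (n + 1)), P.RepF x c → P.RepF y d →
        (c = d ↔ ∃ z : P.G, ∀ i, z⁻¹ * x i * z = y i)) := by
  obtain ⟨Γ, hΓ⟩ := uncountableFamily_definable.{u}.exists_interp
  refine ⟨Γ, fun P hκ => ⟨hΓ _ _ _ (uncountableFamily_interprets hκ),
    Params.exists_repCard_iff, fun n x => Params.exists_repF x, ?_⟩⟩
  exact fun n x y c d h h' => Params.RepF.eq_iff hκ h h'

end
end QuotSym

namespace QuotSym
noncomputable section

/-! ### Regions: supports up to small sets, in the language of groups -/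

section Regions

variable {G : Type u} [Group G]

/-- Being defined in the language of groups, the relation is preserved by automorphisms. For inner
automorphisms this makes `G` act on regions. -/
theorem PreDisj.map (φ : G ≃* G) {x g : G} (h : PreDisj x g) : PreDisj (φ x) (φ g) := by
  intro k hk
  obtain ⟨k, rfl⟩ := φ.surjective k
  obtain ⟨f₁, f₂, h1, h2, h3, h4⟩ := h k fun hc => hk (by rw [← map_mul, hc, map_mul])
  refine ⟨φ f₁, φ f₂, ?_, ?_, ?_, ?_⟩
  · rw [← map_mul, h1, map_mul]
  · rw [← map_mul, h2, map_mul]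
  · simp only [← map_mul, ← map_inv]
    rwa [Ne, map_eq_one_iff φ φ.injective]
  · simp only [← map_mul, ← map_inv]
    rw [h4]

theorem preDisj_map_iff (φ : G ≃* G) {x g : G} : PreDisj (φ x) (φ g) ↔ PreDisj x g :=
  ⟨fun h => by simpa using h.map φ.symm, fun h => h.map φ⟩

theorem Disj.map (φ : G ≃* G) {x y : G} (h : Disj x y) : Disj (φ x) (φ y) := by
  obtain ⟨s, h1, h2, h3⟩ := h
  refine ⟨φ s, ?_, h2.map φ, fun r hr hsr => ?_⟩
  · simp only [← map_mul, h1, map_one]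
  · obtain ⟨r, rfl⟩ := φ.surjective r
    rw [preDisj_map_iff] at hsr ⊢
    refine h3 r (φ.injective ?_) hsr
    simpa only [map_mul, map_one] using hr

theorem disj_map_iff (φ : G ≃* G) {x y : G} : Disj (φ x) (φ y) ↔ Disj x y :=
  ⟨fun h => by simpa using h.map φ.symm, fun h => h.map φ⟩

theorem Sub.map (φ : G ≃* G) {x y : G} (h : Sub x y) : Sub (φ x) (φ y) := by
  intro z hz
  obtain ⟨z, rfl⟩ := φ.surjective z
  rw [disj_map_iff] at hz ⊢
  exact h z hz

theorem Sub.trans {x y z : G} (h : Sub x y) (h' : Sub y z) : Sub x z := fun w hw => h w (h' w hw)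

/-- Two elements are identified if their supports agree up to a small set. -/
def rgnSetoid (G : Type u) [Group G] : Setoid G where
  r := EqR
  iseqv :=
    { refl := fun _ => ⟨fun _ h => h, fun _ h => h⟩
      symm := fun h => ⟨h.2, h.1⟩
      trans := fun h h' => ⟨h.1.trans h'.1, h'.2.trans h.2⟩ }

/-- The supports of elements, up to small sets. -/
def Rgn (G : Type u) [Group G] : Type u := Quotient (rgnSetoid G)

/-- The support of an element, up to a small set. -/
def Rgn.mk (a : G) : Rgn G := Quotient.mk (rgnSetoid G) a

theorem Rgn.mk_eq_iff {a b : G} : Rgn.mk a = Rgn.mk b ↔ EqR a b :=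
  ⟨fun h => Quotient.exact h, fun h => Quotient.sound h⟩

theorem Rgn.mk_surjective : Function.Surjective (Rgn.mk : G → Rgn G) := Quotient.mk_surjective

instance : LE (Rgn G) where
  le := Quotient.lift₂ Sub fun _ _ _ _ h h' =>
    propext ⟨fun k => (h.2.trans k).trans h'.1, fun k => (h.1.trans k).trans h'.2⟩

theorem Rgn.mk_le_iff {a b : G} : Rgn.mk a ≤ Rgn.mk b ↔ Sub a b := Iff.rfl

instance : MulAction G (Rgn G) where
  smul g := Quotient.map (fun a => g * a * g⁻¹) fun _ _ h =>
    ⟨h.1.map (MulAut.conj g), h.2.map (MulAut.conj g)⟩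
  one_smul r := by
    obtain ⟨a, rfl⟩ := Rgn.mk_surjective r
    change Rgn.mk (1 * a * 1⁻¹) = _
    simp
  mul_smul g h r := by
    obtain ⟨a, rfl⟩ := Rgn.mk_surjective r
    change Rgn.mk (g * h * a * (g * h)⁻¹) = Rgn.mk (g * (h * a * h⁻¹) * g⁻¹)
    simp [mul_assoc]

end Regions

/-! ### Points coded by minimal invariant regions -/

section Codes

variable {G : Type u} [Group G] {n : ℕ}

/-- The region `r` is a minimal non-trivial region invariant under `x`. -/
def EndOf (x : G) (r : Rgn G) : Prop :=
  r ≠ Rgn.mk 1 ∧ x • r = r ∧ ∀ s, s ≤ r → s ≠ Rgn.mk 1 → x • s = s → s = r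

/-- The set coded by `x` and `b`. -/
def Pt (x b : G) : Set (Rgn G) := {r | EndOf x r ∧ r ≤ Rgn.mk b}

/-- The complement of the support of `b` is at least as large as that support. -/
def Cobig (b : G) : Prop := ∃ c, Disj c b ∧ CardLe b c

/-- Every entry of `y` permutes the set coded by `x` and `b`. -/
def Acts (x b : G) (y : Fin n → G) : Prop :=
  ∀ i, ∀ p, p ∈ Pt x b → y i • p ∈ Pt x b ∧ (y i)⁻¹ • p ∈ Pt x b

/-- The tuple of permutations coded by `x`, `b` and `y`. -/
def actPerm {x b : G} {y : Fin n → G} (h : Acts x b y) (i : Fin n) : Equiv.Perm (Pt x b) where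
  toFun p := ⟨y i • p.1, (h i p.1 p.2).1⟩
  invFun p := ⟨(y i)⁻¹ • p.1, (h i p.1 p.2).2⟩
  left_inv _ := Subtype.ext (inv_smul_smul _ _)
  right_inv _ := Subtype.ext (smul_inv_smul _ _)

/-- The element `z` maps the first coded set into the second one, equivariantly. -/
def Emb (x' b' : G) (y' : Fin n → G) (x b : G) (y : Fin n → G) (z : G) : Prop :=
  (∀ p, p ∈ Pt x' b' → z • p ∈ Pt x b) ∧ ∀ i, ∀ p, p ∈ Pt x' b' → z • y' i • p = y i • z • p

/-- The set coded by `x` and `d` is finite. -/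
def FinPt (x d : G) : Prop :=
  ∀ z : G, (∀ p, p ∈ Pt x d → z • p ∈ Pt x d) → ∀ p, p ∈ Pt x d → z⁻¹ • p ∈ Pt x d

/-- The point `p` belongs to an orbit which is counted. -/
def Counted (y : Fin n → G) (p : Rgn G) : Prop := FullSupp G ∨ ∃ i, y i • p ≠ p

/-- The code represents a transitive tuple. -/
def IsCode (x b : G) (y : Fin n → G) : Prop :=
  Cobig b ∧ Acts x b y ∧ (∃ p, p ∈ Pt x b ∧ Counted y p) ∧
    ∀ c : G, (∀ i, ∀ p, p ∈ Pt x b → p ≤ Rgn.mk c →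
      y i • p ≤ Rgn.mk c ∧ (y i)⁻¹ • p ≤ Rgn.mk c) →
      (∃ p, p ∈ Pt x b ∧ p ≤ Rgn.mk c) → ∀ p, p ∈ Pt x b → p ≤ Rgn.mk c

/-- The code represents an element of the sort `F_n`. -/
def FnCode (x b : G) (y : Fin n → G) : Prop :=
  Cobig b ∧ Acts x b y ∧ (FullSupp G → ∀ x' b' : G, Cobig b' →
    ∃ z : G, ∀ p, p ∈ Pt x' b' → z • p ∈ Pt x b)

/-- There is an isomorphism between cofinite parts of the coded tuples. -/
def AlmostIsoR (x b : G) (y : Fin n → G) (x' b' : G) (y' : Fin n → G) : Prop :=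
  ∃ c z : G, (∀ p, p ∈ Pt x b → p ≤ Rgn.mk c → Counted y p ∧ z • p ∈ Pt x' b' ∧
      ∀ i, y i • p ≤ Rgn.mk c ∧ (y i)⁻¹ • p ≤ Rgn.mk c ∧ z • y i • p = y' i • z • p) ∧
    (∃ d, Rgn.mk d ≤ Rgn.mk b ∧ FinPt x d ∧
      ∀ p, p ∈ Pt x b → Counted y p → p ≤ Rgn.mk c ∨ p ≤ Rgn.mk d) ∧
    ∃ d, Rgn.mk d ≤ Rgn.mk b' ∧ FinPt x' d ∧
      ∀ p, p ∈ Pt x' b' → Counted y' p →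
        (z⁻¹ • p ∈ Pt x b ∧ z⁻¹ • p ≤ Rgn.mk c) ∨ p ≤ Rgn.mk d

/-- The orbits of `(x, b, y)` of the type represented by `(x', b', y')` have a transversal of the
cardinality represented by `w`. -/
def AppCode (x b : G) (y : Fin n → G) (x' b' : G) (y' : Fin n → G) (w : G) : Prop :=
  ∃ c : G, Rgn.mk c ≤ Rgn.mk b ∧
    (∀ p, p ∈ Pt x c → ∃ z, Emb x' b' y' x b y z ∧ z⁻¹ • p ∈ Pt x' b') ∧
    (∀ z, Emb x' b' y' x b y z → ∃ p, p ∈ Pt x c ∧ z⁻¹ • p ∈ Pt x' b') ∧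
    (∀ z, Emb x' b' y' x b y z → ∀ p q, p ∈ Pt x c → q ∈ Pt x c → z⁻¹ • p ∈ Pt x' b' →
      z⁻¹ • q ∈ Pt x' b' → p = q) ∧
    ((FinPt x c ∧ w = 1) ∨ (¬ FinPt x c ∧ CardLe c w ∧ CardLe w c ∧
      ∀ c' : G, (∀ p, p ∈ Pt x c → p ≤ Rgn.mk c') → CardLe c c'))

/-- The equation holds at all but finitely many points. -/
def EqCode (x b : G) (y : Fin 2 → G) : Prop :=
  ∃ d, Rgn.mk d ≤ Rgn.mk b ∧ FinPt x d ∧ ∀ p, p ∈ Pt x b → y 0 • p = y 1 • p ∨ p ≤ Rgn.mk d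

/-- The equation holds at all but finitely many points. -/
def ProdCode (x b : G) (y : Fin 3 → G) : Prop :=
  ∃ d, Rgn.mk d ≤ Rgn.mk b ∧ FinPt x d ∧ ∀ p, p ∈ Pt x b → y 0 • y 1 • p = y 2 • p ∨ p ≤ Rgn.mk d

end Codes

/-! ### Definability -/

/-- A family of functions from groups to their regions which is given by a term. -/
def URgn {α : Type} (r : ∀ (G : Type u) [Group G], (α → G) → Rgn G) : Prop :=
  ∃ t : ∀ (G : Type u) [Group G], (α → G) → G, UTerm t ∧
    ∀ (G : Type u) [Group G] (v : α → G), r G v = Rgn.mk (t G v)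

section

variable {α : Type} {n : ℕ} {s t : ∀ (G : Type u) [Group G], (α → G) → G}
  {r q : ∀ (G : Type u) [Group G], (α → G) → Rgn G}

theorem URgn.mk (ht : UTerm t) : URgn fun G _ v => Rgn.mk (t G v) := ⟨_, ht, fun _ _ _ => rfl⟩

theorem URgn.smul (ht : UTerm t) (hr : URgn r) : URgn fun G _ v => t G v • r G v := by
  obtain ⟨s, hs, h⟩ := hr
  exact ⟨_, (ht.mul hs).mul ht.inv, fun G _ v => congrArg (t G v • ·) (h G v)⟩

theorem UDef.rgnEq (hr : URgn r) (hq : URgn q) : UDef fun G _ v => r G v = q G v := by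
  obtain ⟨s, hs, h⟩ := hr
  obtain ⟨t, ht, h'⟩ := hq
  exact (UDef.eqR hs ht).congr fun G _ v => by rw [h, h', Rgn.mk_eq_iff]

theorem UDef.rgnNe (hr : URgn r) (hq : URgn q) : UDef fun G _ v => r G v ≠ q G v :=
  (UDef.rgnEq hr hq).not

theorem UDef.rgnLe (hr : URgn r) (hq : URgn q) : UDef fun G _ v => r G v ≤ q G v := by
  obtain ⟨s, hs, h⟩ := hr
  obtain ⟨t, ht, h'⟩ := hq
  exact (UDef.sub hs ht).congr fun G _ v => by rw [h, h', Rgn.mk_le_iff]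

/-- Every region is the support of an element, so quantification over regions is quantification over
elements. -/
theorem UDef.rgnAll {R : ∀ (G : Type u) [Group G], (α → G) → Rgn G → Prop}
    (hR : UDef (α := α ⊕ Unit) fun G _ v =>
      R G (fun a => v (Sum.inl a)) (Rgn.mk (v (Sum.inr ())))) :
    UDef fun G _ v => ∀ p : Rgn G, R G v p :=
  (UDef.all (R := fun G _ v g => R G v (Rgn.mk g)) hR).congr fun _ _ _ =>
    Rgn.mk_surjective.forall.symm

theorem UDef.rgnEx {R : ∀ (G : Type u) [Group G], (α → G) → Rgn G → Prop}
    (hR : UDef (α := α ⊕ Unit) fun G _ v =>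
      R G (fun a => v (Sum.inl a)) (Rgn.mk (v (Sum.inr ())))) :
    UDef fun G _ v => ∃ p : Rgn G, R G v p :=
  (UDef.ex (R := fun G _ v g => R G v (Rgn.mk g)) hR).congr fun _ _ _ =>
    Rgn.mk_surjective.exists.symm

theorem UDef.endOf (hs : UTerm s) (hr : URgn r) : UDef fun G _ v => EndOf (s G v) (r G v) := by
  obtain ⟨t, ht, h⟩ := hr
  refine UDef.congr (R := fun G _ v => EndOf (s G v) (Rgn.mk (t G v))) ?_ fun G _ v => by rw [h]
  refine UDef.subst₂ (R := fun G _ x y => EndOf x (Rgn.mk y)) ?_ hs ht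
  unfold EndOf
  repeat' first
    | apply UDef.rgnNe | apply UDef.rgnEq | apply UDef.rgnLe | apply UDef.and | apply UDef.rgnAll
    | apply UDef.imp | apply URgn.smul | apply URgn.mk | exact UTerm.var _ | exact UTerm.one

theorem UDef.memPt (hs : UTerm s) (ht : UTerm t) (hr : URgn r) :
    UDef fun G _ v => r G v ∈ Pt (s G v) (t G v) :=
  (UDef.endOf hs hr).and (UDef.rgnLe hr (URgn.mk ht))

theorem UDef.cobig (hs : UTerm s) : UDef fun G _ v => Cobig (s G v) := by
  refine UDef.subst₁ (R := fun G _ x => Cobig x) ?_ hs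
  unfold Cobig
  repeat' first
    | apply UDef.disj | apply UDef.cardLe | apply UDef.and | apply UDef.ex | exact UTerm.var _

theorem UDef.finPt (hs : UTerm s) (ht : UTerm t) : UDef fun G _ v => FinPt (s G v) (t G v) := by
  refine UDef.subst₂ (R := fun G _ x y => FinPt x y) ?_ hs ht
  unfold FinPt
  repeat' first
    | apply UDef.memPt | apply UDef.rgnAll | apply UDef.all | apply UDef.imp | apply URgn.smul
    | apply URgn.mk | apply UTerm.inv | exact UTerm.var _

end

section

variable {α : Type} {n : ℕ} {x b x' b' w : ∀ (G : Type u) [Group G], (α → G) → G}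
  {y y' : Fin n → ∀ (G : Type u) [Group G], (α → G) → G}

theorem UDef.substCode {R : ∀ (G : Type u) [Group G], G → G → (Fin n → G) → Prop}
    (hR : UDef (α := Fin 2 ⊕ Fin n) fun G _ v =>
      R G (v (Sum.inl 0)) (v (Sum.inl 1)) (fun i => v (Sum.inr i)))
    (hx : UTerm x) (hb : UTerm b) (hy : ∀ i, UTerm (y i)) :
    UDef fun G _ v => R G (x G v) (b G v) (fun i => y i G v) :=
  hR.subst (t := Sum.elim (fun j => if j = 0 then x else b) y) (by
    rintro (j | i)
    · change UTerm (if j = 0 then x else b)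
      split_ifs
      exacts [hx, hb]
    · exact hy i)

theorem UDef.substCodes
    {R : ∀ (G : Type u) [Group G], G → G → (Fin n → G) → G → G → (Fin n → G) → G → Prop}
    (hR : UDef (α := Fin 5 ⊕ (Fin n ⊕ Fin n)) fun G _ v =>
      R G (v (Sum.inl 0)) (v (Sum.inl 1)) (fun i => v (Sum.inr (Sum.inl i)))
        (v (Sum.inl 2)) (v (Sum.inl 3)) (fun i => v (Sum.inr (Sum.inr i))) (v (Sum.inl 4)))
    (hx : UTerm x) (hb : UTerm b) (hy : ∀ i, UTerm (y i)) (hx' : UTerm x') (hb' : UTerm b')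
    (hy' : ∀ i, UTerm (y' i)) (hw : UTerm w) :
    UDef fun G _ v => R G (x G v) (b G v) (fun i => y i G v) (x' G v) (b' G v)
      (fun i => y' i G v) (w G v) :=
  hR.subst (t := Sum.elim (fun j => if j = 0 then x else if j = 1 then b else if j = 2 then x'
    else if j = 3 then b' else w) (Sum.elim y y')) (by
    rintro (j | i | i)
    · change UTerm (if j = 0 then x else if j = 1 then b else if j = 2 then x'
        else if j = 3 then b' else w)
      split_ifs
      exacts [hx, hb, hx', hb', hw]
    · exact hy i
    · exact hy' i)

theorem UDef.counted {r : ∀ (G : Type u) [Group G], (α → G) → Rgn G} (hy : ∀ i, UTerm (y i))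
    (hr : URgn r) : UDef fun G _ v => Counted (fun i => y i G v) (r G v) :=
  UDef.fullSupp.or (UDef.fex fun i => UDef.rgnNe (URgn.smul (hy i) hr) hr)

theorem UDef.acts (hx : UTerm x) (hb : UTerm b) (hy : ∀ i, UTerm (y i)) :
    UDef fun G _ v => Acts (x G v) (b G v) (fun i => y i G v) := by
  refine UDef.substCode (R := fun G _ x b y => Acts x b y) ?_ hx hb hy
  unfold Acts
  repeat' first
    | apply UDef.memPt | apply UDef.and | apply UDef.rgnAll | apply UDef.imp | apply UDef.fall
    | apply URgn.smul | apply URgn.mk | apply UTerm.inv | exact UTerm.var _ | intro _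

theorem UDef.emb (hx' : UTerm x') (hb' : UTerm b') (hy' : ∀ i, UTerm (y' i)) (hx : UTerm x)
    (hb : UTerm b) (hy : ∀ i, UTerm (y i)) (hw : UTerm w) : UDef fun G _ v =>
      Emb (x' G v) (b' G v) (fun i => y' i G v) (x G v) (b G v) (fun i => y i G v) (w G v) := by
  refine UDef.substCodes (R := fun G _ x' b' y' x b y w => Emb x' b' y' x b y w) ?_
    hx' hb' hy' hx hb hy hw
  unfold Emb
  repeat' first
    | apply UDef.memPt | apply UDef.and | apply UDef.rgnAll | apply UDef.imp | apply UDef.fall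
    | apply UDef.rgnEq | apply URgn.smul | apply URgn.mk | exact UTerm.var _ | intro _

theorem UDef.isCode (hx : UTerm x) (hb : UTerm b) (hy : ∀ i, UTerm (y i)) :
    UDef fun G _ v => IsCode (x G v) (b G v) (fun i => y i G v) := by
  refine UDef.substCode (R := fun G _ x b y => IsCode x b y) ?_ hx hb hy
  unfold IsCode
  repeat' first
    | apply UDef.cobig | apply UDef.acts | apply UDef.counted | apply UDef.memPt
    | apply UDef.rgnLe | apply UDef.and | apply UDef.rgnAll | apply UDef.rgnEx | apply UDef.all
    | apply UDef.imp | apply UDef.fall | apply URgn.smul | apply URgn.mk | apply UTerm.inv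
    | exact UTerm.var _ | intro _

theorem UDef.fnCode (hx : UTerm x) (hb : UTerm b) (hy : ∀ i, UTerm (y i)) :
    UDef fun G _ v => FnCode (x G v) (b G v) (fun i => y i G v) := by
  refine UDef.substCode (R := fun G _ x b y => FnCode x b y) ?_ hx hb hy
  unfold FnCode
  repeat' first
    | apply UDef.cobig | apply UDef.acts | exact UDef.fullSupp | apply UDef.memPt
    | apply UDef.and | apply UDef.rgnAll | apply UDef.all | apply UDef.ex
    | apply UDef.imp | apply URgn.smul | apply URgn.mk | exact UTerm.var _ | intro _

theorem UDef.almostIsoR (hx : UTerm x) (hb : UTerm b) (hy : ∀ i, UTerm (y i)) (hx' : UTerm x')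
    (hb' : UTerm b') (hy' : ∀ i, UTerm (y' i)) : UDef fun G _ v =>
      AlmostIsoR (x G v) (b G v) (fun i => y i G v) (x' G v) (b' G v) (fun i => y' i G v) := by
  refine UDef.substCodes (R := fun G _ x b y x' b' y' _ => AlmostIsoR x b y x' b' y') ?_
    hx hb hy hx' hb' hy' hx
  unfold AlmostIsoR
  repeat' first
    | apply UDef.counted | apply UDef.finPt | apply UDef.memPt | apply UDef.rgnLe
    | apply UDef.rgnEq | apply UDef.and | apply UDef.or | apply UDef.rgnAll | apply UDef.ex
    | apply UDef.fall | apply UDef.imp | apply URgn.smul | apply URgn.mk | apply UTerm.inv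
    | exact UTerm.var _ | intro _

theorem UDef.appCode (hx : UTerm x) (hb : UTerm b) (hy : ∀ i, UTerm (y i)) (hx' : UTerm x')
    (hb' : UTerm b') (hy' : ∀ i, UTerm (y' i)) (hw : UTerm w) : UDef fun G _ v =>
      AppCode (x G v) (b G v) (fun i => y i G v) (x' G v) (b' G v) (fun i => y' i G v)
        (w G v) := by
  refine UDef.substCodes (R := fun G _ x b y x' b' y' w => AppCode x b y x' b' y' w) ?_
    hx hb hy hx' hb' hy' hw
  unfold AppCode
  repeat' first
    | apply UDef.emb | apply UDef.finPt | apply UDef.memPt | apply UDef.rgnLe | apply UDef.cardLe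
    | apply UDef.rgnEq | apply UDef.and | apply UDef.or | apply UDef.not | apply UDef.rgnAll
    | apply UDef.all | apply UDef.ex | apply UDef.rgnEx | apply UDef.imp | apply UDef.eq
    | apply URgn.smul | apply URgn.mk | apply UTerm.inv | exact UTerm.var _ | exact UTerm.one
    | intro _

theorem UDef.eqCode {y : Fin 2 → ∀ (G : Type u) [Group G], (α → G) → G} (hx : UTerm x)
    (hb : UTerm b) (hy : ∀ i, UTerm (y i)) :
    UDef fun G _ v => EqCode (x G v) (b G v) (fun i => y i G v) := by
  refine UDef.substCode (R := fun G _ x b y => EqCode x b y) ?_ hx hb hy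
  unfold EqCode
  repeat' first
    | apply UDef.finPt | apply UDef.memPt | apply UDef.rgnLe | apply UDef.rgnEq
    | apply UDef.and | apply UDef.or | apply UDef.rgnAll | apply UDef.ex | apply UDef.imp
    | apply URgn.smul | apply URgn.mk | exact UTerm.var _

theorem UDef.prodCode {y : Fin 3 → ∀ (G : Type u) [Group G], (α → G) → G} (hx : UTerm x)
    (hb : UTerm b) (hy : ∀ i, UTerm (y i)) :
    UDef fun G _ v => ProdCode (x G v) (b G v) (fun i => y i G v) := by
  refine UDef.substCode (R := fun G _ x b y => ProdCode x b y) ?_ hx hb hy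
  unfold ProdCode
  repeat' first
    | apply UDef.finPt | apply UDef.memPt | apply UDef.rgnLe | apply UDef.rgnEq
    | apply UDef.and | apply UDef.or | apply UDef.rgnAll | apply UDef.ex | apply UDef.imp
    | apply URgn.smul | apply URgn.mk | exact UTerm.var _

end

end
end QuotSym

namespace QuotSym
noncomputable section

namespace Params

variable {P : Params.{u}} {n : ℕ}

/-! ### Regions as sets modulo small sets -/

/-- The region `r` is that of the set `A`. -/
def RReg (P : Params.{u}) (r : Rgn P.G) (A : Set P.Ω) : Prop := ∃ a, Rgn.mk a = r ∧ P.Reg a A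

theorem Reg.rreg {a : P.G} {A : Set P.Ω} (h : P.Reg a A) : P.RReg (Rgn.mk a) A := ⟨a, rfl, h⟩

theorem exists_rreg (r : Rgn P.G) : ∃ A, P.RReg r A ∧ #A < P.lam := by
  obtain ⟨a, rfl⟩ := Rgn.mk_surjective r
  obtain ⟨A, hA, h⟩ := exists_reg a
  exact ⟨A, hA.rreg, h⟩

theorem exists_rgn {A : Set P.Ω} (hA : #A < P.lam) : ∃ r, P.RReg r A :=
  (exists_elem hA).elim fun _ ha => ⟨_, ha.rreg⟩

theorem RReg.congr {r : Rgn P.G} {A B : Set P.Ω} (h : P.RReg r A)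
    (hAB : ∀ᶠ c in P.fil, c ∈ A ↔ c ∈ B) : P.RReg r B := by
  obtain ⟨a, ha, h⟩ := h
  exact ⟨a, ha, h.congr hAB⟩

theorem RReg.le_iff {r s : Rgn P.G} {A B : Set P.Ω} (h : P.RReg r A) (h' : P.RReg s B) :
    r ≤ s ↔ ∀ᶠ c in P.fil, c ∈ A → c ∈ B := by
  obtain ⟨a, rfl, h⟩ := h
  obtain ⟨b, rfl, h'⟩ := h'
  rw [Rgn.mk_le_iff, h.sub_iff h']

theorem RReg.eq_iff {r s : Rgn P.G} {A B : Set P.Ω} (h : P.RReg r A) (h' : P.RReg s B) :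
    r = s ↔ ∀ᶠ c in P.fil, (c ∈ A ↔ c ∈ B) := by
  obtain ⟨a, rfl, h⟩ := h
  obtain ⟨b, rfl, h'⟩ := h'
  rw [Rgn.mk_eq_iff, h.eqR_iff h']

theorem RReg.card_lt {r : Rgn P.G} {A : Set P.Ω} (h : P.RReg r A) : #A < P.lam := by
  obtain ⟨a, rfl, h⟩ := h
  exact h.card_lt

theorem RReg.eq_one_iff {r : Rgn P.G} {A : Set P.Ω} (h : P.RReg r A) :
    r = Rgn.mk 1 ↔ P.Small A := by
  have h1 : P.Reg 1 ∅ := by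
    obtain ⟨B, hB, -⟩ := exists_reg (1 : P.G)
    refine hB.congr ?_
    filter_upwards [P.eventually_notMem.2 (hB.eq_one_iff.1 rfl)] with c hc
    simp [hc]
  rw [h.eq_iff h1.rreg, ← P.eventually_notMem]
  simp

theorem RReg.smul {r : Rgn P.G} {A : Set P.Ω} (h : P.RReg r A) (z : P.SLam) :
    P.RReg (P.coset z • r) {a | (z : Equiv.Perm P.Ω)⁻¹ a ∈ A} := by
  obtain ⟨a, rfl, h⟩ := h
  exact (h.conj z).rreg

theorem RReg.smul_eq_iff {r s : Rgn P.G} {A B : Set P.Ω} (h : P.RReg r A) (h' : P.RReg s B)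
    (z : P.SLam) : P.coset z • r = s ↔
      ∀ᶠ c in P.fil, (c ∈ A ↔ (z : Equiv.Perm P.Ω) c ∈ B) := by
  rw [(h.smul z).eq_iff h', ← P.eventually_perm_iff (z : Equiv.Perm P.Ω)]
  refine Filter.eventually_congr (Filter.Eventually.of_forall fun c => ?_)
  rw [Set.mem_ofPred_eq, perm_inv_apply]

/-- The intersection with an invariant region is an invariant region below `r`, so by minimality it
is trivial or all of `r`. -/
theorem EndOf.eq_of_not_small {f : P.SLam} {r s : Rgn P.G} {A B : Set P.Ω}
    (h : EndOf (P.coset f) r) (hA : P.RReg r A) (hB : P.RReg s B) (hs : P.coset f • s = s)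
    (hAB : ¬ P.Small (A ∩ B)) : ∀ᶠ c in P.fil, c ∈ A → c ∈ B := by
  obtain ⟨t, ht⟩ := exists_rgn (P := P) (A := A ∩ B)
    ((Cardinal.mk_le_mk_of_subset Set.inter_subset_left).trans_lt hA.card_lt)
  have h1 := (hA.smul_eq_iff hA f).1 h.2.1
  have h2 := (hB.smul_eq_iff hB f).1 hs
  have h3 := h.2.2 t ((ht.le_iff hA).2 (Filter.Eventually.of_forall fun c hc => hc.1))
    (fun h => hAB (ht.eq_one_iff.1 h)) ((ht.smul_eq_iff ht f).2 (by
      filter_upwards [h1, h2] with c h4 h5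
      exact and_congr h4 h5))
  filter_upwards [(ht.eq_iff hA).1 h3] with c hc hcA
  exact (hc.2 hcA).2

/-- The invariant set `W` may have size `lam` or more, and then is not the support of an element;
but its intersection with `A` is. -/
theorem exists_rgn_inter {f : P.SLam} {r : Rgn P.G} {A W : Set P.Ω} (h : EndOf (P.coset f) r)
    (hA : P.RReg r A) (hW : ∀ᶠ c in P.fil, c ∈ W ↔ (f : Equiv.Perm P.Ω) c ∈ W)
    (hAW : ¬ P.Small (A ∩ W)) : ∀ᶠ c in P.fil, c ∈ A → c ∈ W := by
  obtain ⟨s, hs⟩ := exists_rgn (P := P) (A := A ∩ W)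
    ((Cardinal.mk_le_mk_of_subset Set.inter_subset_left).trans_lt hA.card_lt)
  have h1 := (hA.smul_eq_iff hA f).1 h.2.1
  have h3 := EndOf.eq_of_not_small h hA hs ((hs.smul_eq_iff hs f).2 (by
    filter_upwards [h1, hW] with c h4 h5
    exact and_congr h4 h5)) (by rwa [← Set.inter_assoc, Set.inter_self])
  exact h3.mono fun c hc hcA => (hc hcA).2

/-! ### Minimal invariant regions lie in one cycle -/

/-- If no cycle contains almost all of `A`, then by `exists_split` a union of cycles divides `A`
into two invariant parts, neither of them small, against minimality. -/
theorem EndOf.exists_cycle {f : P.SLam} {r : Rgn P.G} {A : Set P.Ω} (h : EndOf (P.coset f) r)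
    (hA : P.RReg r A) : ∃ q : Quotient (Equiv.Perm.SameCycle.setoid (f : Equiv.Perm P.Ω)),
      ∀ᶠ c in P.fil, c ∈ A → Quotient.mk _ c = q := by
  by_contra! hcon
  have hns : ¬ P.Small A := fun hs => h.1 (hA.eq_one_iff.2 hs)
  obtain ⟨U, hU1, hU2⟩ := exists_split P.aleph0_le
    (fun c : A => (Quotient.mk (Equiv.Perm.SameCycle.setoid (f : Equiv.Perm P.Ω)) c.1))
    (by
      intro q
      by_contra hlt
      rw [not_le] at hlt
      refine hcon q ((P.eventually_iff).2 (lt_of_le_of_lt ?_ hlt))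
      refine Cardinal.mk_le_of_injective (f := fun c => ⟨⟨c.1, (not_not.1 c.2).1⟩, (not_not.1 c.2).2⟩) fun c c' hcc' => ?_
      simpa [Subtype.ext_iff] using hcc') (not_lt.1 hns)
  set V : Set P.Ω := {c | Quotient.mk (Equiv.Perm.SameCycle.setoid (f : Equiv.Perm P.Ω)) c ∈ U}
  have hV : ∀ c, c ∈ V ↔ (f : Equiv.Perm P.Ω) c ∈ V := by
    intro c
    have : Quotient.mk (Equiv.Perm.SameCycle.setoid (f : Equiv.Perm P.Ω)) c =
        Quotient.mk (Equiv.Perm.SameCycle.setoid (f : Equiv.Perm P.Ω)) ((f : Equiv.Perm P.Ω) c) :=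
      Quotient.sound (Equiv.Perm.SameCycle.refl _ _).apply_right
    simp only [V, Set.mem_ofPred_eq, this]
  have h1 : ¬ P.Small (A ∩ V) := not_lt.2 (hU1.trans (Cardinal.mk_le_of_injective
    (f := fun c => ⟨c.1.1, c.1.2, c.2⟩) fun c c' hcc' => by simpa [Subtype.ext_iff] using hcc'))
  have h2 : ¬ P.Small (A \ V) := not_lt.2 (hU2.trans (Cardinal.mk_le_of_injective
    (f := fun c => ⟨c.1.1, c.1.2, c.2⟩) fun c c' hcc' => by simpa [Subtype.ext_iff] using hcc'))
  refine h2 (P.eventually_notMem.1 ?_)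
  filter_upwards [exists_rgn_inter h hA (Filter.Eventually.of_forall hV) h1] with c hc hc'
  exact hc'.2 (hc hc'.1)

/-- A cycle is countable, hence small for uncountable `κ`, so a minimal region contained in one
cycle would be trivial. -/
theorem not_endOf (hκ : ℵ₀ < P.κ) (x : P.G) (r : Rgn P.G) : ¬ EndOf x r := by
  intro h
  obtain ⟨f, rfl⟩ := P.coset_surj x
  obtain ⟨A, hA, -⟩ := exists_rreg r
  obtain ⟨q, hq⟩ := EndOf.exists_cycle h hA
  refine h.1 (hA.eq_one_iff.2 (P.eventually_notMem.1 ?_))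
  have hc : P.Small {c | Quotient.mk (Equiv.Perm.SameCycle.setoid (f : Equiv.Perm P.Ω)) c = q} := by
    have hsub : {c | Quotient.mk (Equiv.Perm.SameCycle.setoid (f : Equiv.Perm P.Ω)) c = q} ⊆
        Set.range fun k : ULift.{u} ℤ => ((f : Equiv.Perm P.Ω) ^ k.down) q.out := by
      intro c hc
      obtain ⟨k, hk⟩ := Quotient.exact (q.out_eq.trans (Set.mem_ofPred_eq ▸ hc).symm)
      exact ⟨⟨k⟩, hk⟩
    refine (Cardinal.mk_le_mk_of_subset hsub).trans_lt (Cardinal.mk_range_le.trans_lt ?_)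
    simpa using hκ
  filter_upwards [hq, P.eventually_notMem.2 hc] with c h1 h2 h3
  exact h2 (h1 h3)

/-! ### Tails of infinite cycles, for `κ = ℵ₀` -/

/-- The half of the cycle of `c` which goes in the direction given by `ε`. -/
def tailIdx (ε : Bool) (k : ℕ) : ℤ := if ε then Int.ofNat k else Int.negSucc k

theorem tailIdx_injective : Function.Injective fun x : Bool × ℕ => tailIdx x.1 x.2 := by
  rintro ⟨ε, k⟩ ⟨ε', k'⟩ h
  cases ε <;> cases ε' <;> simp_all [tailIdx]

theorem exists_tailIdx (k : ℤ) : ∃ ε m, tailIdx ε m = k := by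
  cases k with
  | ofNat m => exact ⟨true, m, rfl⟩
  | negSucc m => exact ⟨false, m, rfl⟩

/-- The points of a half of the cycle of `c`. -/
def tail (f : Equiv.Perm P.Ω) (c : P.Ω) (ε : Bool) : Set P.Ω :=
  Set.range fun k => (f ^ tailIdx ε k) c

theorem small_iff_finite (hκ : P.κ = ℵ₀) {A : Set P.Ω} : P.Small A ↔ A.Finite := by
  rw [Small, hκ, Cardinal.lt_aleph0_iff_set_finite]

theorem eventually_iff_finite (hκ : P.κ = ℵ₀) {p : P.Ω → Prop} :
    (∀ᶠ c in P.fil, p c) ↔ {c | ¬ p c}.Finite := by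
  rw [eventually_iff, small_iff_finite hκ]

theorem tail_inv (hκ : P.κ = ℵ₀) (f : Equiv.Perm P.Ω) (c : P.Ω) (ε : Bool) :
    ∀ᶠ a in P.fil, a ∈ tail f c ε ↔ f a ∈ tail f c ε := by
  rw [eventually_iff_finite hκ]
  -- The boundary between the two halves of the cycle: these are the only points where membership in
  -- the half can change under `f`.
  refine Set.Finite.subset (Set.toFinite {c, (f ^ (-1 : ℤ)) c}) fun a ha => ?_
  by_contra hne
  refine ha ?_
  simp only [Set.mem_insert_iff, Set.mem_singleton_iff, not_or] at hne
  have hf : ∀ k : ℤ, f ((f ^ k) c) = (f ^ (k + 1)) c := fun k => by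
    rw [add_comm, zpow_add, zpow_one, Equiv.Perm.mul_apply]
  constructor
  · rintro ⟨k, rfl⟩
    cases ε with
    | true => exact ⟨k + 1, (hf (Int.ofNat k)).symm⟩
    | false =>
      obtain _ | k := k
      · exact absurd rfl hne.2
      · refine ⟨k, ?_⟩
        change (f ^ (Int.negSucc k)) c = f ((f ^ (Int.negSucc (k + 1))) c)
        rw [hf]
        congr 1
  · rintro ⟨k, hk⟩
    have ha' : a = (f ^ (tailIdx ε k - 1)) c := by
      apply f.injective
      rw [hf, sub_add_cancel]
      exact hk.symm
    cases ε with
    | true =>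
      obtain _ | k := k
      · exact absurd ha' hne.2
      · refine ⟨k, ?_⟩
        rw [ha']
        change (f ^ (Int.ofNat k)) c = (f ^ (Int.ofNat (k + 1) - 1)) c
        congr 2
        simp
    | false =>
      refine ⟨k + 1, ?_⟩
      rw [ha']
      rfl

theorem tail_infinite {f : Equiv.Perm P.Ω} {c : P.Ω}
    (hc : Function.Injective fun k : ℤ => (f ^ k) c) (ε : Bool) : (tail f c ε).Infinite := by
  refine Set.infinite_range_of_injective fun k k' h => ?_
  exact (Prod.ext_iff.1 (tailIdx_injective (a₁ := (ε, k)) (a₂ := (ε, k')) (hc h))).2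

/-- Along the tail, membership in an almost invariant set changes only finitely often, so it is
eventually constant; as the intersection is infinite, the tail is eventually inside `A`. -/
theorem tail_subset_of_inv (hκ : P.κ = ℵ₀) {f : Equiv.Perm P.Ω} {c : P.Ω}
    (hc : Function.Injective fun k : ℤ => (f ^ k) c) (ε : Bool) {A : Set P.Ω}
    (hA : ∀ᶠ a in P.fil, a ∈ A ↔ f a ∈ A) (hinf : ¬ P.Small (A ∩ tail f c ε)) :
    ∀ᶠ a in P.fil, a ∈ tail f c ε → a ∈ A := by
  have hinj : Function.Injective fun k : ℕ => (f ^ tailIdx ε k) c := fun k k' h =>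
    (Prod.ext_iff.1 (tailIdx_injective (a₁ := (ε, k)) (a₂ := (ε, k')) (hc h))).2
  have hstep : ∀ᶠ k in Filter.atTop, ((f ^ tailIdx ε k) c ∈ A ↔ (f ^ tailIdx ε (k + 1)) c ∈ A) := by
    rw [eventually_iff_finite hκ] at hA
    have hf : ∀ k : ℤ, f ((f ^ k) c) = (f ^ (k + 1)) c := fun k => by
      rw [add_comm, zpow_add, zpow_one, Equiv.Perm.mul_apply]
    have h1 := hinj.tendsto_cofinite.eventually (show ∀ᶠ a in Filter.cofinite, (a ∈ A ↔ f a ∈ A)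
      from hA)
    rw [Nat.cofinite_eq_atTop] at h1
    cases ε with
    | true =>
      filter_upwards [h1] with k hk
      rw [hk, hf]
      rfl
    | false =>
      have h2 := (Filter.tendsto_add_atTop_nat 1).eventually h1
      filter_upwards [h2] with k hk
      rw [hk, hf]
      rfl
  obtain ⟨K, hK⟩ := Filter.eventually_atTop.1 hstep
  have hconst : ∀ k, (f ^ tailIdx ε (K + k)) c ∈ A ↔ (f ^ tailIdx ε K) c ∈ A := by
    intro k
    induction k with
    | zero => rfl
    | succ k ih => rw [← ih, hK (K + k) (Nat.le_add_right _ _)]; rfl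
  rw [small_iff_finite hκ] at hinf
  have hfin : ((fun k : ℕ => (f ^ tailIdx ε k) c) '' Set.Iio K).Finite :=
    (Set.finite_Iio K).image _
  by_cases hKA : (f ^ tailIdx ε K) c ∈ A
  · rw [eventually_iff_finite hκ]
    refine hfin.subset ?_
    intro a ha
    simp only [Set.mem_ofPred_eq, Classical.not_imp] at ha
    obtain ⟨⟨k, rfl⟩, hk⟩ := ha
    refine ⟨k, ?_, rfl⟩
    by_contra hlt
    obtain ⟨m, rfl⟩ := Nat.exists_eq_add_of_le (not_lt.1 hlt)
    exact hk ((hconst m).2 hKA)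
  · refine absurd (hfin.subset ?_) hinf
    rintro a ⟨ha, k, rfl⟩
    refine ⟨k, ?_, rfl⟩
    by_contra hlt
    obtain ⟨m, rfl⟩ := Nat.exists_eq_add_of_le (not_lt.1 hlt)
    exact hKA ((hconst m).1 ha)

theorem endOf_tail (hκ : P.κ = ℵ₀) {f : P.SLam} {c : P.Ω}
    (hc : Function.Injective fun k : ℤ => ((f : Equiv.Perm P.Ω) ^ k) c) (ε : Bool)
    {r : Rgn P.G} (hr : P.RReg r (tail (f : Equiv.Perm P.Ω) c ε)) : EndOf (P.coset f) r := by
  refine ⟨fun h => tail_infinite hc ε ((small_iff_finite hκ).1 (hr.eq_one_iff.1 h)),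
    (hr.smul_eq_iff hr f).2 (tail_inv hκ _ _ ε), fun s hs hs1 hsf => ?_⟩
  obtain ⟨B, hB, -⟩ := exists_rreg s
  have h1 := (hB.le_iff hr).1 hs
  rw [hB.eq_iff hr]
  filter_upwards [h1, tail_subset_of_inv hκ hc ε ((hB.smul_eq_iff hB f).1 hsf) fun hsm => hs1
    (hB.eq_one_iff.2 (P.eventually_notMem.1 (by
      filter_upwards [h1, P.eventually_notMem.2 hsm] with a h2 h3 h4
      exact h3 ⟨h4, h2 h4⟩)))] with a h2 h3
  exact ⟨h2, h3⟩

/-- A minimal region lies in a single cycle, which is infinite since finite sets are small. It meets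
one of the two halves of the cycle in an infinite set and then equals that half, up to finitely many
points. -/
theorem EndOf.exists_tail (hκ : P.κ = ℵ₀) {f : P.SLam} {r : Rgn P.G}
    (h : EndOf (P.coset f) r) :
    ∃ (q : Quotient (Equiv.Perm.SameCycle.setoid (f : Equiv.Perm P.Ω))) (ε : Bool),
      (Function.Injective fun k : ℤ => ((f : Equiv.Perm P.Ω) ^ k) q.out) ∧
      P.RReg r (tail (f : Equiv.Perm P.Ω) q.out ε) := by
  obtain ⟨A, hA, -⟩ := exists_rreg r
  obtain ⟨q, hq⟩ := EndOf.exists_cycle h hA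
  have hAinf : A.Infinite := fun hfin => h.1 (hA.eq_one_iff.2 (P.small_of_finite hfin))
  have hq' : ∀ᶠ a in P.fil, a ∈ A → ∃ k : ℤ, ((f : Equiv.Perm P.Ω) ^ k) q.out = a := by
    filter_upwards [hq] with c hc hcA
    exact Quotient.exact (q.out_eq.trans (hc hcA).symm)
  have hinj : Function.Injective fun k : ℤ => ((f : Equiv.Perm P.Ω) ^ k) q.out := by
    by_contra hni
    have hfin : (Set.range fun k : ℤ => ((f : Equiv.Perm P.Ω) ^ k) q.out).Finite := by
      rw [Function.not_injective_iff] at hni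
      obtain ⟨k, l, hkl, hne⟩ := hni
      have hper : ∃ m : ℤ, 0 < m ∧ ((f : Equiv.Perm P.Ω) ^ m) q.out = q.out := by
        have key : ∀ k l : ℤ, k < l → ((f : Equiv.Perm P.Ω) ^ k) q.out =
            ((f : Equiv.Perm P.Ω) ^ l) q.out →
            ∃ m : ℤ, 0 < m ∧ ((f : Equiv.Perm P.Ω) ^ m) q.out = q.out := by
          intro k l hlt heq
          refine ⟨l - k, sub_pos.2 hlt, ((f : Equiv.Perm P.Ω) ^ k).injective ?_⟩
          rw [← Equiv.Perm.mul_apply, ← zpow_add, add_sub_cancel, heq]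
        rcases lt_or_gt_of_ne hne with hlt | hlt
        · exact key k l hlt hkl
        · exact key l k hlt hkl.symm
      obtain ⟨m, hm, hmq⟩ := hper
      have hmul : ∀ j : ℤ, ((f : Equiv.Perm P.Ω) ^ (m * j)) q.out = q.out := by
        intro j
        rw [zpow_mul]
        exact Function.IsFixedPt.perm_zpow hmq j
      refine ((Set.finite_Ico (0 : ℤ) m).image
        fun k : ℤ => ((f : Equiv.Perm P.Ω) ^ k) q.out).subset ?_
      rintro _ ⟨k, rfl⟩
      refine ⟨k % m, ⟨Int.emod_nonneg _ hm.ne', Int.emod_lt_of_pos _ hm⟩, ?_⟩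
      dsimp only
      conv_rhs => rw [← Int.emod_add_mul_ediv k m, zpow_add, Equiv.Perm.mul_apply, hmul]
    refine h.1 (hA.eq_one_iff.2 (P.eventually_notMem.1 ?_))
    filter_upwards [hq', P.eventually_notMem.2 (P.small_of_finite hfin)] with a h1 h2 h3
    exact h2 (h1 h3)
  have hinvA := (hA.smul_eq_iff hA f).1 h.2.1
  have hex : ∃ ε, ¬ P.Small (A ∩ tail (f : Equiv.Perm P.Ω) q.out ε) := by
    by_contra! hcon
    refine h.1 (hA.eq_one_iff.2 (P.eventually_notMem.1 ?_))
    filter_upwards [hq', P.eventually_notMem.2 (hcon true), P.eventually_notMem.2 (hcon false)]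
      with a h1 h2 h3 h4
    obtain ⟨k, hk⟩ := h1 h4
    obtain ⟨ε, m, rfl⟩ := exists_tailIdx k
    cases ε with
    | true => exact h2 ⟨h4, m, hk⟩
    | false => exact h3 ⟨h4, m, hk⟩
  obtain ⟨ε, hε⟩ := hex
  refine ⟨q, ε, hinj, hA.congr ?_⟩
  filter_upwards [exists_rgn_inter h hA (tail_inv hκ _ _ ε) hε,
    tail_subset_of_inv hκ hinj ε hinvA hε] with a h1 h2
  exact ⟨h1, h2⟩

/-! ### Disjoint representatives of the points of a coded set -/

/-- Tails of distinct ends are disjoint, being in different cycles or opposite halves of one.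
Dropping a finite initial part of each tail, by means of `K`, places all of them inside `B`. -/
theorem exists_fan (hκ : P.κ = ℵ₀) (x b : P.G) {B : Set P.Ω} (hB : P.Reg b B) :
    ∃ τ : Pt x b × ℕ ↪ P.Ω, (∀ e, P.RReg e.1 (Set.range fun k => τ (e, k))) ∧
      Set.range τ ⊆ B := by
  obtain ⟨f, rfl⟩ := P.coset_surj x
  choose q ε hinj hreg using fun e : Pt (P.coset f) b => EndOf.exists_tail hκ e.2.1
  have hK : ∀ e, ∃ K, ∀ k, K ≤ k →
      ((f : Equiv.Perm P.Ω) ^ tailIdx (ε e) k) (q e).out ∈ B := by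
    intro e
    have h1 := ((hreg e).le_iff hB.rreg).1 e.2.2
    rw [eventually_iff_finite hκ] at h1
    have hinj' : Function.Injective fun k : ℕ =>
        ((f : Equiv.Perm P.Ω) ^ tailIdx (ε e) k) (q e).out := fun k k' h =>
      (Prod.ext_iff.1 (tailIdx_injective (a₁ := (ε e, k)) (a₂ := (ε e, k')) (hinj e h))).2
    have h2 := hinj'.tendsto_cofinite.eventually
      (show ∀ᶠ a in Filter.cofinite, (a ∈ tail (f : Equiv.Perm P.Ω) (q e).out (ε e) → a ∈ B) from h1)
    rw [Nat.cofinite_eq_atTop] at h2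
    obtain ⟨K, hK⟩ := Filter.eventually_atTop.1 h2
    exact ⟨K, fun k hk => hK k hk ⟨k, rfl⟩⟩
  choose K hK using hK
  have hclass : ∀ e k, Quotient.mk (Equiv.Perm.SameCycle.setoid (f : Equiv.Perm P.Ω))
      (((f : Equiv.Perm P.Ω) ^ tailIdx (ε e) k) (q e).out) = q e := by
    intro e k
    rw [← (q e).out_eq]
    refine Quotient.sound (Equiv.Perm.SameCycle.symm ⟨tailIdx (ε e) k, ?_⟩)
    rw [(q e).out_eq]
  refine ⟨⟨fun x => ((f : Equiv.Perm P.Ω) ^ tailIdx (ε x.1) (K x.1 + x.2)) (q x.1).out, ?_⟩,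
    fun e => ?_, ?_⟩
  · rintro ⟨e, k⟩ ⟨e', k'⟩ h
    dsimp only at h
    have hq : q e = q e' := by rw [← hclass e (K e + k), h, hclass]
    have h1 : ((f : Equiv.Perm P.Ω) ^ tailIdx (ε e) (K e + k)) (q e).out =
        ((f : Equiv.Perm P.Ω) ^ tailIdx (ε e') (K e' + k')) (q e).out := by rw [h, hq]
    have h2 := Prod.ext_iff.1 (tailIdx_injective (a₁ := (ε e, _)) (a₂ := (ε e', _)) (hinj e h1))
    obtain rfl : e = e' := by
      refine Subtype.ext (((hreg e).eq_iff (hreg e')).2 (Filter.Eventually.of_forall fun c => ?_))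
      rw [hq, show ε e = ε e' from h2.1]
    rw [Nat.add_left_cancel h2.2]
  · refine (hreg e).congr ?_
    rw [eventually_iff_finite hκ]
    refine (((Set.finite_Iio (K e)).image fun k : ℕ =>
      ((f : Equiv.Perm P.Ω) ^ tailIdx (ε e) k) (q e).out)).subset fun a ha => ?_
    by_contra hne
    refine ha ⟨?_, ?_⟩
    · rintro ⟨k, rfl⟩
      have : K e ≤ k := by
        by_contra hlt
        exact hne ⟨k, not_le.1 hlt, rfl⟩
      obtain ⟨m, rfl⟩ := Nat.exists_eq_add_of_le this
      exact ⟨m, rfl⟩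
    · rintro ⟨k, rfl⟩
      exact ⟨_, rfl⟩
  · rintro _ ⟨x, rfl⟩
    exact hK _ _ (Nat.le_add_right _ _)

end Params
end
end QuotSym

namespace QuotSym
noncomputable section

theorem trunc_mono {κ a b : Cardinal.{u}} (h : a ≤ b) : trunc κ a ≤ trunc κ b := by
  unfold trunc
  split_ifs with h1 h2
  · exact h
  · exact absurd (h1.trans h) h2
  · exact zero_le
  · exact le_rfl

theorem trunc_eq_zero {κ a : Cardinal.{u}} (h : a < κ) : trunc κ a = 0 := if_neg (not_le.2 h)

namespace Params

variable {P : Params.{u}} {n : ℕ}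

/-! ### Maps between coded sets -/

/-- The disjoint element which witnesses `Cobig b` shows, up to a finite set, that the complement of
`B` is as large as `B`; finite sets are harmless because `μ` is infinite. -/
theorem Cobig.mk_le (hκ : P.κ = ℵ₀) {b : P.G} (hb : Cobig b) {B S : Set P.Ω} (hB : P.Reg b B)
    (hS : S ⊆ B) : #S ≤ #(Sᶜ : Set P.Ω) := by
  by_cases hfin : S.Finite
  · have h1 := Cardinal.lt_aleph0_iff_set_finite.2 hfin
    rw [mk_compl_eq_of_lt (h1.trans_le P.aleph0_le_μ)]
    exact h1.le.trans P.aleph0_le_μ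
  · have hBinf : ℵ₀ ≤ #B := by
      rw [Cardinal.aleph0_le_mk_iff]
      exact (Set.Infinite.mono hS hfin).to_subtype
    obtain ⟨c, hd, hle⟩ := hb
    obtain ⟨C, hC, -⟩ := exists_reg c
    rw [hC.disj_iff hB, eventually_iff_finite hκ] at hd
    rw [hB.cardLe_iff hC, hκ, trunc, if_pos hBinf] at hle
    have hCB : #B ≤ #C := by
      unfold trunc at hle
      split_ifs at hle with h
      · exact hle
      · exact absurd (hBinf.trans hle) (not_le.2 Cardinal.aleph0_pos)
    have h1 : C ⊆ Bᶜ ∪ {a | ¬ (a ∈ C → a ∉ B)} := by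
      intro a ha
      by_cases haB : a ∈ B
      · exact Or.inr fun h => h ha haB
      · exact Or.inl haB
    have h2 : #B ≤ #(Bᶜ : Set P.Ω) := le_of_le_add hBinf
      (hCB.trans ((Cardinal.mk_le_mk_of_subset h1).trans (Cardinal.mk_union_le _ _)))
      ((Cardinal.lt_aleph0_iff_set_finite.2 hd).trans_le hBinf)
    exact (Cardinal.mk_le_mk_of_subset hS).trans
      (h2.trans (Cardinal.mk_le_mk_of_subset (Set.compl_subset_compl.2 hS)))

theorem mk_Pt_lt (hκ : P.κ = ℵ₀) (x b : P.G) : #(Pt x b) < P.lam := by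
  obtain ⟨B, hB, hlt⟩ := exists_reg b
  obtain ⟨τ, -, hτ⟩ := exists_fan hκ x b hB
  refine lt_of_le_of_lt (Cardinal.mk_le_of_injective (f := fun e => ⟨τ (e, 0), hτ ⟨_, rfl⟩⟩) ?_) hlt
  intro e e' h
  exact (Prod.ext_iff.1 (τ.injective (Subtype.ext_iff.1 h))).1

theorem mk_prod_nat_lt {I : Type u} (h : #I < P.lam) : #(I × ℕ) < P.lam := by
  rw [Cardinal.mk_prod]
  simp only [Cardinal.lift_uzero, Cardinal.mk_nat, Cardinal.lift_aleph0]
  exact Cardinal.mul_lt_of_lt P.aleph0_lt_lam.le h P.aleph0_lt_lam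

/-- Each point of a coded set is represented by a sequence, all sequences being disjoint. Mapping
these sequences onto each other termwise is an injection that leaves enough room, so it extends to
an element of the group. Thus quantification over elements covers all maps between coded sets that
are injective. -/
theorem exists_smul_eq (hκ : P.κ = ℵ₀) {x b x' b' : P.G} (hb : Cobig b) (hb' : Cobig b')
    {D : Set (Rgn P.G)} (hD : D ⊆ Pt x b) (θ : D ↪ Pt x' b') :
    ∃ z : P.G, ∀ e : D, z • e.1 = (θ e).1 := by
  obtain ⟨B, hB, -⟩ := exists_reg b
  obtain ⟨B', hB', -⟩ := exists_reg b'
  obtain ⟨τ, hτ1, hτ2⟩ := exists_fan hκ x b hB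
  obtain ⟨τ', hτ1', hτ2'⟩ := exists_fan hκ x' b' hB'
  let φ : D × ℕ ↪ P.Ω := ((Set.embeddingOfSubset _ _ hD).prodMap (Function.Embedding.refl ℕ)).trans τ
  let ψ : D × ℕ ↪ P.Ω := (θ.prodMap (Function.Embedding.refl ℕ)).trans τ'
  have hφ : Set.range φ ⊆ B := by
    rintro _ ⟨a, rfl⟩
    exact hτ2 ⟨_, rfl⟩
  have hψ : Set.range ψ ⊆ B' := by
    rintro _ ⟨a, rfl⟩
    exact hτ2' ⟨_, rfl⟩
  obtain ⟨z, hz⟩ := exists_extend_of_le φ ψ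
    (mk_prod_nat_lt ((Cardinal.mk_le_mk_of_subset hD).trans_lt (mk_Pt_lt hκ x b)))
    (by rw [← Cardinal.mk_range_eq _ φ.injective]; exact Cobig.mk_le hκ hb hB hφ)
    (by rw [← Cardinal.mk_range_eq _ ψ.injective]; exact Cobig.mk_le hκ hb' hB' hψ)
  refine ⟨P.coset z, fun e => ((hτ1 ⟨e.1, hD e.2⟩).smul_eq_iff (hτ1' (θ e)) z).2
    (Filter.Eventually.of_forall fun c => ⟨?_, ?_⟩)⟩
  · rintro ⟨k, rfl⟩
    exact ⟨k, (hz (e, k)).symm⟩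
  · rintro ⟨k, hk⟩
    exact ⟨k, (z : Equiv.Perm P.Ω).injective ((hz (e, k)).trans hk)⟩

theorem exists_tuple_smul_eq (hκ : P.κ = ℵ₀) {x b : P.G} (hb : Cobig b)
    (σ : Fin n → Equiv.Perm (Pt x b)) :
    ∃ (y : Fin n → P.G) (h : Acts x b y), actPerm h = σ := by
  choose y hy using fun i => exists_smul_eq hκ hb hb subset_rfl (σ i).toEmbedding
  have h : Acts x b y := by
    intro i p hp
    refine ⟨?_, ?_⟩
    · rw [hy i ⟨p, hp⟩]
      exact (σ i ⟨p, hp⟩).2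
    · have h1 := hy i ((σ i).symm ⟨p, hp⟩)
      have h2 : (y i)⁻¹ • p = ((σ i).symm ⟨p, hp⟩).1 := by
        rw [inv_smul_eq_iff, h1]
        simp
      rw [h2]
      exact ((σ i).symm ⟨p, hp⟩).2
  exact ⟨y, h, funext fun i => Equiv.ext fun p => Subtype.ext (hy i p)⟩

theorem Pt_mono {G : Type u} [Group G] {x b c : G} (h : Rgn.mk c ≤ Rgn.mk b) : Pt x c ⊆ Pt x b := by
  rintro p ⟨hp, hle⟩
  refine ⟨hp, ?_⟩
  obtain ⟨a, rfl⟩ := Rgn.mk_surjective p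
  exact Sub.trans hle h

/-- Each point below `c` contributes an element of `C` on its own sequence, and the sequences are
disjoint. -/
theorem mk_le_of_mem_Pt (hκ : P.κ = ℵ₀) {x b c : P.G} {C : Set P.Ω} (hC : P.Reg c C)
    {D : Set (Rgn P.G)} (hD : D ⊆ Pt x b) (h : ∀ p, p ∈ D → p ≤ Rgn.mk c) : #D ≤ #C := by
  obtain ⟨B, hB, -⟩ := exists_reg b
  obtain ⟨τ, hτ1, hτ2⟩ := exists_fan hκ x b hB
  have hex : ∀ e : D, ∃ k, τ (⟨e.1, hD e.2⟩, k) ∈ C := by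
    intro e
    have h1 := ((hτ1 ⟨e.1, hD e.2⟩).le_iff hC.rreg).1 (h e.1 e.2)
    have h2 : ¬ P.Small (Set.range fun k => τ (⟨e.1, hD e.2⟩, k)) := by
      rw [small_iff_finite hκ]
      exact Set.infinite_range_of_injective fun k k' hk => (Prod.ext_iff.1 (τ.injective hk)).2
    obtain ⟨_, ⟨k, rfl⟩, hk⟩ := exists_mem_of_not_small h2 h1
    exact ⟨k, hk ⟨k, rfl⟩⟩
  choose k hk using hex
  refine Cardinal.mk_le_of_injective (f := fun e => ⟨_, hk e⟩) fun e e' he => ?_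
  have h1 : (⟨e.1, hD e.2⟩ : Pt x b) = ⟨e'.1, hD e'.2⟩ :=
    (Prod.ext_iff.1 (τ.injective (Subtype.ext_iff.1 he))).1
  exact Subtype.ext (Subtype.mk.inj h1)

/-- Take the union of the sequences that represent the points in `D`. It almost contains a sequence
only if it contains it, so quantification over elements also covers all subsets of a coded set. The
cardinality of `C` is needed for `App`. -/
theorem exists_Pt_eq (hκ : P.κ = ℵ₀) {x b : P.G} {D : Set (Rgn P.G)} (hD : D ⊆ Pt x b) :
    ∃ c C, P.Reg c C ∧ Rgn.mk c ≤ Rgn.mk b ∧ Pt x c = D ∧ #C = #D * ℵ₀ := by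
  obtain ⟨B, hB, -⟩ := exists_reg b
  obtain ⟨τ, hτ1, hτ2⟩ := exists_fan hκ x b hB
  let φ : D × ℕ ↪ P.Ω := ((Set.embeddingOfSubset _ _ hD).prodMap (Function.Embedding.refl ℕ)).trans τ
  have hcard : #(Set.range φ) = #(D × ℕ) := Cardinal.mk_range_eq _ φ.injective
  obtain ⟨c, hc⟩ := exists_elem (P := P) (A := Set.range φ) (hcard.trans_lt
    (mk_prod_nat_lt ((Cardinal.mk_le_mk_of_subset hD).trans_lt (mk_Pt_lt hκ x b))))
  have hcb : Rgn.mk c ≤ Rgn.mk b := (hc.rreg.le_iff hB.rreg).2 (Filter.Eventually.of_forall (by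
    rintro _ ⟨a, rfl⟩
    exact hτ2 ⟨_, rfl⟩))
  refine ⟨c, _, hc, hcb, ?_, ?_⟩
  · ext p
    constructor
    · intro hp
      have hp' := Pt_mono hcb hp
      have h1 := ((hτ1 ⟨p, hp'⟩).le_iff hc.rreg).1 hp.2
      have h2 : ¬ P.Small (Set.range fun k => τ (⟨p, hp'⟩, k)) := by
        rw [small_iff_finite hκ]
        exact Set.infinite_range_of_injective fun k k' hk => (Prod.ext_iff.1 (τ.injective hk)).2
      obtain ⟨_, ⟨k, rfl⟩, hk⟩ := exists_mem_of_not_small h2 h1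
      obtain ⟨⟨d, m⟩, hdm⟩ := hk ⟨k, rfl⟩
      have h3 := (Prod.ext_iff.1 (τ.injective hdm)).1
      have h4 : d.1 = p := Subtype.ext_iff.1 h3
      exact h4 ▸ d.2
    · intro hp
      refine ⟨(hD hp).1, ((hτ1 ⟨p, hD hp⟩).le_iff hc.rreg).2 (Filter.Eventually.of_forall ?_)⟩
      rintro _ ⟨k, rfl⟩
      exact ⟨(⟨p, hp⟩, k), rfl⟩
  · rw [hcard, Cardinal.mk_prod]
    simp

/-- Dedekind's criterion: `FinPt` says that every injection of the set into itself which is induced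
by the group is onto, and by `exists_smul_eq` all injections are induced. -/
theorem finPt_iff (hκ : P.κ = ℵ₀) {x b c : P.G} (hb : Cobig b) (hc : Rgn.mk c ≤ Rgn.mk b) :
    FinPt x c ↔ (Pt x c).Finite := by
  constructor
  · intro h
    by_contra hinf
    have hinf' : Infinite (Pt x c) := Set.infinite_coe_iff.2 hinf
    obtain ⟨g⟩ : Nonempty (Option (Pt x c) ↪ Pt x c) := by
      rw [← Cardinal.le_def, Cardinal.mk_option,
        Cardinal.add_one_eq (Cardinal.aleph0_le_mk (Pt x c))]
    let θ : Pt x c ↪ Pt x b :=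
      (Function.Embedding.some.trans g).trans (Set.embeddingOfSubset _ _ (Pt_mono hc))
    obtain ⟨z, hz⟩ := exists_smul_eq hκ hb hb (Pt_mono hc) θ
    have h1 := h z (fun p hp => by
      rw [hz ⟨p, hp⟩]
      exact (g (some ⟨p, hp⟩)).2) (g none).1 (g none).2
    have h2 := hz ⟨_, h1⟩
    rw [smul_inv_smul] at h2
    have h3 : g none = g (some ⟨_, h1⟩) := Subtype.ext h2
    simpa using g.injective h3
  · intro hfin z hz p hp
    have hfin' := hfin.to_subtype
    have hinj : Function.Injective fun q : Pt x c => (⟨z • q.1, hz q.1 q.2⟩ : Pt x c) :=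
      fun q q' h => Subtype.ext (MulAction.injective z (Subtype.ext_iff.1 h))
    obtain ⟨q, hq⟩ := Finite.surjective_of_injective hinj ⟨p, hp⟩
    have : z • q.1 = p := Subtype.ext_iff.1 hq
    rw [← this, inv_smul_smul]
    exact q.2

/-! ### Every set of the right size is coded -/

/-- The translation of `X × ℤ` has one infinite cycle for each element of `X`, and only the positive
halves are put below `b`, so each cycle contributes one end. A second copy of the set leaves the
room that `Cobig` asks for. -/
theorem exists_coded (hκ : P.κ = ℵ₀) {X : Type u} (hX : #X < P.lam) :
    ∃ x b : P.G, Cobig b ∧ Nonempty (Pt x b ≃ X) := by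
  have hXμ : #X ≤ P.μ := Order.lt_succ_iff.1 (hX.trans_le P.le)
  have hXZ : #(X × ℤ) < P.lam := by
    rw [Cardinal.mk_prod]
    simp only [Cardinal.lift_uzero, Cardinal.mk_int, Cardinal.lift_aleph0]
    exact Cardinal.mul_lt_of_lt P.aleph0_lt_lam.le hX P.aleph0_lt_lam
  obtain ⟨ι⟩ : Nonempty ((X × ℤ) × Fin 2 ↪ P.Ω) := by
    rw [← Cardinal.le_def, Cardinal.mk_prod, Cardinal.mk_prod]
    simp only [Cardinal.lift_uzero, Cardinal.mk_int, Cardinal.lift_aleph0, Cardinal.mk_fin,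
      Cardinal.lift_natCast]
    calc #X * ℵ₀ * (2 : ℕ) ≤ P.μ * P.μ * P.μ := by
          gcongr
          · exact P.aleph0_le_μ
          · exact (Cardinal.natCast_lt_aleph0).le.trans P.aleph0_le_μ
      _ = P.μ := by rw [Cardinal.mul_eq_self P.aleph0_le_μ, Cardinal.mul_eq_self P.aleph0_le_μ]
  let ι₀ : X × ℤ ↪ P.Ω := ⟨fun a => ι (a, 0), fun a b h => (Prod.ext_iff.1 (ι.injective h)).1⟩
  obtain ⟨f', hf', -⟩ := exists_extendPerm (n := 1)
    (fun _ => Equiv.prodCongr (Equiv.refl X) (Equiv.addRight (1 : ℤ))) hXZ ι₀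
  set f := f' 0 with hfdef
  have hf : ∀ e m, (f : Equiv.Perm P.Ω) (ι₀ (e, m)) = ι₀ (e, m + 1) := fun e m => (hf' 0 (e, m)).symm
  have hfk : ∀ (k : ℤ) e m, ((f : Equiv.Perm P.Ω) ^ k) (ι₀ (e, m)) = ι₀ (e, m + k) := by
    intro k
    induction k using Int.induction_on with
    | zero => simp
    | succ i ih =>
      intro e m
      rw [zpow_add_one, Equiv.Perm.mul_apply, hf, ih]
      congr 2
      ring
    | pred i ih =>
      intro e m
      have : (f : Equiv.Perm P.Ω)⁻¹ (ι₀ (e, m)) = ι₀ (e, m - 1) := by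
        rw [Equiv.Perm.inv_eq_iff_eq, hf, sub_add_cancel]
      rw [zpow_sub_one, Equiv.Perm.mul_apply, this, ih]
      congr 2
      ring
  have hblock : ∀ j : Fin 2, #(Set.range fun a : X × ℕ => ι ((a.1, (a.2 : ℤ)), j)) = #(X × ℕ) := by
    intro j
    refine Cardinal.mk_range_eq _ fun a a' h => ?_
    have := ι.injective h
    simp only [Prod.mk.injEq, Nat.cast_inj, and_true] at this
    exact Prod.ext this.1 this.2
  have hXN : #(X × ℕ) < P.lam := mk_prod_nat_lt hX
  set B : Set P.Ω := Set.range fun a : X × ℕ => ι ((a.1, (a.2 : ℤ)), 0) with hBdef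
  obtain ⟨b, hb⟩ := exists_elem (P := P) (A := B) ((hblock 0).trans_lt hXN)
  obtain ⟨c, hc⟩ := exists_elem (P := P) ((hblock 1).trans_lt hXN)
  have hcobig : Cobig b := by
    refine ⟨c, (hc.disj_iff hb).2 (Filter.Eventually.of_forall ?_), (hb.cardLe_iff hc).2 ?_⟩
    · rintro _ ⟨a, rfl⟩ ⟨a', ha'⟩
      have := ι.injective ha'
      simp at this
    · rw [hblock 0, hblock 1]
  have hinj : ∀ e m, Function.Injective fun k : ℤ => ((f : Equiv.Perm P.Ω) ^ k) (ι₀ (e, m)) := by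
    intro e m k k' h
    simp only [hfk] at h
    simpa using ι₀.injective h
  have hmem : ∀ e a, a ∈ tail (f : Equiv.Perm P.Ω) (ι₀ (e, 0)) true ↔
      ∃ k : ℕ, ι₀ (e, (k : ℤ)) = a := by
    intro e a
    refine exists_congr fun k => ?_
    dsimp only
    rw [hfk, zero_add]
    rfl
  have hsub : ∀ e, tail (f : Equiv.Perm P.Ω) (ι₀ (e, 0)) true ⊆ B := by
    intro e a ha
    obtain ⟨k, rfl⟩ := (hmem e a).1 ha
    exact ⟨(e, k), rfl⟩
  choose r hr using fun e => exists_rgn (P := P)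
    (A := tail (f : Equiv.Perm P.Ω) (ι₀ (e, 0)) true)
    ((Cardinal.mk_le_mk_of_subset (hsub e)).trans_lt hb.card_lt)
  have hend : ∀ e, EndOf (P.coset f) (r e) := fun e => endOf_tail hκ (hinj e 0) true (hr e)
  refine ⟨P.coset f, b, hcobig, ⟨(Equiv.ofBijective (fun e => ⟨r e, hend e,
    ((hr e).le_iff hb.rreg).2 (Filter.Eventually.of_forall (hsub e))⟩) ⟨?_, ?_⟩).symm⟩⟩
  · intro e e' h
    have h1 := ((hr e).eq_iff (hr e')).1 (Subtype.ext_iff.1 h)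
    have h2 : ¬ P.Small (tail (f : Equiv.Perm P.Ω) (ι₀ (e, 0)) true) := by
      rw [small_iff_finite hκ]
      exact tail_infinite (hinj e 0) true
    obtain ⟨a, ha, h3⟩ := exists_mem_of_not_small h2 h1
    obtain ⟨k, rfl⟩ := (hmem e a).1 ha
    obtain ⟨k', hk'⟩ := (hmem e' _).1 (h3.1 ha)
    exact (Prod.ext_iff.1 (ι₀.injective hk')).1.symm
  -- An end below `b` has points in `B`, so it lies in one of the translation cycles. Its points in
  -- `B` belong to the positive half, and minimality of `r e` makes it equal to `r e`.
  · rintro ⟨s, hs, hsb⟩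
    obtain ⟨q, ε, hq, hsr⟩ := EndOf.exists_tail hκ hs
    have h1 := (hsr.le_iff hb.rreg).1 hsb
    have h2 : ¬ P.Small (tail (f : Equiv.Perm P.Ω) q.out ε) := by
      rw [small_iff_finite hκ]
      exact tail_infinite hq ε
    obtain ⟨a, ⟨k, rfl⟩, hk⟩ := exists_mem_of_not_small h2 h1
    obtain ⟨⟨e, m⟩, hem⟩ := hk ⟨k, rfl⟩
    have hout : q.out = ι₀ (e, m - tailIdx ε k) := by
      apply ((f : Equiv.Perm P.Ω) ^ tailIdx ε k).injective
      rw [hfk, sub_add_cancel]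
      exact hem.symm
    have hle : s ≤ r e := by
      rw [hsr.le_iff (hr e)]
      filter_upwards [h1] with a ha hat
      have haB := ha hat
      obtain ⟨j, rfl⟩ := hat
      obtain ⟨⟨e', m'⟩, hem'⟩ := haB
      rw [hmem]
      dsimp only at hem' ⊢
      rw [hout, hfk] at hem' ⊢
      have h3 : (e', (m' : ℤ)) = (e, (m : ℤ) - tailIdx ε k + tailIdx ε j) := ι₀.injective hem'
      rw [Prod.mk.injEq] at h3
      exact ⟨m', by rw [h3.2]⟩
    exact ⟨e, Subtype.ext ((hend e).2.2 s hle hs.1 hs.2.1).symm⟩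

theorem exists_endOf_iff : (∃ (x : P.G) (r : Rgn P.G), EndOf x r) ↔ P.κ = ℵ₀ := by
  constructor
  · rintro ⟨x, r, h⟩
    by_contra hne
    exact not_endOf (lt_of_le_of_ne P.aleph0_le (Ne.symm hne)) x r h
  · intro hκ
    have h1 : #(PUnit.{u + 1}) < P.lam := by
      rw [Cardinal.mk_punit]
      exact Cardinal.one_lt_aleph0.trans P.aleph0_lt_lam
    obtain ⟨x, b, -, ⟨e⟩⟩ := exists_coded hκ h1
    exact ⟨x, _, (e.symm PUnit.unit).2.1⟩

end Params
end
end QuotSym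

/-! ### Codes of transitive tuples and the sorts `IS_n`, for `κ = ℵ₀` -/

namespace QuotSym
noncomputable section

section

variable {X : Type v} {Z : Type w} {n : ℕ}

theorem HasType.orbit_eq_univ {σ : Fin n → Equiv.Perm X} {t : IsoType n}
    (h : HasType σ Set.univ t) (a : X) : orbit σ a = Set.univ := by
  obtain ⟨b, hb⟩ := h.eq_orbit
  exact (orbit_eq (hb ▸ Set.mem_univ a)).symm.trans hb.symm

theorem HasType.exists_mem {σ : Fin n → Equiv.Perm X} {B : Set X} {t : IsoType n}
    (h : HasType σ B t) : ∃ b, b ∈ B := by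
  obtain ⟨b, rfl⟩ := h.eq_orbit
  exact ⟨b, mem_orbit_self σ b⟩

theorem HasType.exists_map {σ : Fin n → Equiv.Perm X} {τ : Fin n → Equiv.Perm Z} {B : Set Z}
    {t : IsoType n} (h : HasType σ Set.univ t) (h' : HasType τ B t) :
    ∃ φ : X ↪ Z, (∀ i a, φ (σ i a) = τ i (φ a)) ∧ Set.range φ = B := by
  obtain ⟨e, he, hr, hσ⟩ := h.exists_out
  obtain ⟨e', he', hr', hτ⟩ := h'.exists_out
  let E := Equiv.ofBijective e ⟨he, Set.range_eq_univ.1 hr⟩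
  have hE : ∀ a, e (E.symm a) = a := E.apply_symm_apply
  refine ⟨⟨fun a => e' (E.symm a), he'.comp E.symm.injective⟩, fun i a => ?_, ?_⟩
  · change e' (E.symm (σ i a)) = τ i (e' (E.symm a))
    rw [← hτ]
    congr 1
    apply he
    rw [hE, hσ, hE]
  · rw [← hr']
    exact E.symm.surjective.range_comp e'

end

namespace Params

variable {P : Params.{u}} {n : ℕ}

/-- The code `(x, b, y)` represents the type `t`. -/
def CodeIS (x b : P.G) (y : Fin n → P.G) (t : P.IS n) : Prop :=
  Cobig b ∧ ∃ h : Acts x b y, HasType (actPerm h) Set.univ t.1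

theorem counted_iff {x b : P.G} {y : Fin n → P.G} (h : Acts x b y) (p : Pt x b) :
    Counted y p.1 ↔ p ∈ P.Dset (actPerm h) := by
  rw [Counted, fullSupp_iff, ← imp_iff_not_or]
  refine imp_congr_right fun _ => exists_congr fun i => ?_
  rw [Ne, Ne, Subtype.ext_iff]
  rfl

theorem isInv_of_le {x b c : P.G} {y : Fin n → P.G} (h : Acts x b y)
    (hc : ∀ i, ∀ p, p ∈ Pt x b → p ≤ Rgn.mk c → y i • p ≤ Rgn.mk c ∧ (y i)⁻¹ • p ≤ Rgn.mk c) :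
    IsInv (actPerm h) {p | p.1 ≤ Rgn.mk c} := by
  intro i a
  constructor
  · intro h1
    have := (hc i _ (actPerm h i a).2 h1).2
    change (y i)⁻¹ • y i • a.1 ≤ _ at this
    rwa [inv_smul_smul] at this
  · exact fun h1 => (hc i a.1 a.2 h1).1

/-- The last clause of `IsCode` quantifies over all subsets of the coded set, by `exists_Pt_eq`, and
so expresses transitivity: test it on the orbit of one point. The counted point excludes the trivial
type when `lam ≤ μ`. -/
theorem isCode_iff (hκ : P.κ = ℵ₀) {x b : P.G} {y : Fin n → P.G} :
    IsCode x b y ↔ ∃ t, CodeIS x b y t := by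
  constructor
  · rintro ⟨hb, h, ⟨p, hp, hpc⟩, hc⟩
    set σ := actPerm h with hσ
    have huniv : orbit σ ⟨p, hp⟩ = Set.univ := by
      set D : Set (Rgn P.G) := Subtype.val '' orbit σ ⟨p, hp⟩
      have hD : D ⊆ Pt x b := by
        rintro _ ⟨a, -, rfl⟩
        exact a.2
      obtain ⟨c, -, -, -, hcD, -⟩ := exists_Pt_eq hκ hD
      have hmem : ∀ a : Pt x b, a.1 ≤ Rgn.mk c ↔ a ∈ orbit σ ⟨p, hp⟩ := by
        intro a
        have : a.1 ≤ Rgn.mk c ↔ a.1 ∈ Pt x c := ⟨fun h => ⟨a.2.1, h⟩, fun h => h.2⟩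
        rw [this, hcD]
        exact Subtype.val_injective.mem_set_image
      refine Set.eq_univ_of_forall fun a => (hmem a).1 (hc c ?_ ⟨p, hp, ?_⟩ a.1 a.2)
      · intro i q hq hqc
        have hq' := (hmem ⟨q, hq⟩).1 hqc
        refine ⟨(hmem (σ i ⟨q, hq⟩)).2 ((isInv_orbit σ _ i _).2 hq'), ?_⟩
        refine (hmem ((σ i)⁻¹ ⟨q, hq⟩)).2 ((isInv_orbit σ _ i _).1 ?_)
        rwa [Equiv.Perm.coe_inv, Equiv.apply_symm_apply]
      · exact (hmem ⟨p, hp⟩).2 (mem_orbit_self _ _)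
    obtain ⟨t, ht⟩ := exists_IS (P := P) ((counted_iff h ⟨p, hp⟩).1 hpc)
    exact ⟨t, hb, h, huniv ▸ ht⟩
  · rintro ⟨t, hb, h, ht⟩
    obtain ⟨p, -⟩ := ht.exists_mem
    have ht' : HasType (actPerm h) (orbit (actPerm h) p) t.1 := ht.orbit_eq_univ p ▸ ht
    refine ⟨hb, h, ⟨p.1, p.2, (counted_iff h p).2 (mem_Dset_of_hasType ht')⟩, ?_⟩
    rintro c hc ⟨q, hq, hqc⟩ r hr
    have := (isInv_of_le h hc).orbit_subset (a := ⟨q, hq⟩) hqc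
    rw [ht.orbit_eq_univ] at this
    exact this (Set.mem_univ ⟨r, hr⟩)

theorem CodeIS.unique {x b : P.G} {y : Fin n → P.G} {t t' : P.IS n} (h : CodeIS x b y t)
    (h' : CodeIS x b y t') : t = t' := by
  obtain ⟨-, h, ht⟩ := h
  obtain ⟨-, h', ht'⟩ := h'
  exact Subtype.ext (ht.unique ht')

/-- Transport the action to a coded set of the same size; all its permutations are induced by
elements of the group. -/
theorem exists_code_of_perm (hκ : P.κ = ℵ₀) {X : Type u} (hX : #X < P.lam)
    (ρ : Fin n → Equiv.Perm X) : ∃ (x b : P.G) (y : Fin n → P.G) (h : Acts x b y) (e : X ≃ Pt x b),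
      Cobig b ∧ ∀ i a, e (ρ i a) = actPerm h i (e a) := by
  obtain ⟨x, b, hb, ⟨e⟩⟩ := exists_coded hκ hX
  obtain ⟨y, h, hy⟩ := exists_tuple_smul_eq hκ hb fun i => (e.trans (ρ i)).trans e.symm
  refine ⟨x, b, y, h, e.symm, hb, fun i a => ?_⟩
  rw [hy]
  simp

theorem exists_codeIS (hκ : P.κ = ℵ₀) (t : P.IS n) :
    ∃ (x b : P.G) (y : Fin n → P.G), CodeIS x b y t := by
  have h1 : #(ULift.{u} t.1.out.A) < P.lam := by
    rw [Cardinal.mk_uLift]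
    refine lt_of_le_of_lt ?_ P.aleph0_lt_lam
    simp
  obtain ⟨x, b, y, h, e, hb, he⟩ := exists_code_of_perm hκ h1
    fun i => Equiv.ulift.trans ((t.1.out.g i).trans Equiv.ulift.symm)
  exact ⟨x, b, y, hb, h, t.1.out, t.1.out_is, fun a => e ⟨a⟩,
    fun a a' haa' => by simpa using e.injective haa', Set.range_eq_univ.2 fun p => by
      obtain ⟨⟨a⟩, rfl⟩ := e.surjective p
      exact ⟨a, rfl⟩, fun i a => he i ⟨a⟩⟩

/-! ### Embeddings of coded tuples -/

/-- The map of coded sets given by an element of the group. -/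
def embFun {x' b' x b z : P.G} {y' y : Fin n → P.G} (hz : Emb x' b' y' x b y z) :
    Pt x' b' ↪ Pt x b :=
  ⟨fun p => ⟨z • p.1, hz.1 p.1 p.2⟩, fun _ _ h =>
    Subtype.ext (MulAction.injective z (Subtype.ext_iff.1 h))⟩

theorem embFun_apply {x' b' x b z : P.G} {y' y : Fin n → P.G} (hz : Emb x' b' y' x b y z)
    (h' : Acts x' b' y') (h : Acts x b y) (i : Fin n) (p : Pt x' b') :
    embFun hz (actPerm h' i p) = actPerm h i (embFun hz p) :=
  Subtype.ext (hz.2 i p.1 p.2)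

theorem mem_range_embFun {x' b' x b z : P.G} {y' y : Fin n → P.G} (hz : Emb x' b' y' x b y z)
    (p : Pt x b) : p ∈ Set.range (embFun hz) ↔ z⁻¹ • p.1 ∈ Pt x' b' := by
  constructor
  · rintro ⟨q, rfl⟩
    change z⁻¹ • z • q.1 ∈ _
    rw [inv_smul_smul]
    exact q.2
  · intro h
    exact ⟨⟨_, h⟩, Subtype.ext (smul_inv_smul z p.1)⟩

theorem exists_emb (hκ : P.κ = ℵ₀) {x' b' x b : P.G} {y' y : Fin n → P.G} (hb' : Cobig b')
    (hb : Cobig b) (h' : Acts x' b' y') (h : Acts x b y) (φ : Pt x' b' ↪ Pt x b)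
    (hφ : ∀ i p, φ (actPerm h' i p) = actPerm h i (φ p)) :
    ∃ (z : P.G) (hz : Emb x' b' y' x b y z), embFun hz = φ := by
  obtain ⟨z, hz⟩ := exists_smul_eq hκ hb' hb subset_rfl φ
  refine ⟨z, ⟨fun p hp => ?_, fun i p hp => ?_⟩, ?_⟩
  · rw [hz ⟨p, hp⟩]
    exact (φ ⟨p, hp⟩).2
  · have h1 := hz (actPerm h' i ⟨p, hp⟩)
    rw [hφ] at h1
    change z • y' i • p = y i • (φ ⟨p, hp⟩).1 at h1
    rw [h1, ← hz ⟨p, hp⟩]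
  · ext p
    exact hz p

/-- An equivariant embedding maps an orbit onto an orbit, so between transitive tuples it is
automatically an isomorphism, and `Emb` need not demand surjectivity. -/
theorem CodeIS.eq_iff (hκ : P.κ = ℵ₀) {x b x' b' : P.G} {y y' : Fin n → P.G} {t t' : P.IS n}
    (h : CodeIS x b y t) (h' : CodeIS x' b' y' t') :
    (∃ z, Emb x b y x' b' y' z) ↔ t = t' := by
  obtain ⟨hb, h, ht⟩ := h
  obtain ⟨hb', h', ht'⟩ := h'
  constructor
  · rintro ⟨z, hz⟩
    obtain ⟨p, -⟩ := ht.exists_mem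
    have h1 := hasType_image (σ := actPerm h) (τ := actPerm h') (φ := embFun hz) (c := p)
      (fun a _ i => embFun_apply hz h h' i a) (embFun hz).injective.injOn t.1
    rw [ht.orbit_eq_univ, ht'.orbit_eq_univ] at h1
    exact Subtype.ext ((h1.2 ht).unique ht')
  · rintro rfl
    obtain ⟨φ, hφ, -⟩ := ht.exists_map ht'
    obtain ⟨z, hz, -⟩ := exists_emb hκ hb hb' h h' φ hφ
    exact ⟨z, hz⟩

theorem CodeIS.exists_equiv {x b : P.G} {y : Fin n → P.G} {t : P.IS n} (h : Acts x b y)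
    (ht : HasType (actPerm h) Set.univ t.1) : ∃ e : t.1.out.A ≃ Pt x b,
      ∀ i a, e (t.1.out.g i a) = actPerm h i (e a) := by
  obtain ⟨e, he, hr, hσ⟩ := ht.exists_out
  exact ⟨Equiv.ofBijective e ⟨he, Set.range_eq_univ.1 hr⟩, hσ⟩

theorem CodeIS.eq1_iff {x b : P.G} {y : Fin 2 → P.G} {t : P.IS 2} (h : CodeIS x b y t) :
    (∀ p, p ∈ Pt x b → y 0 • p = y 1 • p) ↔ P.Eq1 t := by
  obtain ⟨hb, h, ht⟩ := h
  obtain ⟨e, he⟩ := CodeIS.exists_equiv h ht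
  rw [Eq1_iff]
  constructor
  · intro hp m
    apply e.injective
    rw [he, he]
    exact Subtype.ext (hp _ (e m).2)
  · intro hm p hp
    obtain ⟨m, hmp⟩ := e.surjective ⟨p, hp⟩
    have := congrArg e (hm m)
    rw [he, he, hmp] at this
    exact Subtype.ext_iff.1 this

theorem CodeIS.prod1_iff {x b : P.G} {y : Fin 3 → P.G} {t : P.IS 3} (h : CodeIS x b y t) :
    (∀ p, p ∈ Pt x b → y 0 • y 1 • p = y 2 • p) ↔ P.Prod1 t := by
  obtain ⟨hb, h, ht⟩ := h
  obtain ⟨e, he⟩ := CodeIS.exists_equiv h ht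
  rw [Prod1_iff]
  constructor
  · intro hp m
    apply e.injective
    rw [he, he, he]
    exact Subtype.ext (hp _ (e m).2)
  · intro hm p hp
    obtain ⟨m, hmp⟩ := e.surjective ⟨p, hp⟩
    have := congrArg e (hm m)
    rw [he, he, he, hmp] at this
    exact Subtype.ext_iff.1 this

theorem acts_initTuple {x b : P.G} {y : Fin (n + 1) → P.G} (h : Acts x b y) :
    Acts x b (initTuple y) := fun i => h i.castSucc

theorem CodeIS.proj1_iff (hκ : P.κ = ℵ₀) {x b x' b' : P.G} {y : Fin (n + 1) → P.G}
    {y' : Fin n → P.G} {t : P.IS (n + 1)} {t' : P.IS n} (h : CodeIS x b y t)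
    (h' : CodeIS x' b' y' t') : (∃ z, Emb x' b' y' x b (initTuple y) z) ↔ P.Proj1 t t' := by
  obtain ⟨hb, h, ht⟩ := h
  obtain ⟨hb', h', ht'⟩ := h'
  obtain ⟨e, he⟩ := CodeIS.exists_equiv h ht
  have hi := acts_initTuple h
  have key : ∀ m, HasType (actPerm hi) (orbit (actPerm hi) (e m)) t'.1 ↔
      HasType (initTuple t.1.out.g) (orbit (initTuple t.1.out.g) m) t'.1 := fun m =>
    hasType_image (fun a _ i => he i.castSucc a) e.injective.injOn t'.1
  rw [Proj1_iff]
  constructor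
  · rintro ⟨z, hz⟩
    obtain ⟨p, -⟩ := ht'.exists_mem
    have h1 := hasType_image (σ := actPerm h') (τ := actPerm hi) (φ := embFun hz) (c := p)
      (fun a _ i => embFun_apply hz h' hi i a) (embFun hz).injective.injOn t'.1
    rw [ht'.orbit_eq_univ] at h1
    obtain ⟨m, hm⟩ := e.surjective (embFun hz p)
    exact ⟨m, (key m).1 (hm ▸ h1.2 ht')⟩
  · rintro ⟨m, hm⟩
    obtain ⟨φ, hφ, -⟩ := ht'.exists_map ((key m).2 hm)
    obtain ⟨z, hz, -⟩ := exists_emb hκ hb' hb h' hi φ hφ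
    exact ⟨z, hz⟩

end Params
end
end QuotSym

/-! ### Almost isomorphism of codes and the sorts `F_n`, for `κ = ℵ₀` -/

namespace QuotSym
noncomputable section

namespace Params

variable {P : Params.{u}} {n : ℕ}

/-- The exceptional set is itself coded by some `d` below `b`, and `FinPt` says that it is finite.
This expresses "for all but finitely many points" in the language of groups. -/
theorem exists_finPt_iff (hκ : P.κ = ℵ₀) {x b : P.G} (hb : Cobig b) {Q : Rgn P.G → Prop} :
    (∃ d, Rgn.mk d ≤ Rgn.mk b ∧ FinPt x d ∧ ∀ p, p ∈ Pt x b → Q p ∨ p ≤ Rgn.mk d) ↔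
      {p : Pt x b | ¬ Q p.1}.Finite := by
  constructor
  · rintro ⟨d, hd, hfin, h⟩
    refine Set.Finite.of_finite_image (f := Subtype.val)
      (((finPt_iff hκ hb hd).1 hfin).subset ?_) Subtype.val_injective.injOn
    rintro _ ⟨p, hp, rfl⟩
    exact ⟨p.2.1, (h p.1 p.2).resolve_left hp⟩
  · intro h
    have hD : Subtype.val '' {p : Pt x b | ¬ Q p.1} ⊆ Pt x b := by
      rintro _ ⟨p, -, rfl⟩
      exact p.2
    obtain ⟨d, -, -, hd, hPt, -⟩ := exists_Pt_eq hκ hD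
    refine ⟨d, hd, (finPt_iff hκ hb hd).2 (hPt ▸ h.image _), fun p hp => ?_⟩
    by_cases hQ : Q p
    · exact Or.inl hQ
    · have : p ∈ Pt x d := hPt ▸ ⟨⟨p, hp⟩, hQ, rfl⟩
      exact Or.inr this.2

theorem exists_finPt_imp_iff (hκ : P.κ = ℵ₀) {x b : P.G} (hb : Cobig b) {Q R : Rgn P.G → Prop} :
    (∃ d, Rgn.mk d ≤ Rgn.mk b ∧ FinPt x d ∧ ∀ p, p ∈ Pt x b → R p → Q p ∨ p ≤ Rgn.mk d) ↔
      {p : Pt x b | R p.1 ∧ ¬ Q p.1}.Finite := by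
  have := exists_finPt_iff hκ (x := x) hb (Q := fun p => R p → Q p)
  simp only [Classical.not_imp] at this
  rw [← this]
  refine exists_congr fun d => and_congr_right fun _ => and_congr_right fun _ =>
    forall₂_congr fun p _ => ?_
  tauto

theorem mk_lt_κ_iff (hκ : P.κ = ℵ₀) {X : Type u} {A : Set X} : #A < P.κ ↔ A.Finite := by
  rw [hκ, Cardinal.lt_aleph0_iff_set_finite]

/-- In the formula, `c` codes the common part `W` inside the first set, and `z` induces the map from
there into the second. The two finite exceptional sets consist of the counted points that are
missed. -/
theorem almostIsoR_iff (hκ : P.κ = ℵ₀) {x b x' b' : P.G} {y y' : Fin n → P.G} (hb : Cobig b)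
    (hb' : Cobig b') (h : Acts x b y) (h' : Acts x' b' y') :
    AlmostIsoR x b y x' b' y' ↔ P.AlmostIso (actPerm h) (actPerm h') := by
  constructor
  · rintro ⟨c, z, H1, H2, H3⟩
    rw [exists_finPt_imp_iff hκ hb] at H2
    rw [exists_finPt_imp_iff hκ hb'] at H3
    have hinv : IsInv (actPerm h) {p | p.1 ≤ Rgn.mk c} := isInv_of_le h fun i p hp hpc =>
      ⟨((H1 p hp hpc).2.2 i).1, ((H1 p hp hpc).2.2 i).2.1⟩
    let ψ : {p : Pt x b // p.1 ≤ Rgn.mk c} ↪ Pt x' b' :=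
      ⟨fun p => ⟨z • p.1.1, (H1 p.1.1 p.1.2 p.2).2.1⟩, fun p q hpq =>
        Subtype.ext (Subtype.ext (MulAction.injective z (Subtype.ext_iff.1 hpq)))⟩
    have hψ : ∀ p : {p : Pt x b // p.1 ≤ Rgn.mk c}, (ψ p).1 = z • p.1.1 := fun _ => rfl
    refine ⟨{p : Pt x b // p.1 ≤ Rgn.mk c},
      fun i => (actPerm h i).subtypePerm fun a => hinv i a, Function.Embedding.subtype _, ψ,
      fun _ _ => rfl, fun i p => Subtype.ext ((H1 p.1.1 p.1.2 p.2).2.2 i).2.2, ?_, ?_, ?_, ?_⟩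
    · rintro _ ⟨p, rfl⟩
      exact (counted_iff h _).1 (H1 p.1.1 p.1.2 p.2).1
    · rintro _ ⟨p, rfl⟩
      rw [← counted_iff h']
      refine (H1 p.1.1 p.1.2 p.2).1.imp_right fun ⟨i, hi⟩ => ⟨i, fun hc => hi ?_⟩
      rw [hψ, ← ((H1 p.1.1 p.1.2 p.2).2.2 i).2.2] at hc
      exact MulAction.injective z hc
    · rw [mk_lt_κ_iff hκ]
      refine H2.subset fun p hp => ⟨(counted_iff h p).2 hp.1, fun hc => hp.2 ⟨⟨p, hc⟩, rfl⟩⟩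
    · rw [mk_lt_κ_iff hκ]
      refine H3.subset fun p hp => ⟨(counted_iff h' p).2 hp.1, fun hc => hp.2
        ⟨⟨⟨_, hc.1⟩, hc.2⟩, Subtype.ext (smul_inv_smul z p.1)⟩⟩
  · rintro ⟨W, ρ, φ, ψ, hφ, hψ, hφD, hψD, hφc, hψc⟩
    rw [mk_lt_κ_iff hκ] at hφc hψc
    have hinj : Function.Injective fun w => (φ w).1 := Subtype.val_injective.comp φ.injective
    have hD : Set.range (fun w => (φ w).1) ⊆ Pt x b := by
      rintro _ ⟨w, rfl⟩
      exact (φ w).2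
    obtain ⟨c, -, -, hcb, hPt, -⟩ := exists_Pt_eq hκ hD
    obtain ⟨z, hz⟩ := exists_smul_eq hκ hb hb' hD
      ((Equiv.ofInjective _ hinj).symm.toEmbedding.trans ψ)
    have hz' : ∀ w, z • (φ w).1 = (ψ w).1 := by
      intro w
      have := hz (Equiv.ofInjective _ hinj w)
      simpa using this
    have hle : ∀ w, (φ w).1 ≤ Rgn.mk c := fun w => by
      have : (φ w).1 ∈ Pt x c := hPt ▸ ⟨w, rfl⟩
      exact this.2
    have hle' : ∀ p, p ∈ Pt x b → p ≤ Rgn.mk c → ∃ w, (φ w).1 = p := by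
      intro p hp hpc
      have : p ∈ Pt x c := ⟨hp.1, hpc⟩
      rwa [hPt] at this
    refine ⟨c, z, ?_, ?_, ?_⟩
    · intro p hp hpc
      obtain ⟨w, rfl⟩ := hle' p hp hpc
      refine ⟨(counted_iff h _).2 (hφD ⟨w, rfl⟩), hz' w ▸ (ψ w).2, fun i => ?_⟩
      have h1 : y i • (φ w).1 = (φ (ρ i w)).1 := (congrArg Subtype.val (hφ i w)).symm
      have h2 : (y i)⁻¹ • (φ w).1 = (φ ((ρ i).symm w)).1 := by
        rw [inv_smul_eq_iff]
        have := congrArg Subtype.val (hφ i ((ρ i).symm w))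
        rwa [Equiv.apply_symm_apply] at this
      refine ⟨h1 ▸ hle _, h2 ▸ hle _, ?_⟩
      rw [h1, hz', hz', hψ]
      rfl
    · rw [exists_finPt_imp_iff hκ hb]
      refine hφc.subset fun p hp => ⟨(counted_iff h p).1 hp.1, ?_⟩
      rintro ⟨w, rfl⟩
      exact hp.2 (hle w)
    · rw [exists_finPt_imp_iff hκ hb']
      refine hψc.subset fun p hp => ⟨(counted_iff h' p).1 hp.1, ?_⟩
      rintro ⟨w, rfl⟩
      refine hp.2 ?_
      rw [← hz', inv_smul_smul]
      exact ⟨(φ w).2, hle w⟩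

/-! ### Codes of elements of the sort `F_n` -/

/-- The code `(x, b, y)` represents the class `c`. -/
def CodeF (x b : P.G) (y : Fin n → P.G) (c : P.F n) : Prop :=
  Cobig b ∧ ∃ h : Acts x b y, ∃ k : P.FPre n, k.1 = P.chr (actPerm h) ∧ P.cls k = c

theorem CodeF.unique {x b : P.G} {y : Fin n → P.G} {c d : P.F n} (h : CodeF x b y c)
    (h' : CodeF x b y d) : c = d := by
  obtain ⟨-, h, k, hk, rfl⟩ := h
  obtain ⟨-, h', k', hk', rfl⟩ := h'
  rw [Subtype.ext (hk.trans hk'.symm)]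

theorem CodeF.eq_iff (hκ : P.κ = ℵ₀) {x b x' b' : P.G} {y y' : Fin n → P.G} {c d : P.F n}
    (h : CodeF x b y c) (h' : CodeF x' b' y' d) : AlmostIsoR x b y x' b' y' ↔ c = d := by
  obtain ⟨hb, h, k, hk, rfl⟩ := h
  obtain ⟨hb', h', k', hk', rfl⟩ := h'
  rw [almostIsoR_iff hκ hb hb' h h', cls_eq_iff hk hk']

theorem exists_codeF (hκ : P.κ = ℵ₀) (c : P.F n) :
    ∃ (x b : P.G) (y : Fin n → P.G), CodeF x b y c := by
  obtain ⟨k, rfl⟩ := Quotient.exists_rep c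
  obtain ⟨W, ρ, hρ, hW, -, -⟩ := exists_model k
  obtain ⟨x, b, y, h, e, hb, he⟩ := exists_code_of_perm hκ hW ρ
  exact ⟨x, b, y, hb, h, k, hρ.symm.trans (chr_eq_of_injective he e.injective
    fun p _ => e.surjective p), rfl⟩

/-- If `lam = μ⁺`, the definition of `F_n` requires exactly `μ` points. This is expressed by saying
that every coded set embeds into the given one, since by `exists_coded` some coded set has size `μ`.
-/
theorem fnCode_iff (hκ : P.κ = ℵ₀) {x b : P.G} {y : Fin n → P.G} :
    FnCode x b y ↔ ∃ c, CodeF x b y c := by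
  constructor
  · rintro ⟨hb, h, hfull⟩
    have h1 : #(Pt x b) < P.lam := mk_Pt_lt hκ x b
    refine ⟨_, hb, h, ⟨P.chr (actPerm h), chr_mem ((Cardinal.mk_set_le _).trans_lt h1) ?_⟩,
      rfl, rfl⟩
    intro hlam
    have hnot := not_lam_le_of_eq hlam
    rw [Dset_of_not_le hnot, Cardinal.mk_univ]
    refine le_antisymm (Order.lt_succ_iff.1 (hlam ▸ h1)) ?_
    have hΩ : #P.Ω < P.lam := by
      rw [hlam]
      exact Order.lt_succ_iff.2 (by simpa using mk_le_μ (P := P) Set.univ)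
    obtain ⟨x', b', hb', ⟨e⟩⟩ := exists_coded hκ hΩ
    obtain ⟨z, hz⟩ := hfull (fullSupp_iff.2 hnot) x' b' hb'
    have h2 : #(Pt x' b') ≤ #(Pt x b) :=
      Cardinal.mk_le_of_injective (f := fun p : Pt x' b' => (⟨z • p.1, hz p.1 p.2⟩ : Pt x b))
        fun p q hpq => Subtype.ext (MulAction.injective z (Subtype.ext_iff.1 hpq))
    rwa [Cardinal.mk_congr e] at h2
  · rintro ⟨c, hb, h, k, hk, rfl⟩
    refine ⟨hb, h, fun hfull x' b' hb' => ?_⟩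
    have hlam := lam_eq_succ (fullSupp_iff.1 hfull)
    have h1 : #(P.Dset (actPerm h)) = P.μ := by
      rw [mk_Dset, ← total_eq_μ_iff, ← hk]
      exact k.2.2.2 hlam
    have h2 : #(Pt x' b') ≤ #(Pt x b) := by
      refine (Order.lt_succ_iff.1 (hlam ▸ mk_Pt_lt hκ x' b')).trans ?_
      rw [← h1]
      exact Cardinal.mk_set_le _
    obtain ⟨φ⟩ := Cardinal.le_def _ _ |>.1 h2
    obtain ⟨z, hz⟩ := exists_smul_eq hκ hb' hb subset_rfl φ
    exact ⟨z, fun p hp => hz ⟨p, hp⟩ ▸ (φ ⟨p, hp⟩).2⟩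

theorem CodeF.proj_iff (hκ : P.κ = ℵ₀) {x b x' b' : P.G} {y : Fin (n + 1) → P.G}
    {y' : Fin n → P.G} {c : P.F (n + 1)} {d : P.F n} (h : CodeF x b y c) (h' : CodeF x' b' y' d) :
    AlmostIsoR x b (initTuple y) x' b' y' ↔ P.Proj c = d := by
  obtain ⟨hb, h, k, hk, rfl⟩ := h
  have hk' : P.projFun k.1 = P.chr (initTuple (actPerm h)) := by rw [hk, chr_initTuple]
  have hi : CodeF x b (initTuple y) (P.Proj (P.cls k)) :=
    ⟨hb, acts_initTuple h, ⟨P.projFun k.1, P.projFun_mem k⟩, hk', (Proj_cls hk hk').symm⟩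
  exact hi.eq_iff hκ h'

theorem CodeF.eqF_iff (hκ : P.κ = ℵ₀) {x b : P.G} {y : Fin 2 → P.G} {c : P.F 2}
    (h : CodeF x b y c) : EqCode x b y ↔ P.EqF c := by
  obtain ⟨hb, h, k, hk, hc⟩ := h
  rw [EqCode, exists_finPt_iff hκ hb, EqF_iff hk hc, mk_lt_κ_iff hκ]
  simp only [Ne, Subtype.ext_iff]
  rfl

theorem CodeF.prodF_iff (hκ : P.κ = ℵ₀) {x b : P.G} {y : Fin 3 → P.G} {c : P.F 3}
    (h : CodeF x b y c) : ProdCode x b y ↔ P.ProdF c := by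
  obtain ⟨hb, h, k, hk, hc⟩ := h
  rw [ProdCode, exists_finPt_iff hκ hb, ProdF_iff hk hc, mk_lt_κ_iff hκ]
  simp only [Ne, Subtype.ext_iff]
  rfl

/-! ### The number of orbits of a given type -/

/-- Together with `exists_emb_of_orb`, this replaces quantification over orbits of type `t` by
quantification over embeddings of a code of `t`. -/
theorem exists_orb_of_emb {x b x' b' z : P.G} {y y' : Fin n → P.G} {t : IsoType n}
    (h : Acts x b y) (h' : Acts x' b' y') (ht : HasType (actPerm h') Set.univ t)
    (hz : Emb x' b' y' x b y z) :
    ∃ B : Orb (actPerm h) t, ∀ p : Pt x b, z⁻¹ • p.1 ∈ Pt x' b' ↔ p ∈ B.1 := by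
  obtain ⟨p, -⟩ := ht.exists_mem
  have he : ∀ a ∈ orbit (actPerm h') p, ∀ i,
      embFun hz (actPerm h' i a) = actPerm h i (embFun hz a) :=
    fun a _ i => embFun_apply hz h' h i a
  have h1 := hasType_image he (embFun hz).injective.injOn t
  have h2 := image_orbit he
  rw [ht.orbit_eq_univ] at h1 h2
  refine ⟨⟨orbit (actPerm h) (embFun hz p), ⟨_, rfl⟩, h1.2 ht⟩, fun q => ?_⟩
  rw [← mem_range_embFun hz, ← Set.image_univ, h2]

theorem exists_emb_of_orb (hκ : P.κ = ℵ₀) {x b x' b' : P.G} {y y' : Fin n → P.G} {t : IsoType n}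
    (hb : Cobig b) (hb' : Cobig b') (h : Acts x b y) (h' : Acts x' b' y')
    (ht : HasType (actPerm h') Set.univ t) (B : Orb (actPerm h) t) :
    ∃ z, Emb x' b' y' x b y z ∧ ∀ p : Pt x b, z⁻¹ • p.1 ∈ Pt x' b' ↔ p ∈ B.1 := by
  obtain ⟨φ, hφ, hr⟩ := ht.exists_map B.2.2
  obtain ⟨z, hz, rfl⟩ := exists_emb hκ hb' hb h' h φ hφ
  exact ⟨z, hz, fun p => by rw [← hr, mem_range_embFun]⟩

theorem Orb.eq_of_mem {X : Type v} {σ : Fin n → Equiv.Perm X} {t : IsoType n} {B C : Orb σ t}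
    {a : X} (hB : a ∈ B.1) (hC : a ∈ C.1) : B = C := by
  obtain ⟨_, ⟨p, rfl⟩, _⟩ := B
  obtain ⟨_, ⟨q, rfl⟩, _⟩ := C
  exact Subtype.ext (orbit_eq_of_mem_of_mem hB hC)

/-- A transversal has as many points as there are orbits. Its number of points is compared with `w`
through the support of `c`, which could be too large; hence the clause in `AppCode` that `c` be of
least cardinality among the elements that contain its points. -/
theorem CodeF.app_iff (hκ : P.κ = ℵ₀) {x b x' b' w : P.G} {y y' : Fin n → P.G} {c : P.F n}
    {t : P.IS n} {ν : P.CardMinus} (h : CodeF x b y c) (h' : CodeIS x' b' y' t)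
    (hw : P.RepCard w ν) : AppCode x b y x' b' y' w ↔ P.App c t = ν := by
  obtain ⟨hb, h, k, hk, rfl⟩ := h
  obtain ⟨hb', h', ht⟩ := h'
  obtain ⟨A, hA, -⟩ := exists_reg w
  rw [repCard_iff hA] at hw
  have hν : P.App (P.cls k) t = ν ↔ trunc P.κ #(Orb (actPerm h) t.1) = trunc P.κ #A := by
    rw [← App_cls hk, ← hw.2]
    exact Subtype.ext_iff
  rw [hν]
  set σ := actPerm h
  constructor
  · rintro ⟨d, hd, H1, H2, H3, H4⟩
    have hsub := Pt_mono (x := x) hd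
    have hcard : #(Orb σ t.1) = #(Pt x d) := by
      have hex : ∀ B : Orb σ t.1, ∃ p : Pt x d, (⟨p.1, hsub p.2⟩ : Pt x b) ∈ B.1 := by
        intro B
        obtain ⟨z, hz, hzB⟩ := exists_emb_of_orb hκ hb hb' h h' ht B
        obtain ⟨p, hp, hpz⟩ := H2 z hz
        exact ⟨⟨p, hp⟩, (hzB _).1 hpz⟩
      choose f hf using hex
      refine Cardinal.mk_congr (Equiv.ofBijective f ⟨fun B C hBC => ?_, fun p => ?_⟩)
      · have := hf C
        rw [← hBC] at this
        exact Orb.eq_of_mem (hf B) this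
      · obtain ⟨z, hz, hzp⟩ := H1 p.1 p.2
        obtain ⟨B, hB⟩ := exists_orb_of_emb h h' ht hz
        exact ⟨B, Subtype.ext (H3 z hz _ _ (f B).2 p.2 ((hB _).2 (hf B)) hzp)⟩
    rw [hcard]
    obtain ⟨D, hD, -⟩ := exists_reg d
    rcases H4 with ⟨hfin, rfl⟩ | ⟨hfin, H5, H6, H7⟩
    · rw [finPt_iff hκ hb hd] at hfin
      rw [trunc_eq_zero ((mk_lt_κ_iff hκ).2 hfin), trunc_eq_zero (hA.eq_one_iff.1 rfl)]
    · rw [finPt_iff hκ hb hd, ← Cardinal.lt_aleph0_iff_set_finite, not_lt] at hfin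
      -- An element with the same points and a support no larger than necessary. Minimality bounds
      -- the support of `d` by it, while disjointness of the sequences gives the other inequality.
      obtain ⟨d', D', hD', -, hPt, hD'c⟩ := exists_Pt_eq hκ hsub
      rw [Cardinal.mul_eq_left hfin hfin Cardinal.aleph0_ne_zero] at hD'c
      have h1 := H7 d' fun p hp => (hPt ▸ hp : p ∈ Pt x d').2
      rw [hD.cardLe_iff hD', hD'c] at h1
      have h2 := trunc_mono (κ := P.κ) (mk_le_of_mem_Pt hκ hD hsub fun p hp => hp.2)
      rw [hD.cardLe_iff hA] at H5
      rw [hA.cardLe_iff hD] at H6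
      exact le_antisymm (h2.trans H5) (H6.trans h1)
  · intro hν
    choose f hf using fun B : Orb σ t.1 => Orb.nonempty B
    have hinj : Function.Injective fun B => (f B).1 := fun B C hBC => by
      have h1 : f B = f C := Subtype.ext hBC
      exact Orb.eq_of_mem (hf B) (h1 ▸ hf C)
    have hsub : Set.range (fun B => (f B).1) ⊆ Pt x b := by
      rintro _ ⟨B, rfl⟩
      exact (f B).2
    obtain ⟨d, D, hD, hd, hPt, hDc⟩ := exists_Pt_eq hκ hsub
    have hcard : #(Pt x d) = #(Orb σ t.1) := by
      rw [hPt]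
      exact Cardinal.mk_range_eq _ hinj
    refine ⟨d, hd, ?_, ?_, ?_, ?_⟩
    · rw [hPt]
      rintro _ ⟨B, rfl⟩
      obtain ⟨z, hz, hzB⟩ := exists_emb_of_orb hκ hb hb' h h' ht B
      exact ⟨z, hz, (hzB _).2 (hf B)⟩
    · intro z hz
      obtain ⟨B, hB⟩ := exists_orb_of_emb h h' ht hz
      exact ⟨_, hPt ▸ ⟨B, rfl⟩, (hB _).2 (hf B)⟩
    · intro z hz
      rw [hPt]
      rintro _ _ ⟨B, rfl⟩ ⟨C, rfl⟩ hBz hCz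
      obtain ⟨B', hB'⟩ := exists_orb_of_emb h h' ht hz
      rw [Orb.eq_of_mem (hf B) ((hB' _).1 hBz), Orb.eq_of_mem (hf C) ((hB' _).1 hCz)]
    · rw [finPt_iff hκ hb hd, ← mk_lt_κ_iff hκ, hcard]
      rw [← hPt, hcard] at hDc
      by_cases hfin : #(Orb σ t.1) < P.κ
      · refine Or.inl ⟨hfin, hA.eq_one_iff.2 ?_⟩
        rw [trunc_eq_zero hfin, trunc] at hν
        by_contra hA'
        rw [Small, not_lt] at hA'
        rw [if_pos hA'] at hν
        exact (Cardinal.aleph0_pos.trans_le (P.aleph0_le.trans hA')).ne hν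
      · have hfin' : ℵ₀ ≤ #(Orb σ t.1) := hκ.symm.le.trans (not_lt.1 hfin)
        rw [Cardinal.mul_eq_left hfin' hfin' Cardinal.aleph0_ne_zero] at hDc
        refine Or.inr ⟨hfin, ?_, ?_, fun d' hd' => ?_⟩
        · rw [hD.cardLe_iff hA, hDc, hν]
        · rw [hA.cardLe_iff hD, hDc, hν]
        · obtain ⟨D', hD', -⟩ := exists_reg d'
          rw [hD.cardLe_iff hD', hDc, ← hcard]
          exact trunc_mono (mk_le_of_mem_Pt hκ hD' (Pt_mono hd) hd')

end Params
end
end QuotSym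

namespace QuotSym
noncomputable section

/-! ### Combining definable families -/

section

variable {L : MSLanguage} {dim dim' : L.Srt → ℕ}

/-- Only some of the coordinates are used. -/
def RelFamily.comap (D : RelFamily.{u} L dim) (π : ∀ s, Fin (dim s) → Fin (dim' s)) :
    RelFamily.{u} L dim' where
  dom s G _ x := D.dom s G (x ∘ π s)
  eqv s G _ x y := D.eqv s G (x ∘ π s) (y ∘ π s)
  rel R G _ x := D.rel R G fun i => x i ∘ π _
  func F G _ x y := D.func F G (fun i => x i ∘ π _) (y ∘ π _)

theorem RelFamily.Definable.comap {D : RelFamily.{u} L dim} (hD : D.Definable)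
    (π : ∀ s, Fin (dim s) → Fin (dim' s)) : (D.comap π).Definable where
  dom s := (hD.dom s).subst fun i => UTerm.var (π s i)
  eqv s := (hD.eqv s).subst (t := fun i _ _ v => v (i.map (π s) (π s))) fun _ => UTerm.var _
  rel R := (hD.rel R).subst
    (t := fun i _ _ v => v (⟨i.1, π _ i.2⟩ : Σ i, Fin (dim' (L.relSort R i)))) fun _ => UTerm.var _
  func F := (hD.func F).subst (t := fun i _ _ v =>
    v (i.map (fun i : Σ i, Fin (dim (L.funDom F i)) =>
      (⟨i.1, π _ i.2⟩ : Σ i, Fin (dim' (L.funDom F i)))) (π _)))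
    fun _ => UTerm.var _

theorem RelFamily.Interprets.comap {D : RelFamily.{u} L dim} {M : MSStructure.{v} L} {G : Type u}
    [Group G] {rep : ∀ s, (Fin (dim s) → G) → M.carrier s → Prop} (h : D.Interprets M G rep)
    {π : ∀ s, Fin (dim s) → Fin (dim' s)} (hπ : ∀ s, Function.Injective (π s)) :
    (D.comap π).Interprets M G fun s x => rep s (x ∘ π s) where
  dom_iff _ _ := h.dom_iff _ _
  unique _ _ := h.unique _ _
  surj s m := by
    obtain ⟨x, hx⟩ := h.surj s m
    -- The unused coordinates are filled with `1`; any value would do.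
    refine ⟨Function.extend (π s) x fun _ => 1, ?_⟩
    rwa [Function.extend_comp (hπ s)]
  eqv_iff _ _ _ := h.eqv_iff _ _ _
  rel_iff _ _ := h.rel_iff _ _
  func_iff _ _ m y := h.func_iff _ _ m (y ∘ π _)

/-- One family or another, according as the sentence `C` holds or not. -/
def RelFamily.cases (C : ∀ (G : Type u) [Group G], Prop) (D D' : RelFamily.{u} L dim) :
    RelFamily.{u} L dim where
  dom s G _ x := (C G → D.dom s G x) ∧ (¬ C G → D'.dom s G x)
  eqv s G _ x y := (C G → D.eqv s G x y) ∧ (¬ C G → D'.eqv s G x y)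
  rel R G _ x := (C G → D.rel R G x) ∧ (¬ C G → D'.rel R G x)
  func F G _ x y := (C G → D.func F G x y) ∧ (¬ C G → D'.func F G x y)

theorem UDef.cases {α : Type} {C : ∀ (G : Type u) [Group G], Prop}
    (hC : UDef (α := Empty) fun G _ _ => C G) {R S : ∀ (G : Type u) [Group G], (α → G) → Prop}
    (hR : UDef R) (hS : UDef S) :
    UDef fun G _ v => (C G → R G v) ∧ (¬ C G → S G v) := by
  have hC' : UDef (α := α) fun G _ _ => C G :=
    hC.subst (t := fun i => i.elim) fun i => i.elim
  exact (hC'.imp hR).and (hC'.not.imp hS)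

theorem RelFamily.Definable.cases {C : ∀ (G : Type u) [Group G], Prop}
    {D D' : RelFamily.{u} L dim} (hC : UDef (α := Empty) fun G _ _ => C G)
    (hD : D.Definable) (hD' : D'.Definable) : (RelFamily.cases C D D').Definable where
  dom s := hC.cases (hD.dom s) (hD'.dom s)
  eqv s := hC.cases (hD.eqv s) (hD'.eqv s)
  rel R := hC.cases (hD.rel R) (hD'.rel R)
  func F := hC.cases (hD.func F) (hD'.func F)

variable {C : ∀ (G : Type u) [Group G], Prop} {D D' : RelFamily.{u} L dim} {M : MSStructure.{v} L}
  {G : Type u} [Group G] {rep : ∀ s, (Fin (dim s) → G) → M.carrier s → Prop}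

theorem RelFamily.Interprets.cases_left (hC : C G) (h : D.Interprets M G rep) :
    (RelFamily.cases C D D').Interprets M G rep := by
  refine ⟨?_, h.unique, h.surj, ?_, ?_, ?_⟩ <;>
    simp only [RelFamily.cases, hC, not_true_eq_false, true_imp_iff, false_imp_iff, and_true]
  exacts [h.dom_iff, h.eqv_iff, h.rel_iff, h.func_iff]

theorem RelFamily.Interprets.cases_right (hC : ¬ C G) (h : D'.Interprets M G rep) :
    (RelFamily.cases C D D').Interprets M G rep := by
  refine ⟨?_, h.unique, h.surj, ?_, ?_, ?_⟩ <;>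
    simp only [RelFamily.cases, hC, not_false_eq_true, true_imp_iff, false_imp_iff, true_and]
  exacts [h.dom_iff, h.eqv_iff, h.rel_iff, h.func_iff]

end

/-! ### The interpretation for `κ = ℵ₀` -/

/-- Members of `IS_n` and `F_n` are represented by tuples of length `n + 2`. -/
def codeDim : MSort → ℕ
  | .is n => n + 3
  | .card => 1
  | .fn n => n + 3

/-- The tuple part of a code. -/
def codeTail {α : Type v} {n : ℕ} (x : Fin (n + 3) → α) (i : Fin (n + 1)) : α := x i.succ.succ

/-- The relations interpreting `M` for `κ = ℵ₀`. -/
def countableFamily : RelFamily.{u} mLang codeDim where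
  dom
    | .is n => fun G _ (x : Fin (n + 3) → G) => IsCode (x 0) (x 1) (codeTail x)
    | .card => fun G _ (x : Fin 1 → G) => x 0 * x 0 = 1
    | .fn n => fun G _ (x : Fin (n + 3) → G) => FnCode (x 0) (x 1) (codeTail x)
  eqv
    | .is n => fun G _ (x y : Fin (n + 3) → G) =>
        ∃ z, Emb (x 0) (x 1) (codeTail x) (y 0) (y 1) (codeTail y) z
    | .card => fun G _ (x y : Fin 1 → G) => CardLe (x 0) (y 0) ∧ CardLe (y 0) (x 0)
    | .fn n => fun G _ (x y : Fin (n + 3) → G) =>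
        AlmostIsoR (x 0) (x 1) (codeTail x) (y 0) (y 1) (codeTail y)
  rel
    | .eq1 => fun G _ x => ∀ p : Rgn G,
        p ∈ Pt (x (0 : Fin 1) (0 : Fin 4)) (x (0 : Fin 1) (1 : Fin 4)) →
        x (0 : Fin 1) (2 : Fin 4) • p = x (0 : Fin 1) (3 : Fin 4) • p
    | .prod1 => fun G _ x => ∀ p : Rgn G,
        p ∈ Pt (x (0 : Fin 1) (0 : Fin 5)) (x (0 : Fin 1) (1 : Fin 5)) →
        x (0 : Fin 1) (2 : Fin 5) • x (0 : Fin 1) (3 : Fin 5) • p = x (0 : Fin 1) (4 : Fin 5) • p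
    | .proj1 n => fun G _ x => ∃ z, Emb (x (1 : Fin 2) (0 : Fin (n + 3)))
        (x (1 : Fin 2) (1 : Fin (n + 3))) (codeTail (x (1 : Fin 2) : Fin (n + 3) → G))
        (x (0 : Fin 2) (0 : Fin (n + 4))) (x (0 : Fin 2) (1 : Fin (n + 4)))
        (initTuple (codeTail (x (0 : Fin 2) : Fin (n + 4) → G))) z
    | .lt => fun _ _ x =>
        ¬ CardLe (x (1 : Fin 2) (0 : Fin 1)) (x (0 : Fin 2) (0 : Fin 1))
    | .eq => fun G _ x => EqCode (x (0 : Fin 1) (0 : Fin 4)) (x (0 : Fin 1) (1 : Fin 4))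
        (codeTail (x (0 : Fin 1) : Fin 4 → G))
    | .prod => fun G _ x => ProdCode (x (0 : Fin 1) (0 : Fin 5)) (x (0 : Fin 1) (1 : Fin 5))
        (codeTail (x (0 : Fin 1) : Fin 5 → G))
  func
    | .app n => fun G _ x y => AppCode (x (0 : Fin 2) (0 : Fin (n + 3)))
        (x (0 : Fin 2) (1 : Fin (n + 3))) (codeTail (x (0 : Fin 2) : Fin (n + 3) → G))
        (x (1 : Fin 2) (0 : Fin (n + 3))) (x (1 : Fin 2) (1 : Fin (n + 3)))
        (codeTail (x (1 : Fin 2) : Fin (n + 3) → G)) (y (0 : Fin 1))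
    | .proj n => fun G _ x y => AlmostIsoR (x (0 : Fin 1) (0 : Fin (n + 4)))
        (x (0 : Fin 1) (1 : Fin (n + 4)))
        (initTuple (codeTail (x (0 : Fin 1) : Fin (n + 4) → G)))
        (y (0 : Fin (n + 3))) (y (1 : Fin (n + 3))) (codeTail (y : Fin (n + 3) → G))

theorem countableFamily_definable : countableFamily.{u}.Definable where
  dom
    | .is _ => UDef.isCode (UTerm.var _) (UTerm.var _) fun _ => UTerm.var _
    | .card => UDef.eq ((UTerm.var _).mul (UTerm.var _)) UTerm.one
    | .fn _ => UDef.fnCode (UTerm.var _) (UTerm.var _) fun _ => UTerm.var _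
  eqv
    | .is _ => UDef.ex (UDef.emb (UTerm.var _) (UTerm.var _) (fun _ => UTerm.var _)
        (UTerm.var _) (UTerm.var _) (fun _ => UTerm.var _) (UTerm.var _))
    | .card => (UDef.cardLe (UTerm.var _) (UTerm.var _)).and
        (UDef.cardLe (UTerm.var _) (UTerm.var _))
    | .fn _ => UDef.almostIsoR (UTerm.var _) (UTerm.var _) (fun _ => UTerm.var _)
        (UTerm.var _) (UTerm.var _) fun _ => UTerm.var _
  rel
    | .eq1 => UDef.rgnAll ((UDef.memPt (UTerm.var _) (UTerm.var _) (URgn.mk (UTerm.var _))).imp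
        (UDef.rgnEq (URgn.smul (UTerm.var _) (URgn.mk (UTerm.var _)))
          (URgn.smul (UTerm.var _) (URgn.mk (UTerm.var _)))))
    | .prod1 => UDef.rgnAll ((UDef.memPt (UTerm.var _) (UTerm.var _) (URgn.mk (UTerm.var _))).imp
        (UDef.rgnEq
          (URgn.smul (UTerm.var _) (URgn.smul (UTerm.var _) (URgn.mk (UTerm.var _))))
          (URgn.smul (UTerm.var _) (URgn.mk (UTerm.var _)))))
    | .proj1 _ => UDef.ex (UDef.emb (UTerm.var _) (UTerm.var _) (fun _ => UTerm.var _)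
        (UTerm.var _) (UTerm.var _) (fun _ => UTerm.var _) (UTerm.var _))
    | .lt => (UDef.cardLe (UTerm.var _) (UTerm.var _)).not
    | .eq => by
      have h : UDef (α := Σ i, Fin (codeDim (mLang.relSort MRel.eq i))) fun G _ v =>
          EqCode (v ⟨(0 : Fin 1), (0 : Fin 4)⟩) (v ⟨(0 : Fin 1), (1 : Fin 4)⟩)
            fun i => v ⟨(0 : Fin 1), (i.succ.succ : Fin 4)⟩ :=
        UDef.eqCode (UTerm.var _) (UTerm.var _) fun _ => UTerm.var _
      exact h
    | .prod => by
      have h : UDef (α := Σ i, Fin (codeDim (mLang.relSort MRel.prod i))) fun G _ v =>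
          ProdCode (v ⟨(0 : Fin 1), (0 : Fin 5)⟩) (v ⟨(0 : Fin 1), (1 : Fin 5)⟩)
            fun i => v ⟨(0 : Fin 1), (i.succ.succ : Fin 5)⟩ :=
        UDef.prodCode (UTerm.var _) (UTerm.var _) fun _ => UTerm.var _
      exact h
  func
    | .app _ => UDef.appCode (UTerm.var _) (UTerm.var _) (fun _ => UTerm.var _)
        (UTerm.var _) (UTerm.var _) (fun _ => UTerm.var _) (UTerm.var _)
    | .proj _ => UDef.almostIsoR (UTerm.var _) (UTerm.var _) (fun _ => UTerm.var _)
        (UTerm.var _) (UTerm.var _) fun _ => UTerm.var _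

/-- Members of `IS_n` and `F_n` are represented by codes of tuples of permutations. -/
def Params.CodeRep (P : Params.{u}) : ∀ s : MSort, (Fin (codeDim s) → P.G) → P.Carrier s → Prop
  | .is n => fun (x : Fin (n + 3) → P.G) t => Params.CodeIS (x 0) (x 1) (codeTail x) t.down
  | .card => fun x ν => P.RepCard (x (0 : Fin 1)) ν
  | .fn n => fun (x : Fin (n + 3) → P.G) c => Params.CodeF (x 0) (x 1) (codeTail x) c

theorem exists_eq_code {α : Type v} {n : ℕ} (a b : α) (y : Fin (n + 1) → α) :
    ∃ x : Fin (n + 3) → α, x 0 = a ∧ x 1 = b ∧ codeTail x = y :=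
  ⟨Fin.cons a (Fin.cons b y), rfl, rfl, rfl⟩

theorem countableFamily_interprets {P : Params.{u}} (hκ : P.κ = ℵ₀) :
    countableFamily.Interprets P.M P.G P.CodeRep where
  dom_iff
    | .is _, _ => (Params.isCode_iff hκ).trans
        ⟨fun ⟨t, ht⟩ => ⟨⟨t⟩, ht⟩, fun ⟨t, ht⟩ => ⟨t.down, ht⟩⟩
    | .card, x => (Params.exists_repCard_iff (x (0 : Fin 1))).symm
    | .fn _, _ => Params.fnCode_iff hκ
  unique
    | .is _, _, _, _, h, h' => ULift.ext _ _ (Params.CodeIS.unique h h')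
    | .card, _, _, _, h, h' => Params.RepCard.unique h h'
    | .fn _, _, _, _, h, h' => Params.CodeF.unique h h'
  surj
    | .is _, m => by
      obtain ⟨a, b, y, h⟩ := Params.exists_codeIS hκ m.down
      obtain ⟨x, rfl, rfl, rfl⟩ := exists_eq_code a b y
      exact ⟨x, h⟩
    | .card, m => (Params.exists_repCard m).elim fun x hx => ⟨fun _ => x, hx⟩
    | .fn _, m => by
      obtain ⟨a, b, y, h⟩ := Params.exists_codeF hκ m
      obtain ⟨x, rfl, rfl, rfl⟩ := exists_eq_code a b y
      exact ⟨x, h⟩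
  eqv_iff
    | .is _, _, _, _, _, h, h' => (Params.CodeIS.eq_iff hκ h h').trans ulift_down_eq_iff
    | .card, _, _, _, _, h, h' => Params.RepCard.eq_iff h h'
    | .fn _, _, _, _, _, h, h' => Params.CodeF.eq_iff hκ h h'
  rel_iff
    | .eq1, _, _, h => Params.CodeIS.eq1_iff (h (0 : Fin 1))
    | .prod1, _, _, h => Params.CodeIS.prod1_iff (h (0 : Fin 1))
    | .proj1 _, _, _, h => Params.CodeIS.proj1_iff hκ (h (0 : Fin 2)) (h (1 : Fin 2))
    | .lt, _, _, h => Params.RepCard.lt_iff (h (0 : Fin 2)) (h (1 : Fin 2))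
    | .eq, _, _, h => Params.CodeF.eqF_iff hκ (h (0 : Fin 1))
    | .prod, _, _, h => Params.CodeF.prodF_iff hκ (h (0 : Fin 1))
  func_iff
    | .app _, _, _, _, _, h, hc => Params.CodeF.app_iff hκ (h (0 : Fin 2)) (h (1 : Fin 2)) hc
    | .proj _, _, _, _, _, h, hc => Params.CodeF.proj_iff hκ (h (0 : Fin 1)) hc

/-! ### The interpretation for all `κ` -/

/-- The coordinates of the code of a tuple which are used for uncountable `κ`. -/
def tailIndex : ∀ s, Fin (mDim s) → Fin (codeDim s)
  | .is _ => fun i => i.succ.succ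
  | .card => id
  | .fn _ => fun i => i.succ.succ

theorem tailIndex_injective : ∀ s, Function.Injective (tailIndex s)
  | .is _ => (Fin.succ_injective _).comp (Fin.succ_injective _)
  | .card => Function.injective_id
  | .fn _ => (Fin.succ_injective _).comp (Fin.succ_injective _)

/-- Some element of the group has a minimal invariant region. -/
def HasEnds (G : Type u) [Group G] : Prop := ∃ (x : G) (r : Rgn G), EndOf x r

theorem UDef.hasEnds : UDef.{u} (α := Empty) fun G _ _ => HasEnds G :=
  UDef.ex (UDef.rgnEx (UDef.endOf (UTerm.var _) (URgn.mk (UTerm.var _))))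

/-- The sentence `HasEnds` holds exactly for `κ = ℵ₀` and selects the family of relations. For
uncountable `κ` the tuples are padded by two unused coordinates, so that the dimensions agree with
those of the codes. -/
theorem exists_interp_all : ∃ (dim : mLang.Srt → ℕ) (Γ : Interp mLang dim),
    dim MSort.card = 1 ∧
    ∀ P : Params.{u}, ∃ rep : ∀ s, (Fin (dim s) → P.G) → P.M.carrier s → Prop,
      Γ.Interprets P.M P.G rep ∧
      ∀ (g : P.G) (ν : P.CardMinus), rep MSort.card (fun _ => g) ν ↔ P.RepCard g ν := by
  obtain ⟨Γ, hΓ⟩ := (RelFamily.Definable.cases UDef.hasEnds countableFamily_definable.{u}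
    (uncountableFamily_definable.comap tailIndex)).exists_interp
  refine ⟨codeDim, Γ, rfl, fun P => ?_⟩
  have hC : HasEnds P.G ↔ P.κ = ℵ₀ := Params.exists_endOf_iff
  by_cases hκ : P.κ = ℵ₀
  · exact ⟨_, hΓ _ _ _ ((countableFamily_interprets hκ).cases_left (hC.2 hκ)),
      fun _ _ => Iff.rfl⟩
  · exact ⟨_, hΓ _ _ _ (((uncountableFamily_interprets
      (lt_of_le_of_ne P.aleph0_le (Ne.symm hκ))).comap tailIndex_injective).cases_right
        (mt hC.1 hκ)), fun _ _ => Iff.rfl⟩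

end
end QuotSym

theorem theorem4p3 :
    (∃ (dim : QuotSym.mLang.Srt → ℕ) (Γ : QuotSym.Interp QuotSym.mLang dim),
      dim QuotSym.MSort.card = 1 ∧
      ∀ P : QuotSym.Params.{u},
        ∃ rep : ∀ s, (Fin (dim s) → P.G) → P.M.carrier s → Prop,
          Γ.Interprets P.M P.G rep ∧
          ∀ (g : P.G) (ν : P.CardMinus),
            rep QuotSym.MSort.card (fun _ => g) ν ↔ P.RepCard g ν) ∧
    (∃ Γ : QuotSym.Interp QuotSym.mLang QuotSym.mDim,
      ∀ P : QuotSym.Params.{u}, Cardinal.aleph0 < P.κ →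
        Γ.Interprets P.M P.G P.Rep ∧
        (∀ g : P.G, (∃ ν, P.RepCard g ν) ↔ g * g = 1) ∧
        (∀ (n : ℕ) (x : Fin (n + 1) → P.G), ∃ c, P.RepF x c) ∧
        (∀ (n : ℕ) (x y : Fin (n + 1) → P.G) (c d : P.F (n + 1)), P.RepF x c → P.RepF y d →
          (c = d ↔ ∃ z : P.G, ∀ i, z⁻¹ * x i * z = y i))) := by
  exact ⟨QuotSym.exists_interp_all, QuotSym.exists_interp_uncountable⟩
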